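/- Let $J_\nu$, $Y_\nu$ be the Bessel functions, $\mathbf H_\nu$ the Struve function, and for $\nu=qz$ with $q\neq0$ fixed write $$F(\nu,z)\sim \frac{(\tfrac12 z)^{\nu-1}}{\sqrt\pi\,\Gamma(\nu+\tfrac12)}\sum_{k\ge 0}\frac{c_k(q)\,k!}{z^k}\qquad(*)$$ for the Poincar\'e asymptotic expansion as $|z|\to\infty$ with $\arg z=\theta$ fixed, $|\theta|<\tfrac12\pi$. Here the $c_k(q)$ are defined by $(1+u^2)^{-1/2}\,du/ds=\sum_k c_k(q)s^k$ near $s=0$, where $u=u(s)$, $u(0)=0$, is the local inverse of $s=u-q\log(1+u^2)$. A path of steepest descent from $0$ is a continuous path $u(\tau)$, $0\le\tau<\infty$, $u(0)=0$, along which $\tau=e^{i\theta}\{u-q\log(1+u^2)\}$, the logarithm being $0$ at $u=0$ and continued along the path (which may pass to other sheets; at a saddle point, $1+u^2=2qu$, it may leave along any line of steepest descent). (1) If $|\arg\nu|<\tfrac12\pi$, then such a path exists; every such path ends, as $\tau\to\infty$, at $\infty$, at $i$ or at $-i$; and a path that meets no saddle point is the only one. (2) Let $|\arg\nu|\le\tfrac12\pi$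 and let $C$ be a path of steepest descent from $0$. If $C$ ends at $\infty$, then $\mathbf H_\nu(z)-Y_\nu(z)$ has the expansion $(*)$; if $C$ ends at $i$, then $\mathbf H_\nu(z)+iJ_\nu(z)$ has the expansion $(*)$; if $C$ ends at $-i$, then $\mathbf H_\nu(z)-iJ_\nu(z)$ has the expansion $(*)$. When $\theta\ne0$ it is supposed here that $C$ can be deformed in $\mathbb C\setminus\{i,-i\}$ into the positive real axis (with the ends going to infinity in the half-planes $\Re(e^{i\theta}u)>R$), respectively into the straight segment from $0$ to $\pm i$ (with the ends going to $\pm i$; $C$ may spiral around its endpoint). (3) Let $z>0$. If $0<q<1$, the positive real axis is a path of steepest descent from $0$ to $\infty$ that meets no saddle point, and $\mathbf H_\nu(z)-Y_\nu(z)$ has the expansion $(*)$. If $q\ge1$, then for each choice of the sign there is a path of steepest descent that runs along the real axis from $0$ to the saddle point $q-\sqrt{q^2-1}$ and ends at $\pm i$, and $\mathbf H_\nu(z)\pm iJ_\nu(z)$ has the expansion $(*)$. (4) Let $\nu$ and $z$ have the same phase, so $q>0$. For every $\theta\in(0,\tfrac12\pi)$ there is $Q(\theta)\in(0,1)$ such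 that the following holds when $\arg z=\theta$ with the lower signs, and when $\arg z=-\theta$ with the upper signs. If $0<q<Q(\theta)$, there is a path of steepest descent from $0$ to $\infty$ that meets no saddle point and can be deformed as in (2), and $\mathbf H_\nu(z)-Y_\nu(z)$ has the expansion $(*)$. If $q=Q(\theta)$, there are two paths of steepest descent that coincide up to the saddle point $q\pm i\sqrt{1-q^2}$ and end at $\infty$ and at $\pm i$, respectively. If $q\ge Q(\theta)$, then $\mathbf H_\nu(z)\pm iJ_\nu(z)$ has the expansion $(*)$. -/

import Mathlib

open Filter Topology Asymptotics
open scoped NNReal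

noncomputable section

namespace Struve

/-- The Bessel function `J_ν(z)` by its power series; `(Γ(s))⁻¹` is `0` at the poles of `Γ`. -/
def besselJ (ν z : ℂ) : ℂ :=
  (z / 2) ^ ν *
    ∑' n : ℕ, (-1 : ℂ) ^ n * (z / 2) ^ (2 * n) * ((n.factorial : ℂ) * Complex.Gamma (n + ν + 1))⁻¹

/-- The Bessel function of the second kind. The limit `μ → ν`, `μ ≠ ν` is the usual definition at
integers `ν`, and by continuity in the order it is the usual quotient at the other `ν`. -/
def besselY (ν z : ℂ) : ℂ :=
  limUnder (𝓝[≠] ν) fun μ : ℂ =>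
    (besselJ μ z * Complex.cos (μ * Real.pi) - besselJ (-μ) z) / Complex.sin (μ * Real.pi)

/-- The Struve function `𝐇_ν(z)` by its power series. -/
def struveH (ν z : ℂ) : ℂ :=
  (z / 2) ^ (ν + 1) *
    ∑' n : ℕ, (-1 : ℂ) ^ n * (z / 2) ^ (2 * n) *
      (Complex.Gamma (n + 3 / 2) * Complex.Gamma (n + ν + 3 / 2))⁻¹

/-- The phase `u - q log (1 + u²)` near `u = 0` (principal logarithm). -/
def phase (q u : ℂ) : ℂ := u - q * Complex.log (1 + u ^ 2)

theorem hasStrictDerivAt_phase (q : ℂ) : HasStrictDerivAt (phase q) 1 0 := by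
  have h1 : HasStrictDerivAt (fun u : ℂ => 1 + u ^ 2) (2 * 0) 0 := by
    simpa using ((hasStrictDerivAt_id (0 : ℂ)).pow 2).const_add 1
  have h2 := h1.clog (by simp)
  have h3 := (hasStrictDerivAt_id (0 : ℂ)).sub (h2.const_mul q)
  have h4 : (phase q) = id - fun u : ℂ => q * Complex.log (1 + u ^ 2) := rfl
  rw [h4]
  exact h3.congr_deriv (by simp)

/-- The local inverse `s ↦ u(s)`, `u(0) = 0`, of `u ↦ u - q log (1 + u²)`. -/
def inversePhase (q : ℂ) : ℂ → ℂ :=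
  (hasStrictDerivAt_phase q).localInverse (phase q) 1 0 one_ne_zero

/-- The coefficients `c_k(q)` of the power series `(1 + u²)^(-1/2) du/ds = ∑ c_k(q) s^k`,
where `s = u - q log (1 + u²)`. -/
def coeff (q : ℂ) (k : ℕ) : ℂ :=
  iteratedDeriv k
    (fun s => deriv (inversePhase q) s / (1 + inversePhase q s ^ 2) ^ (1 / 2 : ℂ)) 0 / k.factorial

/-- The factor `(z/2)^(ν-1) / (√π Γ(ν + 1/2))`. -/
def prefactor (ν z : ℂ) : ℂ :=
  (z / 2) ^ (ν - 1) / ((Real.sqrt Real.pi : ℂ) * Complex.Gamma (ν + 1 / 2))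

/-- The point `r e^{iθ}`. -/
def rayPoint (θ r : ℝ) : ℂ := r * Complex.exp (θ * Complex.I)

/-- The Poincaré asymptotic expansion
`F(ν, z) ~ (z/2)^(ν-1) / (√π Γ(ν + 1/2)) ∑ c_k(q) k! / z^k`
with `ν = q z`, as `|z| → ∞` with `arg z = θ` and `q` fixed. -/
def HasExpansion (F : ℂ → ℂ → ℂ) (θ : ℝ) (q : ℂ) : Prop :=
  ∀ N : ℕ,
    (fun r : ℝ =>
      F (q * rayPoint θ r) (rayPoint θ r) -
        prefactor (q * rayPoint θ r) (rayPoint θ r) *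
          ∑ k ∈ Finset.range N, coeff q k * (k.factorial : ℂ) / rayPoint θ r ^ k)
    =O[atTop]
    (fun r : ℝ =>
      prefactor (q * rayPoint θ r) (rayPoint θ r) / rayPoint θ r ^ N)

/-- The expansion of `𝐇_ν(z) + ε i J_ν(z)`, to be used with `ε = 1` or `ε = -1`. -/
def HJExpansion (ε θ : ℝ) (q : ℂ) : Prop :=
  HasExpansion (fun ν z => struveH ν z + ε * Complex.I * besselJ ν z) θ q

/-- The expansion of `𝐇_ν(z) - Y_ν(z)`. -/
def HYExpansion (θ : ℝ) (q : ℂ) : Prop :=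
  HasExpansion (fun ν z => struveH ν z - besselY ν z) θ q

/-- A path of steepest descent from `u = 0`, parametrised by `τ ∈ [0, ∞)`: along it
`τ = e^{iθ} (u - q log (1 + u²))`, where the logarithm (`L`) starts from `0` at `u = 0` and is
continued along the path, which may thus pass to other sheets of the Riemann surface.
A path that runs into a saddle point may leave it along any line of steepest descent. -/
def IsSteepestDescentPath (θ : ℝ) (q : ℂ) (γ : ℝ≥0 → ℂ) : Prop :=
  Continuous γ ∧ γ 0 = 0 ∧
    ∃ L : ℝ≥0 → ℂ, Continuous L ∧ L 0 = 0 ∧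
      (∀ t, Complex.exp (L t) = 1 + γ t ^ 2) ∧
      ∀ t, Complex.exp (θ * Complex.I) * (γ t - q * L t) = ((t : ℝ) : ℂ)

/-- The path meets a saddle point, that is, a root of `1 + u² = 2 q u`. -/
def MeetsSaddle (q : ℂ) (γ : ℝ≥0 → ℂ) : Prop := ∃ t, 1 + γ t ^ 2 = 2 * q * γ t

/-- The path from `0` to `∞` can be deformed into the positive real axis in `ℂ ∖ {i, -i}`, with
starting point `0` and with the ends going to infinity in the half-planes `Re (e^{iθ} u) > R`. -/
def DeformableToRealAxis (θ : ℝ) (γ : ℝ≥0 → ℂ) : Prop :=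
  ∃ H : unitInterval × ℝ≥0 → ℂ, Continuous H ∧
    (∀ s, H (s, 0) = 0) ∧ (∀ t, H (0, t) = γ t) ∧ (∀ t, H (1, t) = ((t : ℝ) : ℂ)) ∧
    (∀ p, 1 + H p ^ 2 ≠ 0) ∧
    Tendsto (fun p => (Complex.exp (θ * Complex.I) * H p).re) (⊤ ×ˢ atTop) atTop

/-- The path from `0` to the branch point `b` (`i` or `-i`) can be deformed into the straight
segment in `ℂ ∖ {i, -i}`, with starting point `0` and with the ends going to `b`; in particular,
the path may spiral around `b`. -/
def DeformableToSegment (b : ℂ) (γ : ℝ≥0 → ℂ) : Prop :=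
  ∃ H : unitInterval × ℝ≥0 → ℂ, Continuous H ∧
    (∀ s, H (s, 0) = 0) ∧ (∀ t, H (0, t) = γ t) ∧
    (∀ t, H (1, t) = (1 - Real.exp (-(t : ℝ)) : ℝ) * b) ∧
    (∀ p, 1 + H p ^ 2 ≠ 0) ∧
    Tendsto H (⊤ ×ˢ atTop) (𝓝 b)

end Struve

end

/-! Integral representations. Integrating the exponential series against `(1-t²)^(ν-1/2)` gives
Poisson's formula: `𝐇_ν ± iJ_ν` is a constant times `∫ e^{-zu} (1+u²)^(ν-1/2) du` over the segment
from `0` to `±i` (`struveH_add_besselJ`). `𝐇_ν - Y_ν` is the same integral over the positive axis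
(`struveH_sub_besselY`). For the latter call the integral with its constant `K`. For real `|ν| <
1/2` and `x > 0` the contour is pushed up to `i`, which gives `K = 𝐇 + iJ + W` with `W` the integral
from `i` to `i + ∞`; conjugation gives `K = 𝐇 - iJ + conj W`. A double Euler integral shows `W(-ν) =
e^{-iπν} W(ν)`. Eliminating `W` from the four relations for `ν` and `-ν` leaves `sin(νπ)(K - 𝐇) =
J_{-ν} - J_ν cos(νπ)`, which the identity theorem extends in `z` and then in `ν`.

Expansion. For `ν = qz` the integrand is `e^{-zs} (1+u²)^(-1/2)` with `s = u - q log(1+u²)`. Only a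
neighbourhood of `u = 0` matters, and there Watson's lemma in the variable `s`
(`laplaceSegment_expansion`) yields the coefficients; it suffices that the rest of the contour is
exponentially small (`exists_ball_hasExpansion`). Often a straight contour will do, because
`Re(e^{iθ}s)` is monotone on it: on the real axis if `Re(qe^{iθ}) ≤ cos θ`, on the segment to `εi`
if `ε sin θ ≤ 0` and `Re(qe^{iθ}) > 0`. This covers all expansions in (3) and (4). It also covers
(2) for `θ = 0`, since a path to `∞` then forces `Re q ≤ 1`. For a general `θ` in (2) the integrand
is continued along the given deformation (`exists_primAlong`, `hasExpansion_of_homotopy`); the path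
is compared with the straight contour on a large rectangle of parameters, and the side near the
common end is shown to vanish in the limit.

Paths. Eliminating the logarithm turns steepest descent into `exp((au-t)/b) = 1+u²` with `a =
e^{iθ}`, `b = qa`, an equation that is entire in `u` and ignores sheets (`IsLevel`). Local solutions
exist even at saddle points, as branches in a root of `t - t₀`. Bounded velocity near `∞` and the
isolation of zeros give limits at finite times, so Zorn's lemma gives a path for all times. Along it
`|(1+u²)e^{-au/b}| = e^{-t Re(1/b)}` tends to `0`, so the path leaves every compact set that avoids
`±i`; this determines its possible ends. Uniqueness away from saddle points is the inverse function
theorem and connectedness.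

Location of paths. Everything is deduced from invariant regions for the pair (position, logarithm).
For `z > 0` the region is the box `|x| < 1`, `|y| < √2`. For equal phases let `q = cos φ`, with
saddle point `e^{iφ}`. The sign of `Im(e^{-iθ}s)` at the saddle, studied along the ray through it
and along the unit circle, decides whether a path can leave the wedge between the real axis and that
ray. The first zero of this quantity as a function of `q` is the transition value. -/

noncomputable section

namespace Struve

open MeasureTheory Set

/-! ### Watson's lemma on a segment -/

/-- The Laplace integral `z ∫ e^{-zs} h(s) ds` over the segment from `0` to `s₀`. -/
def laplaceSegment (h : ℂ → ℂ) (s₀ z : ℂ) : ℂ :=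
  z * ∫ x in (0 : ℝ)..1, Complex.exp (-z * (s₀ * x)) * h (s₀ * x) * s₀

theorem mul_mem_ball_of_mem_Icc {s₀ : ℂ} {ρ : ℝ} (hs₀ : s₀ ∈ Metric.ball (0 : ℂ) ρ) {x : ℝ}
    (hx : x ∈ Icc (0 : ℝ) 1) : s₀ * x ∈ Metric.ball (0 : ℂ) ρ := by
  rw [mem_ball_zero_iff] at *
  rw [norm_mul, Complex.norm_real, Real.norm_of_nonneg hx.1]
  exact (mul_le_of_le_one_right (norm_nonneg _) hx.2).trans_lt hs₀

/-- One integration by parts. The end `s₀` contributes only an exponentially small term, and the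
integral of `h'` returns with a factor `1/z`; this recursion carries Watson's lemma. -/
theorem laplaceSegment_eq {h : ℂ → ℂ} {s₀ : ℂ} {ρ : ℝ} (hs₀ : s₀ ∈ Metric.ball (0 : ℂ) ρ)
    (hh : DifferentiableOn ℂ h (Metric.ball 0 ρ)) {z : ℂ} (hz : z ≠ 0) :
    laplaceSegment h s₀ z =
      h 0 - Complex.exp (-z * s₀) * h s₀ + laplaceSegment (deriv h) s₀ z / z := by
  have hseg : ∀ x ∈ uIcc (0 : ℝ) 1, s₀ * x ∈ Metric.ball (0 : ℂ) ρ := fun x hx =>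
    mul_mem_ball_of_mem_Icc hs₀ (by rwa [uIcc_of_le zero_le_one] at hx)
  have hd : ∀ x ∈ uIcc (0 : ℝ) 1, HasDerivAt (fun x : ℝ => -(Complex.exp (-z * (s₀ * x)) *
      h (s₀ * x))) (z * (Complex.exp (-z * (s₀ * x)) * h (s₀ * x) * s₀) -
        Complex.exp (-z * (s₀ * x)) * deriv h (s₀ * x) * s₀) x := by
    intro x hx
    have h0 : HasDerivAt (fun x : ℝ => s₀ * (x : ℂ)) s₀ x := by
      simpa using (Complex.ofRealCLM.hasDerivAt (x := x)).const_mul s₀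
    have h1 := (h0.const_mul (-z)).cexp
    have h2 : HasDerivAt h (deriv h (s₀ * x)) (s₀ * x) :=
      (hh.differentiableAt (Metric.isOpen_ball.mem_nhds (hseg x hx))).hasDerivAt
    have h3 := (h1.mul (h2.comp x h0)).neg
    refine h3.congr_deriv ?_
    simp only [Function.comp]
    ring
  have hc : ContinuousOn (fun x : ℝ => s₀ * (x : ℂ)) (uIcc 0 1) := by fun_prop
  have hc0 : ContinuousOn (fun x : ℝ => h (s₀ * x)) (uIcc 0 1) :=
    hh.continuousOn.comp hc hseg
  have hc1 : ContinuousOn (fun x : ℝ => deriv h (s₀ * x)) (uIcc 0 1) :=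
    (hh.deriv Metric.isOpen_ball).continuousOn.comp hc hseg
  have hce : ContinuousOn (fun x : ℝ => Complex.exp (-z * (s₀ * x))) (uIcc 0 1) := by fun_prop
  have i0 : IntervalIntegrable (fun x : ℝ => Complex.exp (-z * (s₀ * x)) * h (s₀ * x) * s₀)
      volume 0 1 := ((hce.mul hc0).mul continuousOn_const).intervalIntegrable
  have i1 : IntervalIntegrable (fun x : ℝ => Complex.exp (-z * (s₀ * x)) * deriv h (s₀ * x) * s₀)
      volume 0 1 := ((hce.mul hc1).mul continuousOn_const).intervalIntegrable
  have key := intervalIntegral.integral_eq_sub_of_hasDerivAt hd ((i0.const_mul z).sub i1)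
  rw [intervalIntegral.integral_sub (i0.const_mul z) i1, intervalIntegral.integral_const_mul] at key
  unfold laplaceSegment
  rw [mul_div_cancel_left₀ _ hz]
  simp only [Complex.ofReal_one, mul_one, Complex.ofReal_zero, mul_zero, Complex.exp_zero,
    one_mul] at key
  linear_combination key

theorem norm_rayPoint_exp (θ r : ℝ) (s : ℂ) : ‖Complex.exp (-rayPoint θ r * s)‖ =
    Real.exp (-(r * (Complex.exp (θ * Complex.I) * s).re)) := by
  rw [Complex.norm_exp]
  congr 1
  have : -rayPoint θ r * s = -((r : ℂ) * (Complex.exp (θ * Complex.I) * s)) := by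
    unfold rayPoint; ring
  rw [this, Complex.neg_re, Complex.re_ofReal_mul]

theorem norm_rayPoint (θ : ℝ) {r : ℝ} (hr : 0 ≤ r) : ‖rayPoint θ r‖ = r := by
  unfold rayPoint
  rw [norm_mul, Complex.norm_exp_ofReal_mul_I, mul_one, Complex.norm_real, Real.norm_of_nonneg hr]

theorem rayPoint_ne_zero (θ : ℝ) {r : ℝ} (hr : 0 < r) : rayPoint θ r ≠ 0 := by
  rw [← norm_pos_iff, norm_rayPoint θ hr.le]; exact hr

theorem exp_neg_isBigO_inv_pow {δ : ℝ} (hδ : 0 < δ) (N : ℕ) :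
    (fun r : ℝ => Real.exp (-(r * δ))) =O[atTop] (fun r : ℝ => (r ^ N)⁻¹) := by
  have := (isLittleO_exp_neg_mul_rpow_atTop hδ (-(N : ℝ))).isBigO
  refine (this.congr' ?_ ?_)
  · exact Eventually.of_forall fun r => by ring_nf
  · filter_upwards [eventually_gt_atTop 0] with r hr
    rw [Real.rpow_neg hr.le, Real.rpow_natCast]

/-- The factor `z` is compensated by `∫ e^{-rmx} dx ≤ 1/(rm)` with `m = Re(e^{iθ}s₀)`. The segment
need not be a line of steepest descent; a positive `m` is enough. -/
theorem laplaceSegment_isBigO_one {θ : ℝ} {h : ℂ → ℂ} {s₀ : ℂ} {ρ : ℝ}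
    (hs₀ : s₀ ∈ Metric.ball (0 : ℂ) ρ) (hh : DifferentiableOn ℂ h (Metric.ball 0 ρ))
    (hre : 0 < (Complex.exp (θ * Complex.I) * s₀).re) :
    (fun r : ℝ => laplaceSegment h s₀ (rayPoint θ r)) =O[atTop] (fun _ => (1 : ℝ)) := by
  set m := (Complex.exp (θ * Complex.I) * s₀).re with hm
  have hc : ContinuousOn (fun x : ℝ => h (s₀ * x) * s₀) (Icc 0 1) := by
    refine (hh.continuousOn.comp (by fun_prop) fun x hx => ?_).mul continuousOn_const
    exact mul_mem_ball_of_mem_Icc hs₀ hx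
  obtain ⟨M, hM⟩ := isCompact_Icc.exists_bound_of_continuousOn hc
  have hM0 : 0 ≤ M := (norm_nonneg _).trans (hM 0 (by simp))
  refine IsBigO.of_bound (M / m) ?_
  filter_upwards [eventually_gt_atTop 0] with r hr
  have hrm : 0 < r * m := mul_pos hr hre
  have hb : ‖∫ x in (0 : ℝ)..1, Complex.exp (-rayPoint θ r * (s₀ * x)) * h (s₀ * x) * s₀‖ ≤
      ∫ x in (0 : ℝ)..1, M * Real.exp (-(r * m) * x) := by
    refine intervalIntegral.norm_integral_le_of_norm_le zero_le_one ?_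
      (Continuous.intervalIntegrable (by fun_prop) _ _)
    refine (ae_of_all _ fun x hx => ?_)
    have hx' : x ∈ Icc (0 : ℝ) 1 := ⟨hx.1.le, hx.2⟩
    rw [mul_assoc, norm_mul, norm_rayPoint_exp, mul_comm]
    refine mul_le_mul (hM x hx') (le_of_eq ?_) (Real.exp_pos _).le hM0
    congr 1
    rw [← mul_assoc, mul_comm _ (x : ℂ), Complex.re_ofReal_mul]
    ring
  have hi : ∫ x in (0 : ℝ)..1, M * Real.exp (-(r * m) * x) ≤ M / (r * m) := by
    rw [intervalIntegral.integral_const_mul, intervalIntegral.integral_comp_mul_left (fun y => Real.exp y)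
      (neg_ne_zero.mpr hrm.ne'), integral_exp]
    simp only [mul_one, mul_zero, Real.exp_zero, smul_eq_mul]
    have := Real.exp_pos (-(r * m))
    rw [div_eq_mul_inv]
    refine mul_le_mul_of_nonneg_left ?_ hM0
    rw [inv_neg, neg_mul, ← mul_neg]
    exact mul_le_of_le_one_right (by positivity) (by linarith)
  unfold laplaceSegment
  rw [norm_mul, norm_rayPoint θ hr.le, norm_one, mul_one]
  calc r * _ ≤ r * (M / (r * m)) := mul_le_mul_of_nonneg_left (hb.trans hi) hr.le
    _ = M / m := by field_simp

/-- Watson's lemma by induction on `N`, with `h` quantified inside, because the expansion of order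
`N + 1` of `h` comes from that of order `N` of `h'`. -/
theorem laplaceSegment_expansion {θ : ℝ} {s₀ : ℂ} {ρ : ℝ}
    (hs₀ : s₀ ∈ Metric.ball (0 : ℂ) ρ) (hre : 0 < (Complex.exp (θ * Complex.I) * s₀).re) (N : ℕ) :
    ∀ h : ℂ → ℂ, DifferentiableOn ℂ h (Metric.ball 0 ρ) →
    (fun r : ℝ => laplaceSegment h s₀ (rayPoint θ r) -
      ∑ k ∈ Finset.range N, iteratedDeriv k h 0 / rayPoint θ r ^ k) =O[atTop]
      (fun r : ℝ => (r ^ N)⁻¹) := by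
  induction N with
  | zero =>
    intro h hh
    simpa using laplaceSegment_isBigO_one hs₀ hh hre
  | succ N ih =>
    intro h hh
    have h1 := ih (deriv h) (hh.deriv Metric.isOpen_ball)
    have h2 : (fun r : ℝ => (laplaceSegment (deriv h) s₀ (rayPoint θ r) -
      ∑ k ∈ Finset.range N, iteratedDeriv k (deriv h) 0 / rayPoint θ r ^ k) / rayPoint θ r)
        =O[atTop] (fun r : ℝ => (r ^ (N + 1))⁻¹) := by
      have h3 : (fun r : ℝ => (rayPoint θ r)⁻¹) =O[atTop] (fun r : ℝ => r⁻¹) := by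
        refine IsBigO.of_bound 1 ?_
        filter_upwards [eventually_gt_atTop 0] with r hr
        rw [norm_inv, norm_rayPoint θ hr.le, one_mul, norm_inv, Real.norm_of_nonneg hr.le]
      refine (h1.mul h3).congr (fun r => by rw [div_eq_mul_inv]) fun r => ?_
      rw [pow_succ, mul_inv]
    have h3 : (fun r : ℝ => Complex.exp (-rayPoint θ r * s₀) * h s₀) =O[atTop]
        (fun r : ℝ => (r ^ (N + 1))⁻¹) := by
      refine IsBigO.trans ?_ (exp_neg_isBigO_inv_pow hre (N + 1))
      refine IsBigO.of_bound ‖h s₀‖ (Eventually.of_forall fun r => ?_)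
      rw [norm_mul, norm_rayPoint_exp, mul_comm, Real.norm_of_nonneg (Real.exp_pos _).le]
    refine (h2.sub h3).congr' ?_ (Eventually.of_forall fun _ => rfl)
    filter_upwards [eventually_gt_atTop 0] with r hr
    have hz := rayPoint_ne_zero θ hr
    rw [laplaceSegment_eq hs₀ hh hz, Finset.sum_range_succ']
    simp only [iteratedDeriv_succ', iteratedDeriv_zero, pow_zero, div_one]
    rw [sub_div, Finset.sum_div]
    have : ∀ k ∈ Finset.range N, iteratedDeriv k (deriv h) 0 / rayPoint θ r ^ k / rayPoint θ r =
        iteratedDeriv k (deriv h) 0 / rayPoint θ r ^ (k + 1) := fun k _ => by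
      rw [div_div, pow_succ]
    rw [Finset.sum_congr rfl this]
    ring

/-! ### The kernel in the variable `s` -/

/-- The function `(1 + u²)^(-1/2) du/ds` with Taylor coefficients `coeff q k`. -/
def kernel (q s : ℂ) : ℂ :=
  deriv (inversePhase q) s / (1 + inversePhase q s ^ 2) ^ (1 / 2 : ℂ)

/-- The integrand `e^{-z(u - q log(1+u²))} (1+u²)^(-1/2)` near `u = 0`. -/
def phaseIntegrand (q z u : ℂ) : ℂ :=
  Complex.exp (-z * phase q u) / (1 + u ^ 2) ^ (1 / 2 : ℂ)

theorem phase_zero (q : ℂ) : phase q 0 = 0 := by simp [phase]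

theorem inversePhase_zero (q : ℂ) : inversePhase q 0 = 0 := by
  have := (hasStrictDerivAt_phase q).eventually_left_inverse one_ne_zero
  have h := this.self_of_nhds
  rwa [phase_zero] at h

theorem hasDerivAt_phase {q u : ℂ} (hu : 1 + u ^ 2 ∈ Complex.slitPlane) :
    HasDerivAt (phase q) (1 - q * (2 * u / (1 + u ^ 2))) u := by
  have h1 : HasDerivAt (fun u : ℂ => 1 + u ^ 2) (2 * u) u := by
    simpa using ((hasDerivAt_id u).pow 2).const_add 1
  exact ((hasDerivAt_id u).sub ((h1.clog hu).const_mul q))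

theorem eventually_slitPlane : ∀ᶠ u : ℂ in 𝓝 0, 1 + u ^ 2 ∈ Complex.slitPlane := by
  have : ContinuousAt (fun u : ℂ => 1 + u ^ 2) 0 := by fun_prop
  exact this.eventually_mem (Complex.isOpen_slitPlane.mem_nhds (by simp))

theorem phase_analyticAt (q : ℂ) : AnalyticAt ℂ (phase q) 0 := by
  refine Complex.analyticAt_iff_eventually_differentiableAt.mpr ?_
  filter_upwards [eventually_slitPlane] with u hu using (hasDerivAt_phase hu).differentiableAt

theorem inversePhase_analyticAt (q : ℂ) : AnalyticAt ℂ (inversePhase q) 0 := by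
  -- `inversePhase` is built with the literal derivative `1`, while the analyticity of local
  -- inverses is stated for `deriv (phase q) 0`. A variable `d` allows the substitution of one for
  -- the other.
  have gen : ∀ (d : ℂ) (hd : HasStrictDerivAt (phase q) d 0) (h0 : d ≠ 0), d = deriv (phase q) 0 →
      AnalyticAt ℂ (hd.localInverse (phase q) d 0 h0) (phase q 0) := by
    rintro d hd h0 rfl
    exact (phase_analyticAt q).analyticAt_localInverse h0
  have h := gen 1 (hasStrictDerivAt_phase q) one_ne_zero
    (hasStrictDerivAt_phase q).hasDerivAt.deriv.symm
  rwa [phase_zero] at h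

theorem kernel_analyticAt (q : ℂ) : AnalyticAt ℂ (kernel q) 0 := by
  have h := inversePhase_analyticAt q
  have h1 : AnalyticAt ℂ (fun s => (1 + inversePhase q s ^ 2)) 0 := by fun_prop
  refine h.deriv.div (h1.cpow analyticAt_const ?_) ?_
  · simp [inversePhase_zero]
  · simp [inversePhase_zero]

theorem coeff_mul_factorial (q : ℂ) (k : ℕ) :
    coeff q k * (k.factorial : ℂ) = iteratedDeriv k (kernel q) 0 := by
  have : (k.factorial : ℂ) ≠ 0 := by exact_mod_cast k.factorial_ne_zero
  unfold coeff kernel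
  field_simp

/-- Near `0` every primitive of the phase integrand is a Laplace integral of the kernel. -/
theorem exists_ball_primitive (q : ℂ) : ∃ ρ > 0, ∃ ρ' > 0,
    DifferentiableOn ℂ (kernel q) (Metric.ball 0 ρ') ∧
    ∀ u ∈ Metric.ball (0 : ℂ) ρ, 1 + u ^ 2 ∈ Complex.slitPlane ∧ phase q u ∈ Metric.ball (0 : ℂ) ρ' ∧
      ∀ (z : ℂ) (B : ℂ → ℂ),
        (∀ w ∈ Metric.ball (0 : ℂ) ρ, HasDerivAt B (phaseIntegrand q z w) w) →
        z * (B u - B 0) = laplaceSegment (kernel q) (phase q u) z := by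
  obtain ⟨ρ', hρ', hk⟩ : ∃ ρ' > 0, ∀ s ∈ Metric.ball (0 : ℂ) ρ', DifferentiableAt ℂ (kernel q) s :=
    Metric.eventually_nhds_iff_ball.mp
      ((kernel_analyticAt q).eventually_analyticAt.mono fun _ h => h.differentiableAt)
  have hcont : ContinuousAt (phase q) 0 := (phase_analyticAt q).continuousAt
  have e1 : ∀ᶠ u in 𝓝 (0 : ℂ), phase q u ∈ Metric.ball (0 : ℂ) ρ' :=
    hcont.eventually_mem (by rw [phase_zero]; exact Metric.ball_mem_nhds 0 hρ')
  have e2 : ∀ᶠ u in 𝓝 (0 : ℂ), inversePhase q (phase q u) = u :=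
    (hasStrictDerivAt_phase q).eventually_left_inverse one_ne_zero
  have e3 : ∀ᶠ s in 𝓝 (0 : ℂ), DifferentiableAt ℂ (inversePhase q) s :=
    (inversePhase_analyticAt q).eventually_analyticAt.mono fun _ h => h.differentiableAt
  have e4 : ∀ᶠ u in 𝓝 (0 : ℂ), DifferentiableAt ℂ (inversePhase q) (phase q u) := by
    refine hcont.tendsto.eventually ?_
    rwa [phase_zero]
  obtain ⟨ρ, hρ, hall⟩ := Metric.eventually_nhds_iff_ball.mp
    (((e1.and e2.eventually_nhds).and e4).and eventually_slitPlane)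
  have hdk : DifferentiableOn ℂ (kernel q) (Metric.ball 0 ρ') := fun s hs =>
    (hk s hs).differentiableWithinAt
  refine ⟨ρ, hρ, ρ', hρ', hdk, fun u hu => ⟨(hall u hu).2, (hall u hu).1.1.1, fun z B hB => ?_⟩⟩
  set f : ℂ → ℂ := fun s => Complex.exp (-z * s) * kernel q s with hf
  have hfd : DifferentiableOn ℂ f (Metric.ball 0 ρ') := by
    refine DifferentiableOn.mul ?_ hdk
    fun_prop
  obtain ⟨P, hP⟩ := (convex_ball (0 : ℂ) ρ').exists_forall_hasDerivWithinAt hfd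
  have hP' : ∀ s ∈ Metric.ball (0 : ℂ) ρ', HasDerivAt P (f s) s := fun s hs =>
    (hP s hs).hasDerivAt (Metric.isOpen_ball.mem_nhds hs)
  -- the primitive in the plane of `s`
  have hPs : P (phase q u) - P 0 = ∫ x in (0 : ℝ)..1,
      Complex.exp (-z * (phase q u * x)) * kernel q (phase q u * x) * phase q u := by
    set s₀ := phase q u
    have hs₀ : s₀ ∈ Metric.ball (0 : ℂ) ρ' := (hall u hu).1.1.1
    have hseg : ∀ x ∈ uIcc (0 : ℝ) 1, s₀ * x ∈ Metric.ball (0 : ℂ) ρ' := fun x hx =>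
      mul_mem_ball_of_mem_Icc hs₀ (by rwa [uIcc_of_le zero_le_one] at hx)
    have hd : ∀ x ∈ uIcc (0 : ℝ) 1, HasDerivAt (fun x : ℝ => P (s₀ * x)) (f (s₀ * x) * s₀) x := by
      intro x hx
      have h0 : HasDerivAt (fun x : ℝ => s₀ * (x : ℂ)) s₀ x := by
        simpa using (Complex.ofRealCLM.hasDerivAt (x := x)).const_mul s₀
      exact (hP' _ (hseg x hx)).comp x h0
    have hci : ContinuousOn (fun x : ℝ => f (s₀ * x) * s₀) (uIcc 0 1) :=
      (hfd.continuousOn.comp (by fun_prop) hseg).mul continuousOn_const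
    have := intervalIntegral.integral_eq_sub_of_hasDerivAt hd hci.intervalIntegrable
    simp only [Complex.ofReal_one, mul_one, Complex.ofReal_zero, mul_zero] at this
    exact this.symm
  -- the two primitives agree up to a constant
  have hcomp : ∀ w ∈ Metric.ball (0 : ℂ) ρ,
      HasDerivAt (fun w => P (phase q w)) (phaseIntegrand q z w) w := by
    intro w hw
    obtain ⟨⟨⟨h1, h2⟩, h4⟩, h5⟩ := hall w hw
    have hp := hasDerivAt_phase (q := q) h5
    refine ((hP' _ h1).comp w hp).congr_deriv ?_
    -- The chain rule for `u(s(w)) = w`: the factor `du/ds` in the kernel cancels `ds/dw`.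
    have hu' : deriv (inversePhase q) (phase q w) * (1 - q * (2 * w / (1 + w ^ 2))) = 1 := by
      have hc := h4.hasDerivAt.comp w hp
      have hid : HasDerivAt (inversePhase q ∘ phase q) 1 w :=
        (hasDerivAt_id w).congr_of_eventuallyEq (by filter_upwards [h2] with v hv using hv)
      exact hc.unique hid
    simp only [hf, kernel, phaseIntegrand]
    rw [h2.self_of_nhds]
    linear_combination Complex.exp (-z * phase q w) / (1 + w ^ 2) ^ (1 / 2 : ℂ) * hu'
  have h0 : (0 : ℂ) ∈ Metric.ball (0 : ℂ) ρ := Metric.mem_ball_self hρ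
  have hconst : B u - P (phase q u) = B 0 - P (phase q 0) := by
    refine (convex_ball (0 : ℂ) ρ).is_const_of_fderivWithin_eq_zero (𝕜 := ℂ)
      (f := fun w => B w - P (phase q w)) (fun w hw =>
        ((hB w hw).sub (hcomp w hw)).differentiableAt.differentiableWithinAt) (fun w hw => ?_) hu h0
    have hz : HasDerivAt (fun w => B w - P (phase q w)) 0 w :=
      ((hB w hw).sub (hcomp w hw)).congr_deriv (sub_self _)
    rw [fderivWithin_of_isOpen Metric.isOpen_ball hw]
    ext
    simpa using hz.deriv
  unfold laplaceSegment
  rw [← hPs]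
  rw [phase_zero] at hconst
  linear_combination z * hconst

/-- The Poincaré expansion follows from a contour integral whose part away from `0` is
exponentially small. -/
theorem exists_ball_hasExpansion (q : ℂ) : ∃ ρ > 0,
    (∀ u ∈ Metric.ball (0 : ℂ) ρ, 1 + u ^ 2 ∈ Complex.slitPlane) ∧
    ∀ (θ : ℝ) (u : ℂ) (F : ℂ → ℂ → ℂ) (δ C : ℝ), u ∈ Metric.ball (0 : ℂ) ρ → 0 < δ →
    0 < (Complex.exp (θ * Complex.I) * phase q u).re →
    (∀ᶠ r : ℝ in atTop, ∃ B : ℂ → ℂ, ∃ R : ℂ,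
      (∀ w ∈ Metric.ball (0 : ℂ) ρ, HasDerivAt B (phaseIntegrand q (rayPoint θ r) w) w) ∧
      ‖R‖ ≤ C * Real.exp (-(r * δ)) ∧
      F (q * rayPoint θ r) (rayPoint θ r) = prefactor (q * rayPoint θ r) (rayPoint θ r) *
        (rayPoint θ r * (B u - B 0) + rayPoint θ r * R)) →
    HasExpansion F θ q := by
  obtain ⟨ρ, hρ, ρ', hρ', hk, hall⟩ := exists_ball_primitive q
  refine ⟨ρ, hρ, fun u hu => (hall u hu).1, fun θ u F δ C hu hδ hre hF N => ?_⟩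
  obtain ⟨-, hs₀, hB⟩ := hall u hu
  have hW := laplaceSegment_expansion hs₀ hre N (kernel q) hk
  have hsmall : ∃ R : ℝ → ℂ, R =O[atTop] (fun r : ℝ => (r ^ N)⁻¹) ∧ ∀ᶠ r : ℝ in atTop,
      F (q * rayPoint θ r) (rayPoint θ r) = prefactor (q * rayPoint θ r) (rayPoint θ r) *
        (laplaceSegment (kernel q) (phase q u) (rayPoint θ r) + R r) := by
    have hF' : ∀ᶠ r : ℝ in atTop, ∃ R : ℂ, ‖R‖ ≤ C * (r * Real.exp (-(r * δ))) ∧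
        F (q * rayPoint θ r) (rayPoint θ r) = prefactor (q * rayPoint θ r) (rayPoint θ r) *
        (laplaceSegment (kernel q) (phase q u) (rayPoint θ r) + R) := by
      filter_upwards [hF, eventually_gt_atTop 0] with r ⟨B, R, h1, h2, h3⟩ hr
      refine ⟨rayPoint θ r * R, ?_, ?_⟩
      · rw [norm_mul, norm_rayPoint θ hr.le]
        calc r * ‖R‖ ≤ r * (C * Real.exp (-(r * δ))) := mul_le_mul_of_nonneg_left h2 hr.le
          _ = _ := by ring
      · rw [h3, hB _ B h1]
    -- The remainder is given separately for each large `r`; it becomes a function of `r`, with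
    -- irrelevant values before the threshold.
    choose! R hR using hF'.exists_forall_of_atTop.choose_spec
    refine ⟨R, ?_, ?_⟩
    · have h1 : R =O[atTop] (fun r : ℝ => r * Real.exp (-(r * δ))) := by
        refine IsBigO.of_bound C ?_
        filter_upwards [eventually_ge_atTop hF'.exists_forall_of_atTop.choose,
          eventually_gt_atTop 0] with r hr hr0
        rw [Real.norm_of_nonneg (by positivity)]
        exact (hR r hr).1
      have h2 : (fun r : ℝ => r * Real.exp (-(r * δ))) =O[atTop] (fun r : ℝ => (r ^ N)⁻¹) := by
        -- The remainder carries the factor `|z| = r`, so one more power of `1/r` is taken from the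
        -- exponential.
        have h3 := (isBigO_refl (fun r : ℝ => r) atTop).mul (exp_neg_isBigO_inv_pow hδ (N + 1))
        refine h3.congr' EventuallyEq.rfl ?_
        filter_upwards [eventually_gt_atTop 0] with r hr
        field_simp
        ring
      exact h1.trans h2
    · filter_upwards [eventually_ge_atTop hF'.exists_forall_of_atTop.choose] with r hr
      exact (hR r hr).2
  obtain ⟨R, hR, hFR⟩ := hsmall
  have hsum := hW.add hR
  have hpre := (isBigO_refl (fun r : ℝ => prefactor (q * rayPoint θ r) (rayPoint θ r)) atTop).norm_right.mul
    hsum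
  refine (hpre.congr' ?_ EventuallyEq.rfl).trans ?_
  · filter_upwards [hFR] with r hr
    rw [hr]
    simp only [← coeff_mul_factorial]
    ring
  · refine IsBigO.of_bound 1 ?_
    filter_upwards [eventually_gt_atTop 0] with r hr
    rw [one_mul, norm_div, norm_pow, norm_rayPoint θ hr.le, norm_mul, norm_inv, norm_pow,
      Real.norm_of_nonneg hr.le, div_eq_mul_inv, norm_norm]

end Struve

end

noncomputable section

namespace Struve

open MeasureTheory Set

/-! ### Poisson integrals -/

/-- The constant `2 (z/2)^ν / (√π Γ(ν + 1/2))` of the Poisson integrals. -/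
def poissonConst (ν z : ℂ) : ℂ :=
  2 * (z / 2) ^ ν / ((Real.sqrt Real.pi : ℂ) * Complex.Gamma (ν + 1 / 2))

theorem prefactor_mul (ν : ℂ) {z : ℂ} (hz : z ≠ 0) : prefactor ν z * z = poissonConst ν z := by
  have h2 : z / 2 ≠ 0 := div_ne_zero hz two_ne_zero
  unfold prefactor poissonConst
  rw [Complex.cpow_sub _ _ h2, Complex.cpow_one]
  field_simp

/-- This and the next two facts license the substitution `x = t²`, which turns Beta integrals into
Poisson integrals. -/
theorem image_sq_Ioo : (fun t : ℝ => t ^ 2) '' Ioo 0 1 = Ioo 0 1 := by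
  ext x
  constructor
  · rintro ⟨t, ht, rfl⟩
    exact ⟨pow_pos ht.1 2, pow_lt_one₀ ht.1.le ht.2 two_ne_zero⟩
  · intro hx
    refine ⟨Real.sqrt x, ⟨Real.sqrt_pos.mpr hx.1, ?_⟩, Real.sq_sqrt hx.1.le⟩
    rw [Real.sqrt_lt' one_pos]
    simpa using hx.2

theorem injOn_sq_Ioo : InjOn (fun t : ℝ => t ^ 2) (Ioo 0 1) := fun _ ha _ hb h =>
  (pow_left_inj₀ ha.1.le hb.1.le two_ne_zero).mp h

theorem hasDerivWithinAt_sq_Ioo : ∀ t ∈ Ioo (0 : ℝ) 1,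
    HasDerivWithinAt (fun t : ℝ => t ^ 2) (2 * t) (Ioo 0 1) t := fun t _ => by
  simpa using (hasDerivAt_pow 2 t).hasDerivWithinAt

/-- With the Jacobian `2t` the power `(t²)^((m+1)/2 - 1)` becomes `2t^m`, so the moments of
`(1-t²)^(ν-1/2)` are halves of Beta values. -/
theorem abs_smul_betaIntegrand (ν : ℂ) (m : ℕ) {t : ℝ} (ht : t ∈ Ioo (0 : ℝ) 1) :
    |2 * t| • (((t ^ 2 : ℝ) : ℂ) ^ (((m + 1) / 2 : ℂ) - 1) *
      (1 - ((t ^ 2 : ℝ) : ℂ)) ^ (ν + 1 / 2 - 1)) =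
    2 * ((t : ℂ) ^ m * ((1 - t ^ 2 : ℝ) : ℂ) ^ (ν - 1 / 2)) := by
  have ht0 : (t : ℂ) ≠ 0 := by exact_mod_cast ht.1.ne'
  have h1 : ((t ^ 2 : ℝ) : ℂ) ^ (((m + 1) / 2 : ℂ) - 1) * t = (t : ℂ) ^ m := by
    have : ((t ^ 2 : ℝ) : ℂ) = (t : ℂ) ^ (2 : ℂ) := by
      rw [Complex.ofReal_pow]; norm_cast
    rw [this, ← Complex.cpow_mul]
    · rw [← Complex.cpow_natCast, show ((m : ℕ) : ℂ) = 2 * (((m + 1) / 2 : ℂ) - 1) + 1 by ring,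
        Complex.cpow_add _ _ ht0, Complex.cpow_one]
      congr 3
      ring
    · rw [← Complex.ofReal_log ht.1.le]
      norm_cast
      simp [Real.pi_pos]
    · rw [← Complex.ofReal_log ht.1.le]
      norm_cast
      simp [Real.pi_pos.le]
  rw [abs_of_pos (by linarith [ht.1]), Complex.real_smul]
  have h2 : (1 - ((t ^ 2 : ℝ) : ℂ)) ^ (ν + 1 / 2 - 1) = ((1 - t ^ 2 : ℝ) : ℂ) ^ (ν - 1 / 2) := by
    congr 1
    · push_cast; ring
    · ring
  rw [h2, ← h1]
  push_cast
  ring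

theorem integrableOn_poisson {ν : ℂ} (hν : -(1 / 2) < ν.re) (m : ℕ) :
    IntegrableOn (fun t : ℝ => (t : ℂ) ^ m * ((1 - t ^ 2 : ℝ) : ℂ) ^ (ν - 1 / 2)) (Ioo 0 1) := by
  have hu : 0 < ((m + 1) / 2 : ℂ).re := by
    have : ((m + 1) / 2 : ℂ) = (((m + 1) / 2 : ℝ) : ℂ) := by push_cast; ring
    rw [this, Complex.ofReal_re]; positivity
  have hv : 0 < (ν + 1 / 2).re := by
    rw [Complex.add_re]; norm_num; linarith
  have h := Complex.betaIntegral_convergent hu hv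
  rw [intervalIntegrable_iff_integrableOn_Ioo_of_le zero_le_one, ← image_sq_Ioo,
    integrableOn_image_iff_integrableOn_abs_deriv_smul measurableSet_Ioo hasDerivWithinAt_sq_Ioo
      injOn_sq_Ioo] at h
  have h' := h.congr_fun (fun t ht => abs_smul_betaIntegrand ν m ht) measurableSet_Ioo
  have := h'.const_mul (1 / 2 : ℂ)
  refine IntegrableOn.congr_fun this (fun t _ => ?_) measurableSet_Ioo
  ring

theorem integral_poisson_pow {ν : ℂ} (hν : -(1 / 2) < ν.re) (m : ℕ) :
    ∫ t in Ioo (0 : ℝ) 1, (t : ℂ) ^ m * ((1 - t ^ 2 : ℝ) : ℂ) ^ (ν - 1 / 2) =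
      1 / 2 * (Complex.Gamma ((m + 1) / 2) * Complex.Gamma (ν + 1 / 2) /
        Complex.Gamma ((m + 1) / 2 + (ν + 1 / 2))) := by
  have hu : 0 < ((m + 1) / 2 : ℂ).re := by
    have : ((m + 1) / 2 : ℂ) = (((m + 1) / 2 : ℝ) : ℂ) := by push_cast; ring
    rw [this, Complex.ofReal_re]; positivity
  have hv : 0 < (ν + 1 / 2).re := by
    rw [Complex.add_re]; norm_num; linarith
  rw [← Complex.betaIntegral_eq_Gamma_mul_div _ _ hu hv, Complex.betaIntegral,
    intervalIntegral.integral_of_le zero_le_one, integral_Ioc_eq_integral_Ioo]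
  conv_rhs => rw [← image_sq_Ioo]
  rw [integral_image_eq_integral_abs_deriv_smul measurableSet_Ioo hasDerivWithinAt_sq_Ioo
      injOn_sq_Ioo, setIntegral_congr_fun measurableSet_Ioo
      (fun t ht => abs_smul_betaIntegrand ν m ht), integral_const_mul]
  ring

/-- The exponential series may be integrated term by term: since `t ≤ 1`, the norms are dominated by
`|w|^m/m!` times a fixed integral. -/
theorem hasSum_integral_poisson {ν : ℂ} (hν : -(1 / 2) < ν.re) (w : ℂ) :
    HasSum (fun m : ℕ => w ^ m / m.factorial * (1 / 2 * (Complex.Gamma ((m + 1) / 2) *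
      Complex.Gamma (ν + 1 / 2) / Complex.Gamma ((m + 1) / 2 + (ν + 1 / 2)))))
      (∫ t in Ioo (0 : ℝ) 1, Complex.exp (w * t) * ((1 - t ^ 2 : ℝ) : ℂ) ^ (ν - 1 / 2)) := by
  set k : ℝ → ℂ := fun t => ((1 - t ^ 2 : ℝ) : ℂ) ^ (ν - 1 / 2) with hk
  have hk0 : IntegrableOn k (Ioo 0 1) := by simpa [hk] using integrableOn_poisson hν 0
  have hint : ∀ m : ℕ, IntegrableOn (fun t : ℝ => w ^ m / m.factorial * ((t : ℂ) ^ m * k t))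
      (Ioo 0 1) := fun m => (integrableOn_poisson hν m).const_mul _
  have hbound : ∀ m : ℕ, ∫ t in Ioo (0 : ℝ) 1, ‖w ^ m / m.factorial * ((t : ℂ) ^ m * k t)‖ ≤
      ‖w‖ ^ m / m.factorial * ∫ t in Ioo (0 : ℝ) 1, ‖k t‖ := by
    intro m
    rw [← integral_const_mul]
    refine setIntegral_mono_on (hint m).norm (hk0.norm.const_mul _) measurableSet_Ioo fun t ht => ?_
    rw [norm_mul, norm_div, norm_pow, norm_mul, norm_pow, Complex.norm_real,
      Real.norm_of_nonneg ht.1.le, Complex.norm_natCast]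
    refine mul_le_mul_of_nonneg_left ?_ (by positivity)
    exact mul_le_of_le_one_left (norm_nonneg _) (pow_le_one₀ ht.1.le ht.2.le)
  have hsum : Summable fun m : ℕ => ∫ t in Ioo (0 : ℝ) 1, ‖w ^ m / m.factorial * ((t : ℂ) ^ m * k t)‖ :=
    Summable.of_nonneg_of_le (fun m => integral_nonneg fun t => norm_nonneg _) hbound
      ((Real.summable_pow_div_factorial ‖w‖).mul_right _)
  have key := hasSum_integral_of_summable_integral_norm hint hsum
  have e1 : ∀ m : ℕ, ∫ t in Ioo (0 : ℝ) 1, w ^ m / m.factorial * ((t : ℂ) ^ m * k t) =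
      w ^ m / m.factorial * (1 / 2 * (Complex.Gamma ((m + 1) / 2) *
      Complex.Gamma (ν + 1 / 2) / Complex.Gamma ((m + 1) / 2 + (ν + 1 / 2)))) := fun m => by
    rw [integral_const_mul, integral_poisson_pow hν]
  simp only [e1] at key
  have e2 : ∀ t ∈ Ioo (0 : ℝ) 1, ∑' m : ℕ, w ^ m / m.factorial * ((t : ℂ) ^ m * k t) =
      Complex.exp (w * t) * k t := by
    intro t _
    have h := (NormedSpace.expSeries_div_hasSum_exp (w * t)).mul_right (k t)
    rw [← Complex.exp_eq_exp_ℂ] at h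
    rw [← h.tsum_eq]
    refine tsum_congr fun m => ?_
    rw [mul_pow]
    ring
  rwa [setIntegral_congr_fun measurableSet_Ioo e2] at key

/-- Legendre's duplication formula at `n + 1/2`; it converts the `(2n)!` of the even exponential
terms into the `n!` of the Bessel series. -/
theorem Gamma_add_half_div_factorial (n : ℕ) :
    Complex.Gamma (n + 1 / 2) * (n.factorial : ℂ) * 4 ^ n =
      ((2 * n).factorial : ℂ) * (Real.sqrt Real.pi : ℂ) := by
  have h := Complex.Gamma_mul_Gamma_add_half ((n : ℂ) + 1 / 2)
  rw [show (n : ℂ) + 1 / 2 + 1 / 2 = n + 1 by ring, Complex.Gamma_nat_eq_factorial,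
    show 2 * ((n : ℂ) + 1 / 2) = ((2 * n : ℕ) : ℂ) + 1 by push_cast; ring,
    Complex.Gamma_nat_eq_factorial,
    show (1 : ℂ) - (((2 * n : ℕ) : ℂ) + 1) = -((2 * n : ℕ) : ℂ) by ring, Complex.cpow_neg,
    Complex.cpow_natCast, pow_mul] at h
  rw [h]
  have : (4 : ℂ) ^ n ≠ 0 := pow_ne_zero _ (by norm_num)
  norm_num
  field_simp

/-- Duplication at `n + 1`, for the odd terms and the Struve series. -/
theorem Gamma_add_three_half_mul_factorial (n : ℕ) :
    (n.factorial : ℂ) * Complex.Gamma (n + 3 / 2) * (2 * 4 ^ n) =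
      ((2 * n + 1).factorial : ℂ) * (Real.sqrt Real.pi : ℂ) := by
  have h := Complex.Gamma_mul_Gamma_add_half ((n : ℂ) + 1)
  rw [show (n : ℂ) + 1 + 1 / 2 = n + 3 / 2 by ring, Complex.Gamma_nat_eq_factorial,
    show 2 * ((n : ℂ) + 1) = ((2 * n + 1 : ℕ) : ℂ) + 1 by push_cast; ring,
    Complex.Gamma_nat_eq_factorial,
    show (1 : ℂ) - (((2 * n + 1 : ℕ) : ℂ) + 1) = -((2 * n + 1 : ℕ) : ℂ) by ring, Complex.cpow_neg,
    Complex.cpow_natCast, pow_succ, pow_mul] at h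
  rw [h]
  have : (4 : ℂ) ^ n ≠ 0 := pow_ne_zero _ (by norm_num)
  norm_num
  field_simp

/-- For `e = ±i` the even part of `e^{-zet}` does not see the sign of `e`, so the factor `e` stays
in front and gives `±iJ_ν`. -/
theorem poisson_even_term {ν z e : ℂ} (hΓ : Complex.Gamma (ν + 1 / 2) ≠ 0)
    (hw : (-z * e) ^ 2 = -z ^ 2) (n : ℕ) :
    poissonConst ν z * e * ((-z * e) ^ (2 * n) / ((2 * n).factorial : ℂ) *
      (1 / 2 * (Complex.Gamma (((2 * n : ℕ) + 1) / 2) *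
      Complex.Gamma (ν + 1 / 2) / Complex.Gamma (((2 * n : ℕ) + 1) / 2 + (ν + 1 / 2))))) =
      e * ((z / 2) ^ ν * ((-1 : ℂ) ^ n * (z / 2) ^ (2 * n) *
        ((n.factorial : ℂ) * Complex.Gamma (n + ν + 1))⁻¹)) := by
  have hπ : (Real.sqrt Real.pi : ℂ) ≠ 0 := by
    exact_mod_cast (Real.sqrt_pos.mpr Real.pi_pos).ne'
  have hf : ((2 * n).factorial : ℂ) ≠ 0 := by exact_mod_cast (2 * n).factorial_ne_zero
  have hn : (n.factorial : ℂ) ≠ 0 := by exact_mod_cast n.factorial_ne_zero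
  have h4 : (4 : ℂ) ^ n ≠ 0 := pow_ne_zero _ (by norm_num)
  have hg : Complex.Gamma (n + 1 / 2) =
    ((2 * n).factorial : ℂ) * (Real.sqrt Real.pi : ℂ) / ((n.factorial : ℂ) * 4 ^ n) := by
    rw [← Gamma_add_half_div_factorial]; field_simp
  have hz2 : (z / 2) ^ (2 * n) = (z ^ 2) ^ n / 4 ^ n := by
    rw [pow_mul, div_pow, div_pow]; norm_num
  have hwn : (-z * e) ^ (2 * n) = (-1) ^ n * (z ^ 2) ^ n := by
    rw [pow_mul, hw, neg_pow]
  rw [show (((2 * n : ℕ) : ℂ) + 1) / 2 = n + 1 / 2 by push_cast; ring,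
    show (n : ℂ) + 1 / 2 + (ν + 1 / 2) = n + ν + 1 by ring, hg, hwn, hz2, poissonConst]
  generalize Complex.Gamma (ν + 1 / 2) = G at hΓ ⊢
  rw [mul_inv, div_eq_mul_inv _ (Complex.Gamma (n + ν + 1))]
  generalize (Complex.Gamma (n + ν + 1))⁻¹ = G'
  generalize (z / 2) ^ ν = Z
  generalize (z ^ 2) ^ n = Z2
  generalize (Real.sqrt Real.pi : ℂ) = P at hπ ⊢
  field_simp

/-- The odd powers of `-ze` leave one factor `e`, which meets the outer `e` and gives `-e² = 1`.
Both signs therefore produce the same Struve series. -/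
theorem poisson_odd_term {ν z e : ℂ} (hΓ : Complex.Gamma (ν + 1 / 2) ≠ 0)
    (hz : z ≠ 0) (he : e ^ 2 = -1) (n : ℕ) :
    poissonConst ν z * e * ((-z * e) ^ (2 * n + 1) / ((2 * n + 1).factorial : ℂ) *
      (1 / 2 * (Complex.Gamma (((2 * n + 1 : ℕ) + 1) / 2) *
      Complex.Gamma (ν + 1 / 2) / Complex.Gamma (((2 * n + 1 : ℕ) + 1) / 2 + (ν + 1 / 2))))) =
      (z / 2) ^ (ν + 1) * ((-1 : ℂ) ^ n * (z / 2) ^ (2 * n) *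
        (Complex.Gamma (n + 3 / 2) * Complex.Gamma (n + ν + 3 / 2))⁻¹) := by
  have hπ : (Real.sqrt Real.pi : ℂ) ≠ 0 := by
    exact_mod_cast (Real.sqrt_pos.mpr Real.pi_pos).ne'
  have hf : ((2 * n + 1).factorial : ℂ) ≠ 0 := by exact_mod_cast (2 * n + 1).factorial_ne_zero
  have hn : (n.factorial : ℂ) ≠ 0 := by exact_mod_cast n.factorial_ne_zero
  have h4 : (4 : ℂ) ^ n ≠ 0 := pow_ne_zero _ (by norm_num)
  have hG : Complex.Gamma (n + 3 / 2) ≠ 0 := by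
    apply Complex.Gamma_ne_zero_of_re_pos
    rw [Complex.add_re]; norm_num; positivity
  have hg : (n.factorial : ℂ) =
    ((2 * n + 1).factorial : ℂ) * (Real.sqrt Real.pi : ℂ) /
      (Complex.Gamma (n + 3 / 2) * (2 * 4 ^ n)) := by
    rw [← Gamma_add_three_half_mul_factorial]
    generalize Complex.Gamma (n + 3 / 2) = G2 at hG ⊢
    field_simp
  have hz2 : (z / 2) ^ (2 * n) = (z ^ 2) ^ n / 4 ^ n := by
    rw [pow_mul, div_pow, div_pow]; norm_num
  have hwn : (-z * e) ^ (2 * n + 1) = (-1) ^ n * (z ^ 2) ^ n * (-z * e) := by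
    have : (-z * e) ^ 2 = -z ^ 2 := by linear_combination z ^ 2 * he
    rw [pow_succ, pow_mul, this, neg_pow (z ^ 2)]
  rw [show (((2 * n + 1 : ℕ) : ℂ) + 1) / 2 = n + 1 by push_cast; ring,
    Complex.Gamma_nat_eq_factorial,
    show (n : ℂ) + 1 + (ν + 1 / 2) = n + ν + 3 / 2 by ring, hg, hwn, hz2,
    poissonConst, Complex.cpow_add _ _ (div_ne_zero hz two_ne_zero), Complex.cpow_one]
  generalize Complex.Gamma (ν + 1 / 2) = G at hΓ ⊢
  generalize Complex.Gamma (n + 3 / 2) = G2 at hG ⊢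
  rw [mul_inv, div_eq_mul_inv _ (Complex.Gamma (n + ν + 3 / 2))]
  generalize (Complex.Gamma (n + ν + 3 / 2))⁻¹ = G'
  generalize (z / 2) ^ ν = Z
  generalize (z ^ 2) ^ n = Z2
  generalize (Real.sqrt Real.pi : ℂ) = P at hπ ⊢
  generalize ((2 * n + 1).factorial : ℂ) = f at hf ⊢
  generalize (4 : ℂ) ^ n = F at h4 ⊢
  generalize (-1 : ℂ) ^ n = m
  field_simp
  linear_combination (-Z * G' * m * Z2) * he

/-- Poisson's integral for `𝐇_ν ± i J_ν`. -/
theorem struveH_add_besselJ {ν z : ℂ} (hν : -(1 / 2) < ν.re) (hz : z ≠ 0) {ε : ℝ}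
    (hε : ε = 1 ∨ ε = -1) :
    struveH ν z + ε * Complex.I * besselJ ν z = poissonConst ν z *
      ∫ t in Ioo (0 : ℝ) 1, Complex.exp (-z * (ε * Complex.I) * t) *
        ((1 - t ^ 2 : ℝ) : ℂ) ^ (ν - 1 / 2) * (ε * Complex.I) := by
  have he : ((ε : ℂ) * Complex.I) ^ 2 = -1 := by
    rcases hε with rfl | rfl <;> simp
  have hΓ : Complex.Gamma (ν + 1 / 2) ≠ 0 := by
    apply Complex.Gamma_ne_zero_of_re_pos
    rw [Complex.add_re]; norm_num; linarith
  set e : ℂ := ε * Complex.I with hedef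
  have hw : (-z * e) ^ 2 = -z ^ 2 := by linear_combination z ^ 2 * he
  have hs := (hasSum_integral_poisson hν (-z * e)).mul_left (poissonConst ν z * e)
  rw [integral_mul_const]
  set f : ℕ → ℂ := fun m => poissonConst ν z * e * ((-z * e) ^ m / m.factorial *
    (1 / 2 * (Complex.Gamma ((m + 1) / 2) * Complex.Gamma (ν + 1 / 2) /
      Complex.Gamma ((m + 1) / 2 + (ν + 1 / 2))))) with hf
  have hsS : Summable f := hs.summable
  have hE : Summable fun n : ℕ => f (2 * n) :=
    hsS.comp_injective (mul_right_injective₀ (two_ne_zero' ℕ))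
  have hO : Summable fun n : ℕ => f (2 * n + 1) := hsS.comp_injective
    ((add_left_injective 1).comp (mul_right_injective₀ (two_ne_zero' ℕ)))
  have hval := tsum_even_add_odd hE hO
  rw [tsum_congr (poisson_even_term hΓ hw), tsum_congr (poisson_odd_term hΓ hz he), tsum_mul_left,
    tsum_mul_left, tsum_mul_left, hs.tsum_eq] at hval
  unfold struveH besselJ
  linear_combination hval

end Struve

end

noncomputable section

namespace Struve

open MeasureTheory Set

/-! ### Holomorphic parametric integrals -/

/-- Differentiation brings down `ℓ(t)`, and `|ℓ| ≤ η⁻¹ e^{η|ℓ|}`; on the ball of radius `η` the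
derivative is thus dominated by the integrands at the two real parts `Re w₀ ± 2η`. It is applied
with `ℓ = -t` for the argument and with `ℓ = log(1+t²)` for the order. -/
theorem differentiableAt_integral_exp_mul {μ : Measure ℝ} {ℓ : ℝ → ℝ} {k : ℝ → ℂ}
    (hℓ : AEStronglyMeasurable ℓ μ) (hk : AEStronglyMeasurable k μ) {w₀ : ℂ} {η : ℝ} (hη : 0 < η)
    (hint : ∀ c ∈ Icc (w₀.re - 2 * η) (w₀.re + 2 * η),
      Integrable (fun t => Real.exp (c * ℓ t) * ‖k t‖) μ) :
    DifferentiableAt ℂ (fun w : ℂ => ∫ t, Complex.exp (w * ℓ t) * k t ∂μ) w₀ := by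
  have hℓc : AEStronglyMeasurable (fun t => (ℓ t : ℂ)) μ :=
    Complex.continuous_ofReal.comp_aestronglyMeasurable hℓ
  have hm : ∀ w : ℂ, AEStronglyMeasurable (fun t => Complex.exp (w * ℓ t) * k t) μ := fun w =>
    (Complex.continuous_exp.comp_aestronglyMeasurable (hℓc.const_mul w)).mul hk
  have hm' : AEStronglyMeasurable (fun t => (ℓ t : ℂ) * (Complex.exp (w₀ * ℓ t) * k t)) μ :=
    hℓc.mul (hm w₀)
  have hi1 := hint (w₀.re + 2 * η) ⟨by linarith, le_rfl⟩
  have hi2 := hint (w₀.re - 2 * η) ⟨le_rfl, by linarith⟩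
  have hi0 : Integrable (fun t => Complex.exp (w₀ * ℓ t) * k t) μ := by
    refine (hint w₀.re ⟨by linarith, by linarith⟩).mono' (hm w₀) (ae_of_all _ fun t => ?_)
    rw [norm_mul, Complex.norm_exp]
    simp
  refine (hasDerivAt_integral_of_dominated_loc_of_deriv_le (Metric.ball_mem_nhds w₀ hη)
    (Eventually.of_forall hm) hi0
    (F' := fun w t => (ℓ t : ℂ) * (Complex.exp (w * ℓ t) * k t)) hm' (bound := fun t => η⁻¹ *
      (Real.exp ((w₀.re + 2 * η) * ℓ t) * ‖k t‖ + Real.exp ((w₀.re - 2 * η) * ℓ t) * ‖k t‖))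
    (ae_of_all _ fun t w hw => ?_) ((hi1.add hi2).const_mul _)
    (ae_of_all _ fun t w _ => ?_)).2.differentiableAt
  · rw [norm_mul, norm_mul, Complex.norm_exp, Complex.norm_real, Real.norm_eq_abs, ← add_mul,
      ← mul_assoc, ← mul_assoc]
    refine mul_le_mul_of_nonneg_right ?_ (norm_nonneg _)
    have hw' : |w.re - w₀.re| < η := by
      rw [← Complex.sub_re]
      exact (Complex.abs_re_le_norm _).trans_lt (by simpa [dist_eq_norm] using hw)
    have e0 : (w * (ℓ t : ℂ)).re = w.re * ℓ t := by simp
    have e1 : |ℓ t| ≤ η⁻¹ * Real.exp (η * |ℓ t|) := by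
      rw [inv_mul_eq_div, le_div_iff₀ hη]
      nlinarith [Real.add_one_le_exp (η * |ℓ t|)]
    have e2 : w.re * ℓ t ≤ w₀.re * ℓ t + η * |ℓ t| := by
      have : (w.re - w₀.re) * ℓ t ≤ η * |ℓ t| := (le_abs_self _).trans (by
        rw [abs_mul]; exact mul_le_mul_of_nonneg_right hw'.le (abs_nonneg _))
      linarith
    rw [e0]
    calc |ℓ t| * Real.exp (w.re * ℓ t)
        ≤ η⁻¹ * Real.exp (η * |ℓ t|) * Real.exp (w₀.re * ℓ t + η * |ℓ t|) := by
          gcongr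
      _ = η⁻¹ * Real.exp (w₀.re * ℓ t + 2 * η * |ℓ t|) := by
          rw [mul_assoc, ← Real.exp_add]; ring_nf
      _ ≤ _ := by
          refine mul_le_mul_of_nonneg_left ?_ (by positivity)
          rcases abs_cases (ℓ t) with ⟨h, _⟩ | ⟨h, _⟩
          · rw [h, ← add_mul]
            linarith [Real.exp_pos ((w₀.re - 2 * η) * ℓ t)]
          · rw [h, show w₀.re * ℓ t + 2 * η * -ℓ t = (w₀.re - 2 * η) * ℓ t by ring]
            linarith [Real.exp_pos ((w₀.re + 2 * η) * ℓ t)]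
  · have h0 : HasDerivAt (fun w : ℂ => w * (ℓ t : ℂ)) (ℓ t : ℂ) w := by
      simpa using (hasDerivAt_id w).mul_const (ℓ t : ℂ)
    refine (h0.cexp.mul_const (k t)).congr_deriv ?_
    ring

theorem differentiableOn_laplace {k : ℝ → ℂ}
    (hk : AEStronglyMeasurable k (volume.restrict (Ioi 0)))
    (hint : ∀ b : ℝ, 0 < b → IntegrableOn (fun t => Real.exp (-b * t) * ‖k t‖) (Ioi 0)) :
    DifferentiableOn ℂ (fun z : ℂ => ∫ t in Ioi (0 : ℝ), Complex.exp (-z * t) * k t)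
      {z | 0 < z.re} := by
  intro z hz
  have hz' : 0 < z.re := hz
  have h := differentiableAt_integral_exp_mul (μ := volume.restrict (Ioi 0)) (ℓ := fun t => -t)
    (by fun_prop) hk (w₀ := z) (η := z.re / 4) (by linarith) (fun c hc => ?_)
  · refine DifferentiableAt.differentiableWithinAt ?_
    convert h using 1
    ext w
    congr 1
    ext t
    push_cast
    ring_nf
  · have := hint c (by linarith [hc.1])
    have h3 : IntegrableOn (fun t => Real.exp (c * -t) * ‖k t‖) (Ioi 0) := by
      simpa [mul_neg, neg_mul] using this
    exact h3

/-- Euler's integral with a complex parameter. -/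
theorem integral_cpow_mul_exp_neg_mul {a : ℝ} (ha : 0 < a) {z : ℂ} (hz : 0 < z.re) :
    ∫ t in Ioi (0 : ℝ), Complex.exp (-z * t) * (t : ℂ) ^ ((a : ℂ) - 1) =
      z ^ (-(a : ℂ)) * Complex.Gamma a := by
  have hopen : IsOpen {z : ℂ | 0 < z.re} := isOpen_lt continuous_const Complex.continuous_re
  have hconv : Convex ℝ {z : ℂ | 0 < z.re} := convex_halfSpace_re_gt 0
  have hk : AEStronglyMeasurable (fun t : ℝ => (t : ℂ) ^ ((a : ℂ) - 1)) (volume.restrict (Ioi 0)) := by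
    refine ContinuousOn.aestronglyMeasurable (fun t ht => ?_) measurableSet_Ioi
    exact (Complex.continuousAt_ofReal_cpow_const _ _ (Or.inr (ne_of_gt ht))).continuousWithinAt
  have hf : DifferentiableOn ℂ (fun z : ℂ => ∫ t in Ioi (0 : ℝ),
      Complex.exp (-z * t) * (t : ℂ) ^ ((a : ℂ) - 1)) {z | 0 < z.re} := by
    refine differentiableOn_laplace hk fun b hb => ?_
    have := integrableOn_rpow_mul_exp_neg_mul_rpow (p := 1) (s := a - 1) (by linarith) one_pos hb
    refine this.congr_fun (fun t ht => ?_) measurableSet_Ioi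
    have ht' : (0 : ℝ) < t := ht
    simp only [Real.rpow_one]
    rw [Complex.norm_cpow_eq_rpow_re_of_pos ht', mul_comm]
    simp
  have hg : DifferentiableOn ℂ (fun z : ℂ => z ^ (-(a : ℂ)) * Complex.Gamma a) {z | 0 < z.re} := by
    intro w hw
    refine (DifferentiableAt.mul_const ?_ _).differentiableWithinAt
    exact (differentiableAt_id.cpow_const (Or.inl hw))
  refine (hf.analyticOnNhd hopen).eqOn_of_preconnected_of_frequently_eq
    (hg.analyticOnNhd hopen) hconv.isPreconnected (z₀ := 1) (by simp) ?_ hz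
  have key : ∀ x : ℝ, 0 < x → ∫ t in Ioi (0 : ℝ), Complex.exp (-(x : ℂ) * t) *
      (t : ℂ) ^ ((a : ℂ) - 1) = (x : ℂ) ^ (-(a : ℂ)) * Complex.Gamma a := by
    intro x hx
    have := Complex.integral_cpow_mul_exp_neg_mul_Ioi (a := a) (by simpa using ha) hx
    rw [one_div, ← Complex.ofReal_inv, ← Complex.ofReal_cpow (by positivity),
      Real.inv_rpow hx.le, ← Real.rpow_neg hx.le, Complex.ofReal_cpow hx.le] at this
    rw [Complex.ofReal_neg] at this
    rw [← this]
    refine setIntegral_congr_fun measurableSet_Ioi fun t _ => ?_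
    rw [mul_comm, neg_mul]
  -- The formula is known for positive real parameters; the points `1 + 1/(n+1)` accumulate at `1`,
  -- as the identity theorem requires.
  have hseq : Tendsto (fun n : ℕ => ((1 + 1 / ((n : ℝ) + 1) : ℝ) : ℂ)) atTop (𝓝[≠] 1) := by
    refine tendsto_nhdsWithin_iff.mpr ⟨?_, Eventually.of_forall fun n => ?_⟩
    · have : Tendsto (fun n : ℕ => (1 + 1 / ((n : ℝ) + 1) : ℝ)) atTop (𝓝 1) := by
        simpa using tendsto_one_div_add_atTop_nhds_zero_nat.const_add (1 : ℝ)
      have h2 := (Complex.continuous_ofReal.tendsto (1 : ℝ)).comp this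
      rw [Complex.ofReal_one] at h2
      exact h2
    · have : (0 : ℝ) < 1 / ((n : ℝ) + 1) := by positivity
      intro h
      have h' : ((1 + 1 / ((n : ℝ) + 1) : ℝ) : ℂ) = ((1 : ℝ) : ℂ) := by
        rw [Complex.ofReal_one]; exact h
      linarith [Complex.ofReal_injective h']
  refine hseq.frequently (Frequently.of_forall fun n => ?_)
  have := key (1 + 1 / ((n : ℝ) + 1)) (by positivity)
  exact this

/-! ### The symmetry `ν ↦ -ν` -/

/-- The integral `∫ e^{-xt} t^{ν-1/2} (2 - it)^{ν-1/2} dt`. -/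
def hankelInt (ν x : ℝ) : ℂ :=
  ∫ t in Ioi (0 : ℝ), Complex.exp (-(x : ℂ) * t) * (t : ℂ) ^ ((ν + 1 / 2 : ℝ) - 1 : ℂ) *
    (2 - Complex.I * t) ^ (-((1 / 2 - ν : ℝ) : ℂ))

theorem ofReal_mul_cpow {c : ℝ} (hc : 0 < c) {w : ℂ} (hw : w ≠ 0) (s : ℂ) :
    ((c : ℂ) * w) ^ s = (c : ℂ) ^ s * w ^ s := by
  have hc' : (c : ℂ) ≠ 0 := by exact_mod_cast hc.ne'
  rw [Complex.cpow_def_of_ne_zero (mul_ne_zero hc' hw), Complex.cpow_def_of_ne_zero hc',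
    Complex.cpow_def_of_ne_zero hw, Complex.log_ofReal_mul hc hw, Complex.ofReal_log hc.le,
    ← Complex.exp_add]
  ring_nf

theorem integrableOn_exp_mul_cpow {a x : ℝ} (ha : 0 < a) (hx : 0 < x) :
    IntegrableOn (fun t : ℝ => Complex.exp (-(x : ℂ) * t) * (t : ℂ) ^ ((a : ℂ) - 1)) (Ioi 0) := by
  have := integrableOn_rpow_mul_exp_neg_mul_rpow (p := 1) (s := a - 1) (by linarith) one_pos hx
  refine Integrable.mono' this ?_ ?_
  · refine ContinuousOn.aestronglyMeasurable (fun t ht => ?_) measurableSet_Ioi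
    refine ContinuousWithinAt.mul (by fun_prop) ?_
    exact (Complex.continuousAt_ofReal_cpow_const _ _ (Or.inr (ne_of_gt ht))).continuousWithinAt
  · refine (ae_restrict_iff' measurableSet_Ioi).mpr (ae_of_all _ fun t ht => ?_)
    have ht' : (0 : ℝ) < t := ht
    rw [norm_mul, Complex.norm_cpow_eq_rpow_re_of_pos ht', mul_comm, Complex.norm_exp]
    simp

/-- Multiplied by `Γ(1/2-ν)`, the power of `2 - it` becomes Euler's integral in a second variable
`s`. The double integral has the exponent `-xt - 2s + ist`; integrating over `t` first exchanges the
two powers, and `s = xt/2` restores the original form with `-ν`. The bound `|ν| < 1/2` makes both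
Gamma integrals converge. -/
theorem hankelInt_symm {ν x : ℝ} (hν : |ν| < 1 / 2) (hx : 0 < x) :
    hankelInt ν x * Complex.Gamma ((1 / 2 - ν : ℝ) : ℂ) =
      Complex.Gamma ((ν + 1 / 2 : ℝ) : ℂ) * ((x / 2 : ℝ) : ℂ) ^ (-2 * ν : ℂ) * hankelInt (-ν) x := by
  obtain ⟨h1, h2⟩ := abs_lt.mp hν
  have ha : 0 < ν + 1 / 2 := by linarith
  have hb : 0 < 1 / 2 - ν := by linarith
  set a : ℝ := ν + 1 / 2 with hadef
  set b : ℝ := 1 / 2 - ν with hbdef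
  set f : ℝ → ℝ → ℂ := fun t s => Complex.exp (-(x : ℂ) * t) * (t : ℂ) ^ ((a : ℂ) - 1) *
    (Complex.exp (-(2 - Complex.I * t) * s) * (s : ℂ) ^ ((b : ℂ) - 1)) with hf
  have hL : hankelInt ν x * Complex.Gamma b = ∫ t in Ioi (0 : ℝ), ∫ s in Ioi (0 : ℝ), f t s := by
    rw [hankelInt, ← integral_mul_const]
    refine setIntegral_congr_fun measurableSet_Ioi fun t _ => ?_
    simp only [hf]
    rw [integral_const_mul, integral_cpow_mul_exp_neg_mul hb (by simp)]
    ring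
  have hR : ∀ s ∈ Ioi (0 : ℝ), ∫ t in Ioi (0 : ℝ), f t s = Complex.Gamma a *
      (Complex.exp (-2 * s) * (s : ℂ) ^ ((b : ℂ) - 1) * (x - Complex.I * s) ^ (-(a : ℂ))) := by
    intro s _
    have := integral_cpow_mul_exp_neg_mul ha (z := x - Complex.I * s) (by simpa using hx)
    have e : ∀ t : ℝ, f t s = (Complex.exp (-2 * s) * (s : ℂ) ^ ((b : ℂ) - 1)) *
        (Complex.exp (-(x - Complex.I * s) * t) * (t : ℂ) ^ ((a : ℂ) - 1)) := by
      intro t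
      have : Complex.exp (-(x : ℂ) * t) * Complex.exp (-(2 - Complex.I * t) * s) =
          Complex.exp (-2 * s) * Complex.exp (-(x - Complex.I * s) * t) := by
        rw [← Complex.exp_add, ← Complex.exp_add]; ring_nf
      simp only [hf]
      linear_combination ((t : ℂ) ^ ((a : ℂ) - 1) * (s : ℂ) ^ ((b : ℂ) - 1)) * this
    simp only [e]
    rw [integral_const_mul, this]
    ring
  -- The mixed factor `e^{ist}` has modulus one; what remains is a product of two Gamma integrands,
  -- so Fubini applies.
  have hint : Integrable (Function.uncurry f)
      ((volume.restrict (Ioi (0 : ℝ))).prod (volume.restrict (Ioi (0 : ℝ)))) := by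
    have hp := (integrableOn_exp_mul_cpow ha hx).mul_prod (integrableOn_exp_mul_cpow hb two_pos)
    have hbm := hp.bdd_mul (c := 1) (f := fun p : ℝ × ℝ => Complex.exp (Complex.I * p.1 * p.2))
      (Continuous.aestronglyMeasurable (by fun_prop)) (ae_of_all _ fun p => by
        rw [Complex.norm_exp]; simp)
    refine hbm.congr (ae_of_all _ fun p => ?_)
    have : Complex.exp (-(2 - Complex.I * p.1) * p.2) = Complex.exp (Complex.I * p.1 * p.2) *
        Complex.exp (-((2 : ℝ) : ℂ) * p.2) := by
      rw [← Complex.exp_add]; push_cast; ring_nf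
    simp only [Function.uncurry, hf, this]
    ring
  rw [hL, integral_integral_swap hint, setIntegral_congr_fun measurableSet_Ioi hR,
    integral_const_mul, mul_assoc]
  congr 1
  have hx2 : 0 < x / 2 := by positivity
  have hsub := integral_comp_mul_left_Ioi' (fun s : ℝ => Complex.exp (-2 * s) *
    (s : ℂ) ^ ((b : ℂ) - 1) * (x - Complex.I * s) ^ (-(a : ℂ))) 0 hx2
  rw [mul_zero] at hsub
  rw [← hsub, hankelInt, Complex.real_smul, ← integral_const_mul, ← integral_const_mul]
  refine setIntegral_congr_fun measurableSet_Ioi fun t ht => ?_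
  have ht' : (0 : ℝ) < t := ht
  have hne : ((x / 2 : ℝ) : ℂ) ≠ 0 := by exact_mod_cast hx2.ne'
  have e1 : ((x / 2 * t : ℝ) : ℂ) ^ ((b : ℂ) - 1) =
      ((x / 2 : ℝ) : ℂ) ^ ((b : ℂ) - 1) * (t : ℂ) ^ ((b : ℂ) - 1) := by
    rw [Complex.ofReal_mul, ofReal_mul_cpow hx2 (by exact_mod_cast ht'.ne')]
  have hw : (2 - Complex.I * t : ℂ) ≠ 0 := by
    intro h; have := congrArg Complex.re h; simp at this
  have e2 : ((x : ℂ) - Complex.I * ((x / 2 * t : ℝ) : ℂ)) ^ (-(a : ℂ)) =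
      ((x / 2 : ℝ) : ℂ) ^ (-(a : ℂ)) * (2 - Complex.I * t) ^ (-(a : ℂ)) := by
    rw [← ofReal_mul_cpow hx2 hw]
    congr 1
    push_cast
    ring
  have e3 : ((x / 2 : ℝ) : ℂ) * (((x / 2 : ℝ) : ℂ) ^ ((b : ℂ) - 1) * ((x / 2 : ℝ) : ℂ) ^ (-(a : ℂ)))
      = ((x / 2 : ℝ) : ℂ) ^ (-2 * ν : ℂ) := by
    conv_lhs => enter [1]; rw [← Complex.cpow_one ((x / 2 : ℝ) : ℂ)]
    rw [← Complex.cpow_add _ _ hne, ← Complex.cpow_add _ _ hne]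
    congr 1
    rw [hadef, hbdef]
    push_cast
    ring
  have e4 : (-2 : ℂ) * ((x / 2 * t : ℝ) : ℂ) = -(x : ℂ) * t := by push_cast; ring
  rw [e1, e2, e4, show (-ν + 1 / 2 : ℝ) = b by rw [hbdef]; ring,
    show (1 / 2 - -ν : ℝ) = a by rw [hadef]; ring]
  linear_combination (Complex.exp (-(x : ℂ) * t) * (t : ℂ) ^ ((b : ℂ) - 1) *
    (2 - Complex.I * t) ^ (-(a : ℂ))) * e3

end Struve

end

noncomputable section

namespace Struve

open MeasureTheory Set

/-! ### The contour through `i` -/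

/-- The Laplace integral `∫ e^{-zt} (1+t²)^{ν-1/2} dt` over the positive real axis. -/
def laplaceInt (ν z : ℂ) : ℂ :=
  ∫ t in Ioi (0 : ℝ), Complex.exp (-z * t) * ((1 + t ^ 2 : ℝ) : ℂ) ^ (ν - 1 / 2)

/-- `poissonConst` times the Laplace integral, that is `𝐇_ν(z) - Y_ν(z)`. -/
def struveK (ν z : ℂ) : ℂ := poissonConst ν z * laplaceInt ν z

/-- In `1+u² = (u-i)(u+i)` the first factor has modulus at least `t` and the second at least `1`.
The resulting majorant of the integrand does not depend on the height `y`. -/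
theorem norm_one_add_sq_ge {t y : ℝ} (ht : 0 ≤ t) (hy : 0 ≤ y) :
    t ≤ ‖1 + ((t : ℂ) + y * Complex.I) ^ 2‖ := by
  have : 1 + ((t : ℂ) + y * Complex.I) ^ 2 =
      (t + (y - 1) * Complex.I) * (t + (y + 1) * Complex.I) := by
    linear_combination Complex.I_sq
  rw [this, norm_mul]
  have h1 : t ≤ ‖(t : ℂ) + (y - 1) * Complex.I‖ := by
    refine le_trans (le_of_eq ?_) (Complex.re_le_norm _)
    simp
  have h2 : 1 ≤ ‖(t : ℂ) + (y + 1) * Complex.I‖ := by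
    refine le_trans ?_ (Complex.im_le_norm _)
    simp [hy]
  nlinarith [norm_nonneg ((t : ℂ) + (y - 1) * Complex.I)]

/-- The principal branch is analytic below height `1`, and by the next lemma also in the open first
quadrant, but not at `i`. Hence Cauchy's theorem is used at heights below `1` and the height `1` is
reached as a limit. -/
theorem one_add_sq_mem_slitPlane {t y : ℝ} (hy : 0 ≤ y) (hy1 : y < 1) :
    1 + ((t : ℂ) + y * Complex.I) ^ 2 ∈ Complex.slitPlane := by
  left
  have : (1 + ((t : ℂ) + y * Complex.I) ^ 2).re = 1 + t ^ 2 - y ^ 2 := by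
    simp [pow_two]
    ring
  rw [this]
  nlinarith

theorem one_add_sq_mem_slitPlane_of_pos {t y : ℝ} (ht : 0 < t) (hy : 0 < y) :
    1 + ((t : ℂ) + y * Complex.I) ^ 2 ∈ Complex.slitPlane := by
  right
  have : (1 + ((t : ℂ) + y * Complex.I) ^ 2).im = 2 * t * y := by
    simp [pow_two]
    ring
  rw [this]
  positivity

/-- Cauchy's theorem on `[0,R] × [0,η]`, then `R → ∞`, then `η → 1` by dominated convergence. The
exponent `ν - 1/2` is negative, which gives the uniform majorant, and exceeds `-1`, which makes it
integrable at the branch point. -/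
theorem laplaceInt_eq_add {ν x : ℝ} (hν : |ν| < 1 / 2) (hx : 0 < x) :
    laplaceInt ν x = (∫ t in Ioo (0 : ℝ) 1, Complex.exp (-(x : ℂ) * Complex.I * t) *
        ((1 - t ^ 2 : ℝ) : ℂ) ^ ((ν : ℂ) - 1 / 2) * Complex.I) +
      ∫ t in Ioi (0 : ℝ), Complex.exp (-(x : ℂ) * (t + (1 : ℝ) * Complex.I)) *
        (1 + ((t : ℂ) + (1 : ℝ) * Complex.I) ^ 2) ^ ((ν - 1 / 2 : ℝ) : ℂ) := by
  obtain ⟨h1, h2⟩ := abs_lt.mp hν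
  set σ : ℝ := ν - 1 / 2 with hσ
  set f : ℂ → ℂ := fun u => Complex.exp (-(x : ℂ) * u) * (1 + u ^ 2) ^ (σ : ℂ) with hf
  have hσ0 : σ < 0 := by rw [hσ]; linarith
  have hnorm : ∀ t y : ℝ, 0 < t → 0 ≤ y → ‖f (t + y * Complex.I)‖ ≤
      Real.exp (-(x * t)) * t ^ σ := by
    intro t y ht hy
    rw [hf, norm_mul, Complex.norm_exp, Complex.norm_cpow_real]
    have : (-(x : ℂ) * (t + y * Complex.I)).re = -(x * t) := by simp
    rw [this]
    exact mul_le_mul_of_nonneg_left (Real.rpow_le_rpow_of_nonpos ht (norm_one_add_sq_ge ht.le hy)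
      hσ0.le) (Real.exp_pos _).le
  have hbint : IntegrableOn (fun t : ℝ => Real.exp (-(x * t)) * t ^ σ) (Ioi 0) := by
    have := integrableOn_rpow_mul_exp_neg_mul_rpow (p := 1) (s := σ) (by rw [hσ]; linarith)
      one_pos hx
    refine this.congr_fun (fun t _ => ?_) measurableSet_Ioi
    simp only [Real.rpow_one]
    rw [mul_comm, neg_mul]
  have hdiff : ∀ t y : ℝ, 0 ≤ y → (y < 1 ∨ 0 < t ∧ 0 < y) →
      DifferentiableAt ℂ f (t + y * Complex.I) := by
    intro t y hy h
    have hs : 1 + ((t : ℂ) + y * Complex.I) ^ 2 ∈ Complex.slitPlane := by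
      rcases h with h | h
      · exact one_add_sq_mem_slitPlane hy h
      · exact one_add_sq_mem_slitPlane_of_pos h.1 h.2
    refine DifferentiableAt.mul (by fun_prop) (DifferentiableAt.cpow_const ?_ hs)
    fun_prop
  have hcont : ∀ y : ℝ, 0 ≤ y → y ≤ 1 →
      ContinuousOn (fun t : ℝ => f (t + y * Complex.I)) (Ioi 0) := by
    intro y hy hy1 t ht
    have hd : DifferentiableAt ℂ f (t + y * Complex.I) := by
      refine hdiff t y hy ?_
      rcases hy1.lt_or_eq with h | h
      · exact Or.inl h
      · exact Or.inr ⟨ht, by rw [h]; exact one_pos⟩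
    exact (hd.continuousAt.comp (f := fun t : ℝ => (t : ℂ) + y * Complex.I)
      (by fun_prop)).continuousWithinAt
  have hinty : ∀ y : ℝ, 0 ≤ y → y ≤ 1 → IntegrableOn (fun t : ℝ => f (t + y * Complex.I)) (Ioi 0) := by
    intro y hy hy1
    refine Integrable.mono' hbint ((hcont y hy hy1).aestronglyMeasurable measurableSet_Ioi) ?_
    exact (ae_restrict_iff' measurableSet_Ioi).mpr (ae_of_all _ fun t ht => hnorm t y ht hy)
  have hfy : ∀ y ∈ Ioo (0 : ℝ) 1, f (y * Complex.I) = Complex.exp (-(x : ℂ) * Complex.I * y) *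
      ((1 - y ^ 2 : ℝ) : ℂ) ^ ((ν : ℂ) - 1 / 2) := by
    intro y _
    rw [hf]
    have e1 : (1 : ℂ) + (y * Complex.I) ^ 2 = ((1 - y ^ 2 : ℝ) : ℂ) := by
      push_cast; linear_combination (y : ℂ) ^ 2 * Complex.I_sq
    have e2 : (σ : ℂ) = (ν : ℂ) - 1 / 2 := by rw [hσ]; push_cast; ring
    simp only [e1, e2]
    ring_nf
  have hseg : IntegrableOn (fun y : ℝ => f (y * Complex.I)) (Ioo 0 1) := by
    have hb : IntegrableOn (fun t : ℝ => Complex.exp (-(x : ℂ) * Complex.I * t) *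
        ((1 - t ^ 2 : ℝ) : ℂ) ^ ((ν : ℂ) - 1 / 2)) (Ioo 0 1) := by
      have h0 := integrableOn_poisson (ν := ν) (by simpa using h1) 0
      simp only [pow_zero, one_mul] at h0
      refine h0.bdd_mul (c := 1) (Continuous.aestronglyMeasurable (by fun_prop))
        (ae_of_all _ fun t => ?_)
      rw [Complex.norm_exp]
      simp
    exact hb.congr_fun (fun y hy => (hfy y hy).symm) measurableSet_Ioo
  -- At a fixed height `η < 1` the right side of the rectangle is at most `e^{-xR}` and disappears.
  have stepA : ∀ η : ℝ, 0 ≤ η → η < 1 → (∫ t in Ioi (0 : ℝ), f (t + (0 : ℝ) * Complex.I)) -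
      ∫ t in Ioi (0 : ℝ), f (t + η * Complex.I) = Complex.I * ∫ y in (0 : ℝ)..η, f (y * Complex.I) := by
    intro η hη hη1
    have hrect : ∀ R : ℝ, 1 ≤ R → (∫ t in (0 : ℝ)..R, f (t + (0 : ℝ) * Complex.I)) -
        (∫ t in (0 : ℝ)..R, f (t + η * Complex.I)) - Complex.I * ∫ y in (0 : ℝ)..η, f (y * Complex.I) =
        -(Complex.I * ∫ y in (0 : ℝ)..η, f (R + y * Complex.I)) := by
      intro R hR
      have := Complex.integral_boundary_rect_eq_zero_of_differentiableOn f 0 (R + η * Complex.I)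
        (fun u hu => by
          have him : u.im ∈ uIcc (0 : ℝ) η := by
            have := hu.2; simpa using this
          rw [uIcc_of_le hη] at him
          have := hdiff u.re u.im him.1 (Or.inl (him.2.trans_lt hη1))
          rw [Complex.re_add_im] at this
          exact this.differentiableWithinAt)
      simp only [Complex.zero_re, Complex.zero_im, Complex.add_re, Complex.ofReal_re,
        Complex.mul_re, Complex.I_re, mul_zero, Complex.ofReal_im, Complex.I_im, mul_one, sub_self,
        add_zero, Complex.add_im, Complex.mul_im, zero_add, smul_eq_mul, Complex.ofReal_zero] at this
      simp only [Complex.ofReal_zero]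
      linear_combination this
    have l1 := intervalIntegral_tendsto_integral_Ioi 0 (hinty 0 le_rfl zero_le_one) tendsto_id
    have l2 := intervalIntegral_tendsto_integral_Ioi 0 (hinty η hη hη1.le) tendsto_id
    have l3 : Tendsto (fun R : ℝ => -(Complex.I * ∫ y in (0 : ℝ)..η, f (R + y * Complex.I))) atTop
        (𝓝 0) := by
      have hex : Tendsto (fun R : ℝ => Real.exp (-(x * R))) atTop (𝓝 0) :=
        Real.tendsto_exp_neg_atTop_nhds_zero.comp (tendsto_id.const_mul_atTop hx)
      refine squeeze_zero_norm' ?_ hex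
      filter_upwards [eventually_ge_atTop 1] with R hR
      rw [norm_neg, norm_mul, Complex.norm_I, one_mul]
      refine (intervalIntegral.norm_integral_le_of_norm_le_const (C := Real.exp (-(x * R)))
        fun y hy => ?_).trans ?_
      · rw [uIoc_of_le hη] at hy
        refine (hnorm R y (by linarith) hy.1.le).trans ?_
        exact mul_le_of_le_one_right (Real.exp_pos _).le (Real.rpow_le_one_of_one_le_of_nonpos hR hσ0.le)
      · rw [sub_zero, abs_of_nonneg hη]
        exact mul_le_of_le_one_right (Real.exp_pos _).le hη1.le
    have l4 := (l1.sub l2).sub_const (Complex.I * ∫ y in (0 : ℝ)..η, f (y * Complex.I))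
    have l5 : Tendsto (fun R : ℝ => (∫ t in (0 : ℝ)..R, f (t + (0 : ℝ) * Complex.I)) -
        (∫ t in (0 : ℝ)..R, f (t + η * Complex.I)) - Complex.I * ∫ y in (0 : ℝ)..η, f (y * Complex.I))
        atTop (𝓝 0) := by
      refine l3.congr' ?_
      filter_upwards [eventually_ge_atTop 1] with R hR using (hrect R hR).symm
    exact sub_eq_zero.mp (tendsto_nhds_unique l4 l5)
  -- let `η` tend to `1`
  set e : ℕ → ℝ := fun n => 1 - 1 / ((n : ℝ) + 1) with he
  have he0 : ∀ n, 0 ≤ e n := fun n => by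
    rw [he]; simp only
    have : 1 / ((n : ℝ) + 1) ≤ 1 := by rw [div_le_one (by positivity)]; simp
    linarith
  have he1 : ∀ n, e n < 1 := fun n => by
    rw [he]; simp only
    have : 0 < 1 / ((n : ℝ) + 1) := by positivity
    linarith
  have helim : Tendsto e atTop (𝓝 1) := by
    have := (tendsto_one_div_add_atTop_nhds_zero_nat (𝕜 := ℝ)).const_sub 1
    simpa [he] using this
  have lim1 : Tendsto (fun n => ∫ t in Ioi (0 : ℝ), f (t + e n * Complex.I)) atTop
      (𝓝 (∫ t in Ioi (0 : ℝ), f (t + (1 : ℝ) * Complex.I))) := by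
    refine tendsto_integral_of_dominated_convergence _
      (fun n => (hcont (e n) (he0 n) (he1 n).le).aestronglyMeasurable measurableSet_Ioi) hbint
      (fun n => (ae_restrict_iff' measurableSet_Ioi).mpr
        (ae_of_all _ fun t ht => hnorm t (e n) ht (he0 n)))
      ((ae_restrict_iff' measurableSet_Ioi).mpr (ae_of_all _ fun t ht => ?_))
    have hd := (hdiff t 1 zero_le_one (Or.inr ⟨ht, one_pos⟩)).continuousAt
    refine hd.tendsto.comp ?_
    have hc : Continuous fun y : ℝ => (t : ℂ) + y * Complex.I := by fun_prop
    exact (hc.tendsto 1).comp helim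
  have lim2 : Tendsto (fun n => ∫ y in (0 : ℝ)..(e n), f (y * Complex.I)) atTop
      (𝓝 (∫ y in (0 : ℝ)..1, f (y * Complex.I))) := by
    have hio : IntegrableOn (fun y : ℝ => f (y * Complex.I)) (uIcc 0 1) := by
      rw [uIcc_of_le zero_le_one, integrableOn_Icc_iff_integrableOn_Ioo]
      exact hseg
    have hc := intervalIntegral.continuousOn_primitive_interval hio
    have hc1 := hc 1 (by simp)
    refine hc1.tendsto.comp (tendsto_nhdsWithin_iff.mpr ⟨helim, Eventually.of_forall fun n => ?_⟩)
    rw [uIcc_of_le zero_le_one]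
    exact ⟨he0 n, (he1 n).le⟩
  have lim3 := (lim1.const_sub (∫ t in Ioi (0 : ℝ), f (t + (0 : ℝ) * Complex.I))).congr
    fun n => stepA (e n) (he0 n) (he1 n)
  have hfin := tendsto_nhds_unique lim3 (lim2.const_mul Complex.I)
  rw [intervalIntegral.integral_of_le zero_le_one, integral_Ioc_eq_integral_Ioo,
    setIntegral_congr_fun measurableSet_Ioo hfy] at hfin
  have hK : laplaceInt ν x = ∫ t in Ioi (0 : ℝ), f (t + (0 : ℝ) * Complex.I) := by
    refine setIntegral_congr_fun measurableSet_Ioi fun t _ => ?_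
    simp only [hf, hσ]
    push_cast
    ring_nf
  rw [integral_mul_const, hK]
  linear_combination hfin

/-- The integral from `i` to `i + ∞`, multiplied by `poissonConst`. -/
def hankelPart (ν x : ℝ) : ℂ :=
  poissonConst ν x * ∫ t in Ioi (0 : ℝ), Complex.exp (-(x : ℂ) * (t + (1 : ℝ) * Complex.I)) *
        (1 + ((t : ℂ) + (1 : ℝ) * Complex.I) ^ 2) ^ ((ν - 1 / 2 : ℝ) : ℂ)

/-- On the line `u = t + i` one has `1+u² = t · i(2-it)`. The arguments of `i` and `2 - it` add up
to less than `π`, so the principal powers multiply. -/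
theorem hankelPart_eq (ν x : ℝ) : hankelPart ν x = poissonConst ν x *
    (Complex.exp (-(x : ℂ) * Complex.I) * Complex.I ^ ((ν - 1 / 2 : ℝ) : ℂ) * hankelInt ν x) := by
  rw [hankelPart]
  refine congrArg (poissonConst ν x * ·) ?_
  rw [hankelInt, ← integral_const_mul]
  refine setIntegral_congr_fun measurableSet_Ioi fun t ht => ?_
  have ht' : (0 : ℝ) < t := ht
  have hw : (2 - Complex.I * t : ℂ) ≠ 0 := by
    intro h; have := congrArg Complex.re h; simp at this
  have e1 : 1 + ((t : ℂ) + (1 : ℝ) * Complex.I) ^ 2 = (t : ℂ) * (Complex.I * (2 - Complex.I * t)) := by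
    push_cast; linear_combination (1 + (t : ℂ) ^ 2) * Complex.I_sq
  have harg : |Complex.arg (2 - Complex.I * t)| < Real.pi / 2 :=
    Complex.abs_arg_lt_pi_div_two_iff.mpr (Or.inl (by simp))
  have hlog : Complex.log (Complex.I * (2 - Complex.I * t)) =
      Complex.log Complex.I + Complex.log (2 - Complex.I * t) := by
    rw [Complex.log_mul_eq_add_log_iff Complex.I_ne_zero hw, Complex.arg_I]
    obtain ⟨h1, h2⟩ := abs_lt.mp harg
    constructor <;> linarith [Real.pi_pos]
  have e2 : ∀ s : ℂ, (Complex.I * (2 - Complex.I * t)) ^ s =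
      Complex.I ^ s * (2 - Complex.I * t) ^ s := by
    intro s
    rw [Complex.cpow_def_of_ne_zero (mul_ne_zero Complex.I_ne_zero hw), hlog,
      Complex.cpow_def_of_ne_zero Complex.I_ne_zero, Complex.cpow_def_of_ne_zero hw,
      ← Complex.exp_add]
    ring_nf
  have e3 : Complex.exp (-(x : ℂ) * (t + (1 : ℝ) * Complex.I)) =
      Complex.exp (-(x : ℂ) * Complex.I) * Complex.exp (-(x : ℂ) * t) := by
    rw [← Complex.exp_add]; push_cast; ring_nf
  have e4 : ((ν + 1 / 2 : ℝ) - 1 : ℂ) = ((ν - 1 / 2 : ℝ) : ℂ) := by push_cast; ring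
  have e5 : (-((1 / 2 - ν : ℝ) : ℂ)) = ((ν - 1 / 2 : ℝ) : ℂ) := by push_cast; ring
  simp only [e1, e3, e4, e5]
  rw [ofReal_mul_cpow ht' (mul_ne_zero Complex.I_ne_zero hw), e2]
  ring

/-- By `hankelInt_symm` the Gamma factors and powers of `x/2` balance under `ν ↦ -ν`; the only
change left is `i^(-2ν) = e^{-iπν}`. -/
theorem hankelPart_neg {ν x : ℝ} (hν : |ν| < 1 / 2) (hx : 0 < x) :
    hankelPart (-ν) x = Complex.exp (-(ν * Real.pi * Complex.I)) * hankelPart ν x := by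
  obtain ⟨h1, h2⟩ := abs_lt.mp hν
  have hs := hankelInt_symm hν hx
  have hx2 : 0 < x / 2 := by positivity
  have hX : ((x / 2 : ℝ) : ℂ) ≠ 0 := by exact_mod_cast hx2.ne'
  have hG1 : Complex.Gamma ((1 / 2 - ν : ℝ) : ℂ) ≠ 0 :=
    Complex.Gamma_ne_zero_of_re_pos (by rw [Complex.ofReal_re]; linarith)
  have hG2 : Complex.Gamma ((ν + 1 / 2 : ℝ) : ℂ) ≠ 0 :=
    Complex.Gamma_ne_zero_of_re_pos (by rw [Complex.ofReal_re]; linarith)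
  have hπ : (Real.sqrt Real.pi : ℂ) ≠ 0 := by
    exact_mod_cast (Real.sqrt_pos.mpr Real.pi_pos).ne'
  have hpow : ((x / 2 : ℝ) : ℂ) ^ (-2 * ν : ℂ) * ((x / 2 : ℝ) : ℂ) ^ (ν : ℂ) =
      ((x / 2 : ℝ) : ℂ) ^ (-ν : ℂ) := by
    rw [← Complex.cpow_add _ _ hX]; ring_nf
  have hI : Complex.I ^ ((-ν - 1 / 2 : ℝ) : ℂ) =
      Complex.exp (-(ν * Real.pi * Complex.I)) * Complex.I ^ ((ν - 1 / 2 : ℝ) : ℂ) := by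
    rw [Complex.cpow_def_of_ne_zero Complex.I_ne_zero, Complex.cpow_def_of_ne_zero Complex.I_ne_zero,
      Complex.log_I, ← Complex.exp_add]
    push_cast
    ring_nf
  rw [hankelPart_eq, hankelPart_eq, hI, poissonConst, poissonConst]
  have c1 : ((-ν : ℝ) : ℂ) + 1 / 2 = ((1 / 2 - ν : ℝ) : ℂ) := by push_cast; ring
  have c2 : (ν : ℂ) + 1 / 2 = ((ν + 1 / 2 : ℝ) : ℂ) := by push_cast; ring
  have c3 : (x : ℂ) / 2 = ((x / 2 : ℝ) : ℂ) := by push_cast; ring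
  rw [c1, c2, c3, Complex.ofReal_neg, ← hpow]
  generalize Complex.Gamma ((1 / 2 - ν : ℝ) : ℂ) = A at *
  generalize Complex.Gamma ((ν + 1 / 2 : ℝ) : ℂ) = B at *
  generalize ((x / 2 : ℝ) : ℂ) ^ (-2 * ν : ℂ) = Y at *
  generalize ((x / 2 : ℝ) : ℂ) ^ (ν : ℂ) = Z at *
  generalize (Real.sqrt Real.pi : ℂ) = P at *
  field_simp
  linear_combination (-Z) * hs

/-! ### The connection formula for real order and argument -/

theorem conj_ofReal_cpow {c : ℝ} (hc : 0 ≤ c) (s : ℝ) :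
    (starRingEnd ℂ) ((c : ℂ) ^ (s : ℂ)) = (c : ℂ) ^ (s : ℂ) := by
  rw [← Complex.ofReal_cpow hc, Complex.conj_ofReal]

theorem conj_poissonConst (ν : ℝ) {x : ℝ} (hx : 0 < x) :
    (starRingEnd ℂ) (poissonConst ν x) = poissonConst ν x := by
  have c2 : (ν : ℂ) + 1 / 2 = ((ν + 1 / 2 : ℝ) : ℂ) := by push_cast; ring
  have c3 : (x : ℂ) / 2 = ((x / 2 : ℝ) : ℂ) := by push_cast; ring
  rw [poissonConst, c2, c3, map_div₀, map_mul, map_mul, conj_ofReal_cpow (by positivity),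
    Complex.conj_ofReal, ← Complex.Gamma_conj, Complex.conj_ofReal, Complex.conj_ofNat]

theorem conj_struveK (ν : ℝ) {x : ℝ} (hx : 0 < x) :
    (starRingEnd ℂ) (struveK ν x) = struveK ν x := by
  rw [struveK, map_mul, conj_poissonConst ν hx, laplaceInt, ← integral_conj]
  congr 1
  refine setIntegral_congr_fun measurableSet_Ioi fun t _ => ?_
  have c : (ν : ℂ) - 1 / 2 = ((ν - 1 / 2 : ℝ) : ℂ) := by push_cast; ring
  simp only [c]
  rw [map_mul, conj_ofReal_cpow (by positivity), ← Complex.exp_conj]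
  simp

theorem struveK_eq {ν x : ℝ} (hν : |ν| < 1 / 2) (hx : 0 < x) :
    struveK ν x = struveH ν x + Complex.I * besselJ ν x + hankelPart ν x := by
  obtain ⟨h1, h2⟩ := abs_lt.mp hν
  have hx0 : (x : ℂ) ≠ 0 := by exact_mod_cast hx.ne'
  have hP := struveH_add_besselJ (ν := ν) (z := x) (by simpa using h1) hx0 (ε := 1) (Or.inl rfl)
  rw [struveK, laplaceInt_eq_add hν hx, mul_add, ← hankelPart]
  simp only [Complex.ofReal_one, one_mul] at hP
  rw [hP]

/-- The conjugate of `struveK_eq`: for real data `K` is real, and conjugation exchanges the two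
Poisson segments, hence `𝐇 + iJ` and `𝐇 - iJ`. -/
theorem struveK_eq' {ν x : ℝ} (hν : |ν| < 1 / 2) (hx : 0 < x) :
    struveK ν x = struveH ν x - Complex.I * besselJ ν x + (starRingEnd ℂ) (hankelPart ν x) := by
  obtain ⟨h1, h2⟩ := abs_lt.mp hν
  have hx0 : (x : ℂ) ≠ 0 := by exact_mod_cast hx.ne'
  have hP := struveH_add_besselJ (ν := ν) (z := x) (by simpa using h1) hx0 (ε := 1) (Or.inl rfl)
  have hM := struveH_add_besselJ (ν := ν) (z := x) (by simpa using h1) hx0 (ε := -1) (Or.inr rfl)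
  have hconj : (starRingEnd ℂ) (struveH ν x + (1 : ℝ) * Complex.I * besselJ ν x) =
      struveH ν x + ((-1 : ℝ) : ℂ) * Complex.I * besselJ ν x := by
    rw [hP, hM, map_mul, conj_poissonConst ν hx, ← integral_conj]
    congr 1
    refine setIntegral_congr_fun measurableSet_Ioo fun t ht => ?_
    have c : (ν : ℂ) - 1 / 2 = ((ν - 1 / 2 : ℝ) : ℂ) := by push_cast; ring
    have ht2 : 0 ≤ 1 - t ^ 2 := by nlinarith [ht.1, ht.2]
    simp only [c]
    rw [map_mul, map_mul, conj_ofReal_cpow ht2, ← Complex.exp_conj]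
    simp
  have h := struveK_eq hν hx
  rw [← conj_struveK ν hx, h, map_add]
  simp only [Complex.ofReal_one, one_mul, Complex.ofReal_neg] at hconj
  rw [hconj]
  ring

/-- Linear algebra: the Hankel part and its conjugate determine `K - 𝐇`, `J_ν` and, through the
phase `e^{∓iπν}`, also `J_{-ν}`. Three quantities in two unknowns satisfy a relation. -/
theorem sin_mul_struveK_sub_real {ν x : ℝ} (hν : |ν| < 1 / 2) (hx : 0 < x) :
    Complex.sin (ν * Real.pi) * (struveK ν x - struveH ν x) =
      besselJ (-ν) x - besselJ ν x * Complex.cos (ν * Real.pi) := by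
  have hν' : |-ν| < 1 / 2 := by rwa [abs_neg]
  have a1 := struveK_eq hν hx
  have a2 := struveK_eq' hν hx
  have b1 := struveK_eq hν' hx
  have b2 := struveK_eq' hν' hx
  rw [hankelPart_neg hν hx] at b1 b2
  rw [map_mul, ← Complex.exp_conj] at b2
  have hc : (starRingEnd ℂ) (-(ν * Real.pi * Complex.I)) = ν * Real.pi * Complex.I := by simp
  rw [hc] at b2
  rw [Complex.ofReal_neg] at b1 b2
  have hcos := Complex.cos_add_sin_I ((ν : ℂ) * Real.pi)
  have hcos' := Complex.cos_sub_sin_I ((ν : ℂ) * Real.pi)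
  rw [← neg_mul, ← neg_mul] at b1
  rw [neg_mul, neg_mul] at b1
  rw [← hcos] at b2
  rw [show -((ν : ℂ) * Real.pi * Complex.I) = -(ν * Real.pi) * Complex.I by ring, ← hcos'] at b1
  generalize Complex.cos (ν * Real.pi) = c at *
  generalize Complex.sin (ν * Real.pi) = s at *
  generalize (starRingEnd ℂ) (hankelPart ν x) = V at *
  generalize hankelPart ν x = W at *
  have hI := Complex.I_sq
  generalize Complex.I = i at *
  -- `K - H = (W + V)/2`, `J = (V - W)/(2i)`
  have j1 : 2 * i * besselJ ν x = V - W := by linear_combination a2 - a1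
  have j2 : 2 * i * besselJ (-ν) x = (c + s * i) * V - (c - s * i) * W := by
    linear_combination b2 - b1
  have k1 : 2 * (struveK ν x - struveH ν x) = V + W := by linear_combination a1 + a2
  have hi : (2 : ℂ) * i ≠ 0 := by
    refine mul_ne_zero two_ne_zero fun h => ?_
    rw [h] at hI; norm_num at hI
  refine mul_left_cancel₀ hi ?_
  linear_combination s * i * k1 - j2 + c * j1

end Struve

end

noncomputable section

namespace Struve

open MeasureTheory Set

/-! ### Analyticity in the order and in the argument -/

/-- From `1/Γ(w) = w/Γ(w+1)`, the modulus of `1/Γ(n+s)` cannot grow with `n` once `|n+s| ≥ 1`; the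
smaller `n` stay in a compact set. This bound makes the power series converge locally uniformly in
the order. -/
theorem exists_norm_inv_Gamma_le (M : ℝ) :
    ∃ C, 0 ≤ C ∧ ∀ (n : ℕ) (s : ℂ), ‖s‖ ≤ M → ‖(Complex.Gamma (n + s))⁻¹‖ ≤ C := by
  obtain ⟨N, hN⟩ := exists_nat_ge (M + 1)
  obtain ⟨C, hC⟩ := (isCompact_closedBall (0 : ℂ) (N + M)).exists_bound_of_continuousOn
    (f := fun s => (Complex.Gamma s)⁻¹) Complex.differentiable_one_div_Gamma.continuous.continuousOn
  refine ⟨max C 0, le_max_right _ _, fun n s hs => le_trans ?_ (le_max_left _ _)⟩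
  rcases le_total n N with hn | hn
  · refine hC _ ?_
    rw [mem_closedBall_zero_iff]
    have h1 := norm_add_le (n : ℂ) s
    rw [Complex.norm_natCast] at h1
    have : (n : ℝ) ≤ N := by exact_mod_cast hn
    linarith
  · induction n, hn using Nat.le_induction with
    | base =>
      refine hC _ ?_
      rw [mem_closedBall_zero_iff]
      have h1 := norm_add_le (N : ℂ) s
      rw [Complex.norm_natCast] at h1
      linarith
    | succ n hn ih =>
      refine le_trans ?_ ih
      rw [Complex.one_div_Gamma_eq_self_mul_one_div_Gamma_add_one (n + s), norm_mul,
        show ((n + 1 : ℕ) : ℂ) + s = n + s + 1 by push_cast; ring]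
      refine le_mul_of_one_le_left (norm_nonneg _) ?_
      have h1 := norm_sub_norm_le (n : ℂ) (-s)
      rw [Complex.norm_natCast, norm_neg, sub_neg_eq_add] at h1
      have : (N : ℝ) ≤ n := by exact_mod_cast hn
      linarith

/-- The power series common to the functions of Bessel and Struve. -/
def besselSeries (g : ℕ → ℂ) (s x : ℂ) : ℂ :=
  ∑' n : ℕ, (-1 : ℂ) ^ n * x ^ (2 * n) * (g n * Complex.Gamma (n + s))⁻¹

theorem norm_besselSeries_term_le {g : ℕ → ℂ} {C M R : ℝ} {n : ℕ} {s x : ℂ}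
    (hC : ∀ (n : ℕ) (s : ℂ), ‖s‖ ≤ M → ‖(Complex.Gamma (n + s))⁻¹‖ ≤ C) (hs : ‖s‖ ≤ M)
    (hx : ‖x‖ ≤ R) :
    ‖(-1 : ℂ) ^ n * x ^ (2 * n) * (g n * Complex.Gamma (n + s))⁻¹‖ ≤
      ‖(g n)⁻¹‖ * (R ^ 2) ^ n * C := by
  have h0 : 0 ≤ R := (norm_nonneg x).trans hx
  rw [mul_inv, norm_mul, norm_mul, norm_mul, norm_pow, norm_neg, norm_one, one_pow, one_mul, norm_pow,
    pow_mul]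
  calc (‖x‖ ^ 2) ^ n * (‖(g n)⁻¹‖ * ‖(Complex.Gamma (n + s))⁻¹‖)
      ≤ (R ^ 2) ^ n * (‖(g n)⁻¹‖ * C) := by gcongr; exact hC n s hs
    _ = _ := by ring

theorem differentiable_besselSeries_left {g : ℕ → ℂ}
    (hg : ∀ R : ℝ, Summable fun n => ‖(g n)⁻¹‖ * R ^ n) (x : ℂ) :
    Differentiable ℂ fun s => besselSeries g s x := by
  intro s
  obtain ⟨C, -, hC⟩ := exists_norm_inv_Gamma_le (‖s‖ + 1)
  refine (Complex.differentiableOn_tsum_of_summable_norm (U := Metric.ball 0 (‖s‖ + 1))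
    ((hg (‖x‖ ^ 2)).mul_right C) (fun n => ?_) Metric.isOpen_ball fun n w hw => ?_).differentiableAt
    (Metric.isOpen_ball.mem_nhds (by simp))
  · refine Differentiable.differentiableOn ?_
    simp only [mul_inv]
    refine Differentiable.const_mul (Differentiable.const_mul ?_ _) _
    exact Complex.differentiable_one_div_Gamma.comp (differentiable_id.const_add _)
  · exact norm_besselSeries_term_le hC (mem_ball_zero_iff.mp hw).le le_rfl

theorem differentiable_besselSeries_right {g : ℕ → ℂ}
    (hg : ∀ R : ℝ, Summable fun n => ‖(g n)⁻¹‖ * R ^ n) (s : ℂ) :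
    Differentiable ℂ fun x => besselSeries g s x := by
  intro x
  obtain ⟨C, -, hC⟩ := exists_norm_inv_Gamma_le ‖s‖
  refine (Complex.differentiableOn_tsum_of_summable_norm (U := Metric.ball 0 (‖x‖ + 1))
    ((hg ((‖x‖ + 1) ^ 2)).mul_right C) (fun n => ?_) Metric.isOpen_ball
    fun n w hw => ?_).differentiableAt (Metric.isOpen_ball.mem_nhds (by simp))
  · exact Differentiable.differentiableOn (by fun_prop)
  · exact norm_besselSeries_term_le hC le_rfl (mem_ball_zero_iff.mp hw).le

theorem summable_inv_factorial_mul (R : ℝ) :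
    Summable fun n : ℕ => ‖((n.factorial : ℂ))⁻¹‖ * R ^ n := by
  refine (Real.summable_pow_div_factorial R).congr fun n => ?_
  rw [norm_inv, Complex.norm_natCast]
  ring

/-- Duplication and `n!² ≤ (2n+1)!` give `n! ≤ 2·4^n |Γ(n+3/2)|`, which allows comparison with an
exponential series at `4|R|`. -/
theorem summable_inv_Gamma_mul (R : ℝ) :
    Summable fun n : ℕ => ‖(Complex.Gamma (n + 3 / 2))⁻¹‖ * R ^ n := by
  have h0 := (Real.summable_pow_div_factorial (4 * |R|)).mul_left 2
  refine Summable.of_norm_bounded h0 fun n => ?_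
  have h := Gamma_add_three_half_mul_factorial n
  have hG : Complex.Gamma (n + 3 / 2) ≠ 0 := by
    refine Complex.Gamma_ne_zero_of_re_pos ?_
    have : ((n : ℂ) + 3 / 2).re = n + 3 / 2 := by norm_num
    rw [this]; positivity
  have hn := congrArg norm h
  rw [norm_mul, norm_mul, norm_mul, norm_mul, norm_pow, Complex.norm_natCast, Complex.norm_natCast,
    Complex.norm_real, Real.norm_of_nonneg (Real.sqrt_nonneg _)] at hn
  norm_num at hn
  have hG0 : 0 < ‖Complex.Gamma (n + 3 / 2)‖ := norm_pos_iff.mpr hG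
  have hf : (0 : ℝ) < n.factorial := by positivity
  have hfac : (n.factorial : ℝ) * n.factorial ≤ (2 * n + 1).factorial := by
    have h1 : n.factorial * n.factorial ∣ (n + n).factorial :=
      Nat.factorial_mul_factorial_dvd_factorial_add n n
    have h2 := Nat.le_of_dvd (Nat.factorial_pos _) h1
    have h3 : (n + n).factorial ≤ (2 * n + 1).factorial := Nat.factorial_le (by omega)
    exact_mod_cast h2.trans h3
  have hpi : 1 ≤ Real.sqrt Real.pi := by
    rw [Real.one_le_sqrt]; linarith [Real.pi_gt_three]
  have key : (n.factorial : ℝ) ≤ ‖Complex.Gamma (n + 3 / 2)‖ * (2 * 4 ^ n) := by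
    refine le_of_mul_le_mul_left ?_ hf
    calc _ ≤ ((2 * n + 1).factorial : ℝ) := hfac
      _ ≤ ((2 * n + 1).factorial : ℝ) * Real.sqrt Real.pi := le_mul_of_one_le_right (by positivity) hpi
      _ = _ := by rw [← hn]; ring
  rw [norm_mul, norm_norm, norm_pow, Real.norm_eq_abs, norm_inv, mul_pow, ← div_eq_inv_mul,
    mul_div_assoc', div_le_div_iff₀ hG0 hf]
  calc |R| ^ n * n.factorial ≤ |R| ^ n * (‖Complex.Gamma (n + 3 / 2)‖ * (2 * 4 ^ n)) := by gcongr
    _ = _ := by ring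

theorem besselJ_eq (ν z : ℂ) :
    besselJ ν z = (z / 2) ^ ν * besselSeries (fun n => n.factorial) (ν + 1) (z / 2) := by
  simp only [besselJ, besselSeries, add_assoc]

theorem struveH_eq (ν z : ℂ) : struveH ν z =
    (z / 2) ^ (ν + 1) * besselSeries (fun n => Complex.Gamma (n + 3 / 2)) (ν + 3 / 2) (z / 2) := by
  simp only [struveH, besselSeries, add_assoc]

theorem differentiable_besselJ_order {z : ℂ} (hz : z ≠ 0) : Differentiable ℂ fun ν => besselJ ν z := by
  have hz2 : z / 2 ≠ 0 := div_ne_zero hz two_ne_zero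
  simp only [besselJ_eq]
  intro ν
  refine DifferentiableAt.mul (differentiableAt_id.const_cpow (Or.inl hz2)) ?_
  exact ((differentiable_besselSeries_left summable_inv_factorial_mul (z / 2)).comp
    (differentiable_id.add_const 1)) ν

theorem differentiable_struveH_order {z : ℂ} (hz : z ≠ 0) : Differentiable ℂ fun ν => struveH ν z := by
  have hz2 : z / 2 ≠ 0 := div_ne_zero hz two_ne_zero
  simp only [struveH_eq]
  intro ν
  refine DifferentiableAt.mul ((differentiableAt_id.add_const 1).const_cpow (Or.inl hz2)) ?_
  exact ((differentiable_besselSeries_left summable_inv_Gamma_mul (z / 2)).comp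
    (differentiable_id.add_const (3 / 2))) ν

theorem half_re_pos {z : ℂ} (hz : 0 < z.re) : 0 < (z / 2).re := by
  rw [show z / 2 = z / (2 : ℝ) by norm_num, Complex.div_ofReal_re]
  positivity

theorem differentiableAt_half_cpow (s : ℂ) {z : ℂ} (hz : 0 < z.re) :
    DifferentiableAt ℂ (fun z : ℂ => (z / 2) ^ s) z :=
  (differentiableAt_id.div_const 2).cpow_const (Or.inl (half_re_pos hz))

theorem differentiableAt_besselJ (ν : ℂ) {z : ℂ} (hz : 0 < z.re) :
    DifferentiableAt ℂ (fun z => besselJ ν z) z := by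
  simp only [besselJ_eq]
  refine (differentiableAt_half_cpow ν hz).mul ?_
  exact ((differentiable_besselSeries_right summable_inv_factorial_mul (ν + 1)).comp
    (differentiable_id.div_const 2)) z

theorem differentiableAt_struveH (ν : ℂ) {z : ℂ} (hz : 0 < z.re) :
    DifferentiableAt ℂ (fun z => struveH ν z) z := by
  simp only [struveH_eq]
  refine (differentiableAt_half_cpow (ν + 1) hz).mul ?_
  exact ((differentiable_besselSeries_right summable_inv_Gamma_mul (ν + 3 / 2)).comp
    (differentiable_id.div_const 2)) z

theorem continuous_ofReal_cpow_one_add_sq (s : ℂ) :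
    Continuous fun t : ℝ => ((1 + t ^ 2 : ℝ) : ℂ) ^ s := by
  refine Continuous.cpow (by fun_prop) continuous_const fun t => ?_
  rw [Complex.ofReal_mem_slitPlane]
  positivity

theorem integrableOn_exp_mul_one_add_sq_rpow {b : ℝ} (hb : 0 < b) (c : ℝ) :
    IntegrableOn (fun t : ℝ => Real.exp (-b * t) * (1 + t ^ 2) ^ c) (Ioi 0) := by
  have hcont : Continuous fun t : ℝ => Real.exp (-b * t) * (1 + t ^ 2) ^ c := by
    refine Continuous.mul (by fun_prop) (Continuous.rpow_const (by fun_prop) fun t => Or.inl ?_)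
    positivity
  refine integrable_of_isBigO_exp_neg (b := b / 2) (by positivity) hcont.continuousOn ?_
  obtain ⟨n, hn⟩ := exists_nat_ge c
  have h1 : (fun t : ℝ => (1 + t ^ 2) ^ c) =O[atTop] fun t => t ^ (2 * n) := by
    refine IsBigO.of_bound (2 ^ n) ?_
    filter_upwards [eventually_ge_atTop 1] with t ht
    have h2 : (1 : ℝ) ≤ 1 + t ^ 2 := by nlinarith
    rw [Real.norm_of_nonneg (by positivity), Real.norm_of_nonneg (by positivity), pow_mul, ← mul_pow]
    calc (1 + t ^ 2) ^ c ≤ (1 + t ^ 2) ^ (n : ℝ) := Real.rpow_le_rpow_of_exponent_le h2 hn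
      _ = (1 + t ^ 2) ^ n := Real.rpow_natCast _ _
      _ ≤ (2 * t ^ 2) ^ n := by gcongr; nlinarith
  have h3 := h1.trans (isLittleO_pow_exp_pos_mul_atTop (2 * n) (b := b / 2) (by positivity)).isBigO
  refine ((isBigO_refl (fun t : ℝ => Real.exp (-b * t)) atTop).mul h3).congr_right fun t => ?_
  rw [← Real.exp_add]
  ring_nf

theorem norm_ofReal_cpow_one_add_sq (s : ℂ) (t : ℝ) :
    ‖((1 + t ^ 2 : ℝ) : ℂ) ^ s‖ = (1 + t ^ 2) ^ s.re :=
  Complex.norm_cpow_eq_rpow_re_of_pos (by positivity) s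

theorem integrableOn_laplaceInt (ν : ℂ) {z : ℂ} (hz : 0 < z.re) :
    IntegrableOn (fun t : ℝ => Complex.exp (-z * t) * ((1 + t ^ 2 : ℝ) : ℂ) ^ (ν - 1 / 2))
      (Ioi 0) := by
  refine Integrable.mono' (integrableOn_exp_mul_one_add_sq_rpow hz (ν - 1 / 2).re) ?_ ?_
  · exact (Continuous.mul (by fun_prop)
      (continuous_ofReal_cpow_one_add_sq _)).aestronglyMeasurable
  · refine ae_of_all _ fun t => le_of_eq ?_
    rw [norm_mul, norm_ofReal_cpow_one_add_sq, Complex.norm_exp]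
    simp

theorem differentiableAt_laplaceInt (ν : ℂ) {z : ℂ} (hz : 0 < z.re) :
    DifferentiableAt ℂ (fun z => laplaceInt ν z) z := by
  have hopen : IsOpen {z : ℂ | 0 < z.re} := isOpen_lt continuous_const Complex.continuous_re
  refine (differentiableOn_laplace
    (continuous_ofReal_cpow_one_add_sq (ν - 1 / 2)).aestronglyMeasurable
    fun b hb => ?_).differentiableAt (hopen.mem_nhds hz)
  simp only [norm_ofReal_cpow_one_add_sq]
  exact integrableOn_exp_mul_one_add_sq_rpow hb _

theorem differentiable_laplaceInt_order {z : ℂ} (hz : 0 < z.re) :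
    Differentiable ℂ fun ν => laplaceInt ν z := by
  intro ν
  have h := differentiableAt_integral_exp_mul (μ := volume.restrict (Ioi 0))
    (ℓ := fun t => Real.log (1 + t ^ 2))
    (k := fun t => Complex.exp (-z * t) * ((1 + t ^ 2 : ℝ) : ℂ) ^ (-(1 / 2) : ℂ))
    (Continuous.aestronglyMeasurable (Continuous.log (by fun_prop) fun t => by positivity))
    (Continuous.mul (by fun_prop) (continuous_ofReal_cpow_one_add_sq _)).aestronglyMeasurable
    (w₀ := ν) (η := 1) one_pos (fun c _ => ?_)
  · convert h using 1
    ext w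
    refine setIntegral_congr_fun measurableSet_Ioi fun t _ => ?_
    have h0 : ((1 + t ^ 2 : ℝ) : ℂ) ≠ 0 := by
      have : (0 : ℝ) < 1 + t ^ 2 := by positivity
      exact_mod_cast this.ne'
    rw [sub_eq_add_neg, Complex.cpow_add _ _ h0, Complex.cpow_def_of_ne_zero h0 w,
      Complex.ofReal_log (by positivity)]
    ring_nf
  · have h1 := integrableOn_exp_mul_one_add_sq_rpow hz (c - 1 / 2)
    refine IntegrableOn.congr_fun h1 (fun t _ => ?_) measurableSet_Ioi
    have h0 : (0 : ℝ) < 1 + t ^ 2 := by positivity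
    rw [norm_mul, norm_ofReal_cpow_one_add_sq, Complex.norm_exp, sub_eq_add_neg, Real.rpow_add h0,
      Real.rpow_def_of_pos h0 c]
    simp
    ring_nf

theorem differentiableAt_struveK (ν : ℂ) {z : ℂ} (hz : 0 < z.re) :
    DifferentiableAt ℂ (fun z => struveK ν z) z := by
  refine DifferentiableAt.mul ?_ (differentiableAt_laplaceInt ν hz)
  exact ((differentiableAt_half_cpow ν hz).const_mul 2).div_const _

theorem differentiable_struveK_order {z : ℂ} (hz : 0 < z.re) :
    Differentiable ℂ fun ν => struveK ν z := by
  have hz2 : z / 2 ≠ 0 := by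
    intro h; have := half_re_pos hz; rw [h] at this; simp at this
  refine Differentiable.mul ?_ (differentiable_laplaceInt_order hz)
  simp only [poissonConst, div_eq_mul_inv _ ((Real.sqrt Real.pi : ℂ) * _), mul_inv]
  intro ν
  refine DifferentiableAt.mul ((differentiableAt_id.const_cpow (Or.inl hz2)).const_mul 2)
    (DifferentiableAt.const_mul ?_ _)
  exact (Complex.differentiable_one_div_Gamma.comp (differentiable_id.add_const (1 / 2))) ν

theorem frequently_nhdsNE_ofReal {P : ℂ → Prop} {x : ℝ} (h : ∀ᶠ y : ℝ in 𝓝 x, P (y : ℂ)) :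
    ∃ᶠ w in 𝓝[≠] (x : ℂ), P w := by
  have h1 : Tendsto (fun y : ℝ => (y : ℂ)) (𝓝[≠] x) (𝓝[≠] (x : ℂ)) :=
    tendsto_nhdsWithin_of_tendsto_nhds_of_eventually_within _
      ((Complex.continuous_ofReal.tendsto x).mono_left nhdsWithin_le_nhds)
      (eventually_nhdsWithin_of_forall fun y hy h => hy (Complex.ofReal_injective h))
  have h2 : ∀ᶠ y : ℝ in 𝓝[≠] x, P (y : ℂ) := h.filter_mono nhdsWithin_le_nhds
  exact h1.frequently h2.frequently

/-- First use of the identity theorem, in `z`, from the positive axis to the right half-plane. The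
order is still real and small. -/
theorem sin_mul_struveK_sub_of_real_order {ν : ℝ} (hν : |ν| < 1 / 2) {z : ℂ} (hz : 0 < z.re) :
    Complex.sin (ν * Real.pi) * (struveK ν z - struveH ν z) =
      besselJ (-ν) z - besselJ ν z * Complex.cos (ν * Real.pi) := by
  have hopen : IsOpen {z : ℂ | 0 < z.re} := isOpen_lt continuous_const Complex.continuous_re
  have hconv : Convex ℝ {z : ℂ | 0 < z.re} := convex_halfSpace_re_gt 0
  have hf : DifferentiableOn ℂ (fun z : ℂ =>
      Complex.sin (ν * Real.pi) * (struveK ν z - struveH ν z)) {z | 0 < z.re} := fun w hw =>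
    (((differentiableAt_struveK ν hw).sub (differentiableAt_struveH ν hw)).const_mul
      _).differentiableWithinAt
  have hg : DifferentiableOn ℂ (fun z : ℂ =>
      besselJ (-ν) z - besselJ ν z * Complex.cos (ν * Real.pi)) {z | 0 < z.re} := fun w hw =>
    ((differentiableAt_besselJ (-ν) hw).sub
      ((differentiableAt_besselJ ν hw).mul_const _)).differentiableWithinAt
  refine (hf.analyticOnNhd hopen).eqOn_of_preconnected_of_frequently_eq
    (hg.analyticOnNhd hopen) hconv.isPreconnected (z₀ := ((1 : ℝ) : ℂ)) (by simp) ?_ hz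
  refine frequently_nhdsNE_ofReal (x := 1) ?_
  filter_upwards [lt_mem_nhds (one_pos : (0 : ℝ) < 1)] with x hx
  exact sin_mul_struveK_sub_real hν hx

/-- Second use, in `ν`: all terms are entire in the order, and a real interval around `0` is known.
-/
theorem sin_mul_struveK_sub (ν : ℂ) {z : ℂ} (hz : 0 < z.re) :
    Complex.sin (ν * Real.pi) * (struveK ν z - struveH ν z) =
      besselJ (-ν) z - besselJ ν z * Complex.cos (ν * Real.pi) := by
  have hz0 : z ≠ 0 := by
    intro h; rw [h] at hz; simp at hz
  have hf : Differentiable ℂ (fun ν : ℂ =>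
      Complex.sin (ν * Real.pi) * (struveK ν z - struveH ν z)) :=
    Differentiable.mul (by fun_prop)
      ((differentiable_struveK_order hz).sub (differentiable_struveH_order hz0))
  have hg : Differentiable ℂ (fun ν : ℂ =>
      besselJ (-ν) z - besselJ ν z * Complex.cos (ν * Real.pi)) :=
    ((differentiable_besselJ_order hz0).comp differentiable_neg).sub
      ((differentiable_besselJ_order hz0).mul (by fun_prop))
  refine (hf.differentiableOn.analyticOnNhd isOpen_univ).eqOn_of_preconnected_of_frequently_eq
    (hg.differentiableOn.analyticOnNhd isOpen_univ) isPreconnected_univ (z₀ := ((0 : ℝ) : ℂ))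
    (mem_univ _) ?_ (mem_univ ν)
  refine frequently_nhdsNE_ofReal (x := 0) ?_
  have : ∀ᶠ y : ℝ in 𝓝 0, |y| < 1 / 2 :=
    continuous_abs.continuousAt.eventually_lt continuousAt_const (by norm_num)
  filter_upwards [this] with x hx
  exact sin_mul_struveK_sub_of_real_order hx hz

theorem eventually_sin_ne_zero (ν : ℂ) : ∀ᶠ μ in 𝓝[≠] ν, Complex.sin (μ * Real.pi) ≠ 0 := by
  have hd : Differentiable ℂ fun μ : ℂ => Complex.sin (μ * Real.pi) := by fun_prop
  rcases (hd.analyticAt ν).eventually_eq_zero_or_eventually_ne_zero with h | h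
  · exfalso
    have h1 := (hd.differentiableOn.analyticOnNhd isOpen_univ).eqOn_zero_of_preconnected_of_eventuallyEq_zero
      isPreconnected_univ (mem_univ ν) h (mem_univ (1 / 2 : ℂ))
    simp only [Pi.zero_apply] at h1
    rw [show (1 / 2 : ℂ) * Real.pi = Real.pi / 2 by ring, Complex.sin_pi_div_two] at h1
    exact one_ne_zero h1
  · exact h

/-- Off the zeros of `sin(μπ)` the quotient in `besselY` equals `𝐇_μ - K_μ`, which is continuous in
`μ`. The limit therefore exists at every order and has this value, at integers too. -/
theorem besselY_eq (ν : ℂ) {z : ℂ} (hz : 0 < z.re) : besselY ν z = struveH ν z - struveK ν z := by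
  have hz0 : z ≠ 0 := by
    intro h; rw [h] at hz; simp at hz
  have hc : Continuous fun μ => struveH μ z - struveK μ z :=
    ((differentiable_struveH_order hz0).sub (differentiable_struveK_order hz)).continuous
  refine Tendsto.limUnder_eq (((hc.tendsto ν).mono_left nhdsWithin_le_nhds).congr' ?_)
  filter_upwards [eventually_sin_ne_zero ν] with μ hμ
  rw [eq_div_iff hμ]
  linear_combination (-1 : ℂ) * sin_mul_struveK_sub μ hz

/-- The representation of `𝐇_ν(z) - Y_ν(z)` as a Laplace integral. -/
theorem struveH_sub_besselY (ν : ℂ) {z : ℂ} (hz : 0 < z.re) :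
    struveH ν z - besselY ν z = poissonConst ν z * laplaceInt ν z := by
  rw [besselY_eq ν hz, sub_sub_cancel, struveK]

end Struve

end

noncomputable section

namespace Struve

open MeasureTheory Set

/-! ### The straight contours -/

/-- For `ν = qz` the large power joins the exponential and only the exponent `-1/2` is left outside.
-/
theorem exp_mul_cpow_eq_phaseIntegrand {q z u : ℂ} (hu : 1 + u ^ 2 ≠ 0) :
    Complex.exp (-z * u) * (1 + u ^ 2) ^ (q * z - 1 / 2) = phaseIntegrand q z u := by
  rw [phaseIntegrand, phase, Complex.cpow_sub _ _ hu, Complex.cpow_def_of_ne_zero hu (q * z),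
    mul_div_assoc', ← Complex.exp_add]
  ring_nf

theorem rayPoint_re (θ r : ℝ) : (rayPoint θ r).re = r * Real.cos θ := by
  rw [rayPoint, Complex.re_ofReal_mul, Complex.exp_ofReal_mul_I_re]

theorem rayPoint_re_pos {θ r : ℝ} (hθ : |θ| < Real.pi / 2) (hr : 0 < r) : 0 < (rayPoint θ r).re := by
  rw [rayPoint_re]
  exact mul_pos hr (Real.cos_pos_of_mem_Ioo (abs_lt.mp hθ))

theorem mul_rayPoint_re (θ r : ℝ) (q : ℂ) :
    (q * rayPoint θ r).re = r * (q * Complex.exp (θ * Complex.I)).re := by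
  rw [rayPoint, mul_left_comm, Complex.re_ofReal_mul]

theorem struveH_sub_besselY_eq (q : ℂ) {θ r : ℝ} (hθ : |θ| < Real.pi / 2) (hr : 0 < r) :
    struveH (q * rayPoint θ r) (rayPoint θ r) - besselY (q * rayPoint θ r) (rayPoint θ r) =
      prefactor (q * rayPoint θ r) (rayPoint θ r) * (rayPoint θ r *
        ∫ t in Ioi (0 : ℝ), phaseIntegrand q (rayPoint θ r) t) := by
  rw [struveH_sub_besselY _ (rayPoint_re_pos hθ hr), ← prefactor_mul _ (rayPoint_ne_zero θ hr),
    laplaceInt, mul_assoc]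
  congr 2
  refine setIntegral_congr_fun measurableSet_Ioi fun t _ => ?_
  have h : 1 + (t : ℂ) ^ 2 ≠ 0 := by
    have : (0 : ℝ) < 1 + t ^ 2 := by positivity
    exact_mod_cast this.ne'
  simp only [← exp_mul_cpow_eq_phaseIntegrand h]
  push_cast
  rfl

theorem one_add_I_mul_sq {ε : ℝ} (hε : ε = 1 ∨ ε = -1) (t : ℝ) :
    1 + (ε * Complex.I * t) ^ 2 = ((1 - t ^ 2 : ℝ) : ℂ) := by
  have : (ε : ℂ) ^ 2 = 1 := by rcases hε with rfl | rfl <;> norm_num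
  push_cast
  linear_combination (Complex.I ^ 2 * t ^ 2) * this + t ^ 2 * Complex.I_sq

theorem struveH_add_besselJ_eq {q : ℂ} {θ r : ℝ} (hr : 0 < r)
    (hq : 0 < (q * Complex.exp (θ * Complex.I)).re) {ε : ℝ} (hε : ε = 1 ∨ ε = -1) :
    struveH (q * rayPoint θ r) (rayPoint θ r) +
        ε * Complex.I * besselJ (q * rayPoint θ r) (rayPoint θ r) =
      prefactor (q * rayPoint θ r) (rayPoint θ r) * (rayPoint θ r *
        ∫ t in Ioo (0 : ℝ) 1, phaseIntegrand q (rayPoint θ r) (ε * Complex.I * t) *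
          (ε * Complex.I)) := by
  have hν : -(1 / 2) < (q * rayPoint θ r).re := by
    rw [mul_rayPoint_re]; nlinarith [mul_pos hr hq]
  rw [struveH_add_besselJ hν (rayPoint_ne_zero θ hr) hε, ← prefactor_mul _ (rayPoint_ne_zero θ hr),
    mul_assoc]
  congr 2
  refine setIntegral_congr_fun measurableSet_Ioo fun t ht => ?_
  have h : (1 - t ^ 2 : ℝ) ≠ 0 := by nlinarith [ht.1, ht.2]
  have h' : 1 + (ε * Complex.I * t) ^ 2 ≠ 0 := by
    rw [one_add_I_mul_sq hε]; exact_mod_cast h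
  simp only [← exp_mul_cpow_eq_phaseIntegrand h', one_add_I_mul_sq hε]
  ring_nf

theorem norm_phaseIntegrand (q : ℂ) (θ r : ℝ) (u : ℂ) : ‖phaseIntegrand q (rayPoint θ r) u‖ =
    Real.exp (-(r * (Complex.exp (θ * Complex.I) * phase q u).re)) *
      ‖((1 + u ^ 2) ^ (1 / 2 : ℂ))⁻¹‖ := by
  rw [phaseIntegrand, norm_div, norm_rayPoint_exp, norm_inv, div_eq_mul_inv]

theorem differentiableAt_phaseIntegrand {q z u : ℂ} (hu : 1 + u ^ 2 ∈ Complex.slitPlane) :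
    DifferentiableAt ℂ (phaseIntegrand q z) u := by
  refine DifferentiableAt.div ?_ ?_ ?_
  · exact ((hasDerivAt_phase hu).differentiableAt.const_mul (-z)).cexp
  · exact DifferentiableAt.cpow_const (by fun_prop) hu
  · rw [Complex.cpow_def_of_ne_zero (Complex.slitPlane_ne_zero hu)]
    exact Complex.exp_ne_zero _

/-- The expansion of an integral over a straight contour from `0` along which
`Re (e^{iθ} (u - q log (1+u²)))` increases. -/
theorem hasExpansion_of_straight {F : ℂ → ℂ → ℂ} {θ : ℝ} {q e : ℂ} {S : Set ℝ} (he : ‖e‖ = 1)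
    (hS : MeasurableSet S) (hS0 : Ioo 0 1 ⊆ S) (hS1 : S ⊆ Ioi 0)
    (hmono : MonotoneOn (fun t : ℝ => (Complex.exp (θ * Complex.I) * phase q (e * t)).re) S)
    (hpos : ∀ t ∈ S, 0 < (Complex.exp (θ * Complex.I) * phase q (e * t)).re)
    (hint : ∀ r : ℝ, 0 < r → IntegrableOn (fun t : ℝ => phaseIntegrand q (rayPoint θ r) (e * t)) S)
    (hF : ∀ r : ℝ, 0 < r → F (q * rayPoint θ r) (rayPoint θ r) =
      prefactor (q * rayPoint θ r) (rayPoint θ r) * (rayPoint θ r *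
        ∫ t in S, phaseIntegrand q (rayPoint θ r) (e * t) * e)) :
    HasExpansion F θ q := by
  obtain ⟨ρ, hρ, hslit, hmain⟩ := exists_ball_hasExpansion q
  set f : ℝ → ℝ := fun t => (Complex.exp (θ * Complex.I) * phase q (e * t)).re with hf
  -- The contour is cut at `x`: the initial piece lies in the disc of Watson's lemma, and the rest
  -- is governed by monotonicity.
  obtain ⟨x, hx0, hx⟩ := exists_between (lt_min hρ one_pos)
  obtain ⟨hxρ, hx1⟩ := lt_min_iff.mp hx
  have hxS : x ∈ S := hS0 ⟨hx0, hx1⟩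
  have hball : ∀ t ∈ Icc (0 : ℝ) x, e * t ∈ Metric.ball (0 : ℂ) ρ := by
    intro t ht
    rw [mem_ball_zero_iff, norm_mul, he, one_mul, Complex.norm_real, Real.norm_of_nonneg ht.1]
    exact ht.2.trans_lt hxρ
  have hu : e * x ∈ Metric.ball (0 : ℂ) ρ := hball x ⟨hx0.le, le_rfl⟩
  -- The tail at `r = 1` measures all others: beyond `x`, passing from `1` to `r` costs a factor of
  -- at most `e^{-(r-1) f(x)}`.
  set C₀ : ℝ := ∫ t in S ∩ Ioi x, ‖phaseIntegrand q (rayPoint θ 1) (e * t)‖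
  refine hmain θ (e * x) F (f x) (Real.exp (f x) * C₀) hu (hpos x hxS) (hpos x hxS) ?_
  filter_upwards [eventually_ge_atTop 1] with r hr
  have hr0 : 0 < r := by linarith
  have hdo : DifferentiableOn ℂ (phaseIntegrand q (rayPoint θ r)) (Metric.ball 0 ρ) := fun w hw =>
    (differentiableAt_phaseIntegrand (hslit w hw)).differentiableWithinAt
  obtain ⟨B, hB⟩ := hdo.isExactOn_ball
  refine ⟨B, ∫ t in S ∩ Ioi x, phaseIntegrand q (rayPoint θ r) (e * t) * e, hB, ?_, ?_⟩
  · calc ‖∫ t in S ∩ Ioi x, phaseIntegrand q (rayPoint θ r) (e * t) * e‖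
        ≤ ∫ t in S ∩ Ioi x, Real.exp (-((r - 1) * f x)) *
            ‖phaseIntegrand q (rayPoint θ 1) (e * t)‖ := by
          refine norm_integral_le_of_norm_le
            (((hint 1 one_pos).mono_set inter_subset_left).norm.const_mul _) ?_
          refine (ae_restrict_iff' (hS.inter measurableSet_Ioi)).mpr (ae_of_all _ fun t ht => ?_)
          rw [norm_mul, he, mul_one, norm_phaseIntegrand, norm_phaseIntegrand, ← mul_assoc,
            ← Real.exp_add]
          refine mul_le_mul_of_nonneg_right (Real.exp_le_exp.mpr ?_) (norm_nonneg _)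
          have := hmono hxS ht.1 (le_of_lt ht.2)
          simp only [hf] at this ⊢
          nlinarith
      _ = Real.exp (f x) * C₀ * Real.exp (-(r * f x)) := by
          rw [integral_const_mul, mul_right_comm, ← Real.exp_add]
          refine congrArg (Real.exp · * C₀) ?_
          ring
  · rw [hF r hr0, ← mul_add]
    congr 2
    have hdec : S = Ioc 0 x ∪ S ∩ Ioi x := by
      ext t
      simp only [mem_union, mem_Ioc, mem_inter_iff, mem_Ioi]
      refine ⟨fun h => ?_, ?_⟩
      · rcases le_or_gt t x with h1 | h1
        · exact Or.inl ⟨hS1 h, h1⟩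
        · exact Or.inr ⟨h, h1⟩
      · rintro (h | h)
        · exact hS0 ⟨h.1, h.2.trans_lt hx1⟩
        · exact h.1
    have hi : IntegrableOn (fun t : ℝ => phaseIntegrand q (rayPoint θ r) (e * t) * e) S :=
      Integrable.mul_const (hint r hr0) e
    have hsub1 : Ioc 0 x ⊆ S := fun t ht => hS0 ⟨ht.1, ht.2.trans_lt hx1⟩
    have hdisj : Disjoint (Ioc 0 x) (S ∩ Ioi x) :=
      disjoint_left.mpr fun t ht ht' => absurd ht.2 (not_le.mpr ht'.2)
    conv_lhs => rw [hdec]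
    rw [setIntegral_union hdisj (hS.inter measurableSet_Ioi)
      (hi.mono_set hsub1) (hi.mono_set inter_subset_left)]
    congr 1
    rw [← intervalIntegral.integral_of_le hx0.le]
    have hd : ∀ t ∈ uIcc (0 : ℝ) x, HasDerivAt (fun t : ℝ => B (e * t))
        (phaseIntegrand q (rayPoint θ r) (e * t) * e) t := by
      intro t ht
      rw [uIcc_of_le hx0.le] at ht
      have h0 : HasDerivAt (fun x : ℝ => e * (x : ℂ)) e t := by
        simpa using (Complex.ofRealCLM.hasDerivAt (x := t)).const_mul e
      exact (hB _ (hball t ht)).comp t h0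
    have hii : IntervalIntegrable (fun t : ℝ => phaseIntegrand q (rayPoint θ r) (e * t) * e)
        volume 0 x := by
      rw [intervalIntegrable_iff_integrableOn_Ioc_of_le hx0.le]
      exact hi.mono_set hsub1
    rw [intervalIntegral.integral_eq_sub_of_hasDerivAt hd hii]
    simp

/-! ### The positive axis and the segments to `±i` as contours -/

theorem log_one_add_sq_lt {x : ℝ} (hx : 0 < x) : Real.log (1 + x ^ 2) < x := by
  rw [Real.log_lt_iff_lt_exp (by positivity)]
  have h := Real.quadratic_le_exp_of_nonneg (x := x / 2) (by positivity)
  have h2 : Real.exp x = Real.exp (x / 2) ^ 2 := by rw [← Real.exp_nat_mul]; congr 1; push_cast; ring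
  rw [h2]
  have h3 : (1 + x / 2 + (x / 2) ^ 2 / 2) ^ 2 ≤ Real.exp (x / 2) ^ 2 := by gcongr
  refine lt_of_lt_of_le ?_ h3
  -- This is eight times the excess of `(1 + x/2 + x²/8)²` over `1 + x²`.
  have h4 : 0 < x * ((x - 2) ^ 2 + 4) + x ^ 4 / 8 := by positivity
  nlinarith

theorem phase_ofReal_re (θ : ℝ) (q : ℂ) (x : ℝ) :
    (Complex.exp (θ * Complex.I) * phase q x).re =
      Real.cos θ * x - (q * Complex.exp (θ * Complex.I)).re * Real.log (1 + x ^ 2) := by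
  have h : Complex.log (1 + (x : ℂ) ^ 2) = (Real.log (1 + x ^ 2) : ℂ) := by
    rw [Complex.ofReal_log (by positivity)]; push_cast; rfl
  rw [phase, h, show Complex.exp (θ * Complex.I) * (x - q * (Real.log (1 + x ^ 2) : ℂ)) =
    x * Complex.exp (θ * Complex.I) - (Real.log (1 + x ^ 2) : ℂ) *
      (q * Complex.exp (θ * Complex.I)) by ring, Complex.sub_re, Complex.re_ofReal_mul,
    Complex.re_ofReal_mul, Complex.exp_ofReal_mul_I_re]
  ring

/-- On the positive axis `Re(e^{iθ}s) = x cos θ - c log(1+x²)` with `c = Re(qe^{iθ})`. Since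
`2x/(1+x²) ≤ 1` and `log(1+x²) < x`, it is monotone and positive as soon as `c ≤ cos θ`, and no
curved contour is needed. -/
theorem hyExpansion_of_re_le {θ : ℝ} {q : ℂ} (hθ : |θ| < Real.pi / 2)
    (hq : (q * Complex.exp (θ * Complex.I)).re ≤ Real.cos θ) : HYExpansion θ q := by
  have hcos : 0 < Real.cos θ := Real.cos_pos_of_mem_Ioo (abs_lt.mp hθ)
  set c := (q * Complex.exp (θ * Complex.I)).re
  have hlog : ∀ x : ℝ, 0 ≤ Real.log (1 + x ^ 2) := fun x => Real.log_nonneg (by nlinarith [sq_nonneg x])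
  refine hasExpansion_of_straight (e := 1) norm_one measurableSet_Ioi (fun x hx => hx.1) le_rfl ?_ ?_
    (fun r hr => ?_) (fun r hr => ?_)
  · simp only [one_mul, phase_ofReal_re]
    have hd : ∀ x : ℝ, HasDerivAt (fun x : ℝ => Real.cos θ * x - c * Real.log (1 + x ^ 2))
        (Real.cos θ - c * (2 * x / (1 + x ^ 2))) x := by
      intro x
      have h1 : HasDerivAt (fun x : ℝ => 1 + x ^ 2) (2 * x) x := by
        simpa using (hasDerivAt_pow 2 x).const_add 1
      have h2 := h1.log (by positivity)
      have h3 := ((hasDerivAt_id x).const_mul (Real.cos θ)).sub (h2.const_mul c)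
      exact h3.congr_deriv (by simp)
    refine monotoneOn_of_deriv_nonneg (convex_Ioi 0)
      (fun x _ => (hd x).continuousAt.continuousWithinAt)
      (fun x _ => (hd x).differentiableAt.differentiableWithinAt) fun x hx => ?_
    rw [interior_Ioi] at hx
    have hx' : 0 < x := hx
    rw [(hd x).deriv]
    have h1 : 2 * x / (1 + x ^ 2) ≤ 1 := by
      rw [div_le_one (by positivity)]; nlinarith [sq_nonneg (x - 1)]
    have h0 : 0 ≤ 2 * x / (1 + x ^ 2) := by positivity
    nlinarith
  · intro x hx
    have hx' : 0 < x := hx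
    rw [one_mul, phase_ofReal_re]
    have := log_one_add_sq_lt hx'
    nlinarith [hlog x]
  · simp only [one_mul]
    refine (integrableOn_laplaceInt (q * rayPoint θ r) (rayPoint_re_pos hθ hr)).congr_fun
      (fun t _ => ?_) measurableSet_Ioi
    have h : 1 + (t : ℂ) ^ 2 ≠ 0 := by
      have : (0 : ℝ) < 1 + t ^ 2 := by positivity
      exact_mod_cast this.ne'
    simp only [← exp_mul_cpow_eq_phaseIntegrand h]
    push_cast
    rfl
  · simp only [one_mul, mul_one]
    exact struveH_sub_besselY_eq q hθ hr

theorem phase_I_mul_re {ε : ℝ} (hε : ε = 1 ∨ ε = -1) (θ : ℝ) (q : ℂ) {y : ℝ} (hy : 1 - y ^ 2 > 0) :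
    (Complex.exp (θ * Complex.I) * phase q (ε * Complex.I * y)).re =
      -(ε * Real.sin θ) * y - (q * Complex.exp (θ * Complex.I)).re * Real.log (1 - y ^ 2) := by
  rw [phase, one_add_I_mul_sq hε, ← Complex.ofReal_log hy.le,
    show Complex.exp (θ * Complex.I) * (ε * Complex.I * y - q * (Real.log (1 - y ^ 2) : ℂ)) =
    ((ε * y : ℝ) : ℂ) * (Complex.exp (θ * Complex.I) * Complex.I) - (Real.log (1 - y ^ 2) : ℂ) *
      (q * Complex.exp (θ * Complex.I)) by push_cast; ring, Complex.sub_re, Complex.re_ofReal_mul,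
    Complex.re_ofReal_mul, Complex.mul_I_re, Complex.exp_ofReal_mul_I_im]
  ring

theorem integrableOn_phaseIntegrand_segment {q : ℂ} {θ r : ℝ} (hr : 0 < r)
    (hq : 0 < (q * Complex.exp (θ * Complex.I)).re) {ε : ℝ} (hε : ε = 1 ∨ ε = -1) :
    IntegrableOn (fun t : ℝ => phaseIntegrand q (rayPoint θ r) (ε * Complex.I * t)) (Ioo 0 1) := by
  have hν : -(1 / 2) < (q * rayPoint θ r).re := by
    rw [mul_rayPoint_re]; nlinarith [mul_pos hr hq]
  have h0 := integrableOn_poisson hν 0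
  simp only [pow_zero, one_mul] at h0
  have h1 : IntegrableOn (fun t : ℝ => Complex.exp (-rayPoint θ r * (ε * Complex.I * t)) *
      ((1 - t ^ 2 : ℝ) : ℂ) ^ (q * rayPoint θ r - 1 / 2)) (Ioo 0 1) := by
    have hc : Continuous fun t : ℝ => Complex.exp (-rayPoint θ r * (ε * Complex.I * t)) := by fun_prop
    obtain ⟨C, hC⟩ := (isCompact_Icc (a := (0 : ℝ)) (b := 1)).exists_bound_of_continuousOn
      hc.continuousOn
    refine h0.bdd_mul (c := C) hc.aestronglyMeasurable ?_
    exact (ae_restrict_iff' measurableSet_Ioo).mpr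
      (ae_of_all _ fun t ht => hC t ⟨ht.1.le, ht.2.le⟩)
  refine h1.congr_fun (fun t ht => ?_) measurableSet_Ioo
  have h : (1 - t ^ 2 : ℝ) ≠ 0 := by nlinarith [ht.1, ht.2]
  have h' : 1 + (ε * Complex.I * t) ^ 2 ≠ 0 := by
    rw [one_add_I_mul_sq hε]; exact_mod_cast h
  simp only [← exp_mul_cpow_eq_phaseIntegrand h', one_add_I_mul_sq hε]

/-- On the segment to `εi`, `Re(e^{iθ}s) = -ε y sin θ - c log(1-y²)` with `c = Re(qe^{iθ})`. Neither
term decreases when `ε sin θ ≤ 0` and `c > 0`, whatever the size of `q`. -/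
theorem hjExpansion_of_sin_nonpos {θ ε : ℝ} {q : ℂ} (hε : ε = 1 ∨ ε = -1)
    (hs : ε * Real.sin θ ≤ 0) (hq : 0 < (q * Complex.exp (θ * Complex.I)).re) :
    HJExpansion ε θ q := by
  have he : ‖(ε : ℂ) * Complex.I‖ = 1 := by rcases hε with rfl | rfl <;> simp
  have h1 : ∀ y ∈ Ioo (0 : ℝ) 1, 0 < 1 - y ^ 2 := fun y hy => by nlinarith [hy.1, hy.2]
  refine hasExpansion_of_straight (e := ε * Complex.I) he measurableSet_Ioo le_rfl
    (fun x hx => hx.1) ?_ ?_ (fun r hr => integrableOn_phaseIntegrand_segment hr hq hε)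
    (fun r hr => struveH_add_besselJ_eq hr hq hε)
  · intro x hx y hy hxy
    simp only [phase_I_mul_re hε θ q (h1 x hx), phase_I_mul_re hε θ q (h1 y hy)]
    have hl : Real.log (1 - y ^ 2) ≤ Real.log (1 - x ^ 2) :=
      Real.log_le_log (h1 y hy) (by nlinarith [hx.1])
    nlinarith
  · intro y hy
    rw [phase_I_mul_re hε θ q (h1 y hy)]
    have hl : Real.log (1 - y ^ 2) < 0 := Real.log_neg (h1 y hy) (by nlinarith [hy.1])
    nlinarith [hy.1, mul_pos hq (neg_pos.mpr hl)]

end Struve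

end

noncomputable section

namespace Struve

open MeasureTheory Set

/-! ### Branches of the inverse of an analytic function at a critical point -/

/-- Dividing by the smaller power and letting `u → u₀` shows that the order of vanishing and the
leading coefficient are intrinsic. -/
theorem eq_of_eventually_pow_mul_eq {A B : ℂ → ℂ} {u₀ : ℂ} {i j : ℕ} (hA : ContinuousAt A u₀)
    (hB : ContinuousAt B u₀) (hA0 : A u₀ ≠ 0) (hB0 : B u₀ ≠ 0)
    (h : ∀ᶠ u in 𝓝 u₀, (u - u₀) ^ i * A u = (u - u₀) ^ j * B u) : i = j ∧ A u₀ = B u₀ := by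
  wlog hij : i ≤ j generalizing A B i j
  · obtain ⟨h1, h2⟩ := this hB hA hB0 hA0 (h.mono fun _ hu => hu.symm) (le_of_not_ge hij)
    exact ⟨h1.symm, h2.symm⟩
  have h1 : ∀ᶠ u in 𝓝[≠] u₀, A u = (u - u₀) ^ (j - i) * B u := by
    filter_upwards [h.filter_mono nhdsWithin_le_nhds, self_mem_nhdsWithin] with u hu hne
    have hne' : (u - u₀) ^ i ≠ 0 := pow_ne_zero _ (sub_ne_zero.mpr hne)
    refine mul_left_cancel₀ hne' ?_
    rw [hu, ← mul_assoc, ← pow_add, Nat.add_sub_cancel' hij]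
  have h2 : Tendsto (fun u => (u - u₀) ^ (j - i) * B u) (𝓝 u₀)
      (𝓝 ((u₀ - u₀) ^ (j - i) * B u₀)) := by
    have : ContinuousAt (fun u => (u - u₀) ^ (j - i) * B u) u₀ := by fun_prop
    exact this
  have h3 := tendsto_nhds_unique_of_eventuallyEq (hA.tendsto.mono_left nhdsWithin_le_nhds)
    (h2.mono_left nhdsWithin_le_nhds) h1
  rw [sub_self] at h3
  rcases Nat.eq_zero_or_pos (j - i) with h4 | h4
  · refine ⟨by omega, ?_⟩
    rw [h3, h4, pow_zero, one_mul]
  · rw [zero_pow h4.ne', zero_mul] at h3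
    exact absurd h3 hA0

/-- An `(N+1)`-st root of `φ - φ(u₀)` is a local coordinate, and its inverse is the branch. The
choice of `κ` among the roots of its equation selects one of the `N + 1` directions of departure. -/
theorem exists_branch {φ m : ℂ → ℂ} {u₀ κ : ℂ} {N : ℕ} (hφ : AnalyticAt ℂ φ u₀)
    (hm : ContinuousAt m u₀) (hm0 : m u₀ ≠ 0)
    (hd : ∀ᶠ u in 𝓝 u₀, HasDerivAt φ ((u - u₀) ^ N * m u) u)
    (hκ : κ ^ (N + 1) * m u₀ = N + 1) :
    ∃ k : ℂ → ℂ, k 0 = u₀ ∧ HasDerivAt k κ 0 ∧ (∀ᶠ w in 𝓝 0, ContinuousAt k w) ∧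
      ∀ᶠ w in 𝓝 0, φ (k w) = φ u₀ + w ^ (N + 1) := by
  have hf : AnalyticAt ℂ (fun u => φ u - φ u₀) u₀ := hφ.sub analyticAt_const
  have hne : ¬ ∀ᶠ u in 𝓝 u₀, φ u - φ u₀ = 0 := by
    intro h
    have h1 : ∀ᶠ u in 𝓝[≠] u₀, False := by
      filter_upwards [h.eventually_nhds.filter_mono nhdsWithin_le_nhds,
        hd.filter_mono nhdsWithin_le_nhds, self_mem_nhdsWithin,
        (hm.eventually_ne hm0).filter_mono nhdsWithin_le_nhds] with u h1 h2 h3 h4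
      have h5 : HasDerivAt φ 0 u :=
        (hasDerivAt_const u (φ u₀)).congr_of_eventuallyEq (h1.mono fun v hv => sub_eq_zero.mp hv)
      exact mul_ne_zero (pow_ne_zero _ (sub_ne_zero.mpr h3)) h4 (h2.unique h5)
    exact (h1.exists).choose_spec
  obtain ⟨n, g, hg, hg0, hfg⟩ := hf.exists_eventuallyEq_pow_smul_nonzero_iff.mpr hne
  have hn : n ≠ 0 := by
    rintro rfl
    have := hfg.self_of_nhds
    simp only [sub_self, pow_zero, one_smul] at this
    exact hg0 this.symm
  obtain ⟨n, rfl⟩ := Nat.exists_eq_succ_of_ne_zero hn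
  have hdg : ∀ᶠ u in 𝓝 u₀, (u - u₀) ^ n * ((n + 1) * g u + (u - u₀) * deriv g u) =
      (u - u₀) ^ N * m u := by
    filter_upwards [hfg.eventually_nhds, hd, hg.eventually_analyticAt] with u h1 h2 h3
    have h4 : HasDerivAt (fun u => φ u - φ u₀) ((u - u₀) ^ N * m u) u := h2.sub_const _
    have h0 : HasDerivAt (fun u => u - u₀) 1 u := (hasDerivAt_id u).sub_const u₀
    have h5 := ((h0.pow (n + 1)).mul h3.differentiableAt.hasDerivAt)
    have h6 := h4.unique (h5.congr_of_eventuallyEq (h1.mono fun v hv => by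
      simpa [smul_eq_mul] using hv))
    rw [h6]
    simp only [Nat.add_sub_cancel, mul_one, Pi.pow_apply]
    push_cast
    ring
  have hn1 : ((n : ℂ) + 1) ≠ 0 := by exact_mod_cast n.succ_ne_zero
  -- The factorisation of `φ - φ(u₀)` has an unknown order; comparing its derivative with the given
  -- one identifies the order and yields `(N+1) g(u₀) = m(u₀)`.
  obtain ⟨rfl, hg1⟩ := eq_of_eventually_pow_mul_eq (A := fun u => (n + 1) * g u + (u - u₀) * deriv g u)
    (B := m) (by have := hg.continuousAt; have := hg.deriv.continuousAt; fun_prop) hm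
    (by simpa using ⟨hn1, hg0⟩) hm0 hdg
  simp only [sub_self, zero_mul, add_zero] at hg1
  have hκg : κ ^ (n + 1) * g u₀ = 1 := by
    rw [← hg1] at hκ
    refine mul_left_cancel₀ hn1 ?_
    linear_combination hκ
  have hκ0 : κ ≠ 0 := by
    rintro rfl
    simp at hκg
  -- The principal root is taken of `g/g(u₀)`, which is near `1`; the constant sits in `κ⁻¹`, since
  -- `κ^(n+1) g(u₀) = 1`.
  set h : ℂ → ℂ := fun u => (u - u₀) * κ⁻¹ * (g u / g u₀) ^ (((n + 1 : ℕ) : ℂ)⁻¹) with hh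
  have hpow : ∀ᶠ u in 𝓝 u₀, φ u = φ u₀ + h u ^ (n + 1) := by
    filter_upwards [hfg] with u hu
    rw [hh, mul_pow, mul_pow, Complex.cpow_nat_inv_pow _ n.succ_ne_zero]
    rw [smul_eq_mul, Nat.succ_eq_add_one] at hu
    have : κ⁻¹ ^ (n + 1) * (g u / g u₀) = g u := by
      rw [inv_pow]
      have h1 : κ ^ (n + 1) ≠ 0 := pow_ne_zero _ hκ0
      field_simp
      linear_combination (-(g u)) * hκg
    rw [mul_assoc, this]
    linear_combination hu
  have hhan : AnalyticAt ℂ h u₀ := by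
    refine AnalyticAt.mul (by fun_prop) (AnalyticAt.cpow (by fun_prop) analyticAt_const ?_)
    rw [div_self hg0]
    exact Complex.one_mem_slitPlane
  have hu0 : h u₀ = 0 := by simp [hh]
  have hder : HasStrictDerivAt h κ⁻¹ u₀ := by
    have h1 : HasDerivAt h κ⁻¹ u₀ := by
      have hr : DifferentiableAt ℂ (fun u => (g u / g u₀) ^ (((n + 1 : ℕ) : ℂ)⁻¹)) u₀ := by
        refine DifferentiableAt.cpow_const (hg.differentiableAt.div_const _) ?_
        rw [div_self hg0]
        exact Complex.one_mem_slitPlane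
      have h0 : HasDerivAt (fun u => (u - u₀) * κ⁻¹) (1 * κ⁻¹) u₀ :=
        ((hasDerivAt_id u₀).sub_const u₀).mul_const _
      refine (h0.mul hr.hasDerivAt).congr_deriv ?_
      simp [div_self hg0]
    have h2 := hhan.hasStrictDerivAt
    rwa [h1.deriv] at h2
  have hκi : κ⁻¹ ≠ 0 := inv_ne_zero hκ0
  set k := hder.localInverse h κ⁻¹ u₀ hκi with hk
  have hkd : HasStrictDerivAt k κ 0 := by
    have := hder.to_localInverse hκi
    rwa [hu0, inv_inv] at this
  have hk0 : k 0 = u₀ := by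
    have := (hder.eventually_left_inverse hκi).self_of_nhds
    rwa [hu0] at this
  have hright : ∀ᶠ w in 𝓝 0, h (k w) = w := by
    have := hder.eventually_right_inverse hκi
    rwa [hu0] at this
  refine ⟨k, hk0, hkd.hasDerivAt, ?_, ?_⟩
  · obtain ⟨K, s, hs, hlip⟩ := hkd.hasStrictFDerivAt.exists_lipschitzOnWith
    filter_upwards [eventually_mem_nhds_iff.mpr hs] with w hw
    exact hlip.continuousOn.continuousAt hw
  · have hkc : Tendsto k (𝓝 0) (𝓝 u₀) := by
      have := hkd.hasDerivAt.continuousAt.tendsto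
      rwa [hk0] at this
    filter_upwards [hkc.eventually hpow, hright] with w h1 h2
    rw [h1, h2]

/-! ### The curve equation -/

/-- The relation between time and position on a path of steepest descent, `a = e^{iθ}`, `b = q a`. -/
def IsLevel (a b : ℂ) (t : ℝ) (u : ℂ) : Prop := Complex.exp ((a * u - t) / b) = 1 + u ^ 2

/-- The logarithm is recovered from the path as `L = (aγ - t)/b`, automatically continuous and `0`
at the start. What is left is a single-valued equation, so sheets need not be tracked. -/
theorem isSteepestDescentPath_iff {θ : ℝ} {q : ℂ} (hq : q ≠ 0) {γ : ℝ≥0 → ℂ} :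
    IsSteepestDescentPath θ q γ ↔ Continuous γ ∧ γ 0 = 0 ∧
      ∀ t : ℝ≥0, IsLevel (Complex.exp (θ * Complex.I)) (q * Complex.exp (θ * Complex.I)) t (γ t) := by
  unfold IsSteepestDescentPath
  have ha : Complex.exp (θ * Complex.I) ≠ 0 := Complex.exp_ne_zero _
  generalize Complex.exp (θ * Complex.I) = a at *
  refine ⟨fun ⟨h1, h2, L, h3, h4, h5, h6⟩ => ⟨h1, h2, fun t => ?_⟩, fun ⟨h1, h2, h3⟩ =>
    ⟨h1, h2, fun t => (a * γ t - t) / (q * a), by fun_prop, by simp [h2], h3, fun t => ?_⟩⟩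
  · rw [IsLevel, ← h5 t]
    congr 1
    rw [div_eq_iff (mul_ne_zero hq ha)]
    linear_combination h6 t
  · field_simp
    ring

theorem IsLevel.ne_zero {a b : ℂ} {t : ℝ} {u : ℂ} (h : IsLevel a b t u) : 1 + u ^ 2 ≠ 0 := by
  rw [← h]; exact Complex.exp_ne_zero _

/-- The phase near a point `u₀` passed at time `t₀`. -/
def localPhase (a b : ℂ) (t₀ : ℝ) (u₀ u : ℂ) : ℂ :=
  t₀ + a * (u - u₀) - b * Complex.log ((1 + u ^ 2) / (1 + u₀ ^ 2))

theorem localPhase_self (a b : ℂ) (t₀ : ℝ) {u₀ : ℂ} (hu : 1 + u₀ ^ 2 ≠ 0) :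
    localPhase a b t₀ u₀ u₀ = t₀ := by
  simp [localPhase, div_self hu]

theorem eventually_localPhase_mem {u₀ : ℂ} (hu : 1 + u₀ ^ 2 ≠ 0) :
    ∀ᶠ u in 𝓝 u₀, (1 + u ^ 2) / (1 + u₀ ^ 2) ∈ Complex.slitPlane := by
  have : ContinuousAt (fun u : ℂ => (1 + u ^ 2) / (1 + u₀ ^ 2)) u₀ := by fun_prop
  exact this.eventually_mem (Complex.isOpen_slitPlane.mem_nhds (by simp [div_self hu]))

theorem hasDerivAt_localPhase (a b : ℂ) (t₀ : ℝ) {u₀ u : ℂ} (hu : 1 + u₀ ^ 2 ≠ 0)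
    (hs : (1 + u ^ 2) / (1 + u₀ ^ 2) ∈ Complex.slitPlane) :
    HasDerivAt (localPhase a b t₀ u₀) ((a * (1 + u ^ 2) - 2 * b * u) / (1 + u ^ 2)) u := by
  have h1 : HasDerivAt (fun u : ℂ => 1 + u ^ 2) (2 * u) u := by
    simpa using (hasDerivAt_pow 2 u).const_add 1
  have h2 := (h1.div_const (1 + u₀ ^ 2)).clog hs
  have h3 := ((((hasDerivAt_id u).sub_const u₀).const_mul a).const_add (t₀ : ℂ)).sub (h2.const_mul b)
  refine h3.congr_deriv ?_
  have h4 : 1 + u ^ 2 ≠ 0 := by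
    intro h; rw [h, zero_div] at hs; simp at hs
  field_simp

theorem analyticAt_localPhase (a b : ℂ) (t₀ : ℝ) {u₀ : ℂ} (hu : 1 + u₀ ^ 2 ≠ 0) :
    AnalyticAt ℂ (localPhase a b t₀ u₀) u₀ := by
  refine Complex.analyticAt_iff_eventually_differentiableAt.mpr ?_
  filter_upwards [eventually_localPhase_mem hu] with u h
  exact (hasDerivAt_localPhase a b t₀ hu h).differentiableAt

/-- Close to `(t₀,u₀)` the continued logarithm changes its imaginary part by less than `π`, so
taking the principal logarithm of the ratio loses nothing. -/
theorem IsLevel.eventually_iff {a b : ℂ} (hb : b ≠ 0) {t₀ : ℝ} {u₀ : ℂ} (h : IsLevel a b t₀ u₀) :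
    ∀ᶠ p : ℝ × ℂ in 𝓝 (t₀, u₀), IsLevel a b p.1 p.2 ↔ localPhase a b t₀ u₀ p.2 = p.1 := by
  set L₀ := (a * u₀ - t₀) / b with hL₀
  have hu : 1 + u₀ ^ 2 ≠ 0 := h.ne_zero
  have hc : ContinuousAt (fun p : ℝ × ℂ => ((a * p.2 - p.1) / b - L₀).im) (t₀, u₀) := by
    refine Continuous.continuousAt ?_
    fun_prop
  have hz : ((a * u₀ - t₀) / b - L₀).im = 0 := by rw [hL₀, sub_self, Complex.zero_im]
  have e1 : ∀ᶠ p : ℝ × ℂ in 𝓝 (t₀, u₀), ((a * p.2 - p.1) / b - L₀).im < Real.pi :=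
    hc.eventually_lt continuousAt_const (by simpa [hz] using Real.pi_pos)
  have e2 : ∀ᶠ p : ℝ × ℂ in 𝓝 (t₀, u₀), -Real.pi < ((a * p.2 - p.1) / b - L₀).im :=
    continuousAt_const.eventually_lt hc (by simpa [hz] using Real.pi_pos)
  have e3 : ∀ᶠ p : ℝ × ℂ in 𝓝 (t₀, u₀), 1 + p.2 ^ 2 ≠ 0 := by
    have : ContinuousAt (fun p : ℝ × ℂ => 1 + p.2 ^ 2) (t₀, u₀) := by fun_prop
    exact this.eventually_ne hu
  filter_upwards [e1, e2, e3] with p h1 h2 h3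
  have hkey : IsLevel a b p.1 p.2 ↔
      Complex.exp ((a * p.2 - p.1) / b - L₀) = (1 + p.2 ^ 2) / (1 + u₀ ^ 2) := by
    rw [IsLevel, Complex.exp_sub, hL₀, h, div_left_inj' hu]
  rw [hkey]
  have hlin : localPhase a b t₀ u₀ p.2 = p.1 ↔
      (a * p.2 - p.1) / b - L₀ = Complex.log ((1 + p.2 ^ 2) / (1 + u₀ ^ 2)) := by
    rw [hL₀, ← sub_div, div_eq_iff hb, localPhase]
    constructor <;> intro h <;> linear_combination h
  rw [hlin]
  refine ⟨fun h4 => ?_, fun h4 => ?_⟩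
  · rw [← h4, Complex.log_exp h2 h1.le]
  · rw [h4, Complex.exp_log (div_ne_zero h3 hu)]

/-- A branch of the curve from `u₀`, at a point where the derivative of the phase has order `N`. -/
theorem IsLevel.exists_branch {a b : ℂ} (hb : b ≠ 0) {t₀ : ℝ} {u₀ : ℂ} (h : IsLevel a b t₀ u₀)
    {m : ℂ → ℂ} {N : ℕ} {κ : ℂ} (hm : ContinuousAt m u₀) (hm0 : m u₀ ≠ 0)
    (hd : ∀ᶠ u in 𝓝 u₀, a * (1 + u ^ 2) - 2 * b * u = (u - u₀) ^ N * m u)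
    (hκ : κ ^ (N + 1) * m u₀ = (N + 1) * (1 + u₀ ^ 2)) :
    ∃ k : ℂ → ℂ, ∃ ε > 0, k 0 = u₀ ∧ HasDerivAt k κ 0 ∧ ContinuousOn k (Metric.ball 0 ε) ∧
      ∀ w : ℝ, w ∈ Ico 0 ε → IsLevel a b (t₀ + w ^ (N + 1)) (k w) := by
  have hu := h.ne_zero
  obtain ⟨k, h1, h2, h3, h4⟩ := Struve.exists_branch (analyticAt_localPhase a b t₀ hu)
    (m := fun u => m u / (1 + u ^ 2)) (N := N) (κ := κ) (hm.div (by fun_prop) hu)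
    (div_ne_zero hm0 hu) (by
      filter_upwards [hd, eventually_localPhase_mem hu] with u hu1 hu2
      rw [mul_div_assoc', ← hu1]
      exact hasDerivAt_localPhase a b t₀ hu hu2) (by field_simp; linear_combination hκ)
  rw [localPhase_self a b t₀ hu] at h4
  -- Times must be real while `w` is complex; `w.re` agrees with `w` at the real `w` that are used.
  have hk : Tendsto (fun w : ℂ => (t₀ + w.re ^ (N + 1), k w)) (𝓝 0) (𝓝 (t₀, u₀)) := by
    refine Tendsto.prodMk_nhds ?_ ?_
    · have : Continuous fun w : ℂ => t₀ + w.re ^ (N + 1) := by fun_prop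
      simpa using this.tendsto 0
    · have := h2.continuousAt.tendsto
      rwa [h1] at this
  obtain ⟨ε, hε, hall⟩ := Metric.eventually_nhds_iff_ball.mp
    (h3.and (h4.and (hk.eventually (h.eventually_iff hb))))
  refine ⟨k, ε, hε, h1, h2, fun w hw => (hall w hw).1.continuousWithinAt, fun w hw => ?_⟩
  have hw' : (w : ℂ) ∈ Metric.ball (0 : ℂ) ε := by
    rw [mem_ball_zero_iff, Complex.norm_real, Real.norm_of_nonneg hw.1]; exact hw.2
  obtain ⟨-, h5, h6⟩ := hall w hw'
  simp only [Complex.ofReal_re] at h6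
  rw [h6, h5]
  push_cast
  rfl

/-- Away from saddle points the curve coincides with the local inverse of `localPhase`. The
derivative is taken within a set, so that the starting time is included. -/
theorem IsLevel.hasDerivAt {a b : ℂ} (hb : b ≠ 0) {γ : ℝ → ℂ} {t₀ : ℝ} {s : Set ℝ}
    (ht : t₀ ∈ s) (hγ : ContinuousWithinAt γ s t₀) (h : ∀ t ∈ s, IsLevel a b t (γ t))
    (hs : a * (1 + γ t₀ ^ 2) ≠ 2 * b * γ t₀) :
    HasDerivWithinAt γ ((1 + γ t₀ ^ 2) / (a * (1 + γ t₀ ^ 2) - 2 * b * γ t₀)) s t₀ := by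
  have hl := h t₀ ht
  have hu := hl.ne_zero
  have hd := hasDerivAt_localPhase a b t₀ hu (eventually_localPhase_mem hu).self_of_nhds
  have hst := (analyticAt_localPhase a b t₀ hu).hasStrictDerivAt
  rw [hd.deriv] at hst
  have hne : (a * (1 + γ t₀ ^ 2) - 2 * b * γ t₀) / (1 + γ t₀ ^ 2) ≠ 0 :=
    div_ne_zero (sub_ne_zero.mpr hs) hu
  have hinv := (hst.to_localInverse hne).hasDerivAt
  rw [localPhase_self a b t₀ hu, inv_div] at hinv
  have hcomp := (hinv.comp_ofReal).hasDerivWithinAt (s := s)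
  have hpair : Tendsto (fun t => (t, γ t)) (𝓝[s] t₀) (𝓝 (t₀, γ t₀)) :=
    (tendsto_id.mono_left nhdsWithin_le_nhds).prodMk_nhds hγ
  refine hcomp.congr_of_eventuallyEq ?_ ?_
  · filter_upwards [hpair.eventually (hl.eventually_iff hb),
      hγ.eventually (hst.eventually_left_inverse hne), self_mem_nhdsWithin] with t h1 h2 h3
    rw [← h1.mp (h t h3), h2]
  · have := (hst.eventually_left_inverse hne).self_of_nhds
    rw [localPhase_self a b t₀ hu] at this
    exact this.symm

end Struve

end

noncomputable section

namespace Struve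

open MeasureTheory Set

/-! ### Continuation of curves -/

theorem continuousOn_glue {X : Type*} [TopologicalSpace X] {f g : ℝ → X} {S J : Set ℝ} {T : ℝ}
    (hS : IsClosed S) (hJ : IsClosed J) (hST : S ⊆ Iic T) (hJT : J ⊆ Ici T)
    (hf : ContinuousOn f S) (hg : ContinuousOn g J) (h : f T = g T) :
    ContinuousOn (fun x => if x ≤ T then f x else g x) (S ∪ J) := by
  refine ContinuousOn.union_of_isClosed (hf.congr fun x hx => if_pos (hST hx))
    (hg.congr fun x hx => ?_) hS hJ
  have h0 : T ≤ x := hJT hx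
  rcases h0.eq_or_lt with h1 | h1
  · subst h1; simp [h]
  · exact if_neg (not_le.mpr h1)

/-- Zorn's lemma on partial solutions ordered by extension. Uniqueness is not available, since
several branches leave a saddle point. A maximal solution on `[s,T]` would be prolonged by `hext`,
one on `[s,T)` by `hlim`. -/
theorem exists_global {X : Type*} [TopologicalSpace X] {P : ℝ → X → Prop} {s : ℝ}
    (hext : ∀ t, s ≤ t → ∀ u, P t u → ∃ ε > 0, ∃ γ : ℝ → X, ContinuousOn γ (Icc t (t + ε)) ∧
      γ t = u ∧ ∀ x ∈ Icc t (t + ε), P x (γ x))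
    (hlim : ∀ T, s < T → ∀ γ : ℝ → X, ContinuousOn γ (Ico s T) → (∀ x ∈ Ico s T, P x (γ x)) →
      ∃ u, Tendsto γ (𝓝[<] T) (𝓝 u) ∧ P T u)
    {u : X} (hu : P s u) :
    ∃ γ : ℝ → X, ContinuousOn γ (Ici s) ∧ γ s = u ∧ ∀ x ∈ Ici s, P x (γ x) := by
  classical
  let A := {p : Set ℝ × (ℝ → X) // s ∈ p.1 ∧ p.1 ⊆ Ici s ∧ p.1.OrdConnected ∧
    ContinuousOn p.2 p.1 ∧ p.2 s = u ∧ ∀ x ∈ p.1, P x (p.2 x)}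
  let r : A → A → Prop := fun p p' => p.1.1 ⊆ p'.1.1 ∧ EqOn p.1.2 p'.1.2 p.1.1
  obtain ⟨⟨⟨I, γ⟩, hsI, hI, hoc, hγ, hγs, hP⟩, hmax⟩ := exists_maximal_of_chains_bounded (r := r)
    (fun c hc => by
      rcases c.eq_empty_or_nonempty with rfl | ⟨p₀, hp₀⟩
      · refine ⟨⟨({s}, fun _ => u), rfl, by simp, ordConnected_singleton, continuousOn_singleton _ _,
          rfl, ?_⟩, by simp⟩
        rintro x rfl; exact hu
      -- The union of the chain; comparability makes the value independent of the member chosen.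
      let γ : ℝ → X := fun x => if h : ∃ p ∈ c, x ∈ p.1.1 then h.choose.1.2 x else u
      have hγ : ∀ p ∈ c, ∀ x ∈ p.1.1, γ x = p.1.2 x := by
        intro p hp x hx
        have h : ∃ p ∈ c, x ∈ p.1.1 := ⟨p, hp, hx⟩
        simp only [γ, dif_pos h]
        have h1 := h.choose_spec
        by_cases he : h.choose = p
        · rw [he]
        · rcases hc h1.1 hp he with h2 | h2
          · exact h2.2 h1.2
          · exact (h2.2 hx).symm
      let I : Set ℝ := ⋃ p ∈ c, p.1.1
      have hmem : ∀ {x}, x ∈ I ↔ ∃ p ∈ c, x ∈ p.1.1 := by simp [I]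
      have hsub : ∀ p ∈ c, p.1.1 ⊆ I := fun p hp x hx => hmem.mpr ⟨p, hp, hx⟩
      have hIs : I ⊆ Ici s := fun x hx => by
        obtain ⟨p, _, hx⟩ := hmem.mp hx
        exact p.2.2.1 hx
      have hIcc : ∀ p ∈ c, ∀ y ∈ p.1.1, Icc s y ⊆ p.1.1 := fun p _ y hy =>
        p.2.2.2.1.out p.2.1 hy
      refine ⟨⟨(I, γ), hsub p₀ hp₀ p₀.2.1, hIs, ⟨fun x hx y hy z hz => ?_⟩, fun x hx => ?_, ?_, ?_⟩,
        fun p hp => ⟨hsub p hp, fun x hx => (hγ p hp x hx).symm⟩⟩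
      · obtain ⟨p, hp, hy⟩ := hmem.mp hy
        exact hsub p hp (hIcc p hp y hy ⟨(hIs hx).trans hz.1, hz.2⟩)
      -- If `x` is not the last point, a member reaching beyond `x` describes the union near `x`; if
      -- it is, a member containing `x` is everything.
      · by_cases hy : ∃ y ∈ I, x < y
        · obtain ⟨y, hy, hxy⟩ := hy
          obtain ⟨p, hp, hy⟩ := hmem.mp hy
          have hxs : x ∈ Icc s y := ⟨hIs hx, hxy.le⟩
          have h1 : ContinuousWithinAt γ (Icc s y) x :=
            ((p.2.2.2.2.1 x (hIcc p hp y hy hxs)).mono (hIcc p hp y hy)).congr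
              (fun z hz => hγ p hp z (hIcc p hp y hy hz)) (hγ p hp x (hIcc p hp y hy hxs))
          refine h1.mono_of_mem_nhdsWithin ?_
          filter_upwards [self_mem_nhdsWithin, mem_nhdsWithin_of_mem_nhds (Iio_mem_nhds hxy)]
            with z hz1 hz2
          exact ⟨hIs hz1, le_of_lt hz2⟩
        · push Not at hy
          obtain ⟨p, hp, hx'⟩ := hmem.mp hx
          have h2 : I ⊆ p.1.1 := fun z hz => hIcc p hp x hx' ⟨hIs hz, hy z hz⟩
          exact ((p.2.2.2.2.1 x hx').mono h2).congr (fun z hz => hγ p hp z (h2 hz)) (hγ p hp x hx')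
      · exact (hγ p₀ hp₀ s p₀.2.1).trans p₀.2.2.2.2.2.1
      · intro x hx
        obtain ⟨p, hp, hx⟩ := hmem.mp hx
        change P x (γ x)
        rw [hγ p hp x hx]
        exact p.2.2.2.2.2.2 x hx)
    (fun h1 h2 => ⟨h1.1.trans h2.1, fun x hx => (h1.2 hx).trans (h2.2 (h1.1 hx))⟩)
  simp only at hsI hI hoc hγ hγs hP
  have hfull : Ici s ⊆ I := by
    intro y hy
    by_contra hyI
    have hlt : ∀ x ∈ I, x < y := fun x hx => by
      by_contra h
      exact hyI (hoc.out hsI hx ⟨hy, not_lt.mp h⟩)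
    have hbdd : BddAbove I := ⟨y, fun x hx => (hlt x hx).le⟩
    set T := sSup I with hT
    have hle : ∀ x ∈ I, x ≤ T := fun x hx => le_csSup hbdd hx
    have hsT : s ≤ T := hle s hsI
    by_cases hTI : T ∈ I
    · have hIe : I = Icc s T :=
        Subset.antisymm (fun x hx => ⟨hI hx, hle x hx⟩) (hoc.out hsI hTI)
      obtain ⟨ε, hε, g, hg, hgT, hgP⟩ := hext T hsT (γ T) (hP T hTI)
      have hun : Icc s (T + ε) = Icc s T ∪ Icc T (T + ε) :=
        (Icc_union_Icc_eq_Icc hsT (by linarith)).symm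
      let m' : A := ⟨(Icc s (T + ε), fun x => if x ≤ T then γ x else g x),
        ⟨le_rfl, by linarith⟩, fun x hx => hx.1, ordConnected_Icc, by
          rw [hun]
          exact continuousOn_glue isClosed_Icc isClosed_Icc (fun x hx => hx.2) (fun x hx => hx.1)
            (by rwa [← hIe]) hg hgT.symm, by simp [hsT, hγs], by
          intro x hx
          change P x (if x ≤ T then γ x else g x)
          split_ifs with h
          · exact hP x (hIe ▸ ⟨hx.1, h⟩)
          · exact hgP x ⟨(not_le.mp h).le, hx.2⟩⟩
      have h1 := hmax m' ⟨fun x hx => ⟨hI hx, (hle x hx).trans (by linarith)⟩, fun x hx => by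
        change γ x = if x ≤ T then γ x else g x
        rw [if_pos (hle x hx)]⟩
      have h2 : T + ε ∈ I := h1.1 (show T + ε ∈ Icc s (T + ε) from ⟨by linarith, le_rfl⟩)
      have := hle _ h2
      linarith
    · have hsT' : s < T := lt_of_le_of_ne hsT fun h => hTI (h ▸ hsI)
      have hIe : I = Ico s T := by
        refine Subset.antisymm (fun x hx => ⟨hI hx, lt_of_le_of_ne (hle x hx) fun h => hTI (h ▸ hx)⟩) ?_
        intro x hx
        obtain ⟨z, hz, hxz⟩ := exists_lt_of_lt_csSup ⟨s, hsI⟩ hx.2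
        exact hoc.out hsI hz ⟨hx.1, hxz.le⟩
      obtain ⟨v, hv, hvP⟩ := hlim T hsT' γ (hIe ▸ hγ) (hIe ▸ hP)
      have hdiff : Icc s T \ {T} = Ico s T := Icc_sdiff_right
      let m' : A := ⟨(Icc s T, Function.update γ T v), ⟨le_rfl, hsT⟩, fun x hx => hx.1,
        ordConnected_Icc, by
          refine continuousOn_update_iff.mpr ⟨by rw [hdiff, ← hIe]; exact hγ, fun _ => ?_⟩
          rw [hdiff, nhdsWithin_Ico_eq_nhdsLT hsT']
          exact hv, by
          change Function.update γ T v s = u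
          rw [Function.update_of_ne hsT'.ne, hγs], by
          intro x hx
          change P x (Function.update γ T v x)
          rcases hx.2.eq_or_lt with h | h
          · rw [h, Function.update_self]; exact hvP
          · rw [Function.update_of_ne h.ne]; exact hP x (hIe ▸ ⟨hx.1, h⟩)⟩
      have h1 := hmax m' ⟨fun x hx => ⟨hI hx, hle x hx⟩, fun x hx => by
        change γ x = Function.update γ T v x
        have hne : x ≠ T := by rintro rfl; exact hTI hx
        rw [Function.update_of_ne hne]⟩
      exact hTI (h1.1 (show T ∈ Icc s T from ⟨hsT, le_rfl⟩))
  exact ⟨γ, hγ.mono hfull, hγs, fun x hx => hP x (hfull hx)⟩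

theorem lt_of_isPreconnected {X : Type*} [TopologicalSpace X] {I : Set X} (hI : IsPreconnected I)
    {f : X → ℝ} (hf : ContinuousOn f I) {c : ℝ} (hc : ∀ x ∈ I, f x ≠ c) {x₀ : X} (hx₀ : x₀ ∈ I)
    (h : f x₀ < c) : ∀ x ∈ I, f x < c := by
  intro x hx
  by_contra hge
  obtain ⟨y, hy, hyc⟩ := hI.intermediate_value hx₀ hx hf ⟨h.le, not_lt.mp hge⟩
  exact hc y hy hyc

theorem continuousOn_dist_const {I : Set ℝ} {γ : ℝ → ℂ} (hγ : ContinuousOn γ I) (u : ℂ) :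
    ContinuousOn (fun t => dist (γ t) u) I :=
  (continuous_id.dist continuous_const).comp_continuousOn hγ

/-! ### Local continuation, uniqueness, limits -/

/-- The numerator of the derivative of the phase is a quadratic with leading coefficient `a ≠ 0`, so
its order at a point is `0`, `1`, or `2` at a double saddle point. -/
theorem exists_order {a b : ℂ} (ha : a ≠ 0) (u : ℂ) : ∃ (N : ℕ) (m : ℂ → ℂ), ContinuousAt m u ∧
    m u ≠ 0 ∧ ∀ v, a * (1 + v ^ 2) - 2 * b * v = (v - u) ^ N * m v := by
  by_cases h0 : a * (1 + u ^ 2) - 2 * b * u = 0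
  · by_cases h1 : a * (u + u) - 2 * b = 0
    · refine ⟨2, fun _ => a, continuousAt_const, ha, fun v => ?_⟩
      linear_combination h0 + (v - u) * h1
    · refine ⟨1, fun v => a * (v + u) - 2 * b, by fun_prop, h1, fun v => ?_⟩
      linear_combination h0
  · exact ⟨0, fun v => a * (1 + v ^ 2) - 2 * b * v, by fun_prop, h0, fun v => by ring⟩

/-- Reparametrisation by time: `w = (x-t₀)^(1/(N+1))`. The limit of the quotient by `w` records the
direction of departure, which later decides the region that is entered. -/
theorem IsLevel.exists_branch_path {a b : ℂ} (hb : b ≠ 0) {t₀ : ℝ} {u₀ : ℂ} (h : IsLevel a b t₀ u₀)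
    {m : ℂ → ℂ} {N : ℕ} {κ : ℂ} (hm : ContinuousAt m u₀) (hm0 : m u₀ ≠ 0)
    (hd : ∀ u, a * (1 + u ^ 2) - 2 * b * u = (u - u₀) ^ N * m u)
    (hκ : κ ^ (N + 1) * m u₀ = (N + 1) * (1 + u₀ ^ 2)) :
    ∃ ε > 0, ∃ γ : ℝ → ℂ, ContinuousOn γ (Icc t₀ (t₀ + ε)) ∧ γ t₀ = u₀ ∧
      (∀ x ∈ Icc t₀ (t₀ + ε), IsLevel a b x (γ x)) ∧
      ∃ w : ℝ → ℝ, (∀ x, t₀ < x → 0 < w x) ∧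
        Tendsto (fun x => (γ x - u₀) / w x) (𝓝[>] t₀) (𝓝 κ) := by
  obtain ⟨k, ε, hε, hk0, hkd, hkc, hkl⟩ :=
    h.exists_branch hb hm hm0 (Eventually.of_forall hd) hκ
  have hN : (N + 1 : ℕ) ≠ 0 := N.succ_ne_zero
  set w : ℝ → ℝ := fun x => (x - t₀) ^ (((N + 1 : ℕ) : ℝ)⁻¹) with hw
  have hwc : Continuous w := (Real.continuous_rpow_const (by positivity)).comp (by fun_prop)
  have hw0 : w t₀ = 0 := by
    rw [hw]; simp only [sub_self]; exact Real.zero_rpow (inv_ne_zero (by exact_mod_cast hN))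
  have hwpow : ∀ x, t₀ ≤ x → w x ^ (N + 1) = x - t₀ := fun x hx =>
    Real.rpow_inv_natCast_pow (by linarith) hN
  have hwn : ∀ x, t₀ ≤ x → 0 ≤ w x := fun x hx => Real.rpow_nonneg (by linarith) _
  have hwlt : ∀ x ∈ Icc t₀ (t₀ + (ε / 2) ^ (N + 1)), w x ∈ Ico 0 ε := by
    intro x hx
    refine ⟨hwn x hx.1, ?_⟩
    have : w x ≤ ε / 2 := by
      refine le_of_pow_le_pow_left₀ hN (by positivity) ?_
      rw [hwpow x hx.1]; linarith [hx.2]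
    linarith
  refine ⟨(ε / 2) ^ (N + 1), by positivity, fun x => k (w x), ?_, by simp [hw0, hk0], ?_, w, ?_, ?_⟩
  · refine hkc.comp (Continuous.continuousOn (by fun_prop)) fun x hx => ?_
    rw [mem_ball_zero_iff, Complex.norm_real, Real.norm_of_nonneg (hwlt x hx).1]
    exact (hwlt x hx).2
  · intro x hx
    have := hkl (w x) (hwlt x hx)
    rwa [hwpow x hx.1, add_sub_cancel] at this
  · intro x hx
    exact Real.rpow_pos_of_pos (by linarith) _
  · have hs := hkd.tendsto_slope_zero
    have hwt : Tendsto (fun x => (w x : ℂ)) (𝓝[>] t₀) (𝓝[≠] 0) := by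
      refine tendsto_nhdsWithin_iff.mpr ⟨?_, ?_⟩
      · have h1 : Tendsto (fun x => (w x : ℂ)) (𝓝 t₀) (𝓝 ((w t₀ : ℝ) : ℂ)) :=
          (Complex.continuous_ofReal.comp hwc).tendsto t₀
        rw [hw0, Complex.ofReal_zero] at h1
        exact h1.mono_left nhdsWithin_le_nhds
      · filter_upwards [self_mem_nhdsWithin] with x hx
        have : 0 < w x := Real.rpow_pos_of_pos (sub_pos.mpr hx) _
        simpa using this.ne'
    refine (hs.comp hwt).congr fun x => ?_
    simp only [Function.comp, zero_add, hk0, smul_eq_mul]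
    rw [div_eq_inv_mul]

/-- Some direction `κ` exists because `ℂ` is algebraically closed, so a saddle point does not stop
the curve. -/
theorem IsLevel.exists_path_right {a b : ℂ} (ha : a ≠ 0) (hb : b ≠ 0) {t₀ : ℝ} {u₀ : ℂ}
    (h : IsLevel a b t₀ u₀) : ∃ ε > 0, ∃ γ : ℝ → ℂ, ContinuousOn γ (Icc t₀ (t₀ + ε)) ∧
      γ t₀ = u₀ ∧ ∀ x ∈ Icc t₀ (t₀ + ε), IsLevel a b x (γ x) := by
  obtain ⟨N, m, hm, hm0, hd⟩ := exists_order (b := b) ha u₀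
  obtain ⟨κ, hκ⟩ := IsAlgClosed.exists_pow_nat_eq ((N + 1) * (1 + u₀ ^ 2) / m u₀) N.succ_pos
  obtain ⟨ε, hε, γ, h1, h2, h3, -⟩ := h.exists_branch_path hb hm hm0 hd (κ := κ)
    (by rw [hκ]; field_simp)
  exact ⟨ε, hε, γ, h1, h2, h3⟩

/-- The coincidence set is closed, and it is open because `localPhase` is injective near a point
that is not a saddle. Only the first curve has to avoid saddle points. -/
theorem eq_of_isLevel {X : Type*} [TopologicalSpace X] [PreconnectedSpace X] {a b : ℂ} (hb : b ≠ 0)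
    {τ : X → ℝ} {γ₁ γ₂ : X → ℂ} (hτ : Continuous τ) (h₁ : Continuous γ₁) (h₂ : Continuous γ₂)
    (hl₁ : ∀ x, IsLevel a b (τ x) (γ₁ x)) (hl₂ : ∀ x, IsLevel a b (τ x) (γ₂ x))
    (hs : ∀ x, a * (1 + γ₁ x ^ 2) ≠ 2 * b * γ₁ x) {x₀ : X} (hx₀ : γ₁ x₀ = γ₂ x₀) : γ₁ = γ₂ := by
  have hcl : IsClopen {x | γ₁ x = γ₂ x} := by
    refine ⟨isClosed_eq h₁ h₂, isOpen_iff_mem_nhds.mpr fun x hx => ?_⟩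
    have hx' : γ₁ x = γ₂ x := hx
    have hl := hl₁ x
    have hu := hl.ne_zero
    have hd := hasDerivAt_localPhase a b (τ x) hu (eventually_localPhase_mem hu).self_of_nhds
    have hst := (analyticAt_localPhase a b (τ x) hu).hasStrictDerivAt
    rw [hd.deriv] at hst
    have hne : (a * (1 + γ₁ x ^ 2) - 2 * b * γ₁ x) / (1 + γ₁ x ^ 2) ≠ 0 :=
      div_ne_zero (sub_ne_zero.mpr (hs x)) hu
    have hinv := hst.eventually_left_inverse hne
    have hp1 : Tendsto (fun y => (τ y, γ₁ y)) (𝓝 x) (𝓝 (τ x, γ₁ x)) :=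
      (hτ.tendsto x).prodMk_nhds (h₁.tendsto x)
    have hp2 : Tendsto (fun y => (τ y, γ₂ y)) (𝓝 x) (𝓝 (τ x, γ₁ x)) := by
      rw [hx']; exact (hτ.tendsto x).prodMk_nhds (h₂.tendsto x)
    have ht2 : Tendsto γ₂ (𝓝 x) (𝓝 (γ₁ x)) := by rw [hx']; exact h₂.tendsto x
    filter_upwards [hp1.eventually (hl.eventually_iff hb), hp2.eventually (hl.eventually_iff hb),
      (h₁.tendsto x).eventually hinv, ht2.eventually hinv] with y e1 e2 e3 e4
    rw [← e3, ← e4, e1.mp (hl₁ y), e2.mp (hl₂ y)]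
  have := hcl.eq_univ ⟨x₀, hx₀⟩
  funext x
  exact (this ▸ mem_univ x : x ∈ {x | γ₁ x = γ₂ x})

theorem eq_of_exp_eq {X : Type*} [TopologicalSpace X] [PreconnectedSpace X] {f g : X → ℂ}
    (hf : Continuous f) (hg : Continuous g) (h : ∀ x, Complex.exp (f x) = Complex.exp (g x))
    {x₀ : X} (hx₀ : f x₀ = g x₀) : f = g := by
  have hcl : IsClopen {x | f x = g x} := by
    refine ⟨isClosed_eq hf hg, isOpen_iff_mem_nhds.mpr fun x hx => ?_⟩
    have hx' : f x = g x := hx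
    have key : ∀ φ : X → ℂ, Continuous φ → φ x = f x →
        ∀ᶠ y in 𝓝 x, φ y - f x = Complex.log (Complex.exp (φ y - f x)) := by
      intro φ hφ hφx
      have hc : ContinuousAt (fun y => (φ y - f x).im) x := by fun_prop
      have hz : (φ x - f x).im = 0 := by rw [hφx, sub_self, Complex.zero_im]
      filter_upwards [hc.eventually_lt continuousAt_const (by rw [hz]; exact Real.pi_pos),
        (continuousAt_const (y := -Real.pi)).eventually_lt hc
          (by rw [hz]; exact neg_neg_of_pos Real.pi_pos)] with y h1 h2
      rw [Complex.log_exp h2 h1.le]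
    filter_upwards [key f hf rfl, key g hg hx'.symm] with y e1 e2
    rw [Complex.exp_sub, h y, ← Complex.exp_sub, ← e2] at e1
    exact sub_left_injective e1
  have := hcl.eq_univ ⟨x₀, hx₀⟩
  funext x
  exact (this ▸ mem_univ x : x ∈ {x | f x = g x})

/-- For these `u` the term `2bu` is at most half of `a(1+u²)`, so the velocity differs little from
`1/a`. -/
theorem velocity_bound {a b u : ℂ} (ha : a ≠ 0) (hu2 : 2 ≤ ‖u‖)
    (hu : 1 + 4 * ‖b‖ / ‖a‖ ≤ ‖u‖) :
    a * (1 + u ^ 2) ≠ 2 * b * u ∧ ‖(1 + u ^ 2) / (a * (1 + u ^ 2) - 2 * b * u)‖ ≤ 2 / ‖a‖ := by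
  have hap : 0 < ‖a‖ := norm_pos_iff.mpr ha
  have h1 : ‖u‖ ^ 2 - 1 ≤ ‖1 + u ^ 2‖ := by
    have := norm_sub_norm_le (u ^ 2) (-1)
    rw [norm_pow, norm_neg, norm_one, sub_neg_eq_add, add_comm (u ^ 2)] at this
    exact this
  have h2 : 4 * ‖b‖ ≤ ‖a‖ * (‖u‖ - 1) := by
    have : 4 * ‖b‖ / ‖a‖ ≤ ‖u‖ - 1 := by linarith
    rw [div_le_iff₀ hap] at this
    linarith
  have h3 : 4 * ‖b‖ * ‖u‖ ≤ ‖a‖ * ‖1 + u ^ 2‖ := by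
    calc 4 * ‖b‖ * ‖u‖ ≤ ‖a‖ * (‖u‖ - 1) * ‖u‖ := by gcongr
      _ ≤ ‖a‖ * (‖u‖ ^ 2 - 1) := by nlinarith
      _ ≤ _ := by gcongr
  have h4 : 0 < ‖1 + u ^ 2‖ := by nlinarith
  have h5 : ‖a‖ * ‖1 + u ^ 2‖ / 2 ≤ ‖a * (1 + u ^ 2) - 2 * b * u‖ := by
    have := norm_sub_norm_le (a * (1 + u ^ 2)) (2 * b * u)
    rw [norm_mul, norm_mul, norm_mul, Complex.norm_ofNat] at this
    linarith
  have h6 : 0 < ‖a * (1 + u ^ 2) - 2 * b * u‖ := lt_of_lt_of_le (by positivity) h5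
  refine ⟨sub_ne_zero.mp (norm_pos_iff.mp h6), ?_⟩
  rw [norm_div, div_le_div_iff₀ h6 hap]
  linarith

/-- No escape in finite time: outside the radius `R` the speed is at most `2/|a|`, so the norm stays
below `R + K(x-s)`. All saddle points lie inside that radius and cannot interfere. -/
theorem exists_bound_of_isLevel {a b : ℂ} (ha : a ≠ 0) (hb : b ≠ 0) {s T : ℝ} {γ : ℝ → ℂ}
    (hγ : ContinuousOn γ (Ico s T)) (hl : ∀ x ∈ Ico s T, IsLevel a b x (γ x)) :
    ∃ M, ∀ x ∈ Ico s T, ‖γ x‖ ≤ M := by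
  set R : ℝ := max (max 2 (1 + 4 * ‖b‖ / ‖a‖)) ‖γ s‖ with hR
  -- Strictly above the speed bound, because slopes are only controlled by strict inequalities.
  set K : ℝ := 2 / ‖a‖ + 1 with hK
  have hKpos : 0 < K := by positivity
  have key : ∀ T' ∈ Ico s T, ∀ x ∈ Icc s T', ‖γ x‖ ≤ R + K * (x - s) := by
    intro T' hT' x hx
    have hsub : Icc s T' ⊆ Ico s T := fun y hy => ⟨hy.1, hy.2.trans_lt hT'.2⟩
    have hcl : IsClosed ({x | ‖γ x‖ ≤ R + K * (x - s)} ∩ Icc s T') := by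
      have := ContinuousOn.preimage_isClosed_of_isClosed
        (f := fun x => ‖γ x‖ - (R + K * (x - s)))
        ((hγ.mono hsub).norm.sub (by fun_prop)) isClosed_Icc (isClosed_Iic (a := (0 : ℝ)))
      convert this using 1
      ext y
      simp only [mem_inter_iff, mem_ofPred_eq, mem_preimage, mem_Iic, sub_nonpos]
      exact and_comm
    refine hcl.Icc_subset_of_forall_exists_gt (a := s) (b := T') ?_ ?_ hx
    · simp [hR]
    · intro y hy z hz
      have hyI : y ∈ Ico s T := hsub ⟨hy.2.1, hy.2.2.le⟩
      have hmem : Ioc y (min z T') ∈ 𝓝[>] y := Ioc_mem_nhdsGT (lt_min hz hy.2.2)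
      have hIco : Ico s T ∈ 𝓝[>] y :=
        mem_of_superset (Ioo_mem_nhdsGT hyI.2) fun v hv => ⟨hyI.1.trans hv.1.le, hv.2⟩
      have hev : ∀ᶠ v in 𝓝[>] y, ‖γ v‖ ≤ R + K * (v - s) := by
        rcases (show ‖γ y‖ ≤ R + K * (y - s) from hy.1).lt_or_eq with hlt | heq
        · have h1 : ContinuousWithinAt (fun v => ‖γ v‖) (Ico s T) y := (hγ y hyI).norm
          have h2 : ContinuousWithinAt (fun v => R + K * (v - s)) (Ico s T) y := by fun_prop
          have h3 : ∀ᶠ v in 𝓝[Ico s T] y, ‖γ v‖ < R + K * (v - s) := h1.eventually_lt h2 hlt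
          exact (h3.filter_mono (nhdsWithin_le_of_mem hIco)).mono fun v hv => hv.le
        · have hRy : R ≤ ‖γ y‖ := by
            rw [heq]; nlinarith [hyI.1]
          obtain ⟨h1, h2⟩ := velocity_bound (b := b) ha
            (((le_max_left _ _).trans (le_max_left _ _)).trans hRy)
            (((le_max_right _ _).trans (le_max_left _ _)).trans hRy)
          have h3 := IsLevel.hasDerivAt hb hyI (hγ y hyI) hl h1
          have h4 := h3.limsup_norm_slope_le (r := K) (by rw [hK]; linarith)
          filter_upwards [h4.filter_mono (nhdsWithin_le_of_mem hIco), self_mem_nhdsWithin]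
            with v hv hyv
          have hvy : 0 < v - y := sub_pos.mpr hyv
          rw [Real.norm_of_nonneg hvy.le, inv_mul_lt_iff₀ hvy] at hv
          have := norm_sub_norm_le (γ v) (γ y)
          rw [heq] at this
          linarith
      obtain ⟨v, hv1, hv2⟩ := (hev.and hmem).exists
      exact ⟨v, hv1, hv2.1, hv2.2.trans (min_le_left _ _)⟩
  refine ⟨R + K * (T - s), fun x hx => (key x hx x ⟨hx.1, le_rfl⟩).trans ?_⟩
  nlinarith [hx.2]

/-- A limit point `u` exists by boundedness and satisfies the equation at time `T`. Its zeros at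
time `T` are isolated, so small circles around `u` carry no zero at times near `T`, and the curve
cannot cross them. -/
theorem tendsto_of_isLevel {a b : ℂ} (ha : a ≠ 0) (hb : b ≠ 0) {s T : ℝ} (hsT : s < T) {γ : ℝ → ℂ}
    (hγ : ContinuousOn γ (Ico s T)) (hl : ∀ x ∈ Ico s T, IsLevel a b x (γ x)) :
    ∃ u, Tendsto γ (𝓝[<] T) (𝓝 u) ∧ IsLevel a b T u := by
  obtain ⟨M, hM⟩ := exists_bound_of_isLevel ha hb hγ hl
  obtain ⟨x, hxI, hxT⟩ : ∃ x : ℕ → ℝ, (∀ n, x n ∈ Ico s T) ∧ Tendsto x atTop (𝓝 T) := by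
    obtain ⟨x, -, h1, h2⟩ := exists_seq_strictMono_tendsto' hsT
    exact ⟨x, fun n => ⟨(h1 n).1.le, (h1 n).2⟩, h2⟩
  obtain ⟨u, -, σ, hσ, hu⟩ := tendsto_subseq_of_bounded
    (Metric.isBounded_closedBall (x := (0 : ℂ)) (r := M)) (x := fun n => γ (x n))
    fun n => mem_closedBall_zero_iff.mpr (hM _ (hxI n))
  have hxσ : Tendsto (fun n => x (σ n)) atTop (𝓝 T) := hxT.comp hσ.tendsto_atTop
  set F : ℝ × ℂ → ℂ := fun p => Complex.exp ((a * p.2 - p.1) / b) - (1 + p.2 ^ 2) with hF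
  have hFc : Continuous F := by rw [hF]; fun_prop
  have hFl : ∀ t v, F (t, v) = 0 ↔ IsLevel a b t v := fun t v => sub_eq_zero
  have hTu : IsLevel a b T u := by
    rw [← hFl]
    have h1 : Tendsto (fun n => F (x (σ n), γ (x (σ n)))) atTop (𝓝 (F (T, u))) :=
      (hFc.tendsto _).comp (hxσ.prodMk_nhds hu)
    refine tendsto_nhds_unique h1 (tendsto_const_nhds.congr fun n => ?_)
    exact ((hFl _ _).mpr (hl _ (hxI _))).symm
  refine ⟨u, ?_, hTu⟩
  -- zeros of `F (T, ·)` are isolated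
  have hiso : ∀ᶠ v in 𝓝[≠] u, F (T, v) ≠ 0 := by
    have hd : Differentiable ℂ fun v => F (T, v) := by simp only [hF]; fun_prop
    rcases (hd.analyticAt u).eventually_eq_zero_or_eventually_ne_zero with h | h
    · exfalso
      -- The equation is not an identity: at `u = i` the polynomial vanishes and the exponential
      -- does not.
      have h1 := (hd.differentiableOn.analyticOnNhd
        isOpen_univ).eqOn_zero_of_preconnected_of_eventuallyEq_zero isPreconnected_univ
        (mem_univ u) h (mem_univ Complex.I)
      simp only [hF, Pi.zero_apply, Complex.I_sq, add_neg_cancel, sub_zero] at h1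
      exact Complex.exp_ne_zero _ h1
    · exact h
  obtain ⟨δ₀, hδ₀, hball⟩ := Metric.mem_nhdsWithin_iff.mp hiso
  refine Metric.tendsto_nhds.mpr fun δ hδ => ?_
  set d := min δ (δ₀ / 2) with hd
  have hdpos : 0 < d := lt_min hδ (by linarith)
  have hsph : ∀ᶠ t in 𝓝 T, ∀ v ∈ Metric.sphere u d, F (t, v) ≠ 0 := by
    refine (isCompact_sphere u d).eventually_forall_of_forall_eventually fun v hv => ?_
    have hvd : dist v u = d := hv
    have hne : F (T, v) ≠ 0 := by
      refine hball ⟨?_, ?_⟩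
      · rw [Metric.mem_ball, hvd]
        exact (min_le_right _ _).trans_lt (by linarith)
      · intro h
        rw [mem_singleton_iff] at h
        rw [h, dist_self] at hvd
        exact hdpos.ne hvd
    exact (hFc.continuousAt (x := (T, v))).eventually_ne hne
  obtain ⟨l, hlT, hlI⟩ := exists_Ioc_subset_of_mem_nhds hsph ⟨s, hsT⟩
  set l' := max l s with hl'
  have hl'T : l' < T := max_lt hlT hsT
  have hsub : Ioo l' T ⊆ Ico s T := fun y hy => ⟨((le_max_right _ _).trans_lt hy.1).le, hy.2⟩
  obtain ⟨n, hn1, hn2⟩ := ((hxσ.eventually (lt_mem_nhds hl'T)).and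
    (hu.eventually (Metric.ball_mem_nhds u hdpos))).exists
  have hstay := lt_of_isPreconnected (isPreconnected_Ioo (a := l') (b := T))
    (f := fun t => dist (γ t) u) (c := d)
    (continuousOn_dist_const (hγ.mono hsub) u) (fun t ht h => by
      exact hlI ⟨(le_max_left _ _).trans_lt ht.1, ht.2.le⟩ (γ t) h ((hFl _ _).mpr (hl t (hsub ht))))
    (x₀ := x (σ n)) ⟨hn1, (hxI _).2⟩ hn2
  filter_upwards [Ioo_mem_nhdsLT hl'T] with t ht
  exact (hstay t ht).trans_le (min_le_left _ _)

/-- Curves can be continued for all times. -/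
theorem IsLevel.exists_path {a b : ℂ} (ha : a ≠ 0) (hb : b ≠ 0) {t₀ : ℝ} {u₀ : ℂ}
    (h : IsLevel a b t₀ u₀) : ∃ γ : ℝ → ℂ, ContinuousOn γ (Ici t₀) ∧ γ t₀ = u₀ ∧
      ∀ x ∈ Ici t₀, IsLevel a b x (γ x) :=
  exists_global (P := IsLevel a b) (fun _ _ _ hu => hu.exists_path_right ha hb)
    (fun _ hT _ hγ hl => tendsto_of_isLevel ha hb hT hγ hl) h

theorem exists_path_extending {a b : ℂ} (ha : a ≠ 0) (hb : b ≠ 0) {s T : ℝ} (hsT : s ≤ T) {γ : ℝ → ℂ}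
    (hγ : ContinuousOn γ (Icc s T)) (hl : ∀ x ∈ Icc s T, IsLevel a b x (γ x)) :
    ∃ γ' : ℝ → ℂ, ContinuousOn γ' (Ici s) ∧ (∀ x ∈ Ici s, IsLevel a b x (γ' x)) ∧
      ∀ x ≤ T, γ' x = γ x := by
  obtain ⟨g, hg, hgT, hgl⟩ := (hl T ⟨hsT, le_rfl⟩).exists_path ha hb
  refine ⟨fun x => if x ≤ T then γ x else g x, ?_, fun x hx => ?_, fun x hx => if_pos hx⟩
  · rw [← Icc_union_Ici_eq_Ici hsT]
    exact continuousOn_glue isClosed_Icc isClosed_Ici (fun x hx => hx.2) (fun x hx => hx) hγ hg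
      hgT.symm
  · change IsLevel a b x (if x ≤ T then γ x else g x)
    split_ifs with h
    · exact hl x ⟨hx, h⟩
    · exact hgl x (not_le.mp h).le

end Struve

end

noncomputable section

namespace Struve

open MeasureTheory Set

/-! ### Paths of steepest descent: existence, ends, uniqueness -/

theorem isLevel_zero (a b : ℂ) : IsLevel a b 0 0 := by simp [IsLevel]

/-- At `u = 0` the modulus of the equation reads `e^{-t Re(1/b)} = 1`; thus the path never returns
to `0`, on any sheet. -/
theorem IsLevel.time_eq_zero {a b : ℂ} {t : ℝ} (h : IsLevel a b t 0) (hb : 0 < b.re) : t = 0 := by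
  rw [IsLevel] at h
  have h1 := congrArg norm h
  rw [Complex.norm_exp] at h1
  simp only [mul_zero, zero_sub, ne_eq, OfNat.ofNat_ne_zero, not_false_eq_true, zero_pow, add_zero,
    norm_one, Real.exp_eq_one_iff] at h1
  rw [neg_div, Complex.neg_re, Complex.div_re, Complex.ofReal_re, Complex.ofReal_im, zero_mul,
    zero_div, add_zero, neg_eq_zero] at h1
  have hb0 : b ≠ 0 := by rintro rfl; simp at hb
  have := Complex.normSq_pos.mpr hb0
  have h2 : t * b.re = 0 := by
    rcases div_eq_zero_iff.mp h1 with h | h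
    · exact h
    · exact absurd h this.ne'
  exact (mul_eq_zero.mp h2).resolve_right hb.ne'

theorem ne_zero_of_re_pos {b : ℂ} (hb : 0 < b.re) : b ≠ 0 := by rintro rfl; simp at hb

/-- Taking moduli makes time visible in an entire function of position whose only zeros are `±i`;
this is what forces the path to its ends. -/
theorem norm_one_add_sq_of_isLevel {a b : ℂ} {t : ℝ} {u : ℂ} (h : IsLevel a b t u) :
    ‖(1 + u ^ 2) * Complex.exp (-(a * u / b))‖ = Real.exp (-(t * (b⁻¹).re)) := by
  rw [← h, ← Complex.exp_add, Complex.norm_exp]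
  congr 1
  rw [show (a * u - t) / b + -(a * u / b) = -(t * b⁻¹) by ring, Complex.neg_re,
    Complex.re_ofReal_mul]

theorem inv_re_pos {b : ℂ} (hb : 0 < b.re) : 0 < (b⁻¹).re := by
  rw [Complex.inv_re]
  exact div_pos hb (Complex.normSq_pos.mpr (ne_zero_of_re_pos hb))

/-- The curve leaves every compact set that avoids `±i`. -/
theorem eventually_notMem_of_isLevel {a b : ℂ} (hb : 0 < b.re) {γ : ℝ → ℂ}
    (hl : ∀ t ∈ Ici (0 : ℝ), IsLevel a b t (γ t)) {K : Set ℂ} (hK : IsCompact K)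
    (hK' : ∀ u ∈ K, 1 + u ^ 2 ≠ 0) : ∀ᶠ t in atTop, γ t ∉ K := by
  rcases K.eq_empty_or_nonempty with rfl | hne
  · simp
  obtain ⟨v, hv, hmin⟩ := hK.exists_isMinOn hne
    (f := fun u => ‖(1 + u ^ 2) * Complex.exp (-(a * u / b))‖) (Continuous.continuousOn (by fun_prop))
  have hpos : 0 < ‖(1 + v ^ 2) * Complex.exp (-(a * v / b))‖ :=
    norm_pos_iff.mpr (mul_ne_zero (hK' v hv) (Complex.exp_ne_zero _))
  have hexp : Tendsto (fun t : ℝ => Real.exp (-(t * (b⁻¹).re))) atTop (𝓝 0) :=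
    Real.tendsto_exp_neg_atTop_nhds_zero.comp (tendsto_id.atTop_mul_const (inv_re_pos hb))
  filter_upwards [hexp.eventually_lt_const hpos, eventually_ge_atTop 0] with t h1 h2 h3
  have h4 : ‖(1 + v ^ 2) * Complex.exp (-(a * v / b))‖ ≤
      ‖(1 + γ t ^ 2) * Complex.exp (-(a * γ t / b))‖ := hmin h3
  rw [norm_one_add_sq_of_isLevel (hl t h2)] at h4
  linarith

theorem isCompact_away (R δ : ℝ) : IsCompact {u : ℂ | ‖u‖ ≤ R ∧ δ ≤ dist u Complex.I ∧
    δ ≤ dist u (-Complex.I)} := by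
  have h : {u : ℂ | ‖u‖ ≤ R ∧ δ ≤ dist u Complex.I ∧ δ ≤ dist u (-Complex.I)} =
      Metric.closedBall 0 R ∩ {u | δ ≤ dist u Complex.I ∧ δ ≤ dist u (-Complex.I)} := by
    ext u; simp
  rw [h]
  refine (isCompact_closedBall _ _).inter_right ?_
  exact (isClosed_le continuous_const (continuous_id.dist continuous_const)).inter
    (isClosed_le continuous_const (continuous_id.dist continuous_const))

theorem one_add_sq_factor (u : ℂ) : 1 + u ^ 2 = (u - Complex.I) * (u - -Complex.I) := by
  linear_combination Complex.I_sq

theorem one_add_sq_ne_zero_of_away {u : ℂ} {δ : ℝ} (hδ : 0 < δ) (h1 : δ ≤ dist u Complex.I)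
    (h2 : δ ≤ dist u (-Complex.I)) : 1 + u ^ 2 ≠ 0 := by
  rw [one_add_sq_factor]
  refine mul_ne_zero (fun h => ?_) fun h => ?_
  · rw [sub_eq_zero.mp h, dist_self] at h1; linarith
  · rw [sub_eq_zero.mp h, dist_self] at h2; linarith

theorem dist_I_neg_I : dist Complex.I (-Complex.I) = 2 := by
  rw [dist_eq_norm, sub_neg_eq_add, ← two_mul, norm_mul, Complex.norm_I, Complex.norm_ofNat, mul_one]

/-- At late times the curve avoids every compact set without `±i`, in particular the circles of
radius `1/2` around `±i`. By connectedness it settles in one of the two discs or outside both;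
avoiding smaller and larger compact sets then gives convergence. -/
theorem isLevel_ends {a b : ℂ} (hb : 0 < b.re) {γ : ℝ → ℂ} (hγ : ContinuousOn γ (Ici 0))
    (hl : ∀ t ∈ Ici (0 : ℝ), IsLevel a b t (γ t)) :
    Tendsto γ atTop (Bornology.cobounded ℂ) ∨ Tendsto γ atTop (𝓝 Complex.I) ∨
      Tendsto γ atTop (𝓝 (-Complex.I)) := by
  have hout : ∀ R δ : ℝ, 0 < δ → ∀ᶠ t in atTop,
      ¬(‖γ t‖ ≤ R ∧ δ ≤ dist (γ t) Complex.I ∧ δ ≤ dist (γ t) (-Complex.I)) := fun R δ hδ =>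
    eventually_notMem_of_isLevel hb hl (isCompact_away R δ) fun u hu =>
      one_add_sq_ne_zero_of_away hδ hu.2.1 hu.2.2
  have hnear : ∀ e e' : ℂ, ‖e‖ = 1 → dist e e' = 2 →
      (∀ R δ : ℝ, 0 < δ → ∀ᶠ t in atTop, ¬(‖γ t‖ ≤ R ∧ δ ≤ dist (γ t) e ∧ δ ≤ dist (γ t) e')) →
      (∃ᶠ t in atTop, dist (γ t) e < 1 / 2) → Tendsto γ atTop (𝓝 e) := by
    intro e e' he hee hout hfr
    have hbd : ∀ t, dist (γ t) e ≤ 1 / 2 → ‖γ t‖ ≤ 2 ∧ 1 / 2 < dist (γ t) e' := by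
      intro t ht
      constructor
      · have := norm_sub_norm_le (γ t) e
        rw [he, ← dist_eq_norm] at this
        linarith
      · have := dist_triangle e (γ t) e'
        rw [hee, dist_comm e] at this
        linarith
    obtain ⟨T, hT⟩ := eventually_atTop.mp (hout 2 (1 / 2) (by norm_num))
    obtain ⟨t₀, ht₀, hlt⟩ := frequently_atTop.mp hfr (max T 0)
    have hstay := lt_of_isPreconnected (isPreconnected_Ici (a := max T 0))
      (f := fun t => dist (γ t) e) (c := 1 / 2)
      (continuousOn_dist_const (hγ.mono (Ici_subset_Ici.mpr (le_max_right _ _))) e)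
      (fun t ht h => hT t ((le_max_left _ _).trans ht)
        ⟨(hbd t h.le).1, h.ge, (hbd t h.le).2.le⟩) (x₀ := t₀) ht₀ hlt
    refine Metric.tendsto_nhds.mpr fun δ hδ => ?_
    filter_upwards [hout 2 (min δ (1 / 2)) (lt_min hδ (by norm_num)), eventually_ge_atTop (max T 0)]
      with t h1 h2
    have h3 := hbd t (hstay t h2).le
    by_contra h4
    exact h1 ⟨h3.1, (min_le_left _ _).trans (not_lt.mp h4), (min_le_right _ _).trans h3.2.le⟩
  by_cases h1 : ∃ᶠ t in atTop, dist (γ t) Complex.I < 1 / 2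
  · exact Or.inr (Or.inl (hnear _ (-Complex.I) Complex.norm_I dist_I_neg_I hout h1))
  by_cases h2 : ∃ᶠ t in atTop, dist (γ t) (-Complex.I) < 1 / 2
  · refine Or.inr (Or.inr (hnear _ Complex.I (by rw [norm_neg, Complex.norm_I])
      (by rw [dist_comm, dist_I_neg_I]) (fun R δ hδ => ?_) h2))
    exact (hout R δ hδ).mono fun t ht h => ht ⟨h.1, h.2.2, h.2.1⟩
  · left
    rw [← tendsto_norm_atTop_iff_cobounded, tendsto_atTop]
    intro R
    filter_upwards [hout R (1 / 2) (by norm_num), not_frequently.mp h1, not_frequently.mp h2]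
      with t h3 h4 h5
    by_contra h6
    exact h3 ⟨(not_le.mp h6).le, not_lt.mp h4, not_lt.mp h5⟩

/-! ### Between `ℝ≥0` and `ℝ` -/

theorem isSteepestDescentPath_of_isLevel {θ : ℝ} {q : ℂ} (hq : q ≠ 0) {γ : ℝ → ℂ}
    (hγ : ContinuousOn γ (Ici 0)) (h0 : γ 0 = 0) (hl : ∀ t ∈ Ici (0 : ℝ),
      IsLevel (Complex.exp (θ * Complex.I)) (q * Complex.exp (θ * Complex.I)) t (γ t)) :
    IsSteepestDescentPath θ q fun t : ℝ≥0 => γ t :=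
  (isSteepestDescentPath_iff hq).mpr ⟨hγ.comp_continuous NNReal.continuous_coe fun t => t.2, h0,
    fun t => hl t t.2⟩

theorem tendsto_comp_coe {α : Type*} {γ : ℝ → α} {l : Filter α} (h : Tendsto γ atTop l) :
    Tendsto (fun t : ℝ≥0 => γ t) atTop l :=
  h.comp (NNReal.tendsto_coe_atTop.mpr tendsto_id)

theorem IsSteepestDescentPath.continuous_toNNReal {θ : ℝ} {q : ℂ} {γ : ℝ≥0 → ℂ}
    (h : IsSteepestDescentPath θ q γ) : Continuous fun t : ℝ => γ t.toNNReal :=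
  h.1.comp continuous_real_toNNReal

theorem IsSteepestDescentPath.isLevel {θ : ℝ} {q : ℂ} (hq : q ≠ 0) {γ : ℝ≥0 → ℂ}
    (h : IsSteepestDescentPath θ q γ) {t : ℝ} (ht : 0 ≤ t) :
    IsLevel (Complex.exp (θ * Complex.I)) (q * Complex.exp (θ * Complex.I)) t (γ t.toNNReal) := by
  have := ((isSteepestDescentPath_iff hq).mp h).2.2 t.toNNReal
  rwa [Real.coe_toNNReal t ht] at this

theorem meetsSaddle_iff {a q u : ℂ} (ha : a ≠ 0) :
    a * (1 + u ^ 2) = 2 * (q * a) * u ↔ 1 + u ^ 2 = 2 * q * u := by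
  rw [show 2 * (q * a) * u = a * (2 * q * u) by ring]
  exact mul_right_inj' ha

theorem re_pos_of_abs_arg_lt {b : ℂ} (hb : b ≠ 0) (h : |Complex.arg b| < Real.pi / 2) : 0 < b.re :=
  (Complex.abs_arg_lt_pi_div_two_iff.mp h).resolve_right hb

theorem exists_isSteepestDescentPath {θ : ℝ} {q : ℂ} (hq : q ≠ 0) :
    ∃ γ, IsSteepestDescentPath θ q γ := by
  have ha : Complex.exp (θ * Complex.I) ≠ 0 := Complex.exp_ne_zero _
  obtain ⟨γ, h1, h2, h3⟩ := (isLevel_zero (Complex.exp (θ * Complex.I))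
    (q * Complex.exp (θ * Complex.I))).exists_path ha (mul_ne_zero hq ha)
  exact ⟨_, isSteepestDescentPath_of_isLevel hq h1 h2 h3⟩

theorem IsSteepestDescentPath.ends {θ : ℝ} {q : ℂ} (hq : 0 < (q * Complex.exp (θ * Complex.I)).re)
    {γ : ℝ≥0 → ℂ} (h : IsSteepestDescentPath θ q γ) :
    Tendsto γ atTop (Bornology.cobounded ℂ) ∨ Tendsto γ atTop (𝓝 Complex.I) ∨
      Tendsto γ atTop (𝓝 (-Complex.I)) := by
  have hq0 : q ≠ 0 := left_ne_zero_of_mul (ne_zero_of_re_pos hq)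
  have h1 := isLevel_ends hq h.continuous_toNNReal.continuousOn fun t ht => h.isLevel hq0 ht
  have h2 : ∀ l : Filter ℂ, Tendsto (fun t : ℝ => γ t.toNNReal) atTop l → Tendsto γ atTop l := by
    intro l hl
    refine (tendsto_comp_coe hl).congr fun t => by simp
  exact h1.imp (h2 _) (Or.imp (h2 _) (h2 _))

theorem IsSteepestDescentPath.eq_of_not_meetsSaddle {θ : ℝ} {q : ℂ} (hq : q ≠ 0) {γ γ' : ℝ≥0 → ℂ}
    (h : IsSteepestDescentPath θ q γ) (hs : ¬ MeetsSaddle q γ)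
    (h' : IsSteepestDescentPath θ q γ') : γ' = γ := by
  have ha : Complex.exp (θ * Complex.I) ≠ 0 := Complex.exp_ne_zero _
  obtain ⟨c1, z1, l1⟩ := (isSteepestDescentPath_iff hq).mp h
  obtain ⟨c2, z2, l2⟩ := (isSteepestDescentPath_iff hq).mp h'
  refine (eq_of_isLevel (mul_ne_zero hq ha) NNReal.continuous_coe c1 c2 l1 l2 (fun t ht => ?_)
    (x₀ := 0) (z1.trans z2.symm)).symm
  exact hs ⟨t, (meetsSaddle_iff ha).mp ht⟩

theorem isLevel_conj {a b : ℂ} {t : ℝ} {u : ℂ} (h : IsLevel a b t u) :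
    IsLevel ((starRingEnd ℂ) a) ((starRingEnd ℂ) b) t ((starRingEnd ℂ) u) := by
  rw [IsLevel] at *
  have := congrArg (starRingEnd ℂ) h
  rw [← Complex.exp_conj] at this
  simpa using this

theorem conj_exp_mul_I (θ : ℝ) : (starRingEnd ℂ) (Complex.exp (θ * Complex.I)) =
    Complex.exp (((-θ : ℝ) : ℂ) * Complex.I) := by
  rw [← Complex.exp_conj]
  simp

/-- This symmetry reduces the cases of opposite sign to one another. -/
theorem IsSteepestDescentPath.conj {θ : ℝ} {q : ℂ} (hq : q ≠ 0) {γ : ℝ≥0 → ℂ}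
    (h : IsSteepestDescentPath θ q γ) :
    IsSteepestDescentPath (-θ) ((starRingEnd ℂ) q) fun t => (starRingEnd ℂ) (γ t) := by
  obtain ⟨c1, z1, l1⟩ := (isSteepestDescentPath_iff hq).mp h
  refine (isSteepestDescentPath_iff ((map_ne_zero _).mpr hq)).mpr
    ⟨Complex.continuous_conj.comp c1, by simp [z1], fun t => ?_⟩
  have := isLevel_conj (l1 t)
  rwa [map_mul, conj_exp_mul_I] at this

end Struve

end

noncomputable section

namespace Struve

open MeasureTheory Set

/-! ### Invariant regions -/

/-- If membership in the closed set always improves to membership in the open one, then the preimage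
is open and closed in `I`. The target is a general space because position and logarithm have to be
confined together. -/
theorem invariant_region {X Y : Type*} [TopologicalSpace X] [TopologicalSpace Y] {I : Set X}
    (hI : IsPreconnected I) {f : X → Y} (hf : ContinuousOn f I) {O C : Set Y} (hO : IsOpen O)
    (hC : IsClosed C) (hOC : O ⊆ C) (h : ∀ x ∈ I, f x ∈ C → f x ∈ O) {x₀ : X} (hx₀ : x₀ ∈ I)
    (h0 : f x₀ ∈ O) : ∀ x ∈ I, f x ∈ O := by
  have h1 := (hI.image f hf).subset_left_of_subset_union hO hC.isOpen_compl
    (disjoint_left.mpr fun y hy hy' => hy' (hOC hy)) (by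
      rintro _ ⟨x, hx, rfl⟩
      by_cases hc : f x ∈ C
      · exact Or.inl (h x hx hc)
      · exact Or.inr hc) ⟨f x₀, mem_image_of_mem f hx₀, h0⟩
  exact fun x hx => h1 (mem_image_of_mem f hx)

theorem sqrt_two_lt_pi_div_two : Real.sqrt 2 < Real.pi / 2 := by
  have h1 : Real.sqrt 2 < 1.5 := by
    rw [Real.sqrt_lt' (by norm_num)]; norm_num
  linarith [Real.pi_gt_three]

/-- The function `2y cos y - (2-y²) sin y` vanishes at `0` and has the derivative `y² cos y`;
replacing `y` by a smaller angle `β` only helps. The inequality closes the side `x = 1` of the box.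
-/
theorem sin_mul_lt_mul_cos {y β : ℝ} (hβ : 0 < β) (hβy : β ≤ y) (hy : y ≤ Real.sqrt 2) :
    (2 - y ^ 2) * Real.sin β < 2 * y * Real.cos β := by
  have hπ := sqrt_two_lt_pi_div_two
  have hy2 : 0 ≤ 2 - y ^ 2 := by
    have : y ^ 2 ≤ Real.sqrt 2 ^ 2 := by gcongr; linarith
    rw [Real.sq_sqrt (by norm_num)] at this; linarith
  have hmono : StrictMonoOn (fun y => 2 * y * Real.cos y - (2 - y ^ 2) * Real.sin y)
      (Icc 0 (Real.pi / 2)) := by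
    refine strictMonoOn_of_deriv_pos (convex_Icc _ _) (Continuous.continuousOn (by fun_prop))
      fun x hx => ?_
    rw [interior_Icc] at hx
    have h1 : HasDerivAt (fun y => 2 * y * Real.cos y - (2 - y ^ 2) * Real.sin y)
        (x ^ 2 * Real.cos x) x := by
      have e1 := ((hasDerivAt_id x).const_mul 2).mul (Real.hasDerivAt_cos x)
      have e2 := ((hasDerivAt_pow 2 x).const_sub 2).mul (Real.hasDerivAt_sin x)
      refine (e1.sub e2).congr_deriv ?_
      simp
      ring
    rw [h1.deriv]
    exact mul_pos (pow_pos hx.1 2) (Real.cos_pos_of_mem_Ioo ⟨by linarith [hx.1, Real.pi_pos], hx.2⟩)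
  have h0 := hmono (a := 0) (b := y) ⟨le_rfl, by positivity⟩ ⟨by linarith, by linarith⟩ (by linarith)
  simp only [mul_zero, zero_mul, Real.sin_zero, sub_self] at h0
  have hs : Real.sin β ≤ Real.sin y :=
    Real.sin_le_sin_of_le_of_le_pi_div_two (by linarith) (by linarith) hβy
  have hc : Real.cos y ≤ Real.cos β :=
    Real.cos_le_cos_of_nonneg_of_le_pi hβ.le (by linarith) hβy
  nlinarith

/-- On the boundary of the region `|x| < 1`, `0 < y < √2`, `0 < β`, a curve can only be real. -/
theorem trap_boundary {q₁ q₂ t x y α β : ℝ} (hq₁ : 1 ≤ q₁) (hq₂ : 0 ≤ q₂) (ht : 0 < t)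
    (hx : x = t + q₁ * α - q₂ * β) (hy : y = q₁ * β + q₂ * α)
    (hre : Real.exp α * Real.cos β = 1 + x ^ 2 - y ^ 2) (him : Real.exp α * Real.sin β = 2 * x * y)
    (hx1 : |x| ≤ 1) (hy0 : 0 ≤ y) (hy1 : y ≤ Real.sqrt 2) (hβ0 : 0 ≤ β) :
    (y = 0 ∧ β = 0 ∧ q₂ * α = 0 ∧ Real.exp α = 1 + x ^ 2) ∨
      (0 < y ∧ 0 < β ∧ |x| < 1 ∧ y < Real.sqrt 2) := by
  have hexp : Real.exp α ^ 2 = (1 + x ^ 2 - y ^ 2) ^ 2 + (2 * x * y) ^ 2 := by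
    rw [← hre, ← him]
    linear_combination (-(Real.exp α) ^ 2) * Real.sin_sq_add_cos_sq β
  have hα : 1 ≤ Real.exp α ^ 2 → 0 ≤ α := by
    intro h
    rw [← Real.one_le_exp_iff]
    nlinarith [Real.exp_pos α]
  -- On the real axis `|1+u²| ≥ 1`, so `α ≥ 0`, and all terms of `0 = q₁β + q₂α` are nonnegative;
  -- each must vanish.
  rcases hy0.eq_or_lt with h | hypos
  · left
    subst h
    have h1 : 0 ≤ α := hα (by rw [hexp]; nlinarith [sq_nonneg x, sq_nonneg (x ^ 2)])
    have h2 : 0 ≤ q₂ * α := mul_nonneg hq₂ h1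
    have h3 : 0 ≤ q₁ * β := by positivity
    have h4 : q₁ * β = 0 := by linarith
    have h5 : β = 0 := (mul_eq_zero.mp h4).resolve_left (by linarith)
    refine ⟨rfl, h5, by linarith, ?_⟩
    rw [h5, Real.cos_zero] at hre
    linarith
  right
  have hβpos : 0 < β := by
    rcases hβ0.eq_or_lt with h | h
    · exfalso
      subst h
      rw [Real.sin_zero, mul_zero] at him
      have hx0 : x = 0 := by
        rcases mul_eq_zero.mp him.symm with h | h
        · linarith
        · exact absurd h hypos.ne'
      have hαpos : 0 < α := by
        by_contra h
        nlinarith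
      nlinarith
    · exact h
  refine ⟨hypos, hβpos, ?_⟩
  by_contra hcon
  have hbdry : x = 1 ∨ x = -1 ∨ y = Real.sqrt 2 := by
    by_contra h
    push Not at h
    refine hcon ⟨lt_of_le_of_ne hx1 fun h' => ?_, lt_of_le_of_ne hy1 h.2.2⟩
    rcases abs_eq (by norm_num) |>.mp h' with h'' | h''
    · exact h.1 h''
    · exact h.2.1 h''
  have hsq : Real.sqrt 2 ^ 2 = 2 := Real.sq_sqrt (by norm_num)
  have hα0 : 0 ≤ α := by
    refine hα ?_
    rw [hexp]
    rcases hbdry with h | h | h <;> rw [h]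
    · nlinarith [sq_nonneg (y ^ 2)]
    · nlinarith [sq_nonneg (y ^ 2)]
    · rw [mul_pow, hsq]; nlinarith [sq_nonneg x, sq_nonneg (x ^ 2)]
  -- On the remaining sides `α ≥ 0`, so `β ≤ q₁β ≤ y ≤ √2 < π/2` and both `sin β` and `cos β` are
  -- positive. Each of `x = 1`, `x = -1`, `y = √2` contradicts one of the two equations.
  have hβy : β ≤ y := by nlinarith [mul_nonneg hq₂ hα0]
  have hπ := sqrt_two_lt_pi_div_two
  have hsin : 0 < Real.sin β := Real.sin_pos_of_pos_of_lt_pi hβpos (by linarith)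
  have hcos : 0 < Real.cos β := Real.cos_pos_of_mem_Ioo ⟨by linarith, by linarith⟩
  have he := Real.exp_pos α
  rcases hbdry with h | h | h
  · have := sin_mul_lt_mul_cos hβpos hβy hy1
    rw [h] at hre him
    have h1 : 2 - y ^ 2 = Real.exp α * Real.cos β := by linarith
    have h2 : 2 * y = Real.exp α * Real.sin β := by linarith
    rw [h1, h2] at this
    linarith
  · rw [h] at him
    nlinarith [mul_pos he hsin]
  · rw [h, hsq] at hre
    have : x ^ 2 ≤ 1 := by
      rw [← sq_abs]; nlinarith [abs_nonneg x]
    nlinarith [mul_pos he hcos]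

/-- Real and imaginary parts of the curve equation for `z > 0`. -/
theorem IsLevel.real_eqs {q : ℂ} (hq : q ≠ 0) {t : ℝ} {u : ℂ} (h : IsLevel 1 q t u) :
    u.re = t + q.re * ((u - t) / q).re - q.im * ((u - t) / q).im ∧
    u.im = q.re * ((u - t) / q).im + q.im * ((u - t) / q).re ∧
    Real.exp ((u - t) / q).re * Real.cos ((u - t) / q).im = 1 + u.re ^ 2 - u.im ^ 2 ∧
    Real.exp ((u - t) / q).re * Real.sin ((u - t) / q).im = 2 * u.re * u.im := by
  rw [IsLevel, one_mul] at h
  set L := (u - t) / q with hL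
  have h1 : u = t + q * L := by rw [hL]; field_simp; ring
  have hre := congrArg Complex.re h1
  have him := congrArg Complex.im h1
  have hre2 := congrArg Complex.re h
  have him2 := congrArg Complex.im h
  rw [Complex.exp_re] at hre2
  rw [Complex.exp_im] at him2
  simp [pow_two] at hre him hre2 him2
  refine ⟨by linarith, by linarith, by rw [hre2]; ring, by rw [him2]; ring⟩

theorem isLevel_right_deriv_zero {b : ℂ} (hb : b ≠ 0) {γ : ℝ → ℂ} (hγ : ContinuousOn γ (Ici 0))
    {a : ℂ} (ha : a ≠ 0) (h0 : γ 0 = 0) (hl : ∀ t ∈ Ici (0 : ℝ), IsLevel a b t (γ t)) :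
    Tendsto (fun t : ℝ => γ t / t) (𝓝[>] 0) (𝓝 a⁻¹) := by
  have h := IsLevel.hasDerivAt hb (s := Ici (0 : ℝ)) (mem_Ici.mpr le_rfl) (hγ 0 (mem_Ici.mpr le_rfl)) hl
    (by simpa [h0] using ha)
  have h1 := (hasDerivWithinAt_iff_tendsto_slope.mp h).mono_left
    (nhdsWithin_mono (0 : ℝ) (show Ioi (0 : ℝ) ⊆ Ici 0 \ {0} from fun x hx =>
      ⟨mem_Ici.mpr (le_of_lt (mem_Ioi.mp hx)), ne_of_gt (mem_Ioi.mp hx)⟩))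
  simp only [h0, ne_eq, OfNat.ofNat_ne_zero, not_false_eq_true, zero_pow, add_zero, mul_one, mul_zero,
    sub_zero, one_div] at h1
  refine h1.congr fun t => ?_
  rw [slope_def_module, h0, sub_zero, sub_zero, Complex.real_smul, Complex.ofReal_inv, div_eq_inv_mul]

/-- Entry of the region when `z > 0` and `Im q > 0`. -/
theorem trap_entry {q : ℂ} (hq₁ : 1 ≤ q.re) (hq₂ : 0 < q.im) {γ : ℝ → ℂ}
    (hγ : ContinuousOn γ (Ici 0)) (h0 : γ 0 = 0) (hl : ∀ t ∈ Ici (0 : ℝ), IsLevel 1 q t (γ t)) :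
    ∀ᶠ t in 𝓝[>] 0, 0 < (γ t).im ∧ 0 < ((γ t - t) / q).im ∧ |(γ t).re| < 1 ∧
      (γ t).im < Real.sqrt 2 := by
  have hq : q ≠ 0 := by rintro rfl; simp at hq₂
  have hd := isLevel_right_deriv_zero hq hγ one_ne_zero h0 hl
  rw [inv_one] at hd
  have hre : Tendsto (fun t : ℝ => (γ t / t).re) (𝓝[>] 0) (𝓝 1) :=
    (Complex.continuous_re.tendsto 1).comp hd
  have him : Tendsto (fun t : ℝ => (γ t / t).im) (𝓝[>] 0) (𝓝 0) :=
    (Complex.continuous_im.tendsto 1).comp hd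
  have hγ0 : Tendsto γ (𝓝[>] 0) (𝓝 0) := by
    have := (hγ 0 (mem_Ici.mpr le_rfl)).tendsto.mono_left (nhdsWithin_mono (0 : ℝ) Ioi_subset_Ici_self)
    rwa [h0] at this
  have ht0 : Tendsto (fun t : ℝ => (t : ℂ)) (𝓝[>] 0) (𝓝 0) := by
    have := (Complex.continuous_ofReal.tendsto (0 : ℝ)).mono_left (nhdsWithin_le_nhds (s := Ioi 0))
    rwa [Complex.ofReal_zero] at this
  have hL : Tendsto (fun t : ℝ => ((γ t - t) / q).im) (𝓝[>] 0) (𝓝 0) := by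
    have h1 : Tendsto (fun t : ℝ => (γ t - t) / q) (𝓝[>] 0) (𝓝 ((0 - 0) / q)) :=
      (hγ0.sub ht0).div_const q
    rw [sub_zero, zero_div] at h1
    exact (Complex.continuous_im.tendsto 0).comp h1
  -- The radius `1/(8 Re q)` is chosen to give `q₁|β| ≤ |y|/2` below.
  have hγn : ∀ᶠ t in 𝓝[>] (0 : ℝ), ‖γ t‖ < 1 / (8 * q.re) := by
    have := hγ0.norm
    rw [norm_zero] at this
    exact this.eventually_lt_const (by positivity)
  filter_upwards [hre.eventually_const_lt (show (1 / 2 : ℝ) < 1 by norm_num),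
    him.eventually_lt_const (show (0 : ℝ) < 1 / 2 by norm_num),
    him.eventually_const_lt (show (-(1 / 2) : ℝ) < 0 by norm_num),
    hL.eventually_lt_const (show (0 : ℝ) < 1 by norm_num),
    hL.eventually_const_lt (show (-1 : ℝ) < 0 by norm_num), hγn, self_mem_nhdsWithin]
    with t e1 e2 e3 e4 e5 e6 ht
  have ht' : 0 < t := ht
  obtain ⟨f1, f2, f3, f4⟩ := (hl t ht'.le).real_eqs hq
  rw [Complex.div_ofReal_re, lt_div_iff₀ ht'] at e1
  rw [Complex.div_ofReal_im, div_lt_iff₀ ht'] at e2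
  rw [Complex.div_ofReal_im, lt_div_iff₀ ht'] at e3
  set x := (γ t).re
  set y := (γ t).im
  set α := ((γ t - t) / q).re
  set β := ((γ t - t) / q).im
  have hxn : |x| ≤ ‖γ t‖ := Complex.abs_re_le_norm _
  have hyn : |y| ≤ ‖γ t‖ := Complex.abs_im_le_norm _
  have hsmall : 1 / (8 * q.re) ≤ 1 / 8 := by
    apply one_div_le_one_div_of_le <;> linarith
  have hx0 : 0 < x := by nlinarith
  have hyx : |y| < x := abs_lt.mpr ⟨by linarith, by linarith⟩
  have hxq : 8 * (q.re * x) ≤ 1 := by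
    have h1 : x ≤ 1 / (8 * q.re) := by linarith [le_abs_self x]
    rw [le_div_iff₀ (by positivity)] at h1
    linarith
  have hexp : 1 < Real.exp α := by
    have h1 : Real.exp α * Real.cos β ≤ Real.exp α :=
      mul_le_of_le_one_right (Real.exp_pos _).le (Real.cos_le_one _)
    have h2 : y ^ 2 < x ^ 2 := by rw [← sq_abs y]; gcongr
    linarith
  have hα : 0 < α := Real.one_lt_exp_iff.mp hexp
  have hsinβ : |Real.sin β| ≤ 2 * x * |y| := by
    have h1 : Real.exp α * |Real.sin β| = 2 * x * |y| := by
      rw [← abs_of_pos (Real.exp_pos α), ← abs_mul, f4, abs_mul, abs_of_pos (by positivity : 0 < 2 * x)]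
    nlinarith [abs_nonneg (Real.sin β)]
  have hβ : |β| ≤ 2 * |Real.sin β| := by
    have key : ∀ z : ℝ, 0 ≤ z → z < 1 → z ≤ 2 * Real.sin z := by
      intro z h1 h2
      have := Real.mul_le_sin h1 (by linarith [Real.pi_gt_three])
      have h3 : 1 / 2 ≤ 2 / Real.pi := by
        rw [div_le_div_iff₀ two_pos Real.pi_pos]; linarith [Real.pi_lt_four]
      nlinarith
    rcases le_total 0 β with h | h
    · rw [abs_of_nonneg h]
      exact (key β h e4).trans (by linarith [le_abs_self (Real.sin β)])
    · rw [abs_of_nonpos h]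
      have := key (-β) (by linarith) (by linarith)
      rw [Real.sin_neg] at this
      linarith [neg_abs_le (Real.sin β)]
  have hqβ : q.re * |β| ≤ |y| / 2 := by
    calc q.re * |β| ≤ q.re * (2 * (2 * x * |y|)) := by
          refine mul_le_mul_of_nonneg_left ?_ (by linarith); linarith
      _ = (8 * (q.re * x)) * |y| / 2 := by ring
      _ ≤ |y| / 2 := by nlinarith [abs_nonneg y]
  -- The initial direction is real, so the sign of `y` is a second-order effect: in `y = q₁β + q₂α`
  -- the term `q₂α` is positive and `q₁β` is at most half of `|y|`.
  have hypos : 0 < y := by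
    by_contra h
    have h1 : y ≤ 0 := not_lt.mp h
    rw [abs_of_nonpos h1] at hqβ
    have h2 : -|β| ≤ β := neg_abs_le β
    have h3 := mul_pos hq₂ hα
    nlinarith
  refine ⟨hypos, ?_, ?_, ?_⟩
  · by_contra h
    have h1 : Real.sin β ≤ 0 := Real.sin_nonpos_of_nonpos_of_neg_pi_le (not_lt.mp h)
      (by linarith [Real.pi_gt_three])
    nlinarith [Real.exp_pos α, mul_pos hx0 hypos]
  · linarith
  · have : 1 < Real.sqrt 2 := Real.lt_sqrt_of_sq_lt (by norm_num)
    linarith [le_abs_self y]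

theorem norm_le_of_box {u : ℂ} (h1 : |u.re| < 1) (h2 : |u.im| < Real.sqrt 2) : ‖u‖ ≤ 3 := by
  have h3 := Complex.norm_le_abs_re_add_abs_im u
  have : Real.sqrt 2 < 2 := by rw [Real.sqrt_lt' (by norm_num)]; norm_num
  linarith

/-- The path enters the box and cannot leave it. The real axis is excluded as well: there `Im q > 0`
would give `α = β = 0`, hence both `x = t` and `1+x² = 1`, against `t > 0`. -/
theorem not_cobounded_of_im_pos {q : ℂ} (hq₁ : 1 ≤ q.re) (hq₂ : 0 < q.im) {γ : ℝ → ℂ}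
    (hγ : ContinuousOn γ (Ici 0)) (h0 : γ 0 = 0) (hl : ∀ t ∈ Ici (0 : ℝ), IsLevel 1 q t (γ t)) :
    ¬ Tendsto γ atTop (Bornology.cobounded ℂ) := by
  have hq : q ≠ 0 := by rintro rfl; simp at hq₂
  obtain ⟨t₀, ht₀, ht0⟩ := ((trap_entry hq₁ hq₂ hγ h0 hl).and self_mem_nhdsWithin).exists
  have ht0' : 0 < t₀ := ht0
  let O : Set (ℂ × ℂ) := {p | 0 < p.1.im ∧ 0 < p.2.im ∧ |p.1.re| < 1 ∧ p.1.im < Real.sqrt 2}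
  let C : Set (ℂ × ℂ) := {p | 0 ≤ p.1.im ∧ 0 ≤ p.2.im ∧ |p.1.re| ≤ 1 ∧ p.1.im ≤ Real.sqrt 2}
  have c1 : Continuous fun p : ℂ × ℂ => p.1.im := Complex.continuous_im.comp continuous_fst
  have c2 : Continuous fun p : ℂ × ℂ => p.2.im := Complex.continuous_im.comp continuous_snd
  have c3 : Continuous fun p : ℂ × ℂ => |p.1.re| := (Complex.continuous_re.comp continuous_fst).abs
  have hO : IsOpen O := (isOpen_lt continuous_const c1).and ((isOpen_lt continuous_const c2).and
    ((isOpen_lt c3 continuous_const).and (isOpen_lt c1 continuous_const)))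
  have hC : IsClosed C := (isClosed_le continuous_const c1).and ((isClosed_le continuous_const c2).and
    ((isClosed_le c3 continuous_const).and (isClosed_le c1 continuous_const)))
  have hcont : ContinuousOn (fun t : ℝ => (γ t, (γ t - t) / q)) (Ioi 0) := by
    have := hγ.mono (Ioi_subset_Ici_self (a := (0 : ℝ)))
    refine this.prodMk ((this.sub (by fun_prop)).div_const q)
  have hinv := invariant_region isPreconnected_Ioi hcont hO hC
    (fun p hp => ⟨hp.1.le, hp.2.1.le, hp.2.2.1.le, hp.2.2.2.le⟩) (fun t ht hp => by
      have ht' : 0 < t := ht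
      obtain ⟨f1, f2, f3, f4⟩ := (hl t ht'.le).real_eqs hq
      rcases trap_boundary hq₁ hq₂.le ht' f1 f2 f3 f4 hp.2.2.1 hp.1 hp.2.2.2 hp.2.1 with h | h
      · exfalso
        obtain ⟨g1, g2, g3, g4⟩ := h
        have hα := (mul_eq_zero.mp g3).resolve_left hq₂.ne'
        rw [hα, Real.exp_zero] at g4
        rw [hα, g2] at f1
        have : (γ t).re = 0 := by nlinarith
        linarith
      · exact ⟨h.1, h.2.1, h.2.2.1, h.2.2.2⟩) (x₀ := t₀) ht0' ht₀
  intro hcob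
  have h1 := (tendsto_norm_atTop_iff_cobounded.mpr hcob).eventually_gt_atTop 3
  obtain ⟨t, ht1, ht2⟩ := (h1.and (eventually_gt_atTop 0)).exists
  obtain ⟨g1, g2, g3, g4⟩ := hinv t ht2
  have g1' : 0 < (γ t).im := g1
  have := norm_le_of_box g3 (by rw [abs_of_pos g1']; exact g4)
  linarith

end Struve

end

noncomputable section

namespace Struve

open MeasureTheory Set

/-! ### Real paths -/

/-- The phase on the real axis. -/
def realPhase (q x : ℝ) : ℝ := x - q * Real.log (1 + x ^ 2)

theorem hasDerivAt_realPhase (q x : ℝ) :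
    HasDerivAt (realPhase q) ((1 + x ^ 2 - 2 * q * x) / (1 + x ^ 2)) x := by
  have h1 : HasDerivAt (fun x : ℝ => 1 + x ^ 2) (2 * x) x := by
    simpa using (hasDerivAt_pow 2 x).const_add 1
  have h2 := (hasDerivAt_id x).sub ((h1.log (by positivity)).const_mul q)
  refine h2.congr_deriv ?_
  have : 1 + x ^ 2 ≠ 0 := by positivity
  field_simp

theorem continuous_realPhase (q : ℝ) : Continuous (realPhase q) :=
  continuous_iff_continuousAt.mpr fun x => (hasDerivAt_realPhase q x).continuousAt

theorem realPhase_zero (q : ℝ) : realPhase q 0 = 0 := by simp [realPhase]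

theorem realPhase_le_self {q : ℝ} (hq : 0 ≤ q) (x : ℝ) : realPhase q x ≤ x := by
  have : 0 ≤ Real.log (1 + x ^ 2) := Real.log_nonneg (by nlinarith [sq_nonneg x])
  unfold realPhase
  nlinarith

theorem exp_zero_mul_I : Complex.exp (((0 : ℝ) : ℂ) * Complex.I) = 1 := by simp

theorem isLevel_ofReal_iff {q t x : ℝ} (hq : q ≠ 0) :
    IsLevel 1 q t x ↔ realPhase q x = t := by
  have h0 : (0 : ℝ) < 1 + x ^ 2 := by positivity
  rw [IsLevel, show ((1 : ℂ) * x - t) / q = (((x - t) / q : ℝ) : ℂ) by push_cast; ring,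
    show (1 : ℂ) + (x : ℂ) ^ 2 = ((1 + x ^ 2 : ℝ) : ℂ) by push_cast; rfl, ← Complex.ofReal_exp,
    Complex.ofReal_inj, ← Real.exp_log h0, Real.exp_eq_exp, div_eq_iff hq, realPhase]
  constructor <;> intro h <;> linarith

theorem tendsto_realPhase_atBot {q : ℝ} (hq : 0 ≤ q) : Tendsto (realPhase q) atBot atBot :=
  tendsto_atBot_mono (realPhase_le_self hq) tendsto_id

/-- Beyond `c` the function is prolonged with slope one; the result is an increasing bijection of
the line, and its inverse is continuous as an order isomorphism. -/
theorem exists_continuous_inverse {f : ℝ → ℝ} {c : ℝ} (hf : Continuous f)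
    (hm : StrictMonoOn f (Iic c)) (hbot : Tendsto f atBot atBot) :
    ∃ g : ℝ → ℝ, Continuous g ∧ StrictMono g ∧ ∀ y ≤ f c, g y ≤ c ∧ f (g y) = y := by
  set P : ℝ → ℝ := fun x => f (min x c) + (x - min x c) with hP
  have hPle : ∀ x ≤ c, P x = f x := fun x hx => by simp [hP, min_eq_left hx]
  have hPge : ∀ x, c ≤ x → P x = f c + (x - c) := fun x hx => by simp [hP, min_eq_right hx]
  have hPm : StrictMono P := by
    intro x y hxy
    rcases le_total y c with h | h
    · rw [hPle x (hxy.le.trans h), hPle y h]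
      exact hm (hxy.le.trans h) h hxy
    · rw [hPge y h]
      rcases le_total x c with h' | h'
      · rw [hPle x h']
        rcases h'.lt_or_eq with h1 | h1
        · have := hm h' self_mem_Iic h1
          linarith
        · rw [h1] at hxy ⊢; linarith
      · rw [hPge x h']; linarith
  have hPc : Continuous P := by rw [hP]; fun_prop
  have hPs : Function.Surjective P := by
    refine hPc.surjective ?_ ?_
    · refine (tendsto_atTop_add_const_left atTop (f c - c) tendsto_id).congr' ?_
      filter_upwards [eventually_ge_atTop c] with x hx
      rw [hPge x hx, id]; ring
    · refine hbot.congr' ?_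
      filter_upwards [eventually_le_atBot c] with x hx using (hPle x hx).symm
  set e := StrictMono.orderIsoOfSurjective P hPm hPs
  have he : ∀ y, P (e.symm y) = y := fun y => e.apply_symm_apply y
  refine ⟨e.symm, e.symm.continuous, e.symm.strictMono, fun y hy => ?_⟩
  have h1 : e.symm y ≤ c := by
    rw [← hPle c le_rfl] at hy
    rw [← hPm.le_iff_le, he]; exact hy
  exact ⟨h1, by rw [← hPle _ h1, he]⟩

/-- For `z > 0` and `0 < q < 1` the positive real axis is a path of steepest descent. -/
theorem exists_real_path {q : ℝ} (hq0 : 0 < q) (hq1 : q < 1) :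
    ∃ γ, IsSteepestDescentPath 0 q γ ∧ ¬ MeetsSaddle q γ ∧
      (∀ t, (γ t).im = 0 ∧ 0 ≤ (γ t).re) ∧ Tendsto γ atTop (Bornology.cobounded ℂ) := by
  have hnum : ∀ x : ℝ, 0 < 1 + x ^ 2 - 2 * q * x := fun x => by nlinarith [sq_nonneg (x - q)]
  have hm : StrictMono (realPhase q) := strictMono_of_deriv_pos fun x => by
    rw [(hasDerivAt_realPhase q x).deriv]
    exact div_pos (hnum x) (by positivity)
  have htop : Tendsto (realPhase q) atTop atTop := by
    have h1 : Tendsto (fun x : ℝ => (1 - q) * x) atTop atTop :=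
      tendsto_id.const_mul_atTop (by linarith)
    refine tendsto_atTop_mono' _ ?_ h1
    filter_upwards [eventually_gt_atTop 0] with x hx
    have := log_one_add_sq_lt hx
    unfold realPhase
    nlinarith
  set e := StrictMono.orderIsoOfSurjective _ hm
    ((continuous_realPhase q).surjective htop (tendsto_realPhase_atBot hq0.le))
  have he : ∀ y, realPhase q (e.symm y) = y := fun y => e.apply_symm_apply y
  have he0 : e.symm 0 = 0 := by
    rw [OrderIso.symm_apply_eq]; exact (realPhase_zero q).symm
  have hge : ∀ t, t ≤ e.symm t := fun t => by
    have := realPhase_le_self hq0.le (e.symm t)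
    rwa [he] at this
  have hqc : (q : ℂ) ≠ 0 := by exact_mod_cast hq0.ne'
  refine ⟨fun t : ℝ≥0 => ((e.symm (t : ℝ) : ℝ) : ℂ), isSteepestDescentPath_of_isLevel
    (γ := fun t : ℝ => ((e.symm t : ℝ) : ℂ)) hqc
    (Complex.continuous_ofReal.comp e.symm.continuous).continuousOn (by simp [he0])
    (fun t _ => ?_), ?_, fun t => ⟨Complex.ofReal_im _, ?_⟩, ?_⟩
  · rw [exp_zero_mul_I, mul_one]
    exact (isLevel_ofReal_iff hq0.ne').mpr (he t)
  · rintro ⟨t, ht⟩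
    have h1 : (1 + e.symm (t : ℝ) ^ 2 : ℝ) = 2 * q * e.symm (t : ℝ) := by
      simp only at ht
      exact_mod_cast ht
    linarith [hnum (e.symm (t : ℝ))]
  · rw [Complex.ofReal_re]; exact t.2.trans (hge t)
  · rw [← tendsto_norm_atTop_iff_cobounded]
    refine tendsto_atTop_mono (fun t : ℝ≥0 => ?_) (NNReal.tendsto_coe_atTop.mpr tendsto_id)
    rw [Complex.norm_real]
    exact (hge t).trans (le_abs_self _)

/-- The saddle point on the real axis for `q ≥ 1`. -/
def realSaddle (q : ℝ) : ℝ := q - Real.sqrt (q ^ 2 - 1)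

section realSaddle

variable {q : ℝ}

theorem realSaddle_factor (hq : 1 ≤ q) (x : ℝ) :
    1 + x ^ 2 - 2 * q * x = (x - realSaddle q) * (x - (q + Real.sqrt (q ^ 2 - 1))) := by
  have h : Real.sqrt (q ^ 2 - 1) ^ 2 = q ^ 2 - 1 := Real.sq_sqrt (by nlinarith)
  unfold realSaddle
  linear_combination h

theorem realSaddle_pos (hq : 1 ≤ q) : 0 < realSaddle q := by
  have : Real.sqrt (q ^ 2 - 1) < q := by
    rw [Real.sqrt_lt' (by linarith)]; linarith
  unfold realSaddle
  linarith

theorem realSaddle_le_one (hq : 1 ≤ q) : realSaddle q ≤ 1 := by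
  have : q - 1 ≤ Real.sqrt (q ^ 2 - 1) := by
    apply Real.le_sqrt_of_sq_le; nlinarith
  unfold realSaddle
  linarith

theorem realSaddle_lt_one (hq : 1 < q) : realSaddle q < 1 := by
  have : q - 1 < Real.sqrt (q ^ 2 - 1) := by
    apply Real.lt_sqrt_of_sq_lt; nlinarith
  unfold realSaddle
  linarith

theorem one_le_upper (hq : 1 ≤ q) : 1 ≤ q + Real.sqrt (q ^ 2 - 1) := by
  linarith [Real.sqrt_nonneg (q ^ 2 - 1)]

theorem realPhase_strictMonoOn (hq : 1 ≤ q) : StrictMonoOn (realPhase q) (Iic (realSaddle q)) := by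
  refine strictMonoOn_of_deriv_pos (convex_Iic _) (continuous_realPhase q).continuousOn fun x hx => ?_
  rw [interior_Iic] at hx
  have hx' : x < realSaddle q := hx
  rw [(hasDerivAt_realPhase q x).deriv, realSaddle_factor hq]
  refine div_pos (mul_pos_of_neg_of_neg (by linarith) ?_) (by positivity)
  linarith [realSaddle_le_one hq, one_le_upper hq]

/-- The other real saddle point is at least `1`, so the phase falls between the first one and `1`.
Hence no real point of the box can be passed after the time of the saddle point. -/
theorem realPhase_le_saddle (hq : 1 ≤ q) {x : ℝ} (hx : x ≤ 1) :
    realPhase q x ≤ realPhase q (realSaddle q) := by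
  rcases le_total x (realSaddle q) with h | h
  · exact (realPhase_strictMonoOn hq).monotoneOn h self_mem_Iic h
  · have hanti : AntitoneOn (realPhase q) (Icc (realSaddle q) 1) := by
      refine antitoneOn_of_deriv_nonpos (convex_Icc _ _) (continuous_realPhase q).continuousOn
        (fun x _ => (hasDerivAt_realPhase q x).differentiableAt.differentiableWithinAt) fun x hx => ?_
      rw [interior_Icc] at hx
      rw [(hasDerivAt_realPhase q x).deriv, realSaddle_factor hq]
      refine div_nonpos_of_nonpos_of_nonneg (mul_nonpos_of_nonneg_of_nonpos ?_ ?_) (by positivity)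
      · linarith [hx.1]
      · linarith [hx.2, one_le_upper hq]
    exact hanti ⟨le_rfl, realSaddle_le_one hq⟩ ⟨h, hx⟩ h

theorem realPhase_saddle_pos (hq : 1 ≤ q) : 0 < realPhase q (realSaddle q) := by
  rw [← realPhase_zero q]
  exact realPhase_strictMonoOn hq (realSaddle_pos hq).le self_mem_Iic (realSaddle_pos hq)

/-- The real path from `0` to the saddle point. -/
theorem exists_real_segment (hq : 1 ≤ q) : ∃ g : ℝ → ℝ, Continuous g ∧ StrictMono g ∧ g 0 = 0 ∧
    g (realPhase q (realSaddle q)) = realSaddle q ∧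
    ∀ t ≤ realPhase q (realSaddle q), IsLevel 1 q t (g t) := by
  have hm := realPhase_strictMonoOn hq
  obtain ⟨g, h1, h2, h3⟩ := exists_continuous_inverse (continuous_realPhase q) hm
    (tendsto_realPhase_atBot (by linarith))
  refine ⟨g, h1, h2, ?_, ?_, fun t ht => (isLevel_ofReal_iff (by linarith)).mpr (h3 t ht).2⟩
  · obtain ⟨h4, h5⟩ := h3 0 (realPhase_saddle_pos hq).le
    exact hm.injOn h4 (realSaddle_pos hq).le (h5.trans (realPhase_zero q).symm)
  · obtain ⟨h4, h5⟩ := h3 _ le_rfl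
    exact hm.injOn h4 (le_refl (realSaddle q)) h5

/-- After the time of the saddle point a curve in the box `|x| < 1`, `|y| < √2` stays there and
never meets the real axis again. -/
theorem real_trap (hq : 1 ≤ q) {γ : ℝ → ℂ} {T : ℝ} (hT : realPhase q (realSaddle q) ≤ T)
    (hγ : ContinuousOn γ (Ioi T)) (hl : ∀ t ∈ Ioi T, IsLevel 1 q t (γ t)) {t₀ : ℝ} (ht₀ : T < t₀)
    (h1 : |(γ t₀).re| < 1) (h2 : |(γ t₀).im| < Real.sqrt 2) :
    ∀ t ∈ Ioi T, |(γ t).re| < 1 ∧ |(γ t).im| < Real.sqrt 2 ∧ (γ t).im ≠ 0 := by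
  have hq0 : q ≠ 0 := by linarith
  have hqc : (q : ℂ) ≠ 0 := by exact_mod_cast hq0
  have hTpos : 0 < T := (realPhase_saddle_pos hq).trans_le hT
  -- the boundary analysis, first for `0 ≤ y`
  have key : ∀ (t : ℝ) (u : ℂ), T < t → IsLevel 1 q t u → |u.re| ≤ 1 → |u.im| ≤ Real.sqrt 2 →
      0 ≤ u.im → |u.re| < 1 ∧ |u.im| < Real.sqrt 2 ∧ u.im ≠ 0 := by
    intro t u ht hu hx hy hy0
    obtain ⟨f1, f2, f3, f4⟩ := hu.real_eqs hqc
    rw [Complex.ofReal_re, Complex.ofReal_im] at f1 f2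
    rw [abs_of_nonneg hy0] at hy ⊢
    -- For real `q` the imaginary part of the curve equation is `y = qβ`, so the sign of `β` need
    -- not be traced along the path.
    have hβ : 0 ≤ ((u - t) / q).im := by
      have : 0 ≤ q * ((u - t) / q).im := by linarith
      exact nonneg_of_mul_nonneg_right this (by linarith)
    rcases trap_boundary hq le_rfl (hTpos.trans ht) f1 f2 f3 f4 hx hy0 hy hβ with h | h
    · exfalso
      have hur : u = (u.re : ℂ) := by
        apply Complex.ext <;> simp [h.1]
      rw [hur, isLevel_ofReal_iff hq0] at hu
      have := realPhase_le_saddle hq ((le_abs_self _).trans hx)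
      linarith
    · exact ⟨h.2.2.1, h.2.2.2, h.1.ne'⟩
  have key' : ∀ (t : ℝ) (u : ℂ), T < t → IsLevel 1 q t u → |u.re| ≤ 1 → |u.im| ≤ Real.sqrt 2 →
      |u.re| < 1 ∧ |u.im| < Real.sqrt 2 ∧ u.im ≠ 0 := by
    intro t u ht hu hx hy
    rcases le_total 0 u.im with h | h
    · exact key t u ht hu hx hy h
    · have hc := isLevel_conj hu
      rw [map_one, Complex.conj_ofReal] at hc
      have := key t _ ht hc (by simpa using hx) (by simpa using hy) (by simpa using h)
      simpa using this
  have c1 : Continuous fun u : ℂ => |u.re| := Complex.continuous_re.abs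
  have c2 : Continuous fun u : ℂ => |u.im| := Complex.continuous_im.abs
  have hinv := invariant_region isPreconnected_Ioi hγ
    (O := {u | |u.re| < 1 ∧ |u.im| < Real.sqrt 2}) (C := {u | |u.re| ≤ 1 ∧ |u.im| ≤ Real.sqrt 2})
    ((isOpen_lt c1 continuous_const).and (isOpen_lt c2 continuous_const))
    ((isClosed_le c1 continuous_const).and (isClosed_le c2 continuous_const))
    (fun u hu => ⟨hu.1.le, hu.2.le⟩) (fun t ht hu => by
      have := key' t _ ht (hl t ht) hu.1 hu.2
      exact ⟨this.1, this.2.1⟩) (x₀ := t₀) ht₀ ⟨h1, h2⟩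
  intro t ht
  obtain ⟨h3, h4⟩ := hinv t ht
  exact key' t _ ht (hl t ht) h3.le h4.le

/-- Up to the saddle point the path is the real one by uniqueness. For `q > 1` the saddle point has
`x < 1`, inside the box, so any branch leaving it starts in the box and is confined by `real_trap`.
For `q = 1` the saddle point would lie on the boundary. -/
theorem not_cobounded_of_real (hq : 1 < q) {γ : ℝ → ℂ} (hγ : ContinuousOn γ (Ici 0)) (h0 : γ 0 = 0)
    (hl : ∀ t ∈ Ici (0 : ℝ), IsLevel 1 q t (γ t)) : ¬ Tendsto γ atTop (Bornology.cobounded ℂ) := by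
  have hqc : (q : ℂ) ≠ 0 := by
    have : q ≠ 0 := by linarith
    exact_mod_cast this
  obtain ⟨g, g1, g2, g3, g4, g5⟩ := exists_real_segment hq.le
  set T := realPhase q (realSaddle q) with hT
  have hTpos : 0 < T := realPhase_saddle_pos hq.le
  have : PreconnectedSpace (Ico 0 T) := isPreconnected_iff_preconnectedSpace.mp isPreconnected_Ico
  have heq : (fun t : Ico 0 T => ((g t : ℝ) : ℂ)) = fun t : Ico 0 T => γ t := by
    refine eq_of_isLevel (τ := fun t : Ico 0 T => (t : ℝ)) (a := 1) (b := q) hqc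
      continuous_subtype_val
      (by fun_prop) (hγ.comp_continuous continuous_subtype_val fun t => t.2.1) (fun t => g5 _ t.2.2.le)
      (fun t => hl _ t.2.1) (fun t ht => ?_) (x₀ := ⟨0, le_rfl, hTpos⟩) (by simp [g3, h0])
    have h1 : g t < realSaddle q := by
      rw [← g4]; exact g2 t.2.2
    have h2 : (1 + g t ^ 2 : ℝ) - 2 * q * g t = 0 := by
      rw [one_mul] at ht
      have : (1 + g t ^ 2 : ℝ) = 2 * q * g t := by exact_mod_cast ht
      linarith
    rw [realSaddle_factor hq.le] at h2
    rcases mul_eq_zero.mp h2 with h3 | h3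
    · linarith
    · linarith [realSaddle_le_one hq.le, one_le_upper hq.le]
  have heq' : ∀ t ∈ Ico 0 T, γ t = g t := fun t ht => (congrFun heq ⟨t, ht⟩).symm
  have hγT : γ T = realSaddle q := by
    have h1 : Tendsto γ (𝓝[<] T) (𝓝 (γ T)) := by
      have hw := hγ T hTpos.le
      refine (hw.mono (fun x hx => hx.1 : Ico 0 T ⊆ Ici 0)).tendsto.mono_left ?_
      rw [nhdsWithin_Ico_eq_nhdsLT hTpos]
    have h2 : Tendsto (fun t => (g t : ℂ)) (𝓝[<] T) (𝓝 (g T)) :=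
      ((Complex.continuous_ofReal.comp g1).tendsto T).mono_left nhdsWithin_le_nhds
    rw [g4] at h2
    refine tendsto_nhds_unique_of_eventuallyEq h1 h2 ?_
    filter_upwards [Ioo_mem_nhdsLT hTpos] with t ht using heq' t ⟨ht.1.le, ht.2⟩
  have hγ' := hγ.mono (Ioi_subset_Ici hTpos.le)
  have hl' : ∀ t ∈ Ioi T, IsLevel 1 q t (γ t) := fun t ht => hl t (hTpos.le.trans (le_of_lt ht))
  have hTc : ContinuousWithinAt γ (Ioi T) T :=
    (hγ T hTpos.le).mono (Ioi_subset_Ici hTpos.le)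
  have e1 : ∀ᶠ t in 𝓝[>] T, |(γ t).re| < 1 := by
    refine ((Complex.continuous_re.abs.tendsto _).comp hTc).eventually_lt_const ?_
    rw [hγT, Complex.ofReal_re, abs_of_pos (realSaddle_pos hq.le)]
    exact realSaddle_lt_one hq
  have e2 : ∀ᶠ t in 𝓝[>] T, |(γ t).im| < Real.sqrt 2 := by
    refine ((Complex.continuous_im.abs.tendsto _).comp hTc).eventually_lt_const ?_
    rw [hγT, Complex.ofReal_im, abs_zero]
    positivity
  obtain ⟨t₀, ⟨h1, h2⟩, ht₀⟩ := ((e1.and e2).and self_mem_nhdsWithin).exists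
  have htrap := real_trap hq.le le_rfl hγ' hl' ht₀ h1 h2
  intro hcob
  have h3 := (tendsto_norm_atTop_iff_cobounded.mpr hcob).eventually_gt_atTop 3
  obtain ⟨t, ht1, ht2⟩ := (h3.and (eventually_gt_atTop T)).exists
  obtain ⟨h4, h5, -⟩ := htrap t ht2
  linarith [norm_le_of_box h4 h5]

/-- For `z > 0` a path of steepest descent to infinity requires `Re q ≤ 1`. -/
theorem IsSteepestDescentPath.re_le_one {q : ℂ} (hq : q ≠ 0) {γ : ℝ≥0 → ℂ}
    (h : IsSteepestDescentPath 0 q γ) (hγ : Tendsto γ atTop (Bornology.cobounded ℂ)) : q.re ≤ 1 := by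
  by_contra hre
  push Not at hre
  have hlev : ∀ (q : ℂ), q ≠ 0 → ∀ γ : ℝ≥0 → ℂ, IsSteepestDescentPath 0 q γ →
      ∀ t ∈ Ici (0 : ℝ), IsLevel 1 q t (γ t.toNNReal) := fun q hq γ h t ht => by
    have := h.isLevel hq ht
    rwa [exp_zero_mul_I, mul_one] at this
  have hcob : ∀ γ : ℝ≥0 → ℂ, Tendsto γ atTop (Bornology.cobounded ℂ) →
      Tendsto (fun t : ℝ => γ t.toNNReal) atTop (Bornology.cobounded ℂ) := fun γ h =>
    h.comp tendsto_real_toNNReal_atTop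
  rcases lt_trichotomy q.im 0 with him | him | him
  · have hc := h.conj hq
    rw [neg_zero] at hc
    refine not_cobounded_of_im_pos (q := (starRingEnd ℂ) q) (by simpa using hre.le) (by simpa using him)
      hc.continuous_toNNReal.continuousOn (by simp [h.2.1])
      (hlev _ ((map_ne_zero _).mpr hq) _ hc) (hcob (fun t => (starRingEnd ℂ) (γ t)) ?_)
    rw [← tendsto_norm_atTop_iff_cobounded] at hγ ⊢
    simpa using hγ
  · have hqr : q = (q.re : ℂ) := by apply Complex.ext <;> simp [him]
    refine not_cobounded_of_real hre h.continuous_toNNReal.continuousOn (by simp [h.2.1]) ?_ (hcob _ hγ)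
    have := hlev q hq γ h
    rwa [hqr] at this
  · exact not_cobounded_of_im_pos hre.le him h.continuous_toNNReal.continuousOn (by simp [h.2.1])
      (hlev q hq γ h) (hcob _ hγ)

/-- The branch at the real saddle point that enters the upper half-plane. -/
theorem exists_upper_branch (hq : 1 ≤ q) :
    ∃ ε > 0, ∃ γ : ℝ → ℂ,
      ContinuousOn γ (Icc (realPhase q (realSaddle q)) (realPhase q (realSaddle q) + ε)) ∧
      γ (realPhase q (realSaddle q)) = realSaddle q ∧
      (∀ x ∈ Icc (realPhase q (realSaddle q)) (realPhase q (realSaddle q) + ε),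
        IsLevel 1 q x (γ x)) ∧
      ∀ᶠ x in 𝓝[>] (realPhase q (realSaddle q)), 0 < (γ x).im ∧ |(γ x).re| < 1 := by
  have hqc : (q : ℂ) ≠ 0 := by
    have : q ≠ 0 := by linarith
    exact_mod_cast this
  set xs := realSaddle q with hxs
  set T := realPhase q xs with hT
  set xl := q + Real.sqrt (q ^ 2 - 1) with hxl
  have hlev : IsLevel 1 q T xs := (isLevel_ofReal_iff (by linarith)).mpr rfl
  have hfac : ∀ u : ℂ, 1 * (1 + u ^ 2) - 2 * q * u = (u - xs) * (u - xl) := by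
    have hsum : xs + xl = 2 * q := by rw [hxs, hxl, realSaddle]; ring
    have hprod : xs * xl = 1 := by
      have h := realSaddle_factor hq 0
      rw [← hxs, ← hxl] at h
      linarith
    intro u
    have h1 : (xs : ℂ) + xl = 2 * q := by exact_mod_cast hsum
    have h2 : (xs : ℂ) * xl = 1 := by exact_mod_cast hprod
    linear_combination u * h1 - h2
  -- a direction in the upper half-plane
  obtain ⟨N, m, κ, hm, hm0, hd, hκ, hκi, hκr⟩ : ∃ (N : ℕ) (m : ℂ → ℂ) (κ : ℂ), ContinuousAt m xs ∧
      m xs ≠ 0 ∧ (∀ u : ℂ, 1 * (1 + u ^ 2) - 2 * q * u = (u - xs) ^ N * m u) ∧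
      κ ^ (N + 1) * m xs = (N + 1) * (1 + (xs : ℂ) ^ 2) ∧ 0 < κ.im ∧ (xs = 1 → κ.re < 0) := by
    -- For `q = 1` the saddle point is double and lies at `1`, with `κ³ = 6`; the root of argument
    -- `2π/3` points up and to the left, into the box. For `q > 1` the value `m(xs) = xs - xl` is
    -- negative and `κ` is purely imaginary.
    rcases hq.eq_or_lt with h1 | h1
    · have hs0 : Real.sqrt (q ^ 2 - 1) = 0 := by rw [← h1]; simp
      have hx1 : xs = 1 := by rw [hxs, realSaddle, hs0, ← h1]; ring
      have hl1 : xl = 1 := by rw [hxl, hs0, ← h1]; ring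
      obtain ⟨c, hc0, hc⟩ : ∃ c : ℝ, 0 < c ∧ c ^ 3 = 6 :=
        ⟨6 ^ (((3 : ℕ) : ℝ)⁻¹), by positivity, Real.rpow_inv_natCast_pow (by norm_num) (by norm_num)⟩
      have hs3 : Real.sqrt 3 ^ 2 = 3 := Real.sq_sqrt (by norm_num)
      have hs3' : (Real.sqrt 3 : ℂ) ^ 2 = 3 := by exact_mod_cast hs3
      have hc' : (c : ℂ) ^ 3 = 6 := by exact_mod_cast hc
      refine ⟨2, fun _ => 1, ((c * (-1 / 2) : ℝ) : ℂ) + ((c * (Real.sqrt 3 / 2) : ℝ) : ℂ) * Complex.I,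
        continuousAt_const, one_ne_zero, fun u => ?_, ?_, ?_, fun _ => ?_⟩
      · rw [hfac, hx1, hl1]; push_cast; ring
      · rw [hx1]
        push_cast
        have hI3 : Complex.I ^ 3 = -Complex.I := by rw [pow_succ, Complex.I_sq]; ring
        have hs3c : (Real.sqrt 3 : ℂ) ^ 3 = 3 * (Real.sqrt 3 : ℂ) := by rw [pow_succ, hs3']
        ring_nf
        rw [hI3, Complex.I_sq, hs3c, hs3', hc']
        ring
      · rw [Complex.add_im, Complex.ofReal_im, Complex.im_ofReal_mul, Complex.I_im]
        positivity
      · rw [Complex.add_re, Complex.ofReal_re, Complex.re_ofReal_mul, Complex.I_re]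
        linarith
    · have hlt : xs < xl := lt_of_lt_of_le (realSaddle_lt_one h1) (one_le_upper hq)
      set c := Real.sqrt (2 * (1 + xs ^ 2) / (xl - xs)) with hc
      have hpos : 0 < 2 * (1 + xs ^ 2) / (xl - xs) := div_pos (by positivity) (by linarith)
      have hc2 : c ^ 2 * (xl - xs) = 2 * (1 + xs ^ 2) := by
        rw [hc, Real.sq_sqrt hpos.le, div_mul_cancel₀]
        linarith
      have hc2' : (c : ℂ) ^ 2 * (xl - xs) = 2 * (1 + xs ^ 2) := by exact_mod_cast hc2
      refine ⟨1, fun u => u - xl, c * Complex.I, by fun_prop, ?_, fun u => ?_, ?_, ?_, fun h => ?_⟩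
      · rw [sub_ne_zero]
        exact_mod_cast hlt.ne
      · rw [hfac, pow_one]
      · push_cast
        linear_combination hc2' + (xs - xl) * c ^ 2 * Complex.I_sq
      · rw [Complex.im_ofReal_mul, Complex.I_im, mul_one]
        exact Real.sqrt_pos.mpr hpos
      · exact absurd h (realSaddle_lt_one h1).ne
  obtain ⟨ε, hε, γ, h1, h2, h3, w, h4, h5⟩ := hlev.exists_branch_path hqc hm hm0 hd hκ
  refine ⟨ε, hε, γ, h1, h2, h3, ?_⟩
  have him : ∀ᶠ x in 𝓝[>] T, 0 < ((γ x - xs) / w x).im :=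
    ((Complex.continuous_im.tendsto _).comp h5).eventually_const_lt hκi
  have hre : ∀ᶠ x in 𝓝[>] T, (γ x).re < 1 := by
    rcases (realSaddle_le_one hq).lt_or_eq with hlt | heq
    · have hc : ContinuousWithinAt γ (Icc T (T + ε)) T := h1 T ⟨le_rfl, by linarith⟩
      have hc' : Tendsto γ (𝓝[>] T) (𝓝 (γ T)) :=
        hc.tendsto.mono_left (nhdsWithin_le_of_mem
          (mem_of_superset (Ioo_mem_nhdsGT (show T < T + ε by linarith)) Ioo_subset_Icc_self))
      refine ((Complex.continuous_re.tendsto _).comp hc').eventually_lt_const ?_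
      rw [h2, Complex.ofReal_re]; exact hlt
    · have hneg : ∀ᶠ x in 𝓝[>] T, ((γ x - xs) / w x).re < 0 :=
        ((Complex.continuous_re.tendsto _).comp h5).eventually_lt_const (hκr heq)
      filter_upwards [hneg, self_mem_nhdsWithin] with x hx hxT
      rw [Complex.div_ofReal_re, div_neg_iff] at hx
      have := h4 x hxT
      rcases hx with hx | hx
      · linarith [hx.2]
      · rw [Complex.sub_re, Complex.ofReal_re] at hx
        have h6 : xs = 1 := heq
        linarith [hx.1]
  have hre' : ∀ᶠ x in 𝓝[>] T, -1 < (γ x).re := by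
    have hc : ContinuousWithinAt γ (Icc T (T + ε)) T := h1 T ⟨le_rfl, by linarith⟩
    have hc' : Tendsto γ (𝓝[>] T) (𝓝 (γ T)) :=
      hc.tendsto.mono_left (nhdsWithin_le_of_mem
        (mem_of_superset (Ioo_mem_nhdsGT (show T < T + ε by linarith)) Ioo_subset_Icc_self))
    refine ((Complex.continuous_re.tendsto _).comp hc').eventually_const_lt ?_
    rw [h2, Complex.ofReal_re]
    linarith [realSaddle_pos hq]
  filter_upwards [him, hre, hre', self_mem_nhdsWithin] with x e1 e2 e3 e4
  refine ⟨?_, abs_lt.mpr ⟨e3, e2⟩⟩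
  rw [Complex.div_ofReal_im, Complex.sub_im, Complex.ofReal_im, sub_zero] at e1
  exact (div_pos_iff_of_pos_right (h4 x e4)).mp e1

/-- For `z > 0` and `q ≥ 1` there are paths of steepest descent from `0` along the real axis to the
saddle point and from there to `±i`. -/
theorem exists_path_to_I (hq : 1 ≤ q) {ε : ℝ} (hε : ε = 1 ∨ ε = -1) :
    ∃ γ, IsSteepestDescentPath 0 q γ ∧
      (∃ t₀, (∀ t ≤ t₀, (γ t).im = 0) ∧ γ t₀ = ((q - Real.sqrt (q ^ 2 - 1) : ℝ) : ℂ)) ∧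
      Tendsto γ atTop (𝓝 (ε * Complex.I)) := by
  have hqc : (q : ℂ) ≠ 0 := by
    have : q ≠ 0 := by linarith
    exact_mod_cast this
  suffices h : ∃ γ, IsSteepestDescentPath 0 q γ ∧
      (∃ t₀, (∀ t ≤ t₀, (γ t).im = 0) ∧ γ t₀ = ((q - Real.sqrt (q ^ 2 - 1) : ℝ) : ℂ)) ∧
      Tendsto γ atTop (𝓝 Complex.I) by
    rcases hε with rfl | rfl
    · simpa using h
    · obtain ⟨γ, h1, ⟨t₀, h2, h3⟩, h4⟩ := h
      refine ⟨fun t => (starRingEnd ℂ) (γ t), ?_, ⟨t₀, fun t ht => ?_, ?_⟩, ?_⟩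
      · have := h1.conj hqc
        rwa [neg_zero, Complex.conj_ofReal] at this
      · simp [h2 t ht]
      · simp only [h3, Complex.conj_ofReal]
      · have := (Complex.continuous_conj.tendsto _).comp h4
        rw [Complex.conj_I] at this
        rw [show (((-1 : ℝ) : ℂ) * Complex.I) = -Complex.I by simp]
        exact this
  obtain ⟨g, g1, g2, g3, g4, g5⟩ := exists_real_segment hq
  obtain ⟨δ, hδ, β, b1, b2, b3, b4⟩ := exists_upper_branch hq
  set T := realPhase q (realSaddle q) with hT
  have hTpos : 0 < T := realPhase_saddle_pos hq
  have hglue : ContinuousOn (fun x : ℝ => if x ≤ T then (g x : ℂ) else β x) (Icc 0 (T + δ)) := by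
    rw [← Icc_union_Icc_eq_Icc hTpos.le (by linarith : T ≤ T + δ)]
    exact continuousOn_glue isClosed_Icc isClosed_Icc (fun x hx => hx.2) (fun x hx => hx.1)
      (Complex.continuous_ofReal.comp g1).continuousOn b1 (by rw [g4, b2])
  obtain ⟨γ, c1, c2, c3⟩ := exists_path_extending (a := 1) (b := q) one_ne_zero hqc
    (show (0 : ℝ) ≤ T + δ by linarith) hglue (fun x hx => by
      split_ifs with h
      · exact g5 x h
      · exact b3 x ⟨(not_le.mp h).le, hx.2⟩)
  have hγg : ∀ x ≤ T, γ x = g x := fun x hx => by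
    rw [c3 x (by linarith), if_pos hx]
  have hSD : IsSteepestDescentPath 0 q fun t : ℝ≥0 => γ t :=
    isSteepestDescentPath_of_isLevel hqc c1 (by rw [hγg 0 hTpos.le, g3, Complex.ofReal_zero])
      (by rw [exp_zero_mul_I, mul_one]; exact c2)
  -- the path is trapped in the upper half of the box
  have hev : ∀ᶠ x in 𝓝[>] T, 0 < (γ x).im ∧ |(γ x).re| < 1 := by
    filter_upwards [b4, Ioo_mem_nhdsGT (show T < T + δ by linarith)] with x h1 h2
    rw [c3 x h2.2.le, if_neg (not_le.mpr h2.1)]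
    exact h1
  have him : ∀ᶠ x in 𝓝[>] T, |(γ x).im| < Real.sqrt 2 := by
    have hw : ContinuousWithinAt γ (Ioi T) T := (c1 T hTpos.le).mono (Ioi_subset_Ici hTpos.le)
    refine ((Complex.continuous_im.abs.tendsto _).comp hw).eventually_lt_const ?_
    rw [hγg T le_rfl, Complex.ofReal_im, abs_zero]
    positivity
  obtain ⟨t₀, ⟨⟨h1, h2⟩, h3⟩, ht₀⟩ := ((hev.and him).and self_mem_nhdsWithin).exists
  have htrap := real_trap hq le_rfl (c1.mono (Ioi_subset_Ici hTpos.le))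
    (fun t ht => c2 t (hTpos.le.trans (le_of_lt ht))) ht₀ h2 h3
  have hpos : ∀ t ∈ Ioi T, 0 < (γ t).im := by
    have := lt_of_isPreconnected (isPreconnected_Ioi (a := T)) (f := fun t => -(γ t).im) (c := 0)
      (Complex.continuous_im.comp_continuousOn (c1.mono (Ioi_subset_Ici hTpos.le))).neg
      (fun t ht h => (htrap t ht).2.2 (neg_eq_zero.mp h)) (x₀ := t₀) ht₀ (by linarith)
    exact fun t ht => by linarith [this t ht]
  refine ⟨_, hSD, ⟨⟨T, hTpos.le⟩, fun t ht => ?_, ?_⟩, ?_⟩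
  · rw [hγg t ht, Complex.ofReal_im]
  · change γ T = _
    rw [hγg T le_rfl, g4, realSaddle]
  · refine tendsto_comp_coe ?_
    -- The box is bounded, which excludes `∞`, and the path stays in the upper half-plane, which
    -- excludes `-i`.
    rcases isLevel_ends (by simpa using (by linarith : 0 < q)) c1 c2 with h | h | h
    · exfalso
      have h4 := (tendsto_norm_atTop_iff_cobounded.mpr h).eventually_gt_atTop 3
      obtain ⟨t, ht1, ht2⟩ := (h4.and (eventually_gt_atTop T)).exists
      linarith [norm_le_of_box (htrap t ht2).1 (htrap t ht2).2.1]
    · exact h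
    · exfalso
      have h4 : Tendsto (fun t => (γ t).im) atTop (𝓝 (-Complex.I).im) :=
        (Complex.continuous_im.tendsto _).comp h
      have h5 : ∀ᶠ t in atTop, (γ t).im < 0 := h4.eventually_lt_const (by simp)
      obtain ⟨t, ht1, ht2⟩ := (h5.and (eventually_gt_atTop T)).exists
      linarith [hpos t ht2]

end realSaddle

end Struve

end

noncomputable section

namespace Struve

open MeasureTheory Set

/-! ### The phase on a ray and on the unit circle -/

/-- `Im (e^{-iθ} (u - q log (1+u²)))`, which vanishes on the path of steepest descent. -/
def phaseIm (θ : ℝ) (q : ℂ) (u : ℂ) : ℝ := (Complex.exp (((-θ : ℝ) : ℂ) * Complex.I) * phase q u).im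

/-- The numerator of the derivative of `phaseIm` along the ray through the saddle point `e^{iφ}`. -/
def rayNum (θ φ ρ : ℝ) : ℝ :=
  Real.sin (φ - θ) * (1 - ρ ^ 3) - ρ * Real.sin (3 * φ - θ) - ρ ^ 2 * Real.sin (φ + θ)

theorem ray_mem_slitPlane {φ ρ : ℝ} (hφ0 : 0 < φ) (hφ : φ < Real.pi / 2) (hρ : 0 ≤ ρ) :
    1 + (ρ * Complex.exp (φ * Complex.I)) ^ 2 ∈ Complex.slitPlane := by
  rcases hρ.eq_or_lt with rfl | h
  · simp
  · right
    have : (1 + (ρ * Complex.exp (φ * Complex.I)) ^ 2).im = ρ ^ 2 * Real.sin (2 * φ) := by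
      rw [mul_pow, ← Complex.exp_nat_mul, Complex.add_im, Complex.one_im, ← Complex.ofReal_pow,
        Complex.im_ofReal_mul, show ((2 : ℕ) : ℂ) * (φ * Complex.I) = ((2 * φ : ℝ) : ℂ) * Complex.I by
          push_cast; ring, Complex.exp_ofReal_mul_I_im, zero_add]
    rw [this]
    have := Real.sin_pos_of_pos_of_lt_pi (x := 2 * φ) (by linarith) (by linarith)
    positivity

/-- With `E = e^{iφ}` and `2q = E + E⁻¹`, the saddle numerator at `ρE` factors as `(1-ρ)(1-ρE²)`.
Multiplication by the conjugate of `1+u²` makes the denominator real, and the imaginary part is a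
trigonometric cubic in `ρ`. -/
theorem hasDerivAt_phaseIm_ray {θ φ ρ : ℝ} (hφ0 : 0 < φ) (hφ : φ < Real.pi / 2) (hρ : 0 ≤ ρ) :
    HasDerivAt (fun ρ : ℝ => phaseIm θ (Real.cos φ) (ρ * Complex.exp (φ * Complex.I)))
      ((1 - ρ) * rayNum θ φ ρ / Complex.normSq (1 + (ρ * Complex.exp (φ * Complex.I)) ^ 2)) ρ := by
  have hs := ray_mem_slitPlane hφ0 hφ hρ
  have hW := Complex.slitPlane_ne_zero hs
  set E := Complex.exp (φ * Complex.I) with hE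
  set a := Complex.exp (((-θ : ℝ) : ℂ) * Complex.I) with ha
  set W := 1 + ((ρ : ℂ) * E) ^ 2 with hWdef
  have h0 : HasDerivAt (fun x : ℝ => (x : ℂ) * E) E ρ := by
    simpa using (Complex.ofRealCLM.hasDerivAt (x := ρ)).mul_const E
  have h1 := ((hasDerivAt_phase (q := (Real.cos φ : ℂ)) hs).comp ρ h0).const_mul a
  have h2 := Complex.imCLM.hasFDerivAt.comp_hasDerivAt ρ h1
  refine h2.congr_deriv ?_
  simp only [Complex.imCLM_apply]
  set E' := Complex.exp (((-φ : ℝ) : ℂ) * Complex.I) with hE'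
  have hEE : E * E' = 1 := by
    rw [hE, hE', ← Complex.exp_add]; simp
  have hcos : (Real.cos φ : ℂ) = (E + E') / 2 := by
    rw [Complex.ofReal_cos, Complex.cos, hE, hE']
    push_cast
    rfl
  have hconj : (starRingEnd ℂ) W = 1 + ρ ^ 2 * E' ^ 2 := by
    rw [hWdef, map_add, map_one, map_pow, map_mul, Complex.conj_ofReal, hE, conj_exp_mul_I, mul_pow]
  have hexp : ∀ x : ℝ, ∀ z : ℂ, z = (x : ℂ) * Complex.I → (Complex.exp z).im = Real.sin x := by
    rintro x z rfl; exact Complex.exp_ofReal_mul_I_im x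
  have i1 : (a * E).im = Real.sin (φ - θ) := by
    rw [ha, hE, ← Complex.exp_add]
    exact hexp _ _ (by push_cast; ring)
  have i2 : (a * E ^ 3).im = Real.sin (3 * φ - θ) := by
    rw [ha, hE, ← Complex.exp_nat_mul, ← Complex.exp_add]
    exact hexp _ _ (by push_cast; ring)
  have i3 : (a * E').im = -Real.sin (φ + θ) := by
    rw [ha, hE', ← Complex.exp_add, ← Real.sin_neg]
    exact hexp _ _ (by push_cast; ring)
  have key : a * ((1 - (Real.cos φ : ℂ) * (2 * (ρ * E) / W)) * E) =
      (((1 - ρ) / Complex.normSq W : ℝ) : ℂ) * (((1 - ρ ^ 3 : ℝ) : ℂ) * (a * E) -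
        (ρ : ℂ) * (a * E ^ 3) + ((ρ ^ 2 : ℝ) : ℂ) * (a * E')) := by
    have e1 : a * ((1 - (Real.cos φ : ℂ) * (2 * (ρ * E) / W)) * E) =
        a * E * (W - 2 * Real.cos φ * (ρ * E)) * W⁻¹ := by field_simp
    have e2 : W - 2 * Real.cos φ * (ρ * E) = (1 - ρ) * (1 - ρ * E ^ 2) := by
      rw [hWdef, hcos]
      linear_combination (-(ρ : ℂ)) * hEE
    rw [e1, e2, Complex.inv_def, hconj]
    push_cast
    linear_combination ((1 - ρ) * a * ρ ^ 2 * (Complex.normSq W : ℂ)⁻¹ *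
      (E' - ρ * E * (E * E' + 1))) * hEE
  rw [key, Complex.im_ofReal_mul, Complex.add_im, Complex.sub_im, Complex.im_ofReal_mul,
    Complex.im_ofReal_mul, Complex.im_ofReal_mul, i1, i2, i3, rayNum]
  ring

theorem phaseIm_zero (θ : ℝ) (q : ℂ) : phaseIm θ q 0 = 0 := by simp [phaseIm, phase_zero]

/-- Along the ray through the saddle point, `phaseIm` is positive off the saddle point if it is
nonnegative there. -/
theorem phaseIm_ray_pos {θ φ ρ : ℝ} (hθ : 0 < θ) (hθφ : θ < φ) (hφ : φ < Real.pi / 2)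
    (h1 : 0 ≤ phaseIm θ (Real.cos φ) (Complex.exp (φ * Complex.I))) (hρ : 0 < ρ) (hρ1 : ρ ≠ 1) :
    0 < phaseIm θ (Real.cos φ) (ρ * Complex.exp (φ * Complex.I)) := by
  have hφ0 : 0 < φ := hθ.trans hθφ
  set R : ℝ → ℝ := fun ρ => phaseIm θ (Real.cos φ) (ρ * Complex.exp (φ * Complex.I)) with hR
  have hd : ∀ ρ, 0 ≤ ρ → HasDerivAt R
      ((1 - ρ) * rayNum θ φ ρ / Complex.normSq (1 + (ρ * Complex.exp (φ * Complex.I)) ^ 2)) ρ :=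
    fun ρ hρ => hasDerivAt_phaseIm_ray hφ0 hφ hρ
  have hden : ∀ ρ : ℝ, 0 ≤ ρ → 0 < Complex.normSq (1 + (ρ * Complex.exp (φ * Complex.I)) ^ 2) :=
    fun ρ hρ => Complex.normSq_pos.mpr (Complex.slitPlane_ne_zero (ray_mem_slitPlane hφ0 hφ hρ))
  have hR0 : R 0 = 0 := by simp [hR, phaseIm_zero]
  have hR1 : 0 ≤ R 1 := by simpa [hR] using h1
  have hsδ : 0 < Real.sin (φ - θ) := Real.sin_pos_of_pos_of_lt_pi (by linarith) (by linarith)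
  have hsB : 0 < Real.sin (φ + θ) := Real.sin_pos_of_pos_of_lt_pi (by linarith) (by linarith)
  have hN0 : 0 < rayNum θ φ 0 := by simp [rayNum, hsδ]
  have hN1 : rayNum θ φ 1 < 0 := by
    have e : rayNum θ φ 1 = -(2 * Real.sin (2 * φ) * Real.cos (φ - θ)) := by
      rw [rayNum, show 3 * φ - θ = 2 * φ + (φ - θ) by ring,
        show φ + θ = 2 * φ - (φ - θ) by ring, Real.sin_add, Real.sin_sub (2 * φ)]
      ring
    rw [e]
    have hs2 := Real.sin_pos_of_pos_of_lt_pi (x := 2 * φ) (by linarith) (by linarith)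
    have hc := Real.cos_pos_of_mem_Ioo (x := φ - θ) ⟨by linarith, by linarith⟩
    nlinarith [mul_pos hs2 hc]
  -- Equivalently `rayNum/ρ` decreases strictly, so `rayNum` changes sign only once, at a point `ρ₀`
  -- between `0` and `1`.
  have hmono : ∀ r₁ r₂ : ℝ, 0 ≤ r₁ → r₁ < r₂ → r₁ * rayNum θ φ r₂ < r₂ * rayNum θ φ r₁ := by
    intro r₁ r₂ h0 h
    have e : r₂ * rayNum θ φ r₁ - r₁ * rayNum θ φ r₂ = Real.sin (φ - θ) * (r₂ - r₁) +
        Real.sin (φ + θ) * (r₁ * r₂ * (r₂ - r₁)) +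
        Real.sin (φ - θ) * (r₁ * r₂ * (r₂ ^ 2 - r₁ ^ 2)) := by
      unfold rayNum; ring
    have h2 : 0 ≤ r₁ * r₂ := mul_nonneg h0 (h0.trans h.le)
    have h3 : 0 ≤ r₂ ^ 2 - r₁ ^ 2 := by nlinarith
    have h4 : 0 < r₂ - r₁ := by linarith
    have : 0 < r₂ * rayNum θ φ r₁ - r₁ * rayNum θ φ r₂ := by rw [e]; positivity
    linarith
  obtain ⟨ρ₀, ⟨hρ₀0, hρ₀1⟩, hρ₀⟩ : ∃ ρ₀ ∈ Icc (0 : ℝ) 1, rayNum θ φ ρ₀ = 0 := by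
    have hc : ContinuousOn (rayNum θ φ) (Icc 0 1) := by unfold rayNum; fun_prop
    exact intermediate_value_Icc' zero_le_one hc ⟨hN1.le, hN0.le⟩
  have hρ₀0' : 0 < ρ₀ := lt_of_le_of_ne hρ₀0 fun h => by rw [← h] at hρ₀; linarith
  have hρ₀1' : ρ₀ < 1 := lt_of_le_of_ne hρ₀1 fun h => by rw [h] at hρ₀; linarith
  have hNpos : ∀ r, 0 ≤ r → r < ρ₀ → 0 < rayNum θ φ r := fun r h0 h => by
    have := hmono r ρ₀ h0 h
    rw [hρ₀, mul_zero] at this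
    exact (mul_pos_iff_of_pos_left hρ₀0').mp this
  have hNneg : ∀ r, ρ₀ < r → rayNum θ φ r < 0 := fun r h => by
    have := hmono ρ₀ r hρ₀0 h
    rw [hρ₀, mul_zero] at this
    by_contra hcon
    nlinarith
  have hcont : ∀ s : Set ℝ, s ⊆ Ici 0 → ContinuousOn R s := fun s hs x hx =>
    (hd x (hs hx)).continuousAt.continuousWithinAt
  change 0 < R ρ
  -- `R` rises from `R(0) = 0` to `ρ₀`, falls to `R(1) ≥ 0`, and rises again; it is therefore
  -- positive except possibly at `1`.
  rcases le_or_gt ρ ρ₀ with hc | hc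
  · have hm : StrictMonoOn R (Icc 0 ρ₀) := by
      refine strictMonoOn_of_deriv_pos (convex_Icc _ _) (hcont _ fun x hx => hx.1) fun x hx => ?_
      rw [interior_Icc] at hx
      rw [(hd x hx.1.le).deriv]
      exact div_pos (mul_pos (by linarith [hx.2]) (hNpos x hx.1.le hx.2)) (hden x hx.1.le)
    rw [← hR0]
    exact hm ⟨le_rfl, hρ₀0⟩ ⟨hρ.le, hc⟩ hρ
  rcases lt_or_gt_of_ne hρ1 with hc1 | hc1
  · have hm : StrictAntiOn R (Icc ρ₀ 1) := by
      refine strictAntiOn_of_deriv_neg (convex_Icc _ _) (hcont _ fun x hx => hρ₀0.trans hx.1)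
        fun x hx => ?_
      rw [interior_Icc] at hx
      have hx0 : 0 ≤ x := hρ₀0.trans hx.1.le
      rw [(hd x hx0).deriv]
      exact div_neg_of_neg_of_pos (mul_neg_of_pos_of_neg (by linarith [hx.2]) (hNneg x hx.1))
        (hden x hx0)
    exact hR1.trans_lt (hm ⟨hc.le, hc1.le⟩ ⟨hρ₀1, le_rfl⟩ hc1)
  · have hm : StrictMonoOn R (Ici 1) := by
      refine strictMonoOn_of_deriv_pos (convex_Ici _) (hcont _ (Ici_subset_Ici.mpr zero_le_one))
        fun x hx => ?_
      rw [interior_Ici] at hx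
      have hx1 : 1 < x := hx
      rw [(hd x (by linarith)).deriv]
      exact div_pos (mul_pos_of_neg_of_neg (by linarith) (hNneg x (by linarith)))
        (hden x (by linarith))
    exact hR1.trans_lt (hm self_mem_Ici hc1.le hc1)

/-- `phaseIm` on the unit circle. -/
def arcPhase (θ q ψ : ℝ) : ℝ :=
  Real.cos θ * (Real.sin ψ - q * ψ) - Real.sin θ * (Real.cos ψ - q * Real.log (2 * Real.cos ψ))

theorem one_add_exp_sq (ψ : ℝ) : 1 + Complex.exp (ψ * Complex.I) ^ 2 =
    ((2 * Real.cos ψ : ℝ) : ℂ) * Complex.exp (ψ * Complex.I) := by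
  push_cast
  rw [Complex.two_cos, add_mul, ← Complex.exp_add, ← Complex.exp_add, ← Complex.exp_nat_mul]
  ring_nf
  simp [add_comm]

theorem phase_exp_mul_I (q : ℝ) {ψ : ℝ} (hψ : |ψ| < Real.pi / 2) :
    phase q (Complex.exp (ψ * Complex.I)) =
      ((Real.cos ψ - q * Real.log (2 * Real.cos ψ) : ℝ) : ℂ) +
        ((Real.sin ψ - q * ψ : ℝ) : ℂ) * Complex.I := by
  have hc : 0 < Real.cos ψ := Real.cos_pos_of_mem_Ioo (abs_lt.mp hψ)
  obtain ⟨h1, h2⟩ := abs_lt.mp hψ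
  rw [phase, one_add_exp_sq, Complex.log_ofReal_mul (by positivity) (Complex.exp_ne_zero _),
    Complex.log_exp (by simp; linarith [Real.pi_pos]) (by simp; linarith [Real.pi_pos]),
    Complex.exp_mul_I]
  push_cast
  ring

theorem exp_neg_mul_re_im (θ X Y : ℝ) :
    (Complex.exp (((-θ : ℝ) : ℂ) * Complex.I) * (X + Y * Complex.I)).re =
      X * Real.cos θ + Y * Real.sin θ ∧
    (Complex.exp (((-θ : ℝ) : ℂ) * Complex.I) * (X + Y * Complex.I)).im =
      Y * Real.cos θ - X * Real.sin θ := by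
  have h1 := Complex.exp_ofReal_mul_I_re (-θ)
  have h2 := Complex.exp_ofReal_mul_I_im (-θ)
  rw [Real.cos_neg] at h1
  rw [Real.sin_neg] at h2
  rw [Complex.mul_re, Complex.mul_im, h1, h2]
  simp
  constructor <;> ring

theorem phaseIm_exp_mul_I (θ q : ℝ) {ψ : ℝ} (hψ : |ψ| < Real.pi / 2) :
    phaseIm θ q (Complex.exp (ψ * Complex.I)) = arcPhase θ q ψ := by
  rw [phaseIm, phase_exp_mul_I q hψ, (exp_neg_mul_re_im θ _ _).2, arcPhase]
  ring

/-- The derivative is `(cos ψ - cos φ)(cos θ + sin θ tan ψ)` with a positive second factor, so on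
the quarter circle the saddle point is the strict maximum. -/
theorem arcPhase_lt {θ φ ψ : ℝ} (hθ : 0 < θ) (hθ' : θ < Real.pi / 2) (hφ0 : 0 < φ)
    (hφ : φ < Real.pi / 2) (hψ0 : 0 ≤ ψ) (hψ : ψ < Real.pi / 2) (hne : ψ ≠ φ) :
    arcPhase θ (Real.cos φ) ψ < arcPhase θ (Real.cos φ) φ := by
  have hcos : ∀ x, 0 ≤ x → x < Real.pi / 2 → 0 < Real.cos x := fun x h0 h =>
    Real.cos_pos_of_mem_Ioo ⟨by linarith [Real.pi_pos], h⟩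
  have hC := hcos θ hθ.le hθ'
  have hS : 0 < Real.sin θ := Real.sin_pos_of_pos_of_lt_pi hθ (by linarith)
  have hd : ∀ x, 0 ≤ x → x < Real.pi / 2 → HasDerivAt (arcPhase θ (Real.cos φ))
      ((Real.cos x - Real.cos φ) * (Real.cos θ + Real.sin θ * (Real.sin x / Real.cos x))) x := by
    intro x h0 h
    have hx := hcos x h0 h
    have e1 := ((Real.hasDerivAt_sin x).sub ((hasDerivAt_id x).const_mul (Real.cos φ))).const_mul
      (Real.cos θ)
    have e2 := ((Real.hasDerivAt_cos x).const_mul 2).log (by positivity)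
    have e3 := ((Real.hasDerivAt_cos x).sub (e2.const_mul (Real.cos φ))).const_mul (Real.sin θ)
    refine (e1.sub e3).congr_deriv ?_
    field_simp
    ring
  have hfac : ∀ x, 0 ≤ x → x < Real.pi / 2 →
      0 < Real.cos θ + Real.sin θ * (Real.sin x / Real.cos x) := by
    intro x h0 h
    have hx := hcos x h0 h
    have hs : 0 ≤ Real.sin x := Real.sin_nonneg_of_nonneg_of_le_pi h0 (by linarith)
    positivity
  rcases lt_or_gt_of_ne hne with h | h
  · have hm : StrictMonoOn (arcPhase θ (Real.cos φ)) (Icc 0 φ) := by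
      refine strictMonoOn_of_deriv_pos (convex_Icc _ _)
        (fun x hx => (hd x hx.1 (by linarith [hx.2])).continuousAt.continuousWithinAt) fun x hx => ?_
      rw [interior_Icc] at hx
      rw [(hd x hx.1.le (by linarith [hx.2])).deriv]
      refine mul_pos (sub_pos.mpr ?_) (hfac x hx.1.le (by linarith [hx.2]))
      exact Real.cos_lt_cos_of_nonneg_of_le_pi_div_two hx.1.le hφ.le hx.2
    exact hm ⟨hψ0, h.le⟩ ⟨hφ0.le, le_rfl⟩ h
  · have hm : StrictAntiOn (arcPhase θ (Real.cos φ)) (Icc φ ψ) := by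
      refine strictAntiOn_of_deriv_neg (convex_Icc _ _)
        (fun x hx => (hd x (hφ0.le.trans hx.1)
          (by linarith [hx.2])).continuousAt.continuousWithinAt) fun x hx => ?_
      rw [interior_Icc] at hx
      have hx0 := hφ0.le.trans hx.1.le
      rw [(hd x hx0 (by linarith [hx.2])).deriv]
      refine mul_neg_of_neg_of_pos (sub_neg.mpr ?_) (hfac x hx0 (by linarith [hx.2]))
      exact Real.cos_lt_cos_of_nonneg_of_le_pi_div_two hφ0.le (by linarith [hx.2]) hx.1
    exact hm ⟨le_rfl, h.le⟩ ⟨h.le, le_rfl⟩ h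

/-- If `φ ≤ θ`, then `log(2cos φ) ≤ 2cos φ - 1` and `sin(θ-φ) ≥ 0` lead to `sin φ (2 - 2cos φ) ≤ sin
φ - φ cos φ`, against `sin φ < φ`. So the path starts below the ray through the saddle point. -/
theorem lt_of_arcPhase_nonneg {θ φ : ℝ} (hθ : 0 < θ) (hθ' : θ < Real.pi / 2) (hφ0 : 0 < φ)
    (hφ : φ < Real.pi / 2) (h : 0 ≤ arcPhase θ (Real.cos φ) φ) : θ < φ := by
  by_contra hcon
  push Not at hcon
  have hcφ : 0 < Real.cos φ := Real.cos_pos_of_mem_Ioo ⟨by linarith, hφ⟩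
  have hcθ : 0 < Real.cos θ := Real.cos_pos_of_mem_Ioo ⟨by linarith, hθ'⟩
  have hsθ : 0 < Real.sin θ := Real.sin_pos_of_pos_of_lt_pi hθ (by linarith)
  have hsφ : 0 < Real.sin φ := Real.sin_pos_of_pos_of_lt_pi hφ0 (by linarith)
  have hlog : Real.log (2 * Real.cos φ) ≤ 2 * Real.cos φ - 1 :=
    Real.log_le_sub_one_of_pos (by positivity)
  have hc1 : Real.cos φ < 1 := by
    rw [← Real.cos_zero]
    exact Real.cos_lt_cos_of_nonneg_of_le_pi_div_two le_rfl hφ.le hφ0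
  have hlt := Real.sin_lt hφ0
  -- `sin θ cos φ ≥ cos θ sin φ`
  have hsub : 0 ≤ Real.sin (θ - φ) :=
    Real.sin_nonneg_of_nonneg_of_le_pi (by linarith) (by linarith)
  rw [Real.sin_sub] at hsub
  unfold arcPhase at h
  have h1 : Real.sin θ * (Real.cos φ * (2 - 2 * Real.cos φ)) ≤
      Real.sin θ * (Real.cos φ - Real.cos φ * Real.log (2 * Real.cos φ)) := by
    refine mul_le_mul_of_nonneg_left ?_ hsθ.le
    nlinarith
  have h2 : Real.cos θ * Real.sin φ * (2 - 2 * Real.cos φ) ≤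
      Real.sin θ * Real.cos φ * (2 - 2 * Real.cos φ) :=
    mul_le_mul_of_nonneg_right (by linarith) (by linarith)
  have h3 : Real.cos θ * (Real.sin φ * (2 - 2 * Real.cos φ)) ≤
      Real.cos θ * (Real.sin φ - Real.cos φ * φ) := by linarith
  have h4 := le_of_mul_le_mul_left h3 hcθ
  nlinarith [mul_lt_mul_of_pos_left hlt hcφ]

end Struve

end

noncomputable section

namespace Struve

open MeasureTheory Set

/-! ### Paths of steepest descent when the order and the argument have the same phase -/

/-- The analysis is made for `arg z = -θ` with `θ > 0`: the path then leaves `0` in the direction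
`e^{iθ}`, and the relevant saddle point is in the upper half-plane. The case `arg z = θ` follows by
conjugation. -/
abbrev rotA (θ : ℝ) : ℂ := Complex.exp (((-θ : ℝ) : ℂ) * Complex.I)

/-- The logarithm of `1 + u²` on the sheet of a path that passes `u` at time `t`. -/
def rotLog (θ q t : ℝ) (u : ℂ) : ℂ := (rotA θ * u - t) / (q * rotA θ)

section rot

variable {θ q t : ℝ} {u : ℂ}

theorem eq_add_rotLog (hq : q ≠ 0) (θ t : ℝ) (u : ℂ) :
    u = t * Complex.exp (θ * Complex.I) + q * rotLog θ q t u := by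
  have hqc : (q : ℂ) ≠ 0 := by exact_mod_cast hq
  have h1 : Complex.exp (θ * Complex.I) * rotA θ = 1 := by
    rw [rotA, ← Complex.exp_add]; simp
  have h2 : rotA θ ≠ 0 := Complex.exp_ne_zero _
  refine mul_left_cancel₀ h2 ?_
  rw [rotLog]
  field_simp
  linear_combination (-(t : ℂ)) * h1

theorem re_im_rotLog (hq : q ≠ 0) (θ t : ℝ) (u : ℂ) :
    u.re = t * Real.cos θ + q * (rotLog θ q t u).re ∧
      u.im = t * Real.sin θ + q * (rotLog θ q t u).im := by
  have h := eq_add_rotLog hq θ t u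
  have h1 := congrArg Complex.re h
  have h2 := congrArg Complex.im h
  rw [Complex.add_re, Complex.re_ofReal_mul, Complex.re_ofReal_mul, Complex.exp_ofReal_mul_I_re] at h1
  rw [Complex.add_im, Complex.im_ofReal_mul, Complex.im_ofReal_mul, Complex.exp_ofReal_mul_I_im] at h2
  exact ⟨h1, h2⟩

theorem IsLevel.cos_sin_rotLog (h : IsLevel (rotA θ) (q * rotA θ) t u) :
    Real.exp (rotLog θ q t u).re * Real.cos (rotLog θ q t u).im = 1 + u.re ^ 2 - u.im ^ 2 ∧
      Real.exp (rotLog θ q t u).re * Real.sin (rotLog θ q t u).im = 2 * u.re * u.im := by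
  have h' : Complex.exp (rotLog θ q t u) = 1 + u ^ 2 := h
  have h1 := congrArg Complex.re h'
  have h2 := congrArg Complex.im h'
  rw [Complex.exp_re] at h1
  rw [Complex.exp_im] at h2
  rw [h1, h2]
  simp [pow_two]
  constructor <;> ring

/-- The logarithm on the path and the principal one have the same real part, so `phaseIm` measures
precisely by how much the sheet differs from the principal one. -/
theorem IsLevel.phaseIm_eq (hq : q ≠ 0) (h : IsLevel (rotA θ) (q * rotA θ) t u) :
    phaseIm θ q u = q * Real.cos θ * ((rotLog θ q t u).im - Complex.arg (1 + u ^ 2)) := by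
  have h' : Complex.exp (rotLog θ q t u) = 1 + u ^ 2 := h
  obtain ⟨h1, h2⟩ := re_im_rotLog hq θ t u
  have h3 : Complex.log (1 + u ^ 2) =
      ((rotLog θ q t u).re : ℂ) + Complex.arg (1 + u ^ 2) * Complex.I := by
    rw [Complex.log, ← h', Complex.norm_exp, Real.log_exp]
  have h4 : phase q u = ((u.re - q * (rotLog θ q t u).re : ℝ) : ℂ) +
      ((u.im - q * Complex.arg (1 + u ^ 2) : ℝ) : ℂ) * Complex.I := by
    rw [phase, h3]
    nth_rw 1 [← Complex.re_add_im u]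
    push_cast
    ring
  rw [phaseIm, h4, (exp_neg_mul_re_im θ _ _).2]
  linear_combination Real.cos θ * h2 - Real.sin θ * h1

theorem IsLevel.phase_eq (hq : q ≠ 0) (h : IsLevel (rotA θ) (q * rotA θ) t u)
    (h1 : -Real.pi < (rotLog θ q t u).im) (h2 : (rotLog θ q t u).im ≤ Real.pi) :
    rotA θ * phase q u = t := by
  have h' : Complex.exp (rotLog θ q t u) = 1 + u ^ 2 := h
  have hqc : (q : ℂ) ≠ 0 := by exact_mod_cast hq
  have h2 : rotA θ ≠ 0 := Complex.exp_ne_zero _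
  rw [phase, ← h', Complex.log_exp h1 (by assumption), rotLog]
  field_simp
  ring

theorem eq_ofReal_mul_exp {φ : ℝ} (hc : 0 < Real.cos φ)
    (h : u.im * Real.cos φ - u.re * Real.sin φ = 0) :
    u = ((u.re / Real.cos φ : ℝ) : ℂ) * Complex.exp (φ * Complex.I) := by
  have e1 := Complex.exp_ofReal_mul_I_re φ
  have e2 := Complex.exp_ofReal_mul_I_im φ
  refine Complex.ext ?_ ?_
  · rw [Complex.re_ofReal_mul, e1]; field_simp
  · rw [Complex.im_ofReal_mul, e2]; field_simp; linarith

end rot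

section wedge

variable {θ φ : ℝ}

/-- The hypotheses on the phase `θ` and the saddle point `e^{iφ}`. -/
structure SaddleAngle (θ φ : ℝ) : Prop where
  hθ : 0 < θ
  hθ' : θ < Real.pi / 2
  hφ : 0 < φ
  hφ' : φ < Real.pi / 2
  nonneg : 0 ≤ arcPhase θ (Real.cos φ) φ

theorem SaddleAngle.cos_pos (S : SaddleAngle θ φ) : 0 < Real.cos φ :=
  Real.cos_pos_of_mem_Ioo ⟨by linarith [S.hφ, Real.pi_pos], S.hφ'⟩

theorem SaddleAngle.sin_pos (S : SaddleAngle θ φ) : 0 < Real.sin φ :=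
  Real.sin_pos_of_pos_of_lt_pi S.hφ (by linarith [S.hφ', Real.pi_pos])

theorem SaddleAngle.cos_pos' (S : SaddleAngle θ φ) : 0 < Real.cos θ :=
  Real.cos_pos_of_mem_Ioo ⟨by linarith [S.hθ, Real.pi_pos], S.hθ'⟩

theorem SaddleAngle.sin_pos' (S : SaddleAngle θ φ) : 0 < Real.sin θ :=
  Real.sin_pos_of_pos_of_lt_pi S.hθ (by linarith [S.hθ', Real.pi_pos])

theorem SaddleAngle.lt (S : SaddleAngle θ φ) : θ < φ :=
  lt_of_arcPhase_nonneg S.hθ S.hθ' S.hφ S.hφ' S.nonneg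

theorem SaddleAngle.abs_angle_lt (S : SaddleAngle θ φ) : |φ| < Real.pi / 2 := by
  rw [abs_of_pos S.hφ]; exact S.hφ'

theorem SaddleAngle.phaseIm_nonneg (S : SaddleAngle θ φ) :
    0 ≤ phaseIm θ (Real.cos φ) (Complex.exp (φ * Complex.I)) := by
  rw [phaseIm_exp_mul_I θ _ S.abs_angle_lt]; exact S.nonneg

theorem SaddleAngle.re_pos (S : SaddleAngle θ φ) : 0 < ((Real.cos φ : ℂ) * rotA θ).re := by
  rw [Complex.re_ofReal_mul, Complex.exp_ofReal_mul_I_re, Real.cos_neg]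
  exact mul_pos S.cos_pos S.cos_pos'

/-- The point `u` lies strictly between the positive real axis and the ray through `e^{iφ}`. -/
def InWedge (θ φ t : ℝ) (u : ℂ) : Prop :=
  0 < u.im ∧ u.im * Real.cos φ - u.re * Real.sin φ < 0 ∧
    |(rotLog θ (Real.cos φ) t u).im| < Real.pi

/-- The angle `±π` would make `1+u²` a negative number, impossible in the closed wedge; so the sheet
is principal and `phaseIm` vanishes. On the positive axis the phase is positive, and its rotation by
`-θ` is not real; on the ray `phaseIm_ray_pos` leaves only the saddle point. -/
theorem SaddleAngle.closed_wedge (S : SaddleAngle θ φ) {t : ℝ} (ht : 0 < t) {u : ℂ}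
    (h : IsLevel (rotA θ) (Real.cos φ * rotA θ) t u) (h1 : 0 ≤ u.im)
    (h2 : u.im * Real.cos φ - u.re * Real.sin φ ≤ 0)
    (h3 : |(rotLog θ (Real.cos φ) t u).im| ≤ Real.pi) :
    |(rotLog θ (Real.cos φ) t u).im| < Real.pi ∧ rotA θ * phase (Real.cos φ) u = t ∧ 0 < u.im ∧
      (u.im * Real.cos φ - u.re * Real.sin φ < 0 ∨ u = Complex.exp (φ * Complex.I)) := by
  have hc := S.cos_pos
  have hs := S.sin_pos
  obtain ⟨e1, e2⟩ := h.cos_sin_rotLog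
  set L := rotLog θ (Real.cos φ) t u with hL
  have hx : 0 ≤ u.re := by
    by_contra hx
    push Not at hx
    nlinarith [mul_nonneg h1 hc.le, mul_pos_of_neg_of_neg hx (neg_neg_of_pos hs)]
  have hu0 : u ≠ 0 := by
    rintro rfl
    exact ht.ne' (h.time_eq_zero S.re_pos)
  have hβ : |L.im| < Real.pi := by
    refine lt_of_le_of_ne h3 fun hπ => ?_
    have hsin : Real.sin L.im = 0 := by
      rcases abs_cases L.im with ⟨h4, -⟩ | ⟨h4, -⟩
      · rw [← h4, hπ, Real.sin_pi]
      · rw [← neg_neg L.im, ← h4, hπ, Real.sin_neg, Real.sin_pi, neg_zero]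
    have hcos : Real.cos L.im = -1 := by rw [← Real.cos_abs, hπ, Real.cos_pi]
    rw [hsin, mul_zero] at e2
    rw [hcos] at e1
    have hp := Real.exp_pos L.re
    rcases eq_or_ne u.re 0 with h0 | h0
    · rw [h0] at h2 e1
      have : u.im = 0 := by nlinarith
      rw [this] at e1
      nlinarith
    · have : u.im = 0 := by
        rcases mul_eq_zero.mp e2.symm with h5 | h5
        · exact absurd (by simpa using h5) h0
        · exact h5
      rw [this] at e1
      nlinarith
  have hph := h.phase_eq hc.ne' (by linarith [(abs_lt.mp hβ).1]) (abs_lt.mp hβ).2.le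
  have him0 : phaseIm θ (Real.cos φ) u = 0 := by rw [phaseIm, hph, Complex.ofReal_im]
  have hy : 0 < u.im := by
    refine lt_of_le_of_ne h1 fun hy => ?_
    have hux : u = (u.re : ℂ) := Complex.ext rfl (by simp [← hy])
    have hx0 : 0 < u.re := by
      refine lt_of_le_of_ne hx fun hx0 => hu0 ?_
      rw [hux, ← hx0, Complex.ofReal_zero]
    have hlog := log_one_add_sq_lt hx0
    have hpos : 0 < u.re - Real.cos φ * Real.log (1 + u.re ^ 2) := by
      have h5 : 0 ≤ Real.log (1 + u.re ^ 2) := Real.log_nonneg (by nlinarith)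
      nlinarith [Real.cos_le_one φ]
    have hp : phase (Real.cos φ) u =
        ((u.re - Real.cos φ * Real.log (1 + u.re ^ 2) : ℝ) : ℂ) + ((0 : ℝ) : ℂ) * Complex.I := by
      rw [phase]
      nth_rw 1 2 [hux]
      rw [show (1 : ℂ) + (u.re : ℂ) ^ 2 = ((1 + u.re ^ 2 : ℝ) : ℂ) by push_cast; rfl,
        ← Complex.ofReal_log (by positivity)]
      push_cast
      ring
    rw [phaseIm, hp, (exp_neg_mul_re_im θ _ _).2] at him0
    nlinarith [S.sin_pos', mul_pos hpos S.sin_pos']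
  refine ⟨hβ, hph, hy, ?_⟩
  rcases h2.lt_or_eq with h4 | h4
  · exact Or.inl h4
  · right
    have h5 := eq_ofReal_mul_exp hc h4
    have hx0 : 0 < u.re := by
      refine lt_of_le_of_ne hx fun hx0 => hu0 ?_
      rw [h5, ← hx0]; simp
    by_cases hρ : u.re / Real.cos φ = 1
    · rw [h5, hρ]; simp
    · have := phaseIm_ray_pos S.hθ S.lt S.hφ' S.phaseIm_nonneg (div_pos hx0 hc) hρ
      rw [← h5, him0] at this
      exact absurd this (lt_irrefl _)

theorem continuousOn_rotLog {q : ℝ} {I : Set ℝ} {γ : ℝ → ℂ} (hγ : ContinuousOn γ I) :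
    ContinuousOn (fun t => rotLog θ q t (γ t)) I := by
  unfold rotLog
  refine ContinuousOn.div_const ?_ _
  exact (continuousOn_const.mul hγ).sub Complex.continuous_ofReal.continuousOn

/-- By `closed_wedge` the saddle point is the only possible exit, and it could be used only at the
time equal to its rotated phase. -/
theorem SaddleAngle.wedge_trap (S : SaddleAngle θ φ) {I : Set ℝ} (hI : IsPreconnected I)
    (hI0 : ∀ t ∈ I, 0 < t) {γ : ℝ → ℂ} (hγ : ContinuousOn γ I)
    (hl : ∀ t ∈ I, IsLevel (rotA θ) (Real.cos φ * rotA θ) t (γ t))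
    (hs : ∀ t ∈ I, γ t = Complex.exp (φ * Complex.I) →
      rotA θ * phase (Real.cos φ) (Complex.exp (φ * Complex.I)) ≠ t)
    {t₀ : ℝ} (ht₀ : t₀ ∈ I) (h0 : InWedge θ φ t₀ (γ t₀)) : ∀ t ∈ I, InWedge θ φ t (γ t) := by
  let O : Set (ℂ × ℂ) := {p | 0 < p.1.im ∧ p.1.im * Real.cos φ - p.1.re * Real.sin φ < 0 ∧
    |p.2.im| < Real.pi}
  let C : Set (ℂ × ℂ) := {p | 0 ≤ p.1.im ∧ p.1.im * Real.cos φ - p.1.re * Real.sin φ ≤ 0 ∧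
    |p.2.im| ≤ Real.pi}
  have c1 : Continuous fun p : ℂ × ℂ => p.1.im := Complex.continuous_im.comp continuous_fst
  have c2 : Continuous fun p : ℂ × ℂ => p.1.im * Real.cos φ - p.1.re * Real.sin φ :=
    (c1.mul_const _).sub ((Complex.continuous_re.comp continuous_fst).mul_const _)
  have c3 : Continuous fun p : ℂ × ℂ => |p.2.im| := (Complex.continuous_im.comp continuous_snd).abs
  refine invariant_region hI (f := fun t => (γ t, rotLog θ (Real.cos φ) t (γ t)))
    (hγ.prodMk (continuousOn_rotLog hγ)) (O := O) (C := C)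
    ((isOpen_lt continuous_const c1).and ((isOpen_lt c2 continuous_const).and
      (isOpen_lt c3 continuous_const)))
    ((isClosed_le continuous_const c1).and ((isClosed_le c2 continuous_const).and
      (isClosed_le c3 continuous_const)))
    (fun p hp => ⟨hp.1.le, hp.2.1.le, hp.2.2.le⟩) (fun t ht hC => ?_) ht₀ h0
  obtain ⟨h1, h2, h3, h4⟩ := S.closed_wedge (hI0 t ht) (hl t ht) hC.1 hC.2.1 hC.2.2
  rcases h4 with h4 | h4
  · exact ⟨h3, h4, h1⟩
  · rw [h4] at h2
    exact absurd h2 (hs t ht h4)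

/-- The initial direction is `e^{iθ}`, and `0 < θ < φ` by `SaddleAngle.lt`. -/
theorem SaddleAngle.wedge_entry (S : SaddleAngle θ φ) {γ : ℝ → ℂ} (hγ : ContinuousOn γ (Ici 0))
    (h0 : γ 0 = 0) (hl : ∀ t ∈ Ici (0 : ℝ), IsLevel (rotA θ) (Real.cos φ * rotA θ) t (γ t)) :
    ∀ᶠ t in 𝓝[>] 0, InWedge θ φ t (γ t) := by
  have hd := isLevel_right_deriv_zero (ne_zero_of_re_pos S.re_pos) hγ (Complex.exp_ne_zero _) h0 hl
  have hinv : (rotA θ)⁻¹ = Complex.exp (θ * Complex.I) := by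
    rw [rotA, ← Complex.exp_neg]; congr 1; push_cast; ring
  rw [hinv] at hd
  have him : Tendsto (fun t : ℝ => (γ t / t).im) (𝓝[>] 0) (𝓝 (Real.sin θ)) := by
    rw [← Complex.exp_ofReal_mul_I_im]
    exact (Complex.continuous_im.tendsto _).comp hd
  have hre : Tendsto (fun t : ℝ => (γ t / t).re) (𝓝[>] 0) (𝓝 (Real.cos θ)) := by
    rw [← Complex.exp_ofReal_mul_I_re]
    exact (Complex.continuous_re.tendsto _).comp hd
  have hV := (him.mul_const (Real.cos φ)).sub (hre.mul_const (Real.sin φ))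
  have hneg : Real.sin θ * Real.cos φ - Real.cos θ * Real.sin φ < 0 := by
    rw [← Real.sin_sub]
    exact Real.sin_neg_of_neg_of_neg_pi_lt (by linarith [S.lt])
      (by linarith [S.hφ', S.hθ, Real.pi_pos])
  have hL : Tendsto (fun t => |(rotLog θ (Real.cos φ) t (γ t)).im|) (𝓝[>] 0) (𝓝 0) := by
    have h1 := ((continuousOn_rotLog (θ := θ) (q := Real.cos φ) hγ) 0 self_mem_Ici).mono
      Ioi_subset_Ici_self
    have h2 := (Complex.continuous_im.abs.tendsto _).comp h1
    have h3 : rotLog θ (Real.cos φ) 0 (γ 0) = 0 := by simp [rotLog, h0]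
    simp only [h3, Complex.zero_im, abs_zero] at h2
    exact h2
  filter_upwards [him.eventually_const_lt S.sin_pos', hV.eventually_lt_const hneg,
    hL.eventually_lt_const Real.pi_pos, self_mem_nhdsWithin] with t h1 h2 h3 ht
  have ht' : 0 < t := ht
  rw [Complex.div_ofReal_im] at h1 h2
  rw [Complex.div_ofReal_re] at h2
  refine ⟨?_, ?_, h3⟩
  · have := mul_pos h1 ht'
    rwa [div_mul_cancel₀ _ ht'.ne'] at this
  · have := mul_neg_of_neg_of_pos h2 ht'
    have e : ((γ t).im / t * Real.cos φ - (γ t).re / t * Real.sin φ) * t =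
        (γ t).im * Real.cos φ - (γ t).re * Real.sin φ := by field_simp
    rwa [e] at this

/-- Neither `i` nor `-i` belongs to the closed wedge, so `∞` is the only end left. -/
theorem SaddleAngle.tendsto_of_wedge (S : SaddleAngle θ φ) {γ : ℝ → ℂ} (hγ : ContinuousOn γ (Ici 0))
    (hl : ∀ t ∈ Ici (0 : ℝ), IsLevel (rotA θ) (Real.cos φ * rotA θ) t (γ t)) {T : ℝ}
    (hw : ∀ t ∈ Ioi T, InWedge θ φ t (γ t)) : Tendsto γ atTop (Bornology.cobounded ℂ) := by
  rcases isLevel_ends S.re_pos hγ hl with h | h | h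
  · exact h
  · exfalso
    have h1 := ((Complex.continuous_im.tendsto _).comp h).mul_const (Real.cos φ)
    have h2 := ((Complex.continuous_re.tendsto _).comp h).mul_const (Real.sin φ)
    have h3 := le_of_tendsto (h1.sub h2) ((eventually_gt_atTop T).mono fun t ht => (hw t ht).2.1.le)
    simp at h3
    linarith [S.cos_pos]
  · exfalso
    have h1 := (Complex.continuous_im.tendsto _).comp h
    have h3 := ge_of_tendsto h1 ((eventually_gt_atTop T).mono fun t ht => (hw t ht).1.le)
    simp at h3
    linarith

theorem SaddleAngle.ne_saddle_of_wedge (S : SaddleAngle θ φ) {t : ℝ} {u : ℂ}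
    (h : InWedge θ φ t u) : 1 + u ^ 2 ≠ 2 * (Real.cos φ : ℂ) * u := by
  intro he
  have e1 := Complex.exp_ofReal_mul_I_re φ
  have e2 := Complex.exp_ofReal_mul_I_im φ
  have h1 : (u - Complex.exp (φ * Complex.I)) * (u - Complex.exp (-φ * Complex.I)) = 0 := by
    have h2 : Complex.exp (φ * Complex.I) * Complex.exp (-φ * Complex.I) = 1 := by
      rw [← Complex.exp_add]; simp
    have h3 : 2 * (Real.cos φ : ℂ) = Complex.exp (φ * Complex.I) + Complex.exp (-φ * Complex.I) := by
      rw [Complex.ofReal_cos, Complex.two_cos]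
    linear_combination he + h2 + u * h3
  obtain ⟨h4, h5, -⟩ := h
  rcases mul_eq_zero.mp h1 with h2 | h2
  · rw [sub_eq_zero.mp h2, e1, e2] at h5
    linarith [mul_comm (Real.sin φ) (Real.cos φ)]
  · rw [sub_eq_zero.mp h2, ← Complex.ofReal_neg, Complex.exp_ofReal_mul_I_im, Real.sin_neg] at h4
    linarith [S.sin_pos]

/-- The closed wedge is convex and avoids `±i`, so the straight homotopy works. For the ends, `u =
te^{iθ} + qL` with `Re L` and `Im L` eventually nonnegative gives `Re(e^{-iθ}u) ≥ t`, while the axis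
contributes `t cos θ`. -/
theorem SaddleAngle.deformable (S : SaddleAngle θ φ) {γ : ℝ → ℂ} (hγ : ContinuousOn γ (Ici 0))
    (h0 : γ 0 = 0) (hl : ∀ t ∈ Ici (0 : ℝ), IsLevel (rotA θ) (Real.cos φ * rotA θ) t (γ t))
    (hw : ∀ t ∈ Ioi (0 : ℝ), InWedge θ φ t (γ t)) :
    DeformableToRealAxis (-θ) fun t : ℝ≥0 => γ t := by
  have hc := S.cos_pos
  have hcl : ∀ t : ℝ≥0, 0 ≤ (γ t).im ∧ (γ t).im * Real.cos φ - (γ t).re * Real.sin φ ≤ 0 := by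
    intro t
    rcases eq_or_ne t 0 with rfl | ht
    · simp [h0]
    · have := hw t (NNReal.coe_pos.mpr (pos_iff_ne_zero.mpr ht))
      exact ⟨this.1.le, this.2.1.le⟩
  have hγc : Continuous fun t : ℝ≥0 => γ t :=
    hγ.comp_continuous NNReal.continuous_coe fun t => t.2
  have htend := S.tendsto_of_wedge hγ hl hw
  -- the real part of `e^{-iθ} γ` is eventually at least `t`
  have hbig : ∀ᶠ t : ℝ in atTop, t ≤ (rotA θ * γ t).re := by
    filter_upwards [(tendsto_norm_atTop_iff_cobounded.mpr htend).eventually_gt_atTop 2,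
      eventually_gt_atTop 0] with t h2 ht
    have hlt := hl t ht.le
    obtain ⟨e1, e2⟩ := re_im_rotLog hc.ne' θ t (γ t)
    obtain ⟨e3, e4⟩ := hlt.cos_sin_rotLog
    have h' : Complex.exp (rotLog θ (Real.cos φ) t (γ t)) = 1 + γ t ^ 2 := hlt
    obtain ⟨w1, w2, w3⟩ := hw t ht
    set L := rotLog θ (Real.cos φ) t (γ t)
    have hα : 0 ≤ L.re := by
      have h5 := congrArg norm h'
      rw [Complex.norm_exp] at h5
      have h6 := norm_sub_norm_le (γ t ^ 2) (-1)
      rw [norm_pow, norm_neg, norm_one, sub_neg_eq_add, add_comm, ← h5] at h6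
      have : (1 : ℝ) ≤ Real.exp L.re := by nlinarith
      exact Real.one_le_exp_iff.mp this
    have hx : 0 < (γ t).re := by
      by_contra hx
      nlinarith [S.sin_pos, mul_pos w1 hc]
    have hβ : 0 ≤ L.im := by
      by_contra hβ
      push Not at hβ
      have := Real.sin_neg_of_neg_of_neg_pi_lt hβ (abs_lt.mp w3).1
      nlinarith [Real.exp_pos L.re, mul_pos hx w1]
    have hre : (rotA θ * γ t).re = (γ t).re * Real.cos θ + (γ t).im * Real.sin θ := by
      have := (exp_neg_mul_re_im θ (γ t).re (γ t).im).1
      rwa [Complex.re_add_im] at this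
    rw [hre, e1, e2]
    have := Real.sin_sq_add_cos_sq θ
    have h8 := mul_nonneg (mul_nonneg hc.le hα) S.cos_pos'.le
    have h9 := mul_nonneg (mul_nonneg hc.le hβ) S.sin_pos'.le
    nlinarith
  refine ⟨fun p => (1 - (p.1 : ℝ) : ℝ) * γ p.2 + ((p.1 : ℝ) * (p.2 : ℝ) : ℝ), ?_, ?_, ?_, ?_, ?_, ?_⟩
  · have h1 : Continuous fun p : unitInterval × ℝ≥0 => γ p.2 := hγc.comp continuous_snd
    exact .add (.mul (by fun_prop) h1) (by fun_prop)
  · intro s; simp [h0]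
  · intro t; simp
  · intro t; simp
  · rintro ⟨s, t⟩ he
    obtain ⟨h1, h2⟩ := hcl t
    have hs0 : 0 ≤ (s : ℝ) := s.2.1
    have hs1 : 0 ≤ 1 - (s : ℝ) := by linarith [s.2.2]
    set H : ℂ := (1 - (s : ℝ) : ℝ) * γ t + ((s : ℝ) * (t : ℝ) : ℝ) with hH
    have k1 : H.im = (1 - s) * (γ t).im := by
      rw [hH, Complex.add_im, Complex.im_ofReal_mul, Complex.ofReal_im, add_zero]
    have k2 : H.re = (1 - s) * (γ t).re + s * t := by
      rw [hH, Complex.add_re, Complex.re_ofReal_mul, Complex.ofReal_re]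
    have k3 : 0 ≤ H.im := k1 ▸ mul_nonneg hs1 h1
    have k4 : H.im * Real.cos φ - H.re * Real.sin φ ≤ 0 := by
      rw [k1, k2]
      have := mul_nonneg hs1 (neg_nonneg.mpr h2)
      have := mul_nonneg (mul_nonneg hs0 t.coe_nonneg) S.sin_pos.le
      nlinarith
    have he' : 1 + H ^ 2 = 0 := he
    rw [one_add_sq_factor] at he'
    rcases mul_eq_zero.mp he' with h5 | h5
    · rw [sub_eq_zero.mp h5] at k4
      simp at k4
      linarith
    · rw [sub_eq_zero.mp h5] at k3
      simp at k3
      linarith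
  · have hlow : Tendsto (fun p : unitInterval × ℝ≥0 => (p.2 : ℝ) * Real.cos θ) (⊤ ×ˢ atTop) atTop :=
      ((NNReal.tendsto_coe_atTop.mpr tendsto_id).comp tendsto_snd).atTop_mul_const S.cos_pos'
    refine tendsto_atTop_mono' _ ?_ hlow
    have h1 := (tendsto_snd (f := (⊤ : Filter unitInterval)) (g := (atTop : Filter ℝ≥0))).eventually
      ((NNReal.tendsto_coe_atTop.mpr tendsto_id).eventually hbig)
    filter_upwards [h1] with p hp
    have hp' : (p.2 : ℝ) ≤ (rotA θ * γ p.2).re := hp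
    have hs0 : 0 ≤ (p.1 : ℝ) := p.1.2.1
    have hs1 : 0 ≤ 1 - (p.1 : ℝ) := by linarith [p.1.2.2]
    have e : (rotA θ * ((1 - (p.1 : ℝ) : ℝ) * γ p.2 + ((p.1 : ℝ) * (p.2 : ℝ) : ℝ))).re =
        (1 - p.1) * (rotA θ * γ p.2).re + p.1 * p.2 * Real.cos θ := by
      rw [mul_add, Complex.add_re, mul_left_comm, mul_comm (rotA θ) ((_ : ℝ) : ℂ),
        Complex.re_ofReal_mul, Complex.re_ofReal_mul, Complex.exp_ofReal_mul_I_re, Real.cos_neg]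
    change _ ≤ (rotA θ * ((1 - (p.1 : ℝ) : ℝ) * γ p.2 + ((p.1 : ℝ) * (p.2 : ℝ) : ℝ))).re
    rw [e]
    have ht0 : 0 ≤ (p.2 : ℝ) := p.2.coe_nonneg
    have := Real.cos_le_one θ
    have h7 := mul_le_mul_of_nonneg_left hp' hs1
    have h8 : (p.2 : ℝ) * Real.cos θ ≤ p.2 := mul_le_of_le_one_right ht0 this
    have h9 := mul_le_mul_of_nonneg_left h8 hs1
    nlinarith

/-- Below the transition the path stays in the wedge and ends at infinity. -/
theorem SaddleAngle.exists_wedge_path (S : SaddleAngle θ φ)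
    (hpos : 0 < arcPhase θ (Real.cos φ) φ) :
    ∃ γ, IsSteepestDescentPath (-θ) (Real.cos φ) γ ∧ ¬ MeetsSaddle (Real.cos φ) γ ∧
      Tendsto γ atTop (Bornology.cobounded ℂ) ∧ DeformableToRealAxis (-θ) γ := by
  have ha : rotA θ ≠ 0 := Complex.exp_ne_zero _
  have hqc : (Real.cos φ : ℂ) ≠ 0 := by exact_mod_cast S.cos_pos.ne'
  obtain ⟨γ, c1, c2, c3⟩ := (isLevel_zero (rotA θ) (Real.cos φ * rotA θ)).exists_path ha
    (mul_ne_zero hqc ha)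
  obtain ⟨t₀, ht₀, ht0⟩ := ((S.wedge_entry c1 c2 c3).and self_mem_nhdsWithin).exists
  -- `phaseIm` is strictly positive at the saddle point, so no real time corresponds to it and the
  -- exit is closed.
  have hw := S.wedge_trap isPreconnected_Ioi (fun t ht => ht) (c1.mono Ioi_subset_Ici_self)
    (fun t ht => c3 t (Ioi_subset_Ici_self ht)) (fun t _ _ he => by
      have h1 : phaseIm θ (Real.cos φ) (Complex.exp (φ * Complex.I)) = 0 := by
        rw [phaseIm, he, Complex.ofReal_im]
      rw [phaseIm_exp_mul_I θ _ S.abs_angle_lt] at h1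
      exact hpos.ne' h1) ht0 ht₀
  refine ⟨_, isSteepestDescentPath_of_isLevel hqc c1 c2 c3, ?_,
    tendsto_comp_coe (S.tendsto_of_wedge c1 c3 hw), S.deformable c1 c2 c3 hw⟩
  rintro ⟨t, ht⟩
  rcases eq_or_ne t 0 with rfl | h
  · simp [c2] at ht
  · exact S.ne_saddle_of_wedge (hw t (NNReal.coe_pos.mpr (pos_iff_ne_zero.mpr h))) ht

end wedge

end Struve

end

noncomputable section

namespace Struve

open MeasureTheory Set

/-! ### The transition -/

section transition

variable {θ φ : ℝ}

/-- The strict maximum of `arcPhase` is now `0`, so `phaseIm` has no other zero on the quarter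
circle. -/
theorem SaddleAngle.eq_saddle_of_norm (S : SaddleAngle θ φ) (h0 : arcPhase θ (Real.cos φ) φ = 0)
    {u : ℂ} (hu : ‖u‖ = 1) (hx : 0 < u.re) (hy : 0 < u.im)
    (hp : phaseIm θ (Real.cos φ) u = 0) : u = Complex.exp (φ * Complex.I) := by
  have h1 : u = Complex.exp (u.arg * Complex.I) := by
    have := Complex.norm_mul_exp_arg_mul_I u
    rw [hu, Complex.ofReal_one, one_mul] at this
    exact this.symm
  have h2 : |u.arg| < Real.pi / 2 := Complex.abs_arg_lt_pi_div_two_iff.mpr (Or.inl hx)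
  have h3 : 0 ≤ u.arg := Complex.arg_nonneg_iff.mpr hy.le
  by_cases hne : u.arg = φ
  · rw [h1, hne]
  · have h4 := arcPhase_lt S.hθ S.hθ' S.hφ S.hφ' h3 (abs_lt.mp h2).2 hne
    rw [h1, phaseIm_exp_mul_I θ _ h2] at hp
    linarith

theorem SaddleAngle.saddle_im (S : SaddleAngle θ φ) : 0 < (Complex.exp (φ * Complex.I)).im := by
  rw [Complex.exp_ofReal_mul_I_im]; exact S.sin_pos

theorem saddle_on_ray (φ : ℝ) : (Complex.exp (φ * Complex.I)).im * Real.cos φ -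
    (Complex.exp (φ * Complex.I)).re * Real.sin φ = 0 := by
  rw [Complex.exp_ofReal_mul_I_im, Complex.exp_ofReal_mul_I_re]; ring

theorem InWedge.re_pos {t : ℝ} {u : ℂ} (S : SaddleAngle θ φ) (h : InWedge θ φ t u) : 0 < u.re := by
  by_contra hx
  push Not at hx
  nlinarith [mul_pos h.1 S.cos_pos, mul_nonneg_of_nonpos_of_nonpos hx (neg_nonpos.mpr S.sin_pos.le),
    h.2.1]

/-- At the transition the path runs into the saddle point. -/
theorem SaddleAngle.exists_path_to_saddle (S : SaddleAngle θ φ)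
    (h0 : arcPhase θ (Real.cos φ) φ = 0) :
    ∃ γ : ℝ → ℂ, ∃ T : ℝ, 0 < T ∧ ContinuousOn γ (Ici 0) ∧ γ 0 = 0 ∧
      (∀ t ∈ Ici (0 : ℝ), IsLevel (rotA θ) (Real.cos φ * rotA θ) t (γ t)) ∧
      γ T = Complex.exp (φ * Complex.I) ∧
      rotA θ * phase (Real.cos φ) (Complex.exp (φ * Complex.I)) = T ∧
      |(rotLog θ (Real.cos φ) T (γ T)).im| < Real.pi := by
  have ha : rotA θ ≠ 0 := Complex.exp_ne_zero _
  have hqc : (Real.cos φ : ℂ) ≠ 0 := by exact_mod_cast S.cos_pos.ne'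
  obtain ⟨γ, c1, c2, c3⟩ := (isLevel_zero (rotA θ) (Real.cos φ * rotA θ)).exists_path ha
    (mul_ne_zero hqc ha)
  set A : Set ℝ := Ici 0 ∩ γ ⁻¹' {Complex.exp (φ * Complex.I)} with hA
  have hAc : IsClosed A := c1.preimage_isClosed_of_isClosed isClosed_Ici isClosed_singleton
  have hbdd : BddBelow A := ⟨0, fun t ht => ht.1⟩
  have hwedge : ∀ t, InWedge θ φ t (γ t) → 0 < t → phaseIm θ (Real.cos φ) (γ t) = 0 := by
    intro t h ht
    rw [phaseIm, (S.closed_wedge ht (c3 t ht.le) h.1.le h.2.1.le h.2.2.le).2.1, Complex.ofReal_im]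
  -- A path that never met the saddle point would run to `∞` inside the wedge and cross the unit
  -- circle at a zero of `phaseIm`, which can only be the saddle point.
  have hne : A.Nonempty := by
    by_contra hemp
    rw [not_nonempty_iff_eq_empty] at hemp
    have hns : ∀ t ∈ Ioi (0 : ℝ), γ t ≠ Complex.exp (φ * Complex.I) := fun t ht h => by
      have : t ∈ A := ⟨Ioi_subset_Ici_self ht, h⟩
      rw [hemp] at this
      exact this
    obtain ⟨t₀, ht₀, ht0⟩ := ((S.wedge_entry c1 c2 c3).and self_mem_nhdsWithin).exists
    have hw := S.wedge_trap isPreconnected_Ioi (fun t ht => ht) (c1.mono Ioi_subset_Ici_self)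
      (fun t ht => c3 t (Ioi_subset_Ici_self ht)) (fun t ht h => absurd h (hns t ht)) ht0 ht₀
    have htend := tendsto_norm_atTop_iff_cobounded.mpr (S.tendsto_of_wedge c1 c3 hw)
    obtain ⟨t₁, h1, h2⟩ := ((htend.eventually_gt_atTop 1).and (eventually_ge_atTop 0)).exists
    obtain ⟨t, ht, ht'⟩ := isPreconnected_Ici.intermediate_value (self_mem_Ici (a := (0 : ℝ)))
      h2 c1.norm ⟨by rw [c2]; simp, h1.le⟩
    have htp : 0 < t := by
      refine lt_of_le_of_ne ht fun h => ?_
      rw [← h] at ht'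
      simp [c2] at ht'
    have hwt := hw t htp
    exact hns t htp (S.eq_saddle_of_norm h0 ht' (hwt.re_pos S) hwt.1 (hwedge t hwt htp))
  have hTA := hAc.csInf_mem hne hbdd
  -- The first time at the saddle point; before it the path is in the wedge, so it arrives on the
  -- principal sheet.
  set T := sInf A with hT
  have hT0 : 0 < T := by
    refine lt_of_le_of_ne hTA.1 fun h => ?_
    have h1 : γ T = Complex.exp (φ * Complex.I) := hTA.2
    rw [← h, c2] at h1
    exact Complex.exp_ne_zero _ h1.symm
  have hTs : γ T = Complex.exp (φ * Complex.I) := hTA.2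
  have hsub : Ioo 0 T ⊆ Ici 0 := fun t ht => ht.1.le
  obtain ⟨t₀, ht₀, ht0⟩ := ((S.wedge_entry c1 c2 c3).and (Ioo_mem_nhdsGT hT0)).exists
  have hw := S.wedge_trap isPreconnected_Ioo (fun t ht => ht.1) (c1.mono hsub)
    (fun t ht => c3 t (hsub ht)) (fun t ht h => absurd (csInf_le hbdd ⟨ht.1.le, h⟩)
      (not_le.mpr ht.2)) ht0 ht₀
  have hβ : |(rotLog θ (Real.cos φ) T (γ T)).im| ≤ Real.pi := by
    have h1 := ((continuousOn_rotLog (θ := θ) (q := Real.cos φ) c1) T hT0.le).mono hsub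
    have h2 := (Complex.continuous_im.abs.tendsto _).comp h1
    have : (𝓝[Ioo 0 T] T).NeBot := by
      rw [nhdsWithin_Ioo_eq_nhdsLT hT0]; infer_instance
    refine le_of_tendsto h2 ?_
    filter_upwards [self_mem_nhdsWithin] with t ht
    exact (hw t ht).2.2.le
  have hcl := S.closed_wedge hT0 (c3 T hT0.le) (by rw [hTs]; exact S.saddle_im.le)
    (by rw [hTs]; exact (saddle_on_ray φ).le) hβ
  refine ⟨γ, T, hT0, c1, c2, c3, hTs, ?_, hcl.1⟩
  rw [← hTs]
  exact hcl.2.1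

/-- The two lines of steepest descent at the saddle point. -/
theorem SaddleAngle.exists_saddle_branch (S : SaddleAngle θ φ) {T : ℝ}
    (hl : IsLevel (rotA θ) (Real.cos φ * rotA θ) T (Complex.exp (φ * Complex.I))) {s : ℝ}
    (hs : s = 1 ∨ s = -1) :
    ∃ ε > 0, ∃ γ : ℝ → ℂ, ContinuousOn γ (Icc T (T + ε)) ∧ γ T = Complex.exp (φ * Complex.I) ∧
      (∀ x ∈ Icc T (T + ε), IsLevel (rotA θ) (Real.cos φ * rotA θ) x (γ x)) ∧
      ∀ᶠ x in 𝓝[>] T, s * ((γ x).im * Real.cos φ - (γ x).re * Real.sin φ) < 0 ∧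
        0 < s * ((γ x).re ^ 2 + (γ x).im ^ 2 - 1) := by
  have hc := S.cos_pos
  have hsp := S.sin_pos
  have ha : rotA θ ≠ 0 := Complex.exp_ne_zero _
  have hqc : (Real.cos φ : ℂ) ≠ 0 := by exact_mod_cast S.cos_pos.ne'
  have hs2 : s ^ 2 = 1 := by rcases hs with rfl | rfl <;> norm_num
  set c : ℝ := Real.sqrt (2 * Real.cos φ / Real.sin φ) with hcdef
  have hc0 : 0 < c := Real.sqrt_pos.mpr (by positivity)
  have hc2 : c ^ 2 * Real.sin φ = 2 * Real.cos φ := by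
    rw [hcdef, Real.sq_sqrt (by positivity)]; field_simp
  -- The equation for `κ` reduces to `κ² = 2 cot φ · e^{i(φ+θ-π/2)}`; this explains the modulus `c`
  -- and the argument `ψ`.
  set ψ : ℝ := (φ + θ) / 2 - Real.pi / 4 with hψ
  set u₀ := Complex.exp (φ * Complex.I) with hu₀
  have hE : u₀ * Complex.exp (-φ * Complex.I) = 1 := by
    rw [hu₀, ← Complex.exp_add]; simp
  have hcos : 2 * (Real.cos φ : ℂ) = u₀ + Complex.exp (-φ * Complex.I) := by
    rw [Complex.ofReal_cos, Complex.two_cos]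
  have hsin : u₀ - Complex.exp (-φ * Complex.I) = 2 * Complex.I * Real.sin φ := by
    rw [hu₀, Complex.exp_mul_I, Complex.exp_mul_I, Complex.cos_neg, Complex.sin_neg]
    push_cast; ring
  have hκ2 : Complex.exp (ψ * Complex.I) ^ 2 * rotA θ = -Complex.I * u₀ := by
    have h1 : -Complex.I = Complex.exp (-(Real.pi / 2 * Complex.I)) := by
      rw [Complex.exp_neg, Complex.exp_pi_div_two_mul_I, Complex.inv_I]
    rw [h1, ← Complex.exp_nat_mul, rotA, hu₀, ← Complex.exp_add, ← Complex.exp_add, hψ]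
    congr 1
    push_cast
    ring
  obtain ⟨ε, hε, γ, g1, g2, g3, w, w1, w2⟩ := hl.exists_branch_path (mul_ne_zero hqc ha)
    (m := fun u => rotA θ * (u - Complex.exp (-φ * Complex.I))) (N := 1)
    (κ := s * c * Complex.exp (ψ * Complex.I)) (by fun_prop)
    (mul_ne_zero ha (by
      rw [hsin]
      have : (Real.sin φ : ℂ) ≠ 0 := by exact_mod_cast hsp.ne'
      exact mul_ne_zero (mul_ne_zero two_ne_zero Complex.I_ne_zero) this))
    (fun u => by linear_combination (-(rotA θ) * u) * hcos - rotA θ * hE) (by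
      have h3 : ((c : ℂ)) ^ 2 * Real.sin φ = 2 * Real.cos φ := by exact_mod_cast hc2
      have h4 : (s : ℂ) ^ 2 = 1 := by exact_mod_cast hs2
      change (s * c * Complex.exp (ψ * Complex.I)) ^ (1 + 1) *
        (rotA θ * (u₀ - Complex.exp (-φ * Complex.I))) = (((1 : ℕ) : ℂ) + 1) * (1 + u₀ ^ 2)
      rw [hsin]
      have h5 : 1 + u₀ ^ 2 = 2 * Real.cos φ * u₀ := by
        linear_combination (-u₀) * hcos - hE
      rw [h5]
      push_cast
      calc ((s : ℂ) * c * Complex.exp (ψ * Complex.I)) ^ (1 + 1) *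
            (rotA θ * (2 * Complex.I * Complex.sin φ)) =
          (s : ℂ) ^ 2 * (c ^ 2 * Complex.sin φ) * (Complex.exp (ψ * Complex.I) ^ 2 * rotA θ) *
            (2 * Complex.I) := by ring
        _ = _ := by
          rw [h4, hκ2]
          push_cast at h3
          rw [h3]
          linear_combination (-4 * Complex.cos φ * u₀) * Complex.I_sq)
  refine ⟨ε, hε, γ, g1, g2, g3, ?_⟩
  -- the direction of departure
  set κ : ℂ := s * c * Complex.exp (ψ * Complex.I) with hκ
  have hκre : κ.re = s * c * Real.cos ψ := by
    rw [hκ, ← Complex.ofReal_mul, Complex.re_ofReal_mul, Complex.exp_ofReal_mul_I_re]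
  have hκim : κ.im = s * c * Real.sin ψ := by
    rw [hκ, ← Complex.ofReal_mul, Complex.im_ofReal_mul, Complex.exp_ofReal_mul_I_im]
  have hre : Tendsto (fun x => ((γ x - u₀) / w x).re) (𝓝[>] T) (𝓝 κ.re) :=
    (Complex.continuous_re.tendsto _).comp w2
  have him : Tendsto (fun x => ((γ x - u₀) / w x).im) (𝓝[>] T) (𝓝 κ.im) :=
    (Complex.continuous_im.tendsto _).comp w2
  -- Since `ψ - φ = (θ-φ)/2 - π/4` lies between `-π/2` and `0`, the branch `s = 1` leaves below the
  -- ray and outside the unit circle, and `s = -1` above the ray and inside the circle.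
  have hη1 : Real.sin (ψ - φ) < 0 :=
    Real.sin_neg_of_neg_of_neg_pi_lt (by rw [hψ]; linarith [S.lt, Real.pi_pos])
      (by rw [hψ]; linarith [S.hφ', S.hθ, Real.pi_pos])
  have hη2 : 0 < Real.cos (ψ - φ) := Real.cos_pos_of_mem_Ioo
    ⟨by rw [hψ]; linarith [S.hφ', S.hθ, Real.pi_pos], by rw [hψ]; linarith [S.lt, Real.pi_pos]⟩
  have hγT : Tendsto γ (𝓝[>] T) (𝓝 u₀) := by
    have h1 := (g1 T ⟨le_rfl, by linarith⟩).mono_of_mem_nhdsWithin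
      (Icc_mem_nhdsGT (show T < T + ε by linarith))
    rw [← g2]
    exact h1
  have hdre : Tendsto (fun x => (γ x - u₀).re) (𝓝[>] T) (𝓝 0) := by
    have := (Complex.continuous_re.tendsto _).comp (hγT.sub_const u₀)
    rw [sub_self] at this
    exact this
  have hdim : Tendsto (fun x => (γ x - u₀).im) (𝓝[>] T) (𝓝 0) := by
    have := (Complex.continuous_im.tendsto _).comp (hγT.sub_const u₀)
    rw [sub_self] at this
    exact this
  have t1 := ((him.mul_const (Real.cos φ)).sub (hre.mul_const (Real.sin φ))).const_mul s
  -- With `d = γ - u₀` one has `|γ|² - 1 = 2 Re(conj u₀ · d) + |d|²`; after division by `w` the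
  -- square tends to `0`.
  have t2 := ((((hre.mul_const (Real.cos φ)).add (him.mul_const (Real.sin φ))).const_mul 2).add
    ((hdre.mul hre).add (hdim.mul him))).const_mul s
  have v1 : s * (κ.im * Real.cos φ - κ.re * Real.sin φ) < 0 := by
    have : s * (κ.im * Real.cos φ - κ.re * Real.sin φ) = c * Real.sin (ψ - φ) := by
      rw [hκre, hκim, Real.sin_sub ψ φ]
      linear_combination (c * (Real.sin ψ * Real.cos φ - Real.cos ψ * Real.sin φ)) * hs2
    rw [this]
    exact mul_neg_of_pos_of_neg hc0 hη1
  have v2 : 0 < s * (2 * (κ.re * Real.cos φ + κ.im * Real.sin φ) + (0 * κ.re + 0 * κ.im)) := by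
    have : s * (2 * (κ.re * Real.cos φ + κ.im * Real.sin φ) + (0 * κ.re + 0 * κ.im)) =
        2 * c * Real.cos (ψ - φ) := by
      rw [hκre, hκim, Real.cos_sub ψ φ]
      linear_combination (2 * c * (Real.cos ψ * Real.cos φ + Real.sin ψ * Real.sin φ)) * hs2
    rw [this]
    positivity
  filter_upwards [t1.eventually_lt_const v1, t2.eventually_const_lt v2, self_mem_nhdsWithin]
    with x h1 h2 hx
  have hwx : 0 < w x := w1 x hx
  have hu1 : u₀.re = Real.cos φ := Complex.exp_ofReal_mul_I_re φ
  have hu2 : u₀.im = Real.sin φ := Complex.exp_ofReal_mul_I_im φ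
  rw [Complex.div_ofReal_re, Complex.div_ofReal_im] at h1 h2
  rw [Complex.sub_re, Complex.sub_im, hu1, hu2] at h1 h2
  constructor
  · have := mul_neg_of_neg_of_pos h1 hwx
    calc _ = _ := ?_
      _ < 0 := this
    field_simp
    ring
  · have := mul_pos h2 hwx
    calc 0 < _ := this
      _ = _ := ?_
    field_simp
    linear_combination (-s) * Real.sin_sq_add_cos_sq φ

/-- The two paths at the transition. -/
theorem SaddleAngle.exists_saddle_paths (S : SaddleAngle θ φ)
    (h0 : arcPhase θ (Real.cos φ) φ = 0) : ∃ (g : ℝ → ℂ) (T : ℝ), 0 < T ∧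
      g T = Complex.exp (φ * Complex.I) ∧
      rotA θ * phase (Real.cos φ) (Complex.exp (φ * Complex.I)) = T ∧
      ∀ s : ℝ, s = 1 ∨ s = -1 → ∃ γ : ℝ → ℂ, ContinuousOn γ (Ici 0) ∧ γ 0 = 0 ∧
        (∀ t ∈ Ici (0 : ℝ), IsLevel (rotA θ) (Real.cos φ * rotA θ) t (γ t)) ∧
        (∀ t ≤ T, γ t = g t) ∧ ∀ᶠ t in 𝓝[>] T, 0 < (γ t).im ∧
          s * ((γ t).im * Real.cos φ - (γ t).re * Real.sin φ) < 0 ∧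
          0 < s * ((γ t).re ^ 2 + (γ t).im ^ 2 - 1) ∧
          |(rotLog θ (Real.cos φ) t (γ t)).im| < Real.pi := by
  have ha : rotA θ ≠ 0 := Complex.exp_ne_zero _
  have hqc : (Real.cos φ : ℂ) ≠ 0 := by exact_mod_cast S.cos_pos.ne'
  obtain ⟨g, T, hT, g1, g2, g3, g4, g5, g6⟩ := S.exists_path_to_saddle h0
  refine ⟨g, T, hT, g4, g5, fun s hs => ?_⟩
  obtain ⟨δ, hδ, β, b1, b2, b3, b4⟩ := S.exists_saddle_branch (g4 ▸ g3 T hT.le) hs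
  have hglue : ContinuousOn (fun x : ℝ => if x ≤ T then g x else β x) (Icc 0 (T + δ)) := by
    rw [← Icc_union_Icc_eq_Icc hT.le (by linarith : T ≤ T + δ)]
    exact continuousOn_glue isClosed_Icc isClosed_Icc (fun x hx => hx.2) (fun x hx => hx.1)
      (g1.mono Icc_subset_Ici_self) b1 (by rw [g4, b2])
  obtain ⟨γ, c1, c2, c3⟩ := exists_path_extending ha (mul_ne_zero hqc ha)
    (show (0 : ℝ) ≤ T + δ by linarith) hglue (fun x hx => by
      split_ifs with h
      · exact g3 x hx.1
      · exact b3 x ⟨(not_le.mp h).le, hx.2⟩)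
  have hγg : ∀ x ≤ T, γ x = g x := fun x hx => by rw [c3 x (by linarith), if_pos hx]
  refine ⟨γ, c1, by rw [hγg 0 hT.le, g2], c2, hγg, ?_⟩
  have hγT : ContinuousWithinAt γ (Ioi T) T := (c1 T hT.le).mono (Ioi_subset_Ici hT.le)
  have him : ∀ᶠ x in 𝓝[>] T, 0 < (γ x).im := by
    refine ((Complex.continuous_im.tendsto _).comp hγT).eventually_const_lt ?_
    rw [hγg T le_rfl, g4]
    exact S.saddle_im
  have hβ : ∀ᶠ x in 𝓝[>] T, |(rotLog θ (Real.cos φ) x (γ x)).im| < Real.pi := by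
    have h1 := ((continuousOn_rotLog (θ := θ) (q := Real.cos φ) c1) T hT.le).mono
      (Ioi_subset_Ici hT.le)
    refine ((Complex.continuous_im.abs.tendsto _).comp h1).eventually_lt_const ?_
    change |(rotLog θ (Real.cos φ) T (γ T)).im| < Real.pi
    rw [hγg T le_rfl]
    exact g6
  filter_upwards [him, hβ, b4, Ioo_mem_nhdsGT (show T < T + δ by linarith)] with x h1 h2 h3 h4
  have e : γ x = β x := by rw [c3 x h4.2.le, if_neg (not_le.mpr h4.1)]
  rw [← e] at h3
  exact ⟨h1, h3.1, h3.2, h2⟩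

/-- The region that the path to `i` does not leave. -/
theorem SaddleAngle.closed_region (S : SaddleAngle θ φ) (h0 : arcPhase θ (Real.cos φ) φ = 0) {t : ℝ}
    (ht : 0 < t) (hs : rotA θ * phase (Real.cos φ) (Complex.exp (φ * Complex.I)) ≠ t) {u : ℂ}
    (h : IsLevel (rotA θ) (Real.cos φ * rotA θ) t u) (h1 : 0 ≤ u.im)
    (h2 : 0 ≤ u.im * Real.cos φ - u.re * Real.sin φ)
    (h3 : (rotLog θ (Real.cos φ) t u).im ≤ Real.pi)
    (h4 : (rotLog θ (Real.cos φ) t u).im ≤ 0 ∨ u.re ^ 2 + u.im ^ 2 ≤ 1) :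
    0 < u.im ∧ 0 < u.im * Real.cos φ - u.re * Real.sin φ ∧
      (rotLog θ (Real.cos φ) t u).im < Real.pi ∧
      ((rotLog θ (Real.cos φ) t u).im < 0 ∨ u.re ^ 2 + u.im ^ 2 < 1) := by
  have hc := S.cos_pos
  have hsp := S.sin_pos
  obtain ⟨e1, e2⟩ := h.cos_sin_rotLog
  obtain ⟨r1, r2⟩ := re_im_rotLog hc.ne' θ t u
  have hph := fun h1 h2 => h.phase_eq hc.ne' h1 h2
  have hpe := h.phaseIm_eq hc.ne'
  set L := rotLog θ (Real.cos φ) t u with hL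
  have hE := Real.exp_pos L.re
  have hu0 : u ≠ 0 := by
    rintro rfl
    exact ht.ne' (h.time_eq_zero S.re_pos)
  have hy : 0 < u.im := by
    refine lt_of_le_of_ne h1 fun hy => ?_
    rw [← hy] at h2 e1
    have hx : u.re ≤ 0 := by
      by_contra hx
      push Not at hx
      nlinarith [mul_pos hx hsp]
    have hα : 0 ≤ L.re := by
      refine Real.one_le_exp_iff.mp ?_
      nlinarith [Real.cos_le_one L.im]
    nlinarith [mul_pos ht S.cos_pos', mul_nonneg hc.le hα]
  -- the principal sheet is excluded on the ray and on the unit circle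
  have hprin : 0 ≤ L.im → L.im < Real.pi → ∀ hx : 0 < u.re,
      phaseIm θ (Real.cos φ) u = 0 ∧ u ≠ Complex.exp (φ * Complex.I) := by
    intro k1 k2 _
    have k3 := hph (by linarith [Real.pi_pos]) k2.le
    refine ⟨by rw [phaseIm, k3, Complex.ofReal_im], fun k4 => hs ?_⟩
    rw [← k4]
    exact k3
  have hV : 0 < u.im * Real.cos φ - u.re * Real.sin φ := by
    refine lt_of_le_of_ne h2 fun hV => ?_
    have k1 := eq_ofReal_mul_exp hc hV.symm
    have hx : 0 < u.re := by
      have : u.re * Real.sin φ = u.im * Real.cos φ := by linarith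
      have : 0 < u.re * Real.sin φ := this ▸ mul_pos hy hc
      exact pos_of_mul_pos_left this hsp.le
    have hρ : 0 < u.re / Real.cos φ := div_pos hx hc
    -- On the ray `phaseIm` and `arg(1+u²)` are both nonnegative, so `phaseIm_eq` bounds the angle
    -- below by `0`: the sheet is principal, where only the saddle point would be possible.
    have hge : 0 ≤ phaseIm θ (Real.cos φ) u := by
      by_cases k2 : u.re / Real.cos φ = 1
      · rw [k1, k2, Complex.ofReal_one, one_mul]; exact S.phaseIm_nonneg
      · rw [k1]; exact (phaseIm_ray_pos S.hθ S.lt S.hφ' S.phaseIm_nonneg hρ k2).le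
    have harg : 0 ≤ Complex.arg (1 + u ^ 2) := by
      refine Complex.arg_nonneg_iff.mpr ?_
      have : (1 + u ^ 2).im = 2 * u.re * u.im := by simp [pow_two]; ring
      rw [this]; positivity
    have hβ : 0 ≤ L.im := by
      rw [hpe] at hge
      have := nonneg_of_mul_nonneg_right hge (mul_pos hc S.cos_pos')
      linarith
    have hβ' : L.im < Real.pi := by
      refine lt_of_le_of_ne h3 fun k2 => ?_
      rw [k2, Real.sin_pi, mul_zero] at e2
      have : 0 < 2 * u.re * u.im := by positivity
      linarith
    obtain ⟨k2, k3⟩ := hprin hβ hβ' hx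
    by_cases k4 : u.re / Real.cos φ = 1
    · exact k3 (by rw [k1, k4]; simp)
    · have := phaseIm_ray_pos S.hθ S.lt S.hφ' S.phaseIm_nonneg hρ k4
      rw [← k1, k2] at this
      exact lt_irrefl _ this
  have hβπ : L.im < Real.pi := by
    refine lt_of_le_of_ne h3 fun k2 => ?_
    rw [k2, Real.sin_pi, mul_zero] at e2
    rw [k2, Real.cos_pi] at e1
    rw [k2] at h4
    have hx : u.re = 0 := by
      have : u.re * u.im = 0 := by linarith
      exact (mul_eq_zero.mp this).resolve_right hy.ne'
    rcases h4 with h4 | h4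
    · linarith [Real.pi_pos]
    · nlinarith
  refine ⟨hy, hV, hβπ, ?_⟩
  -- Two pieces of boundary remain. Angle `0` outside the open disc makes `1+u²` positive with `u`
  -- imaginary and `|u| ≥ 1`, which is impossible. On the unit circle with a nonnegative angle the
  -- point would be `i` or the saddle point. The circle may thus be crossed only on sheets of
  -- negative angle.
  by_contra hcon
  push Not at hcon
  obtain ⟨k1, k2⟩ := hcon
  have hx : 0 ≤ u.re := by
    have : 0 ≤ 2 * u.re * u.im := e2 ▸ mul_nonneg hE.le (Real.sin_nonneg_of_nonneg_of_le_pi k1 h3)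
    by_contra hx
    push Not at hx
    nlinarith [mul_neg_of_neg_of_pos hx hy]
  rcases h4 with h4 | h4
  · have hβ0 : L.im = 0 := le_antisymm h4 k1
    rw [hβ0, Real.sin_zero, mul_zero] at e2
    rw [hβ0, Real.cos_zero, mul_one] at e1
    have hx0 : u.re = 0 := by
      have : u.re * u.im = 0 := by linarith
      exact (mul_eq_zero.mp this).resolve_right hy.ne'
    rw [hx0] at e1 k2
    nlinarith
  · have hx0 : 0 < u.re := by
      refine lt_of_le_of_ne hx fun hx0 => h.ne_zero ?_
      have hy1 : u.im = 1 := by nlinarith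
      have : u = Complex.I := Complex.ext (by simp [← hx0]) (by simp [hy1])
      rw [this, Complex.I_sq]; ring
    obtain ⟨k3, k4⟩ := hprin k1 hβπ hx0
    refine k4 (S.eq_saddle_of_norm h0 ?_ hx0 hy k3)
    rw [Complex.norm_eq_sqrt_sq_add_sq, le_antisymm h4 k2, Real.sqrt_one]

/-- Far out the region forces `Im L < 0` while `Re L ≥ 0`; then `u = te^{iθ} + qL` is below the ray
because `θ < φ`, a contradiction. The upper half-plane excludes `-i`. -/
theorem SaddleAngle.tendsto_I (S : SaddleAngle θ φ) (h0 : arcPhase θ (Real.cos φ) φ = 0)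
    {γ : ℝ → ℂ} {T : ℝ} (hT : 0 < T)
    (hs : rotA θ * phase (Real.cos φ) (Complex.exp (φ * Complex.I)) = T)
    (hγ : ContinuousOn γ (Ici 0))
    (hl : ∀ t ∈ Ici (0 : ℝ), IsLevel (rotA θ) (Real.cos φ * rotA θ) t (γ t))
    (hev : ∀ᶠ t in 𝓝[>] T, 0 < (γ t).im ∧
      (-1) * ((γ t).im * Real.cos φ - (γ t).re * Real.sin φ) < 0 ∧
      0 < (-1) * ((γ t).re ^ 2 + (γ t).im ^ 2 - 1) ∧
      |(rotLog θ (Real.cos φ) t (γ t)).im| < Real.pi) : Tendsto γ atTop (𝓝 Complex.I) := by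
  let O : Set (ℂ × ℂ) := {p | 0 < p.1.im ∧ 0 < p.1.im * Real.cos φ - p.1.re * Real.sin φ ∧
    p.2.im < Real.pi ∧ (p.2.im < 0 ∨ p.1.re ^ 2 + p.1.im ^ 2 < 1)}
  let C : Set (ℂ × ℂ) := {p | 0 ≤ p.1.im ∧ 0 ≤ p.1.im * Real.cos φ - p.1.re * Real.sin φ ∧
    p.2.im ≤ Real.pi ∧ (p.2.im ≤ 0 ∨ p.1.re ^ 2 + p.1.im ^ 2 ≤ 1)}
  have c1 : Continuous fun p : ℂ × ℂ => p.1.im := Complex.continuous_im.comp continuous_fst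
  have c1' : Continuous fun p : ℂ × ℂ => p.1.re := Complex.continuous_re.comp continuous_fst
  have c2 : Continuous fun p : ℂ × ℂ => p.1.im * Real.cos φ - p.1.re * Real.sin φ :=
    (c1.mul_const _).sub (c1'.mul_const _)
  have c3 : Continuous fun p : ℂ × ℂ => p.2.im := Complex.continuous_im.comp continuous_snd
  have c4 : Continuous fun p : ℂ × ℂ => p.1.re ^ 2 + p.1.im ^ 2 := (c1'.pow 2).add (c1.pow 2)
  obtain ⟨t₀, ⟨k1, k2, k3, k4⟩, ht₀⟩ := (hev.and self_mem_nhdsWithin).exists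
  have hsub : Ioi T ⊆ Ici 0 := Ioi_subset_Ici hT.le
  have htrap := invariant_region isPreconnected_Ioi
    (f := fun t => (γ t, rotLog θ (Real.cos φ) t (γ t))) (O := O) (C := C)
    ((hγ.mono hsub).prodMk (continuousOn_rotLog (hγ.mono hsub)))
    ((isOpen_lt continuous_const c1).and ((isOpen_lt continuous_const c2).and
      ((isOpen_lt c3 continuous_const).and
        ((isOpen_lt c3 continuous_const).union (isOpen_lt c4 continuous_const)))))
    ((isClosed_le continuous_const c1).and ((isClosed_le continuous_const c2).and
      ((isClosed_le c3 continuous_const).and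
        ((isClosed_le c3 continuous_const).union (isClosed_le c4 continuous_const)))))
    (fun p hp => ⟨hp.1.le, hp.2.1.le, hp.2.2.1.le, hp.2.2.2.imp le_of_lt le_of_lt⟩)
    (fun t ht hC => S.closed_region h0 (hT.trans ht)
      (by rw [hs]; exact_mod_cast (ne_of_lt (mem_Ioi.mp ht))) (hl t (hsub ht)) hC.1 hC.2.1 hC.2.2.1
        hC.2.2.2) ht₀
    ⟨k1, by linarith, (abs_lt.mp k4).2, Or.inr (by linarith)⟩
  rcases isLevel_ends S.re_pos hγ hl with h | h | h
  · exfalso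
    obtain ⟨t, h1, h2⟩ := (((tendsto_norm_atTop_iff_cobounded.mpr h).eventually_gt_atTop 2).and
      (eventually_gt_atTop T)).exists
    obtain ⟨m1, m2, m3, m4⟩ := htrap t h2
    have ht0 : 0 < t := hT.trans h2
    have hlt := hl t ht0.le
    have h' : Complex.exp (rotLog θ (Real.cos φ) t (γ t)) = 1 + γ t ^ 2 := hlt
    obtain ⟨r1, r2⟩ := re_im_rotLog S.cos_pos.ne' θ t (γ t)
    change 0 < (γ t).im at m1
    change 0 < (γ t).im * Real.cos φ - (γ t).re * Real.sin φ at m2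
    change (rotLog θ (Real.cos φ) t (γ t)).im < 0 ∨ (γ t).re ^ 2 + (γ t).im ^ 2 < 1 at m4
    set L := rotLog θ (Real.cos φ) t (γ t)
    have hα : 0 ≤ L.re := by
      have h5 := congrArg norm h'
      rw [Complex.norm_exp] at h5
      have h6 := norm_sub_norm_le (γ t ^ 2) (-1)
      rw [norm_pow, norm_neg, norm_one, sub_neg_eq_add, add_comm, ← h5] at h6
      exact Real.one_le_exp_iff.mp (by nlinarith)
    have hβ : L.im < 0 := m4.resolve_right fun h7 => by
      have := Complex.sq_norm (γ t)
      rw [Complex.normSq_apply] at this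
      nlinarith
    have h8 : Real.sin θ * Real.cos φ - Real.cos θ * Real.sin φ < 0 := by
      rw [← Real.sin_sub]
      exact Real.sin_neg_of_neg_of_neg_pi_lt (by linarith [S.lt])
        (by linarith [S.hφ', S.hθ, Real.pi_pos])
    rw [r1, r2] at m2
    have h9 := mul_neg_of_pos_of_neg ht0 h8
    have h10 := mul_pos S.cos_pos (mul_pos (neg_pos.mpr hβ) S.cos_pos)
    have h11 := mul_nonneg S.cos_pos.le (mul_nonneg hα S.sin_pos.le)
    nlinarith
  · exact h
  · exfalso
    have h1 := (Complex.continuous_im.tendsto _).comp h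
    have h3 := ge_of_tendsto h1 ((eventually_gt_atTop T).mono fun t ht => (htrap t ht).1.le)
    simp at h3
    linarith

theorem SaddleAngle.tendsto_infinity (S : SaddleAngle θ φ)
    {γ : ℝ → ℂ} {T : ℝ} (hT : 0 < T)
    (hs : rotA θ * phase (Real.cos φ) (Complex.exp (φ * Complex.I)) = T)
    (hγ : ContinuousOn γ (Ici 0))
    (hl : ∀ t ∈ Ici (0 : ℝ), IsLevel (rotA θ) (Real.cos φ * rotA θ) t (γ t))
    (hev : ∀ᶠ t in 𝓝[>] T, InWedge θ φ t (γ t)) : Tendsto γ atTop (Bornology.cobounded ℂ) := by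
  have hsub : Ioi T ⊆ Ici 0 := Ioi_subset_Ici hT.le
  obtain ⟨t₀, h1, ht₀⟩ := (hev.and self_mem_nhdsWithin).exists
  exact S.tendsto_of_wedge hγ hl (S.wedge_trap isPreconnected_Ioi (fun t ht => hT.trans ht)
    (hγ.mono hsub) (fun t ht => hl t (hsub ht))
    (fun t ht _ => by rw [hs]; exact_mod_cast (ne_of_lt (mem_Ioi.mp ht))) ht₀ h1)

/-- The same path up to the saddle point is continued by `s = 1` into the wedge and by `s = -1` into
the region that leads to `i`. -/
theorem SaddleAngle.exists_transition_paths (S : SaddleAngle θ φ)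
    (h0 : arcPhase θ (Real.cos φ) φ = 0) :
    ∃ γ₁ γ₂, IsSteepestDescentPath (-θ) (Real.cos φ) γ₁ ∧
      IsSteepestDescentPath (-θ) (Real.cos φ) γ₂ ∧
      (∃ t₀, (∀ t ≤ t₀, γ₁ t = γ₂ t) ∧ γ₁ t₀ = Complex.exp (φ * Complex.I)) ∧
      Tendsto γ₁ atTop (Bornology.cobounded ℂ) ∧ Tendsto γ₂ atTop (𝓝 Complex.I) := by
  have hqc : (Real.cos φ : ℂ) ≠ 0 := by exact_mod_cast S.cos_pos.ne'
  obtain ⟨g, T, hT, g1, g2, hp⟩ := S.exists_saddle_paths h0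
  obtain ⟨γ₁, c1, c2, c3, c4, c5⟩ := hp 1 (Or.inl rfl)
  obtain ⟨γ₂, d1, d2, d3, d4, d5⟩ := hp (-1) (Or.inr rfl)
  refine ⟨_, _, isSteepestDescentPath_of_isLevel hqc c1 c2 c3,
    isSteepestDescentPath_of_isLevel hqc d1 d2 d3, ⟨⟨T, hT.le⟩, fun t ht => ?_, ?_⟩,
    tendsto_comp_coe (S.tendsto_infinity hT g2 c1 c3 (c5.mono fun t h => ?_)),
    tendsto_comp_coe (S.tendsto_I h0 hT g2 d1 d3 d5)⟩
  · have ht' : (t : ℝ) ≤ T := ht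
    rw [c4 t ht', d4 t ht']
  · change γ₁ T = _
    rw [c4 T le_rfl, g1]
  · exact ⟨h.1, by linarith [h.2.1], h.2.2.2⟩

end transition

end Struve

end

noncomputable section

namespace Struve

open MeasureTheory Set

/-! ### The transition value of `q` -/

/-- `Im (e^{-iθ} (u - q log (1+u²)))` at the saddle point `q + i √(1-q²)`. -/
def saddlePhase (θ q : ℝ) : ℝ := arcPhase θ q (Real.arccos q)

/-- The product `2q log(2q)` is continuous at `q = 0`, so the closed interval is covered. -/
theorem continuousOn_saddlePhase (θ : ℝ) : ContinuousOn (saddlePhase θ) (Icc 0 1) := by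
  have h : Continuous fun q : ℝ => Real.cos θ * (Real.sin (Real.arccos q) - q * Real.arccos q) -
      Real.sin θ * (q - (2 * q) * Real.log (2 * q) / 2) := by
    have h1 : Continuous fun q : ℝ => (2 * q) * Real.log (2 * q) :=
      Real.continuous_mul_log.comp (continuous_const_mul 2)
    have h2 := Real.continuous_arccos
    have h3 : Continuous fun q : ℝ => Real.sin (Real.arccos q) := Real.continuous_sin.comp h2
    exact ((h3.sub (continuous_id.mul h2)).const_mul _).sub
      ((continuous_id.sub (h1.div_const 2)).const_mul _)
  refine h.continuousOn.congr fun q hq => ?_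
  rw [saddlePhase, arcPhase, Real.cos_arccos (by linarith [hq.1]) hq.2]
  ring

theorem saddlePhase_zero_pos {θ : ℝ} (hθ : 0 < θ) (hθ' : θ < Real.pi / 2) :
    0 < saddlePhase θ 0 := by
  rw [saddlePhase, arcPhase, Real.arccos_zero]
  simp only [Real.sin_pi_div_two, Real.cos_pi_div_two, zero_mul, sub_zero, mul_one, mul_zero]
  exact Real.cos_pos_of_mem_Ioo ⟨by linarith [Real.pi_pos], hθ'⟩

theorem saddlePhase_one_neg {θ : ℝ} (hθ : 0 < θ) (hθ' : θ < Real.pi / 2) :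
    saddlePhase θ 1 < 0 := by
  rw [saddlePhase, arcPhase, Real.arccos_one]
  simp only [Real.sin_zero, Real.cos_zero, mul_zero, sub_zero, zero_sub, mul_one, one_mul,
    Left.neg_neg_iff]
  have h1 : Real.log 2 < 1 := by linarith [Real.log_two_lt_d9]
  exact mul_pos (Real.sin_pos_of_pos_of_lt_pi hθ (by linarith)) (by linarith)

/-- The least `q` at which the path of steepest descent meets the saddle point. -/
def transition (θ : ℝ) : ℝ := sInf {q ∈ Icc (0 : ℝ) 1 | saddlePhase θ q ≤ 0}

/-- The sign changes from positive at `q = 0` to negative at `q = 1`. The infimum of the nonpositive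
set provides the first zero, without any claim that it is the only one. -/
theorem transition_spec {θ : ℝ} (hθ : 0 < θ) (hθ' : θ < Real.pi / 2) :
    0 < transition θ ∧ transition θ < 1 ∧ saddlePhase θ (transition θ) = 0 ∧
      ∀ q, 0 < q → q < transition θ → 0 < saddlePhase θ q := by
  set A := {q ∈ Icc (0 : ℝ) 1 | saddlePhase θ q ≤ 0} with hA
  have hc := continuousOn_saddlePhase θ
  have hAc : IsClosed A := hc.preimage_isClosed_of_isClosed isClosed_Icc isClosed_Iic
  have h1 : (1 : ℝ) ∈ A := ⟨⟨zero_le_one, le_rfl⟩, (saddlePhase_one_neg hθ hθ').le⟩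
  have hb : BddBelow A := ⟨0, fun q hq => hq.1.1⟩
  have hQ : transition θ ∈ A := hAc.csInf_mem ⟨1, h1⟩ hb
  have hQ1 : transition θ ≤ 1 := hQ.1.2
  have hz : saddlePhase θ (transition θ) = 0 := by
    obtain ⟨q, hq, hq0⟩ := isPreconnected_Icc.intermediate_value
      (right_mem_Icc.mpr hQ.1.1) (left_mem_Icc.mpr hQ.1.1)
      (hc.mono (Icc_subset_Icc_right hQ1)) ⟨hQ.2, (saddlePhase_zero_pos hθ hθ').le⟩
    have h2 : transition θ ≤ q := csInf_le hb ⟨⟨hq.1, hq.2.trans hQ1⟩, hq0.le⟩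
    rwa [le_antisymm hq.2 h2] at hq0
  refine ⟨lt_of_le_of_ne hQ.1.1 fun h => ?_, lt_of_le_of_ne hQ1 fun h => ?_, hz, fun q h0 h2 => ?_⟩
  · rw [← h] at hz
    exact (saddlePhase_zero_pos hθ hθ').ne' hz
  · rw [h] at hz
    exact (saddlePhase_one_neg hθ hθ').ne hz
  · by_contra hcon
    exact absurd (csInf_le hb ⟨⟨h0.le, h2.le.trans hQ1⟩, not_lt.mp hcon⟩) (not_le.mpr h2)

theorem saddleAngle_arccos {θ q : ℝ} (hθ : 0 < θ) (hθ' : θ < Real.pi / 2) (h0 : 0 < q) (h1 : q < 1)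
    (h : 0 ≤ saddlePhase θ q) : SaddleAngle θ (Real.arccos q) where
  hθ := hθ
  hθ' := hθ'
  hφ := Real.arccos_pos.mpr h1
  hφ' := Real.arccos_lt_pi_div_two.mpr h0
  nonneg := by rwa [Real.cos_arccos (by linarith) h1.le]

theorem norm_conj_tendsto {X : Type*} {l : Filter X} {γ : X → ℂ}
    (h : Tendsto γ l (Bornology.cobounded ℂ)) :
    Tendsto (fun t => (starRingEnd ℂ) (γ t)) l (Bornology.cobounded ℂ) := by
  rw [← tendsto_norm_atTop_iff_cobounded] at h ⊢
  simpa using h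

theorem DeformableToRealAxis.conj {θ : ℝ} {γ : ℝ≥0 → ℂ} (h : DeformableToRealAxis θ γ) :
    DeformableToRealAxis (-θ) fun t => (starRingEnd ℂ) (γ t) := by
  obtain ⟨H, h1, h2, h3, h4, h5, h6⟩ := h
  refine ⟨fun p => (starRingEnd ℂ) (H p), Complex.continuous_conj.comp h1, fun s => by simp [h2],
    fun t => by simp [h3], fun t => by simp [h4], fun p hp => h5 p ?_, h6.congr fun p => ?_⟩
  · have := congrArg (starRingEnd ℂ) hp
    simpa using this
  · rw [← conj_exp_mul_I, ← map_mul, Complex.conj_re]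

theorem not_meetsSaddle_conj {q : ℝ} {γ : ℝ≥0 → ℂ} (h : ¬ MeetsSaddle q γ) :
    ¬ MeetsSaddle q fun t => (starRingEnd ℂ) (γ t) := by
  rintro ⟨t, ht⟩
  refine h ⟨t, ?_⟩
  have := congrArg (starRingEnd ℂ) ht
  simpa [map_ofNat] using this

theorem exists_path_below_transition {θ q : ℝ} (hθ : 0 < θ) (hθ' : θ < Real.pi / 2) (h0 : 0 < q)
    (h1 : q < transition θ) {ε : ℝ} (hε : ε = 1 ∨ ε = -1) :
    ∃ γ, IsSteepestDescentPath (ε * θ) q γ ∧ ¬ MeetsSaddle q γ ∧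
      Tendsto γ atTop (Bornology.cobounded ℂ) ∧ DeformableToRealAxis (ε * θ) γ := by
  obtain ⟨-, k2, -, k4⟩ := transition_spec hθ hθ'
  have hpos := k4 q h0 h1
  have hcos : Real.cos (Real.arccos q) = q := Real.cos_arccos (by linarith) (by linarith)
  obtain ⟨γ, g1, g2, g3, g4⟩ := (saddleAngle_arccos hθ hθ' h0 (h1.trans k2) hpos.le).exists_wedge_path
    (by rw [hcos]; exact hpos)
  rw [hcos] at g1 g2
  rcases hε with rfl | rfl
  · have hq : (q : ℂ) ≠ 0 := by exact_mod_cast h0.ne'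
    have c1 := g1.conj hq
    have c2 := g4.conj
    rw [neg_neg, Complex.conj_ofReal] at c1
    rw [neg_neg] at c2
    rw [one_mul]
    exact ⟨_, c1, not_meetsSaddle_conj g2, norm_conj_tendsto g3, c2⟩
  · rw [neg_one_mul]
    exact ⟨γ, g1, g2, g3, g4⟩

theorem exists_paths_at_transition {θ : ℝ} (hθ : 0 < θ) (hθ' : θ < Real.pi / 2) {ε : ℝ}
    (hε : ε = 1 ∨ ε = -1) :
    ∃ γ₁ γ₂, IsSteepestDescentPath (ε * θ) (transition θ) γ₁ ∧
      IsSteepestDescentPath (ε * θ) (transition θ) γ₂ ∧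
      (∃ t₀, (∀ t ≤ t₀, γ₁ t = γ₂ t) ∧ γ₁ t₀ = (transition θ : ℂ) -
        ε * Complex.I * (Real.sqrt (1 - transition θ ^ 2) : ℂ)) ∧
      Tendsto γ₁ atTop (Bornology.cobounded ℂ) ∧ Tendsto γ₂ atTop (𝓝 (-ε * Complex.I)) := by
  obtain ⟨k1, k2, k3, -⟩ := transition_spec hθ hθ'
  set q := transition θ with hq
  have hcos : Real.cos (Real.arccos q) = q := Real.cos_arccos (by linarith) (by linarith)
  have hE : Complex.exp (Real.arccos q * Complex.I) = q + Complex.I * (Real.sqrt (1 - q ^ 2) : ℂ) := by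
    rw [Complex.exp_mul_I, ← Complex.ofReal_cos, ← Complex.ofReal_sin, hcos, Real.sin_arccos]
    ring
  obtain ⟨γ₁, γ₂, g1, g2, ⟨t₀, g3, g4⟩, g5, g6⟩ :=
    (saddleAngle_arccos hθ hθ' k1 k2 k3.ge).exists_transition_paths (by rw [hcos]; exact k3)
  rw [hcos] at g1 g2
  rw [hE] at g4
  rcases hε with rfl | rfl
  · have hqc : (q : ℂ) ≠ 0 := by exact_mod_cast k1.ne'
    have c1 := g1.conj hqc
    have c2 := g2.conj hqc
    rw [neg_neg, Complex.conj_ofReal] at c1 c2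
    rw [one_mul]
    refine ⟨_, _, c1, c2, ⟨t₀, fun t ht => by rw [g3 t ht], ?_⟩, norm_conj_tendsto g5, ?_⟩
    · simp only [g4]
      simp
      ring
    · have := (Complex.continuous_conj.tendsto _).comp g6
      rw [Complex.conj_I] at this
      rw [Complex.ofReal_one, neg_one_mul]
      exact this
  · rw [neg_one_mul]
    refine ⟨γ₁, γ₂, g1, g2, ⟨t₀, g3, ?_⟩, g5, ?_⟩
    · rw [g4]; push_cast; ring
    · simpa using g6

theorem mul_exp_re (θ q : ℝ) : ((q : ℂ) * Complex.exp (θ * Complex.I)).re = q * Real.cos θ := by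
  rw [Complex.re_ofReal_mul, Complex.exp_ofReal_mul_I_re]

/-- Paths and expansions are independent here. The real axis serves for `q ≤ 1`, and the segment to
`-εi` serves for all `q > 0`, since `-ε sin(εθ) = -sin θ`. -/
theorem exists_transition : ∃ Q : ℝ → ℝ, ∀ θ : ℝ, 0 < θ → θ < Real.pi / 2 →
    0 < Q θ ∧ Q θ < 1 ∧
    ∀ ε : ℝ, ε = 1 ∨ ε = -1 →
      (∀ q : ℝ, 0 < q → q < Q θ →
        (∃ γ, IsSteepestDescentPath (ε * θ) q γ ∧ ¬ MeetsSaddle q γ ∧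
          Tendsto γ atTop (Bornology.cobounded ℂ) ∧ DeformableToRealAxis (ε * θ) γ) ∧
        HYExpansion (ε * θ) q) ∧
      (∃ γ₁ γ₂, IsSteepestDescentPath (ε * θ) (Q θ) γ₁ ∧
        IsSteepestDescentPath (ε * θ) (Q θ) γ₂ ∧
        (∃ t₀, (∀ t ≤ t₀, γ₁ t = γ₂ t) ∧
          γ₁ t₀ = (Q θ : ℂ) - ε * Complex.I * (Real.sqrt (1 - Q θ ^ 2) : ℂ)) ∧
        Tendsto γ₁ atTop (Bornology.cobounded ℂ) ∧
        Tendsto γ₂ atTop (𝓝 (-ε * Complex.I))) ∧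
      (∀ q : ℝ, Q θ ≤ q → HJExpansion (-ε) (ε * θ) q) := by
  refine ⟨transition, fun θ hθ hθ' => ?_⟩
  obtain ⟨k1, k2, -, -⟩ := transition_spec hθ hθ'
  refine ⟨k1, k2, fun ε hε => ?_⟩
  have habs : |ε * θ| < Real.pi / 2 := by
    rcases hε with rfl | rfl
    · rwa [one_mul, abs_of_pos hθ]
    · rwa [neg_one_mul, abs_neg, abs_of_pos hθ]
  have hcos : 0 < Real.cos (ε * θ) := Real.cos_pos_of_mem_Ioo (abs_lt.mp habs)
  refine ⟨fun q h0 h1 => ⟨exists_path_below_transition hθ hθ' h0 h1 hε, ?_⟩,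
    exists_paths_at_transition hθ hθ' hε, fun q hq => ?_⟩
  · refine hyExpansion_of_re_le habs ?_
    rw [mul_exp_re]
    exact mul_le_of_le_one_left hcos.le (by linarith)
  · refine hjExpansion_of_sin_nonpos ?_ ?_ ?_
    · rcases hε with rfl | rfl <;> simp
    · have := Real.sin_pos_of_pos_of_lt_pi hθ (by linarith)
      rcases hε with rfl | rfl <;> simp [this.le]
    · rw [mul_exp_re]
      exact mul_pos (by linarith) hcos

end Struve

end

noncomputable section

namespace Struve

open MeasureTheory Set

/-! ### Primitives along a map -/

/-- A closed difference cocycle on a bounded convex set is a coboundary. -/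
theorem exists_potential {E : Type*} [NormedAddCommGroup E] [NormedSpace ℝ E] {K : Set E}
    (hK : Convex ℝ K) (hb : Bornology.IsBounded K) {p₀ : E} (hp₀ : p₀ ∈ K) (c : E → E → ℂ) {δ : ℝ}
    (hδ : 0 < δ) (hc : ∀ p ∈ K, ∀ p' ∈ K, ∀ p'' ∈ K, dist p p' < δ → dist p p'' < δ →
      dist p' p'' < δ → c p p' + c p' p'' = c p p'') :
    ∃ Φ : E → ℂ, ∀ p ∈ K, ∀ p' ∈ K, dist p p' < δ / 2 → Φ p' - Φ p = c p p' := by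
  obtain ⟨D, hD⟩ := hb.subset_closedBall p₀
  obtain ⟨N, hN⟩ := exists_nat_gt (max 1 (2 * D / δ))
  have hN1 : (1 : ℝ) < N := (le_max_left _ _).trans_lt hN
  have hN0 : (0 : ℝ) < N := by linarith
  have hN2 : D / N < δ / 2 := by
    rw [div_lt_iff₀ hN0]
    have := (div_lt_iff₀ hδ).mp ((le_max_right _ _).trans_lt hN)
    linarith
  -- The segment from `p₀` to `p` in `N` steps shorter than `δ/2`; the potential is the sum of `c`
  -- over the steps.
  let pt : ℕ → E → E := fun i p => AffineMap.lineMap p₀ p ((i : ℝ) / N)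
  have hpt0 : ∀ p, pt 0 p = p₀ := fun p => by simp [pt]
  have hptN : ∀ p, pt N p = p := fun p => by simp [pt, div_self hN0.ne']
  have hptK : ∀ p ∈ K, ∀ i ≤ N, pt i p ∈ K := fun p hp i hi =>
    hK.lineMap_mem hp₀ hp ⟨by positivity, (div_le_one hN0).mpr (by exact_mod_cast hi)⟩
  have hstep : ∀ p ∈ K, ∀ i, dist (pt i p) (pt (i + 1) p) < δ / 2 := fun p hp i => by
    have h1 : dist p₀ p ≤ D := by rw [dist_comm]; exact hD hp
    simp only [pt]
    rw [dist_lineMap_lineMap, Real.dist_eq]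
    have : ((i : ℝ) / N - ((i + 1 : ℕ) : ℝ) / N) = -(1 / N) := by push_cast; ring
    rw [this, abs_neg, abs_of_pos (by positivity), one_div_mul_eq_div]
    exact (div_le_div_of_nonneg_right h1 hN0.le).trans_lt hN2
  have hside : ∀ p p' : E, ∀ i ≤ N, dist (pt i p) (pt i p') ≤ dist p p' := fun p p' i hi => by
    have h1 : (i : ℝ) / N ≤ 1 := (div_le_one hN0).mpr (by exact_mod_cast hi)
    have h0 : 0 ≤ (i : ℝ) / N := by positivity
    simp only [pt, AffineMap.lineMap_apply, vsub_eq_sub, vadd_eq_add, dist_eq_norm]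
    rw [add_sub_add_right_eq_sub, ← smul_sub, sub_sub_sub_cancel_right, norm_smul,
      Real.norm_of_nonneg h0]
    exact mul_le_of_le_one_left (norm_nonneg _) h1
  have hdiag : ∀ p ∈ K, c p p = 0 := fun p hp => by
    have := hc p hp p hp p hp (by simpa) (by simpa) (by simpa)
    simpa using this
  refine ⟨fun p => ∑ i ∈ Finset.range N, c (pt i p) (pt (i + 1) p), fun p hp p' hp' hd => ?_⟩
  -- Two segments with neighbouring ends form a ladder; each of its cells splits into two small
  -- triangles on which `c` is closed.
  have key : ∀ n ≤ N, ∑ i ∈ Finset.range n, c (pt i p') (pt (i + 1) p') -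
      ∑ i ∈ Finset.range n, c (pt i p) (pt (i + 1) p) = c (pt n p) (pt n p') := by
    intro n
    induction n with
    | zero => intro _; simp [hpt0, hdiag p₀ hp₀]
    | succ n ih =>
      intro hn
      have hn' : n ≤ N := Nat.le_of_succ_le hn
      have e1 := hside p p' n hn'
      have e2 := hside p p' (n + 1) hn
      have e3 := hstep p hp n
      have e4 := hstep p' hp' n
      have e5 := dist_triangle (pt n p) (pt n p') (pt (n + 1) p')
      have h1 := hc _ (hptK p hp n hn') _ (hptK p' hp' n hn') _ (hptK p' hp' (n + 1) hn)
        (by linarith) (by linarith) (by linarith)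
      have h2 := hc _ (hptK p hp n hn') _ (hptK p hp (n + 1) hn) _ (hptK p' hp' (n + 1) hn)
        (by linarith) (by linarith) (by linarith)
      rw [Finset.sum_range_succ, Finset.sum_range_succ]
      linear_combination ih hn' + h1 - h2
  have := key N le_rfl
  rwa [hptN, hptN] at this

theorem eventually_eq_of_exp_eq {X : Type*} [TopologicalSpace X] {f g : X → ℂ} {x : X}
    (hf : ContinuousAt f x) (hg : ContinuousAt g x) (hfg : f x = g x)
    (h : ∀ᶠ y in 𝓝 x, Complex.exp (f y) = Complex.exp (g y)) : ∀ᶠ y in 𝓝 x, f y = g y := by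
  have hc : ContinuousAt (fun y => ‖f y - g y‖) x := (hf.sub hg).norm
  have h1 : ∀ᶠ y in 𝓝 x, ‖f y - g y‖ < Real.pi :=
    hc.eventually_lt continuousAt_const (by simp [hfg, Real.pi_pos])
  filter_upwards [h, h1] with y hy hy1
  have him := abs_lt.mp ((Complex.abs_im_le_norm _).trans_lt hy1)
  have h2 := Complex.log_exp him.1 him.2.le
  rw [Complex.exp_sub, hy, div_self (Complex.exp_ne_zero _), Complex.log_one] at h2
  exact (sub_eq_zero.mp h2.symm)

/-- `Φ` is a primitive of `exp (-zu) (1+u²)^(ν-1/2) du` along `h`, where the power is taken with the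
branch `lam` of `log (1+h²)`. -/
def IsPrimAlong {X : Type*} [TopologicalSpace X] (z ν : ℂ) (h lam Φ : X → ℂ) : Prop :=
  ∀ x, ∃ F ℓ : ℂ → ℂ, ℓ (h x) = lam x ∧ ContinuousAt ℓ (h x) ∧
    (∀ᶠ u in 𝓝 (h x), Complex.exp (ℓ u) = 1 + u ^ 2 ∧
      HasDerivAt F (Complex.exp (-z * u + (ν - 1 / 2) * ℓ u)) u) ∧
    ∀ᶠ y in 𝓝 x, Φ y - Φ x = F (h y) - F (h x)

section IsPrimAlong

variable {X : Type*} [TopologicalSpace X] {z ν : ℂ} {h lam Φ Φ' : X → ℂ}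

/-- The branches of the logarithm agree near `h x`, so the local primitives differ by a constant
there; hence `Φ - Φ'` is locally constant. -/
theorem IsPrimAlong.sub_eq_sub [PreconnectedSpace X] (hh : Continuous h)
    (H : IsPrimAlong z ν h lam Φ) (H' : IsPrimAlong z ν h lam Φ') (x y : X) :
    Φ x - Φ y = Φ' x - Φ' y := by
  have hl : IsLocallyConstant fun x => Φ x - Φ' x := by
    refine (IsLocallyConstant.iff_eventually_eq _).mpr fun x => ?_
    obtain ⟨F, ℓ, h1, h2, h3, h4⟩ := H x
    obtain ⟨F', ℓ', h1', h2', h3', h4'⟩ := H' x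
    have hℓ := eventually_eq_of_exp_eq h2 h2' (h1.trans h1'.symm)
      (by filter_upwards [h3, h3'] with u a b; rw [a.1, b.1])
    obtain ⟨ε, hε, hball⟩ := Metric.eventually_nhds_iff_ball.mp (h3.and (h3'.and hℓ))
    have hconst : ∀ u ∈ Metric.ball (h x) ε, F u - F' u = F (h x) - F' (h x) := by
      intro u hu
      have := (convex_ball (h x) ε).norm_image_sub_le_of_norm_hasDerivWithin_le
        (f := fun u => F u - F' u) (f' := fun _ => 0) (C := 0)
        (fun v hv => by
          obtain ⟨a, b, c⟩ := hball v hv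
          have := a.2.sub b.2
          rw [c, sub_self] at this
          exact this.hasDerivWithinAt) (fun v _ => by simp) (Metric.mem_ball_self hε) hu
      rw [zero_mul] at this
      exact sub_eq_zero.mp (norm_le_zero_iff.mp this)
    filter_upwards [h4, h4', (hh.tendsto x).eventually (Metric.ball_mem_nhds _ hε)] with y a b c
    have := hconst _ c
    linear_combination a - b + this
  have := hl.apply_eq_of_preconnectedSpace x y
  linear_combination this

theorem IsPrimAlong.continuous (hh : Continuous h) (H : IsPrimAlong z ν h lam Φ) :
    Continuous Φ := by
  rw [continuous_iff_continuousAt]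
  intro x
  obtain ⟨F, ℓ, -, -, h3, h4⟩ := H x
  have h5 : ContinuousAt (fun y => F (h y) - F (h x) + Φ x) x :=
    ((h3.self_of_nhds.2.continuousAt.comp hh.continuousAt).sub continuousAt_const).add
      continuousAt_const
  exact h5.congr (h4.mono fun y hy => by simp only [← hy]; ring)

theorem IsPrimAlong.hasDerivAt {h lam Φ : ℝ → ℂ} (H : IsPrimAlong z ν h lam Φ) {x : ℝ} {h' : ℂ}
    (hd : HasDerivAt h h' x) :
    HasDerivAt Φ (Complex.exp (-z * h x + (ν - 1 / 2) * lam x) * h') x := by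
  obtain ⟨F, ℓ, h1, -, h3, h4⟩ := H x
  have h5 := h3.self_of_nhds.2
  rw [h1] at h5
  have h6 : HasDerivAt (fun y => F (h y) - F (h x) + Φ x)
      (Complex.exp (-z * h x + (ν - 1 / 2) * lam x) * h') x :=
    ((h5.comp x hd).sub_const _).add_const _
  exact h6.congr_of_eventuallyEq (h4.mono fun y hy => by simp only [← hy]; ring)

/-- It allows a primitive obtained along the homotopy to be compared with an explicit one wherever a
single-valued branch exists. -/
theorem isPrimAlong_of_isOpen {U : Set ℂ} (hU : IsOpen U) (hh : ∀ x, h x ∈ U) {G ℓ : ℂ → ℂ}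
    (hℓ : ContinuousOn ℓ U) (hexp : ∀ u ∈ U, Complex.exp (ℓ u) = 1 + u ^ 2)
    (hG : ∀ u ∈ U, HasDerivAt G (Complex.exp (-z * u + (ν - 1 / 2) * ℓ u)) u)
    (hlam : ∀ x, ℓ (h x) = lam x) : IsPrimAlong z ν h lam (G ∘ h) := fun x =>
  ⟨G, ℓ, hlam x, hℓ.continuousAt (hU.mem_nhds (hh x)), by
    filter_upwards [hU.mem_nhds (hh x)] with u hu using ⟨hexp u hu, hG u hu⟩,
    Eventually.of_forall fun _ => rfl⟩

end IsPrimAlong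

/-- The branch of `log (1+u²)` near `w` with the value `l` at `w`. -/
def nearLog (w l u : ℂ) : ℂ := l + Complex.log ((1 + u ^ 2) / (1 + w ^ 2))

theorem nearLog_self {w l : ℂ} (hw : 1 + w ^ 2 ≠ 0) : nearLog w l w = l := by
  simp [nearLog, div_self hw]

theorem exp_nearLog {w l u : ℂ} (hl : Complex.exp l = 1 + w ^ 2) (hu : 1 + u ^ 2 ≠ 0) :
    Complex.exp (nearLog w l u) = 1 + u ^ 2 := by
  have hw : 1 + w ^ 2 ≠ 0 := hl ▸ Complex.exp_ne_zero l
  rw [nearLog, Complex.exp_add, hl, Complex.exp_log (div_ne_zero hu hw), mul_div_cancel₀ _ hw]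

theorem differentiableAt_nearLog {w l u : ℂ} (h : (1 + u ^ 2) / (1 + w ^ 2) ∈ Complex.slitPlane) :
    DifferentiableAt ℂ (nearLog w l) u := by
  have h1 : DifferentiableAt ℂ (fun u : ℂ => (1 + u ^ 2) / (1 + w ^ 2)) u :=
    DifferentiableAt.div_const (by fun_prop) _
  exact (h1.clog h).const_add l

theorem mem_slitPlane_of_near {w : ℂ} (h : ‖w - 1‖ ≤ 1 / 2) :
    w ∈ Complex.slitPlane ∧ ‖Complex.log w‖ ≤ 3 / 4 := by
  have h1 : w = 1 + (w - 1) := by ring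
  refine ⟨?_, ?_⟩
  · rw [h1]
    exact Complex.mem_slitPlane_of_norm_lt_one (by linarith)
  · have := Complex.norm_log_one_add_half_le_self h
    rw [← h1] at this
    linarith

/-- The branches differ by a multiple of `2πi` and by at most `1 + 3/4 + 3/4 < π`. -/
theorem nearLog_eq {w l w' l' u : ℂ} (hl : Complex.exp l = 1 + w ^ 2)
    (hl' : Complex.exp l' = 1 + w' ^ 2) (hd : ‖l - l'‖ ≤ 1)
    (hu : ‖(1 + u ^ 2) / (1 + w ^ 2) - 1‖ ≤ 1 / 2)
    (hu' : ‖(1 + u ^ 2) / (1 + w' ^ 2) - 1‖ ≤ 1 / 2) : nearLog w l u = nearLog w' l' u := by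
  obtain ⟨s1, n1⟩ := mem_slitPlane_of_near hu
  obtain ⟨s2, n2⟩ := mem_slitPlane_of_near hu'
  have h0 : 1 + u ^ 2 ≠ 0 := fun h => by
    rw [h, zero_div] at s1; simp at s1
  have h1 := exp_nearLog hl h0
  have h2 := exp_nearLog hl' h0
  have h3 : ‖nearLog w l u - nearLog w' l' u‖ < Real.pi := by
    have e : nearLog w l u - nearLog w' l' u = (l - l') +
        (Complex.log ((1 + u ^ 2) / (1 + w ^ 2)) - Complex.log ((1 + u ^ 2) / (1 + w' ^ 2))) := by
      rw [nearLog, nearLog]; ring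
    rw [e]
    have := norm_add_le (l - l') (Complex.log ((1 + u ^ 2) / (1 + w ^ 2)) -
      Complex.log ((1 + u ^ 2) / (1 + w' ^ 2)))
    have := norm_sub_le (Complex.log ((1 + u ^ 2) / (1 + w ^ 2)))
      (Complex.log ((1 + u ^ 2) / (1 + w' ^ 2)))
    linarith [Real.pi_gt_three]
  have him := abs_lt.mp ((Complex.abs_im_le_norm _).trans_lt h3)
  have h4 := Complex.log_exp him.1 him.2.le
  rw [Complex.exp_sub, h1, h2, div_self h0, Complex.log_one] at h4
  exact sub_eq_zero.mp h4.symm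

theorem exists_uniform_radius {M m : ℝ} (hM : 0 ≤ M) (hm : 0 < m) : ∃ ρ > 0, ∀ w : ℂ, ‖w‖ ≤ M →
    m ≤ ‖1 + w ^ 2‖ → ∀ u ∈ Metric.ball w ρ, ‖(1 + u ^ 2) / (1 + w ^ 2) - 1‖ ≤ 1 / 2 := by
  refine ⟨min 1 (m / (2 * (2 * M + 1))), by positivity, fun w hw hw' u hu => ?_⟩
  have hw0 : 1 + w ^ 2 ≠ 0 := norm_pos_iff.mp (hm.trans_le hw')
  rw [mem_ball_iff_norm, lt_min_iff] at hu
  have e : (1 + u ^ 2) / (1 + w ^ 2) - 1 = (u - w) * (2 * w + (u - w)) / (1 + w ^ 2) := by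
    field_simp; ring
  rw [e, norm_div, norm_mul, div_le_iff₀ (hm.trans_le hw')]
  have h1 : ‖2 * w + (u - w)‖ ≤ 2 * M + 1 := by
    refine (norm_add_le _ _).trans ?_
    rw [norm_mul, Complex.norm_ofNat]
    linarith
  have h2 : ‖u - w‖ * (2 * M + 1) ≤ m / 2 := by
    have := (lt_div_iff₀ (by positivity)).mp hu.2
    linarith
  have := mul_le_mul_of_nonneg_left h1 (norm_nonneg (u - w))
  linarith

/-- Primitives along a map exist on compact convex sets. -/
theorem exists_primAlong {E : Type*} [NormedAddCommGroup E] [NormedSpace ℝ E] {K : Set E}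
    (hK : Convex ℝ K) (hKc : IsCompact K) (hne : K.Nonempty) {h lam : E → ℂ} (hh : Continuous h)
    (hlam : Continuous lam) (hexp : ∀ p, Complex.exp (lam p) = 1 + h p ^ 2) (z ν : ℂ) :
    ∃ Φ : E → ℂ, ∀ {X : Type} [TopologicalSpace X] (k : X → E), Continuous k → (∀ x, k x ∈ K) →
      IsPrimAlong z ν (h ∘ k) (lam ∘ k) (Φ ∘ k) := by
  have hw0 : ∀ p, 1 + h p ^ 2 ≠ 0 := fun p => hexp p ▸ Complex.exp_ne_zero _
  obtain ⟨M, hM⟩ := hKc.exists_bound_of_continuousOn hh.continuousOn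
  obtain ⟨p₁, hp₁, hmin⟩ := hKc.exists_isMinOn hne (f := fun p => ‖1 + h p ^ 2‖)
    (Continuous.continuousOn (by fun_prop))
  have hM0 : 0 ≤ M := (norm_nonneg _).trans (hM p₁ hp₁)
  obtain ⟨ρ, hρ, hnear⟩ := exists_uniform_radius hM0 (norm_pos_iff.mpr (hw0 p₁))
  have hnear' : ∀ p ∈ K, ∀ u ∈ Metric.ball (h p) ρ, ‖(1 + u ^ 2) / (1 + h p ^ 2) - 1‖ ≤ 1 / 2 :=
    fun p hp => hnear _ (hM p hp) (hmin hp)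
  have hF : ∀ p, ∃ F : ℂ → ℂ, p ∈ K → ∀ u ∈ Metric.ball (h p) ρ,
      HasDerivAt F (Complex.exp (-z * u + (ν - 1 / 2) * nearLog (h p) (lam p) u)) u := by
    intro p
    by_cases hp : p ∈ K
    · have hd : DifferentiableOn ℂ (fun u =>
          Complex.exp (-z * u + (ν - 1 / 2) * nearLog (h p) (lam p) u)) (Metric.ball (h p) ρ) := by
        intro u hu
        have := differentiableAt_nearLog (l := lam p) (mem_slitPlane_of_near (hnear' p hp u hu)).1
        exact (((differentiableAt_id.const_mul (-z)).add (this.const_mul (ν - 1 / 2))).cexp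
          ).differentiableWithinAt
      obtain ⟨F, hF⟩ := hd.isExactOn_ball
      exact ⟨F, fun _ => hF⟩
    · exact ⟨0, fun h => absurd h hp⟩
  choose F hF using hF
  obtain ⟨δ₁, hδ₁, hu₁⟩ := Metric.uniformContinuousOn_iff.mp
    (hKc.uniformContinuousOn_of_continuous hh.continuousOn) ρ hρ
  obtain ⟨δ₂, hδ₂, hu₂⟩ := Metric.uniformContinuousOn_iff.mp
    (hKc.uniformContinuousOn_of_continuous hlam.continuousOn) 1 one_pos
  obtain ⟨p₀, hp₀⟩ := hne
  have hδ : 0 < min δ₁ δ₂ := lt_min hδ₁ hδ₂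
  -- The cocycle is the increment of a local primitive. It is closed at small distances, because
  -- local primitives for nearby points have the same derivative on the convex intersection of their
  -- discs.
  obtain ⟨Φ, hΦ⟩ := exists_potential hK hKc.isBounded hp₀ (fun p p' => F p (h p') - F p (h p)) hδ
    (by
      intro p hp p' hp' p'' hp'' d1 d2 d3
      have b1 : h p' ∈ Metric.ball (h p) ρ := by
        rw [Metric.mem_ball, dist_comm]; exact hu₁ p hp p' hp' (d1.trans_le (min_le_left _ _))
      have b2 : h p'' ∈ Metric.ball (h p) ρ := by
        rw [Metric.mem_ball, dist_comm]; exact hu₁ p hp p'' hp'' (d2.trans_le (min_le_left _ _))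
      have b3 : h p'' ∈ Metric.ball (h p') ρ := by
        rw [Metric.mem_ball, dist_comm]; exact hu₁ p' hp' p'' hp'' (d3.trans_le (min_le_left _ _))
      have hl : ‖lam p - lam p'‖ ≤ 1 := by
        rw [← dist_eq_norm]; exact (hu₂ p hp p' hp' (d1.trans_le (min_le_right _ _))).le
      have := ((convex_ball (h p) ρ).inter (convex_ball (h p') ρ)
        ).norm_image_sub_le_of_norm_hasDerivWithin_le
        (f := fun u => F p u - F p' u) (f' := fun _ => 0) (C := 0)
        (fun v hv => by
          have := (hF p hp v hv.1).sub (hF p' hp' v hv.2)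
          rw [nearLog_eq (hexp p) (hexp p') hl (hnear' p hp v hv.1) (hnear' p' hp' v hv.2),
            sub_self] at this
          exact this.hasDerivWithinAt) (fun v _ => by simp)
        ⟨b1, Metric.mem_ball_self hρ⟩ ⟨b2, b3⟩
      rw [zero_mul] at this
      linear_combination -(sub_eq_zero.mp (norm_le_zero_iff.mp this)))
  refine ⟨Φ, fun k hk hkK x => ?_⟩
  have hx := hkK x
  refine ⟨F (k x), nearLog (h (k x)) (lam (k x)), nearLog_self (hw0 _),
    (differentiableAt_nearLog ?_).continuousAt, ?_, ?_⟩
  · change (1 + h (k x) ^ 2) / (1 + h (k x) ^ 2) ∈ _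
    rw [div_self (hw0 _)]
    simp
  · filter_upwards [Metric.ball_mem_nhds (h (k x)) hρ] with u hu
    have hs := (mem_slitPlane_of_near (hnear' _ hx u hu)).1
    exact ⟨exp_nearLog (hexp _) fun h0 => by rw [h0, zero_div] at hs; simp at hs, hF _ hx u hu⟩
  · filter_upwards [(hk.tendsto x).eventually (Metric.ball_mem_nhds _ (half_pos hδ))] with y hy
    rw [dist_comm] at hy
    exact hΦ _ hx _ (hkK y) hy

end Struve

end

noncomputable section

namespace Struve

open MeasureTheory Set

/-! ### Homotopy of contours -/

/-- An integral of `e^{-rt} dv(t)` by parts, with a bounded velocity for large `t`. -/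
theorem side_bound {v D : ℝ → ℂ} {S : Set ℝ} (hS : S.Countable) {t₁ T₀ M : ℝ} (h01 : t₁ < T₀)
    (hv : Continuous v) (hvd : ∀ t ∈ Ioo t₁ T₀ \ S, HasDerivAt v (D t) t)
    (hM : ∀ t, T₀ ≤ t → ‖D t‖ ≤ M) (hST : ∀ t, T₀ ≤ t → t ∉ S) :
    ∃ C, ∀ r : ℝ, 1 ≤ r → ∀ T, T₀ < T → ∀ Φ : ℝ → ℂ, Continuous Φ →
      (∀ t ∈ Ioo t₁ T \ S, HasDerivAt Φ (Real.exp (-(r * t)) * D t) t) →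
      ‖Φ T - Φ t₁‖ ≤ C * Real.exp (-(r * t₁)) := by
  obtain ⟨V, hV⟩ := isCompact_Icc.exists_bound_of_continuousOn (s := Icc t₁ T₀) hv.continuousOn
  have hM0 : 0 ≤ M := (norm_nonneg _).trans (hM T₀ le_rfl)
  have hV0 : 0 ≤ V := (norm_nonneg _).trans (hV t₁ ⟨le_rfl, h01.le⟩)
  refine ⟨3 * V + M, fun r hr T hT Φ hΦ hΦd => ?_⟩
  have hr0 : 0 < r := by linarith
  have he : ∀ t : ℝ, HasDerivAt (fun t : ℝ => Real.exp (-(r * t))) (-r * Real.exp (-(r * t))) t := by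
    intro t
    have := (((hasDerivAt_id t).const_mul r).neg).exp
    simpa [mul_comm] using this
  have hec : Continuous fun t : ℝ => Real.exp (-(r * t)) := by fun_prop
  have hmono : Real.exp (-(r * T₀)) ≤ Real.exp (-(r * t₁)) :=
    Real.exp_le_exp.mpr (by nlinarith)
  -- The velocity may be unbounded near saddle points, but its primitive `v` is bounded. Integration
  -- by parts therefore gives an estimate that is uniform in `r`.
  have h1 : ‖(Φ T₀ - Real.exp (-(r * T₀)) * v T₀) - (Φ t₁ - Real.exp (-(r * t₁)) * v t₁)‖ ≤
      V * Real.exp (-(r * t₁)) := by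
    have hfc : Continuous fun t : ℝ => ((r * Real.exp (-(r * t)) : ℝ) : ℂ) * v t :=
      (Complex.continuous_ofReal.comp (hec.const_mul r)).mul hv
    have hint := integral_eq_of_hasDerivAt_off_countable_of_le
      (fun t => Φ t - Real.exp (-(r * t)) * v t) (fun t => ((r * Real.exp (-(r * t)) : ℝ) : ℂ) * v t)
      h01.le hS (hΦ.sub ((Complex.continuous_ofReal.comp hec).mul hv)).continuousOn
      (fun t ht => by
        have d1 := hΦd t ⟨⟨ht.1.1, ht.1.2.trans hT⟩, ht.2⟩
        have d2 := ((he t).ofReal_comp).mul (hvd t ht)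
        refine (d1.sub d2).congr_deriv ?_
        push_cast
        ring)
      (hfc.intervalIntegrable _ _)
    rw [← hint]
    have hb : ∀ t ∈ Ioc t₁ T₀, ‖((r * Real.exp (-(r * t)) : ℝ) : ℂ) * v t‖ ≤
        V * (r * Real.exp (-(r * t))) := by
      intro t ht
      rw [norm_mul, Complex.norm_real, Real.norm_of_nonneg (by positivity), mul_comm]
      exact mul_le_mul_of_nonneg_right (hV t ⟨ht.1.le, ht.2⟩) (by positivity)
    refine (intervalIntegral.norm_integral_le_of_norm_le h01.le (ae_of_all _ hb)
      (Continuous.intervalIntegrable (by fun_prop) _ _)).trans ?_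
    rw [intervalIntegral.integral_const_mul]
    refine mul_le_mul_of_nonneg_left ?_ hV0
    rw [intervalIntegral.integral_eq_sub_of_hasDerivAt (f := fun t => -Real.exp (-(r * t)))
      (fun t _ => (show HasDerivAt (fun t => -Real.exp (-(r * t))) (r * Real.exp (-(r * t))) t by
        simpa using (he t).fun_neg)) (Continuous.intervalIntegrable (by fun_prop) _ _)]
    linarith [Real.exp_pos (-(r * T₀))]
  -- Beyond `T₀` there are no saddle points, and the bound `M` on the velocity is integrated
  -- directly.
  have h2 : ‖Φ T - Φ T₀‖ ≤ M * Real.exp (-(r * t₁)) := by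
    have := image_norm_le_of_norm_deriv_right_le_deriv_boundary
      (f := fun t => Φ t - Φ T₀) (f' := fun t => Real.exp (-(r * t)) * D t) (a := T₀) (b := T)
      (B := fun t => M / r * (Real.exp (-(r * T₀)) - Real.exp (-(r * t))))
      (B' := fun t => M * Real.exp (-(r * t)))
      (hΦ.sub continuous_const).continuousOn
      (fun t ht => ((hΦd t ⟨⟨h01.trans_le ht.1, ht.2⟩, hST t ht.1⟩).sub_const _).hasDerivWithinAt)
      (by simp) (fun t => by
        refine (((he t).const_sub (Real.exp (-(r * T₀)))).const_mul (M / r)).congr_deriv ?_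
        field_simp)
      (fun t ht => by
        rw [norm_mul, Complex.norm_real, Real.norm_of_nonneg (Real.exp_pos _).le, mul_comm]
        exact mul_le_mul_of_nonneg_right (hM t ht.1) (Real.exp_pos _).le)
      (right_mem_Icc.mpr hT.le)
    refine this.trans ?_
    have h3 : M / r ≤ M := div_le_self hM0 hr
    have h4 : Real.exp (-(r * T₀)) - Real.exp (-(r * T)) ≤ Real.exp (-(r * t₁)) := by
      linarith [Real.exp_pos (-(r * T))]
    have h5 : 0 ≤ Real.exp (-(r * T₀)) - Real.exp (-(r * T)) :=
      sub_nonneg.mpr (Real.exp_le_exp.mpr (by nlinarith))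
    exact mul_le_mul h3 h4 h5 hM0
  have n1 : ‖(Real.exp (-(r * T₀)) : ℂ) * v T₀‖ ≤ V * Real.exp (-(r * t₁)) := by
    rw [norm_mul, Complex.norm_real, Real.norm_of_nonneg (Real.exp_pos _).le,
      mul_comm]
    exact mul_le_mul (hV T₀ ⟨h01.le, le_rfl⟩) hmono (Real.exp_pos _).le hV0
  have n2 : ‖(Real.exp (-(r * t₁)) : ℂ) * v t₁‖ ≤ V * Real.exp (-(r * t₁)) := by
    rw [norm_mul, Complex.norm_real, Real.norm_of_nonneg (Real.exp_pos _).le,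
      mul_comm]
    exact mul_le_mul_of_nonneg_right (hV t₁ ⟨le_rfl, h01.le⟩) (Real.exp_pos _).le
  have e : Φ T - Φ t₁ = (Φ T - Φ T₀) + ((Φ T₀ - Real.exp (-(r * T₀)) * v T₀) -
      (Φ t₁ - Real.exp (-(r * t₁)) * v t₁)) + Real.exp (-(r * T₀)) * v T₀ -
      Real.exp (-(r * t₁)) * v t₁ := by ring
  rw [e]
  have m1 := norm_sub_le ((Φ T - Φ T₀) + ((Φ T₀ - Real.exp (-(r * T₀)) * v T₀) -
      (Φ t₁ - Real.exp (-(r * t₁)) * v t₁)) + Real.exp (-(r * T₀)) * v T₀)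
      (Real.exp (-(r * t₁)) * v t₁)
  have m2 := norm_add_le ((Φ T - Φ T₀) + ((Φ T₀ - Real.exp (-(r * T₀)) * v T₀) -
      (Φ t₁ - Real.exp (-(r * t₁)) * v t₁))) (Real.exp (-(r * T₀)) * v T₀)
  have m3 := norm_add_le (Φ T - Φ T₀) ((Φ T₀ - Real.exp (-(r * T₀)) * v T₀) -
      (Φ t₁ - Real.exp (-(r * t₁)) * v t₁))
  linarith

theorem phaseIntegrand_eq_exp (q z : ℂ) {u : ℂ} (hu : 1 + u ^ 2 ≠ 0) :
    phaseIntegrand q z u =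
      Complex.exp (-z * u + (q * z - 1 / 2) * Complex.log (1 + u ^ 2)) := by
  rw [← exp_mul_cpow_eq_phaseIntegrand hu, Complex.cpow_def_of_ne_zero hu, ← Complex.exp_add]
  congr 1
  ring

/-- There are at most two saddle points, and each is met at countably many times because fibres of
`exp` are countable. The fundamental theorem of calculus tolerates such a set. -/
theorem countable_saddle_times {θ : ℝ} {q : ℂ} (hq : q ≠ 0) {γ : ℝ≥0 → ℂ}
    (hγ : IsSteepestDescentPath θ q γ) :
    {t : ℝ | 0 ≤ t ∧ 1 + γ t.toNNReal ^ 2 = 2 * q * γ t.toNNReal}.Countable := by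
  have ha : Complex.exp (θ * Complex.I) ≠ 0 := Complex.exp_ne_zero _
  have hb : q * Complex.exp (θ * Complex.I) ≠ 0 := mul_ne_zero hq ha
  have hfin : {u : ℂ | 1 + u ^ 2 = 2 * q * u}.Countable := by
    rcases Set.eq_empty_or_nonempty {u : ℂ | 1 + u ^ 2 = 2 * q * u} with h | ⟨u, hu⟩
    · rw [h]; exact countable_empty
    · refine (Set.toFinite {u, 2 * q - u}).countable.mono fun v hv => ?_
      have hu' : 1 + u ^ 2 = 2 * q * u := hu
      have hv' : 1 + v ^ 2 = 2 * q * v := hv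
      have : (v - u) * (v - (2 * q - u)) = 0 := by linear_combination hv' - hu'
      rcases mul_eq_zero.mp this with h | h
      · exact Or.inl (sub_eq_zero.mp h)
      · exact Or.inr (sub_eq_zero.mp h)
  have hlev : ∀ u : ℂ, {t : ℝ | IsLevel (Complex.exp (θ * Complex.I))
      (q * Complex.exp (θ * Complex.I)) t u}.Countable := by
    intro u
    have h1 : (Complex.exp ⁻¹' {1 + u ^ 2}).Countable :=
      Complex.countable_preimage_exp.mpr (countable_singleton _)
    refine h1.preimage_of_injOn (f := fun t : ℝ => (Complex.exp (θ * Complex.I) * u - t) /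
      (q * Complex.exp (θ * Complex.I))) fun s _ t _ hst => ?_
    have := (div_left_inj' hb).mp hst
    exact_mod_cast sub_right_injective this
  refine (hfin.biUnion fun u _ => hlev u).mono fun t ht => ?_
  exact mem_biUnion ht.2 (hγ.isLevel hq ht.1)

section homotopy

variable {θ : ℝ} {q : ℂ} {γ : ℝ≥0 → ℂ} {H : unitInterval × ℝ≥0 → ℂ}

/-- The homotopy, extended to the plane. -/
def extendHomotopy (H : unitInterval × ℝ≥0 → ℂ) (p : ℝ × ℝ) : ℂ :=
  H (projIcc 0 1 zero_le_one p.1, p.2.toNNReal)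

theorem continuous_extendHomotopy (hH : Continuous H) : Continuous (extendHomotopy H) :=
  hH.comp ((continuous_projIcc.comp continuous_fst).prodMk
    (continuous_real_toNNReal.comp continuous_snd))

theorem extendHomotopy_left (p : ℝ) : extendHomotopy H (0, p) = H (0, p.toNNReal) := by
  rw [extendHomotopy, projIcc_left]; rfl

theorem extendHomotopy_right (p : ℝ) : extendHomotopy H (1, p) = H (1, p.toNNReal) := by
  rw [extendHomotopy, projIcc_right]; rfl

/-- The logarithm of `1 + u²` continued along the path. -/
def pathLog (θ : ℝ) (q : ℂ) (γ : ℝ≥0 → ℂ) (t : ℝ) : ℂ :=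
  (Complex.exp (θ * Complex.I) * γ t.toNNReal - ((max t 0 : ℝ) : ℂ)) /
    (q * Complex.exp (θ * Complex.I))

theorem pathLog_of_nonneg {t : ℝ} (ht : 0 ≤ t) : pathLog θ q γ t =
    (Complex.exp (θ * Complex.I) * γ t.toNNReal - t) / (q * Complex.exp (θ * Complex.I)) := by
  rw [pathLog, max_eq_left ht]

theorem exp_pathLog (hq : q ≠ 0) (hγ : IsSteepestDescentPath θ q γ) (t : ℝ) :
    Complex.exp (pathLog θ q γ t) = 1 + γ t.toNNReal ^ 2 := by
  have h1 := ((isSteepestDescentPath_iff hq).mp hγ).2.2 t.toNNReal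
  rw [IsLevel, Real.coe_toNNReal'] at h1
  exact h1

theorem continuous_pathLog (hγ : Continuous γ) : Continuous (pathLog θ q γ) := by
  unfold pathLog
  have h1 : Continuous fun t : ℝ => γ t.toNNReal := hγ.comp continuous_real_toNNReal
  have h2 : Continuous fun t : ℝ => ((max t 0 : ℝ) : ℂ) := by fun_prop
  exact ((continuous_const.mul h1).sub h2).div_const _

theorem mul_pathLog (hq : q ≠ 0) {t : ℝ} (ht : 0 ≤ t) :
    q * Complex.exp (θ * Complex.I) * pathLog θ q γ t =
      Complex.exp (θ * Complex.I) * γ t.toNNReal - t := by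
  rw [pathLog_of_nonneg ht]
  field_simp [Complex.exp_ne_zero (θ * Complex.I)]

/-- The velocity of the path. -/
def pathVelocity (θ : ℝ) (q : ℂ) (γ : ℝ≥0 → ℂ) (t : ℝ) : ℂ :=
  (1 + γ t.toNNReal ^ 2) / (Complex.exp (θ * Complex.I) * (1 + γ t.toNNReal ^ 2) -
    2 * (q * Complex.exp (θ * Complex.I)) * γ t.toNNReal)

theorem hasDerivAt_path (hq : q ≠ 0) (hγ : IsSteepestDescentPath θ q γ) {t : ℝ} (ht : 0 < t)
    (hs : 1 + γ t.toNNReal ^ 2 ≠ 2 * q * γ t.toNNReal) :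
    HasDerivAt (fun t : ℝ => γ t.toNNReal) (pathVelocity θ q γ t) t := by
  have ha : Complex.exp (θ * Complex.I) ≠ 0 := Complex.exp_ne_zero _
  have := IsLevel.hasDerivAt (mul_ne_zero hq ha) (s := Ici 0) (γ := fun t : ℝ => γ t.toNNReal) ht.le
    hγ.continuous_toNNReal.continuousWithinAt (fun t ht => hγ.isLevel hq ht)
    (fun h => hs ((meetsSaddle_iff ha).mp h))
  exact this.hasDerivAt (Ici_mem_nhds ht)

theorem eventually_projIcc_eq {c d t : ℝ} (hcd : c ≤ d) (ht : t ∈ Ioo c d) :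
    ∀ᶠ s in 𝓝 t, (projIcc c d hcd s : ℝ) = s := by
  filter_upwards [Ioo_mem_nhds ht.1 ht.2] with s hs
  rw [projIcc_of_mem hcd ⟨hs.1.le, hs.2.le⟩]

/-- A contour may be deformed into a path of steepest descent. -/
theorem hasExpansion_of_homotopy {F : ℂ → ℂ → ℂ} {e : ℂ} {x x' : ℝ → ℝ} (hq : q ≠ 0)
    (hγ : IsSteepestDescentPath θ q γ) (hH : Continuous H) (hH0 : ∀ s, H (s, 0) = 0)
    (hHl : ∀ t, H (0, t) = γ t) (hHr : ∀ t : ℝ≥0, H (1, t) = (x t : ℝ) * e)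
    (hH1 : ∀ p, 1 + H p ^ 2 ≠ 0) (hxd : ∀ t, 0 < t → HasDerivAt x (x' t) t)
    (hxs : ∀ t, 0 ≤ t → 1 + ((x t : ℝ) * e : ℂ) ^ 2 ∈ Complex.slitPlane)
    {M : ℝ} (hM : ∀ᶠ t : ℝ in atTop, 1 + γ t.toNNReal ^ 2 ≠ 2 * q * γ t.toNNReal ∧
      ‖Complex.exp (-(1 / 2) * pathLog θ q γ t) * pathVelocity θ q γ t‖ ≤ M)
    (hend : ∀ r : ℝ, 1 ≤ r → ∀ η > 0, ∀ᶠ T in atTop, ∀ lam Φ : ℝ → ℂ, Continuous lam →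
      (∀ s, Complex.exp (lam s) = 1 + extendHomotopy H (s, T) ^ 2) → lam 0 = pathLog θ q γ T →
      lam 1 = Complex.log (1 + ((x T : ℝ) * e : ℂ) ^ 2) →
      IsPrimAlong (rayPoint θ r) (q * rayPoint θ r) (fun s => extendHomotopy H (s, T)) lam Φ →
      ‖Φ 1 - Φ 0‖ ≤ η)
    (hF : ∀ r : ℝ, 1 ≤ r → ∃ (w : ℝ → ℂ) (J : ℂ), ContinuousOn w (Ici 0) ∧ w 0 = 0 ∧
      (∀ t, 0 < t → HasDerivAt w (phaseIntegrand q (rayPoint θ r) ((x t : ℝ) * e) * (x' t * e)) t) ∧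
      Tendsto w atTop (𝓝 J) ∧ F (q * rayPoint θ r) (rayPoint θ r) =
        prefactor (q * rayPoint θ r) (rayPoint θ r) * (rayPoint θ r * J)) :
    HasExpansion F θ q := by
  have ha : Complex.exp (θ * Complex.I) ≠ 0 := Complex.exp_ne_zero _
  have hb : q * Complex.exp (θ * Complex.I) ≠ 0 := mul_ne_zero hq ha
  obtain ⟨ρ, hρ, hslit, hmain⟩ := exists_ball_hasExpansion q
  set h := extendHomotopy H with hdef
  have hh : Continuous h := continuous_extendHomotopy hH
  have hγc : Continuous fun t : ℝ => γ t.toNNReal := hγ.continuous_toNNReal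
  -- the logarithm along the homotopy
  obtain ⟨Λ, ⟨hΛ0, hΛ⟩, -⟩ := Complex.isCoveringMapOn_exp.existsUnique_continuousMap_lifts
    (A := ℝ × ℝ) ⟨fun p => 1 + h p ^ 2, by fun_prop⟩ (a₀ := (0, 0)) (e₀ := 0)
    (by simp [hdef, extendHomotopy, hH0]) (fun p => show 1 + H _ ^ 2 ≠ 0 from hH1 _)
  have hΛe : ∀ p, Complex.exp (Λ p) = 1 + h p ^ 2 := fun p => congrFun hΛ p
  have hΛc : Continuous Λ := Λ.continuous
  have h_left : ∀ t : ℝ, h (0, t) = γ t.toNNReal := fun t => by rw [hdef, extendHomotopy_left, hHl]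
  have h_right : ∀ t : ℝ, 0 ≤ t → h (1, t) = (x t : ℝ) * e := fun t ht => by
    rw [hdef, extendHomotopy_right, hHr, Real.coe_toNNReal t ht]
  have h_zero : ∀ s : ℝ, h (s, 0) = 0 := fun s => by
    rw [hdef, extendHomotopy, Real.toNNReal_zero, hH0]
  have hx0 : ((x 0 : ℝ) : ℂ) * e = 0 := by rw [← h_right 0 le_rfl, h_zero]
  have hΛl : ∀ t : ℝ, Λ (0, t) = pathLog θ q γ t := by
    refine congrFun (eq_of_exp_eq (f := fun t : ℝ => Λ (0, t)) (g := pathLog θ q γ) (by fun_prop)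
      (continuous_pathLog hγ.1) (fun t => by rw [hΛe, h_left, exp_pathLog hq hγ]) (x₀ := 0) ?_)
    rw [hΛ0, pathLog_of_nonneg le_rfl, Real.toNNReal_zero, hγ.2.1]
    simp
  have hΛz : ∀ s : ℝ, Λ (s, 0) = 0 := by
    refine congrFun (eq_of_exp_eq (f := fun s : ℝ => Λ (s, 0)) (g := fun _ => 0) (by fun_prop)
      continuous_const (fun s => by rw [hΛe, h_zero]; simp) (x₀ := 0) hΛ0)
  have hΛr : ∀ t : ℝ, 0 ≤ t → Λ (1, t) = Complex.log (1 + ((x t : ℝ) * e : ℂ) ^ 2) := by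
    have hs : ∀ t : ℝ, 1 + h (1, max t 0) ^ 2 ∈ Complex.slitPlane := fun t => by
      rw [h_right _ (le_max_right _ _)]; exact hxs _ (le_max_right _ _)
    have hc : Continuous fun t : ℝ => 1 + h (1, max t 0) ^ 2 := by fun_prop
    intro t ht
    have := congrFun (eq_of_exp_eq (f := fun t : ℝ => Λ (1, max t 0))
      (g := fun t => Complex.log (1 + h (1, max t 0) ^ 2)) (by fun_prop) (hc.clog hs)
      (fun t => by rw [hΛe, Complex.exp_log (Complex.slitPlane_ne_zero (hs t))]) (x₀ := 0)
      (by simp [hΛz, h_zero])) t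
    simpa only [max_eq_left ht, h_right t ht] using this
  set S : Set ℝ := {t : ℝ | 0 ≤ t ∧ 1 + γ t.toNNReal ^ 2 = 2 * q * γ t.toNNReal} with hSdef
  have hS : S.Countable := countable_saddle_times hq hγ
  obtain ⟨T₀', hT₀'⟩ := eventually_atTop.mp hM
  set T₀ := max T₀' 1 with hT₀
  have hT0M : ∀ t, T₀ ≤ t → 1 + γ t.toNNReal ^ 2 ≠ 2 * q * γ t.toNNReal ∧
      ‖Complex.exp (-(1 / 2) * pathLog θ q γ t) * pathVelocity θ q γ t‖ ≤ M := fun t ht =>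
    hT₀' t ((le_max_left _ _).trans ht)
  have hT01 : 1 ≤ T₀ := le_max_right _ _
  -- The path is cut at time `t₁`: before it Watson's lemma applies, after it the integrand is of
  -- size `e^{-rt}` with `t ≥ t₁`.
  obtain ⟨t₁, ht₁, ht₁1, ht₁b⟩ : ∃ t₁ : ℝ, 0 < t₁ ∧ t₁ < 1 ∧
      ∀ t ∈ Icc 0 t₁, γ t.toNNReal ∈ Metric.ball 0 ρ := by
    have h0 : ∀ᶠ t in 𝓝 (0 : ℝ), γ t.toNNReal ∈ Metric.ball 0 ρ :=
      hγc.continuousAt.eventually_mem (by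
        rw [Real.toNNReal_zero, hγ.2.1]; exact Metric.ball_mem_nhds _ hρ)
    obtain ⟨ε, hε, hball⟩ := Metric.eventually_nhds_iff_ball.mp h0
    refine ⟨min (ε / 2) (1 / 2), by positivity, (min_le_right _ _).trans_lt (by norm_num),
      fun t ht => hball t ?_⟩
    rw [mem_ball_zero_iff, Real.norm_of_nonneg ht.1]
    exact (ht.2.trans (min_le_left _ _)).trans_lt (by linarith)
  -- the principal logarithm near the origin
  let k₁ : ℝ → ℝ := fun t => projIcc 0 t₁ ht₁.le t
  have hk₁c : Continuous k₁ := continuous_subtype_val.comp continuous_projIcc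
  have hk₁ : ∀ t, k₁ t ∈ Icc 0 t₁ := fun t => (projIcc 0 t₁ ht₁.le t).2
  have hk₁0 : k₁ 0 = 0 := by simp [k₁]
  have hk₁1 : k₁ t₁ = t₁ := by simp [k₁]
  have hlog₁ : ∀ t, Complex.log (1 + γ (k₁ t).toNNReal ^ 2) = pathLog θ q γ (k₁ t) := by
    have hs : ∀ t, 1 + γ (k₁ t).toNNReal ^ 2 ∈ Complex.slitPlane := fun t =>
      hslit _ (ht₁b _ (hk₁ t))
    have hc : Continuous fun t : ℝ => 1 + γ (k₁ t).toNNReal ^ 2 :=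
      ((hγc.comp hk₁c).pow 2).const_add 1
    refine congrFun (eq_of_exp_eq (hc.clog hs) ((continuous_pathLog hγ.1).comp hk₁c)
      (fun t => by
        rw [Complex.exp_log (Complex.slitPlane_ne_zero (hs t)),
          exp_pathLog hq hγ]) (x₀ := 0) ?_)
    rw [hk₁0, ← hΛl, hΛz, Real.toNNReal_zero, hγ.2.1]
    simp
  have hphase : Complex.exp (θ * Complex.I) * phase q (γ t₁.toNNReal) = t₁ := by
    have h1 := hlog₁ t₁
    rw [hk₁1] at h1
    rw [phase, h1]
    linear_combination -(mul_pathLog (θ := θ) (γ := γ) hq ht₁.le)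
  -- paths in the rectangle
  have hrect : ∀ T : ℝ, 0 ≤ T → Convex ℝ (Icc (0 : ℝ) 1 ×ˢ Icc 0 T) ∧
      IsCompact (Icc (0 : ℝ) 1 ×ˢ Icc 0 T) ∧ (Icc (0 : ℝ) 1 ×ˢ Icc 0 T).Nonempty := fun T hT =>
    ⟨(convex_Icc _ _).prod (convex_Icc _ _), isCompact_Icc.prod isCompact_Icc,
      ⟨(0, 0), ⟨le_rfl, zero_le_one⟩, le_rfl, hT⟩⟩
  have hleft : ∀ (z ν : ℂ) (T : ℝ) (hT : 0 ≤ T) (Φ : ℝ → ℂ),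
      IsPrimAlong z ν (fun t => h (0, (projIcc 0 T hT t : ℝ)))
        (fun t => Λ (0, (projIcc 0 T hT t : ℝ))) Φ → ∀ t ∈ Ioo 0 T \ S,
      HasDerivAt Φ (Complex.exp (-z * γ t.toNNReal + (ν - 1 / 2) * pathLog θ q γ t) *
        pathVelocity θ q γ t) t := by
    intro z ν T hT Φ hΦ t ht
    have h1 := hasDerivAt_path hq hγ ht.1.1 fun h => ht.2 ⟨ht.1.1.le, h⟩
    have h2 : HasDerivAt (fun t => h (0, (projIcc 0 T hT t : ℝ))) (pathVelocity θ q γ t) t :=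
      h1.congr_of_eventuallyEq ((eventually_projIcc_eq hT ht.1).mono fun s hs => by
        simp only [hs, h_left])
    have h3 := hΦ.hasDerivAt h2
    have h4 := (eventually_projIcc_eq hT ht.1).self_of_nhds
    simpa only [h4, h_left, hΛl] using h3
  have hproj : ∀ T (hT : 0 ≤ T), Continuous fun t : ℝ => (projIcc 0 T hT t : ℝ) := fun T hT =>
    continuous_subtype_val.comp continuous_projIcc
  -- the integral along the path
  obtain ⟨C, hC⟩ : ∃ C, ∀ r : ℝ, 1 ≤ r → ∀ T, T₀ < T → ∀ Φ : ℝ → ℂ, Continuous Φ →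
      (∀ t ∈ Ioo t₁ T \ S, HasDerivAt Φ (Real.exp (-(r * t)) *
        (Complex.exp (-(1 / 2) * pathLog θ q γ t) * pathVelocity θ q γ t)) t) →
      ‖Φ T - Φ t₁‖ ≤ C * Real.exp (-(r * t₁)) := by
    have hT00 : (0 : ℝ) ≤ T₀ := by linarith
    -- With `z = ν = 0` this is a primitive of `(1+u²)^(-1/2) du` along the path, the part of the
    -- integrand that does not depend on `r`.
    obtain ⟨v, hv⟩ := exists_primAlong (hrect T₀ hT00).1 (hrect T₀ hT00).2.1 (hrect T₀ hT00).2.2 hh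
      hΛc hΛe 0 0
    have hv' := hv (fun t : ℝ => ((0 : ℝ), (projIcc 0 T₀ hT00 t : ℝ)))
      (continuous_const.prodMk (hproj _ _)) fun t => ⟨⟨le_rfl, zero_le_one⟩, (projIcc 0 T₀ hT00 t).2⟩
    refine side_bound hS (by linarith) (hv'.continuous (hh.comp (continuous_const.prodMk (hproj _ _))))
      (fun t ht => ?_) (fun t ht => (hT0M t ht).2) (fun t ht hts => (hT0M t ht).1 hts.2)
    refine (hleft 0 0 T₀ hT00 _ hv' t ⟨⟨ht₁.trans ht.1.1, ht.1.2⟩, ht.2⟩).congr_deriv ?_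
    congr 2
    ring
  refine hmain θ (γ t₁.toNNReal) F t₁ C (ht₁b t₁ ⟨ht₁.le, le_rfl⟩) ht₁
    (by rw [hphase, Complex.ofReal_re]; exact ht₁) ?_
  filter_upwards [eventually_ge_atTop 1] with r hr
  set z := rayPoint θ r with hz
  have hdo : DifferentiableOn ℂ (phaseIntegrand q z) (Metric.ball 0 ρ) := fun w hw =>
    (differentiableAt_phaseIntegrand (hslit w hw)).differentiableWithinAt
  obtain ⟨B, hB⟩ := hdo.isExactOn_ball
  obtain ⟨w, J, w1, w2, w3, w4, w5⟩ := hF r hr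
  refine ⟨B, J - (B (γ t₁.toNNReal) - B 0), hB, ?_, by rw [w5]; ring⟩
  -- The deformation is truncated at a time `T` so late that its top side and the tail of the
  -- straight integral are each at most `η/2`.
  refine le_of_forall_pos_le_add fun η hη => ?_
  obtain ⟨T, ⟨hT1, hT2⟩, hT3⟩ := (((hend r hr (η / 2) (by positivity)).and
    (Metric.tendsto_nhds.mp w4 (η / 2) (by positivity))).and (eventually_gt_atTop T₀)).exists
  have hT : 0 ≤ T := by linarith
  obtain ⟨Φ, hΦ⟩ := exists_primAlong (hrect T hT).1 (hrect T hT).2.1 (hrect T hT).2.2 hh hΛc hΛe z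
    (q * z)
  -- the four sides
  have p01 := continuous_subtype_val.comp (continuous_projIcc (h := (zero_le_one : (0 : ℝ) ≤ 1)))
  have hbot : Φ (1, 0) = Φ (0, 0) := by
    have h1 := hΦ (fun s : ℝ => ((projIcc 0 1 zero_le_one s : ℝ), (0 : ℝ)))
      (p01.prodMk continuous_const) fun s => ⟨(projIcc 0 1 zero_le_one s).2, le_rfl, hT⟩
    have h2 : IsPrimAlong z (q * z) (h ∘ fun s : ℝ => ((projIcc 0 1 zero_le_one s : ℝ), (0 : ℝ)))
        (Λ ∘ fun s : ℝ => ((projIcc 0 1 zero_le_one s : ℝ), (0 : ℝ))) (fun _ => 0) := by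
      intro s
      obtain ⟨F, ℓ, a1, a2, a3, -⟩ := h1 s
      exact ⟨F, ℓ, a1, a2, a3, Eventually.of_forall fun y => by simp [h_zero]⟩
    have h3 := IsPrimAlong.sub_eq_sub (hh.comp (p01.prodMk continuous_const)) h1 h2 1 0
    simp only [Function.comp_apply, projIcc_right, projIcc_left, sub_self] at h3
    exact sub_eq_zero.mp h3
  have htop : ‖Φ (1, T) - Φ (0, T)‖ ≤ η / 2 := by
    have h1 := hΦ (fun s : ℝ => ((projIcc 0 1 zero_le_one s : ℝ), T))
      (p01.prodMk continuous_const) fun s => ⟨(projIcc 0 1 zero_le_one s).2, hT, le_rfl⟩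
    have e1 : ∀ s : ℝ, h ((projIcc 0 1 zero_le_one s : ℝ), T) = h (s, T) := fun s => by
      rw [hdef, extendHomotopy, extendHomotopy, projIcc_val]
    have h2 := hT1 (fun s : ℝ => Λ ((projIcc 0 1 zero_le_one s : ℝ), T))
      (fun s : ℝ => Φ ((projIcc 0 1 zero_le_one s : ℝ), T))
      (hΛc.comp (p01.prodMk continuous_const)) (fun s => by rw [hΛe, e1])
      (by rw [projIcc_left]; exact hΛl T) (by rw [projIcc_right]; exact hΛr T hT) (by
        have e2 : (fun s => h (s, T)) = h ∘ fun s : ℝ => ((projIcc 0 1 zero_le_one s : ℝ), T) :=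
          funext fun s => (e1 s).symm
        rw [e2]
        exact h1)
    simpa only [projIcc_left, projIcc_right] using h2
  have hrt : Φ (1, T) - Φ (1, 0) = w T := by
    have hk : Continuous fun t : ℝ => ((1 : ℝ), (projIcc 0 T hT t : ℝ)) :=
      continuous_const.prodMk (hproj _ _)
    have h1 := hΦ (fun t : ℝ => ((1 : ℝ), (projIcc 0 T hT t : ℝ))) hk fun t =>
      ⟨⟨zero_le_one, le_rfl⟩, (projIcc 0 T hT t).2⟩
    have h2 := h1.continuous (hh.comp hk)
    have h3 := integral_eq_of_hasDerivAt_off_countable_of_le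
      (fun t => (Φ ∘ fun t : ℝ => ((1 : ℝ), (projIcc 0 T hT t : ℝ))) t - w t) (fun _ => 0) hT
      countable_empty (h2.continuousOn.sub (w1.mono Icc_subset_Ici_self)) (fun t ht => by
        have ht' : t ∈ Ioo 0 T := ht.1
        have d1 : HasDerivAt (h ∘ fun t : ℝ => ((1 : ℝ), (projIcc 0 T hT t : ℝ)))
            ((x' t : ℂ) * e) t := by
          refine ((hxd t ht'.1).ofReal_comp.mul_const e).congr_of_eventuallyEq ?_
          filter_upwards [eventually_projIcc_eq hT ht', Ioi_mem_nhds ht'.1] with s hs hs0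
          simp only [Function.comp_apply, hs, h_right s (le_of_lt hs0)]
        have d2 := h1.hasDerivAt d1
        have d3 := (eventually_projIcc_eq hT ht').self_of_nhds
        have d4 := d2.sub (w3 t ht'.1)
        refine d4.congr_deriv ?_
        simp only [Function.comp_apply, d3, h_right t ht'.1.le, hΛr t ht'.1.le]
        rw [phaseIntegrand_eq_exp _ _ (Complex.slitPlane_ne_zero (hxs t ht'.1.le)), sub_self])
      (by simp)
    simp only [intervalIntegral.integral_zero, Function.comp_apply, projIcc_left, projIcc_right, w2]
      at h3
    linear_combination -h3
  have hk0 : Continuous fun t : ℝ => ((0 : ℝ), (projIcc 0 T hT t : ℝ)) :=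
    continuous_const.prodMk (hproj _ _)
  have hside : ‖Φ (0, T) - Φ (0, t₁)‖ ≤ C * Real.exp (-(r * t₁)) := by
    have h1 := hΦ (fun t : ℝ => ((0 : ℝ), (projIcc 0 T hT t : ℝ))) hk0 fun t =>
      ⟨⟨le_rfl, zero_le_one⟩, (projIcc 0 T hT t).2⟩
    have h2 := hC r hr T hT3 _ (h1.continuous (hh.comp hk0)) fun t ht => by
      have ht0 : 0 < t := ht₁.trans ht.1.1
      refine (hleft z (q * z) T hT _ h1 t ⟨⟨ht0, ht.1.2⟩, ht.2⟩).congr_deriv ?_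
      -- On the path `-zγ + qzL = -rt`, so the integrand is `e^{-rt}` times the part that does not
      -- involve `r`.
      rw [← mul_assoc, Complex.ofReal_exp, ← Complex.exp_add]
      congr 2
      have := mul_pathLog (θ := θ) (γ := γ) hq ht0.le
      rw [hz, rayPoint]
      push_cast
      linear_combination (r : ℂ) * this
    have e1 : (projIcc 0 T hT t₁ : ℝ) = t₁ := by
      rw [projIcc_of_mem hT ⟨ht₁.le, by linarith⟩]
    simpa only [Function.comp_apply, projIcc_right, e1] using h2
  have hstart : Φ (0, t₁) - Φ (0, 0) = B (γ t₁.toNNReal) - B 0 := by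
    have hk : Continuous fun t : ℝ => ((0 : ℝ), k₁ t) := continuous_const.prodMk hk₁c
    have h1 := hΦ (fun t : ℝ => ((0 : ℝ), k₁ t)) hk fun t =>
      ⟨⟨le_rfl, zero_le_one⟩, (hk₁ t).1, (hk₁ t).2.trans (by linarith)⟩
    have h2 : IsPrimAlong z (q * z) (h ∘ fun t : ℝ => ((0 : ℝ), k₁ t))
        (Λ ∘ fun t : ℝ => ((0 : ℝ), k₁ t)) (B ∘ (h ∘ fun t : ℝ => ((0 : ℝ), k₁ t))) := by
      refine isPrimAlong_of_isOpen (U := Metric.ball 0 ρ) Metric.isOpen_ball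
        (fun t => by rw [Function.comp_apply, h_left]; exact ht₁b _ (hk₁ t))
        (ℓ := fun u => Complex.log (1 + u ^ 2)) (ContinuousOn.clog (by fun_prop) hslit)
        (fun u hu => Complex.exp_log (Complex.slitPlane_ne_zero (hslit u hu)))
        (fun u hu => ?_) (fun t => ?_)
      · rw [← phaseIntegrand_eq_exp _ _ (Complex.slitPlane_ne_zero (hslit u hu))]
        exact hB u hu
      · simp only [Function.comp_apply, h_left, hΛl]
        exact hlog₁ t
    have h3 := IsPrimAlong.sub_eq_sub (hh.comp hk) h1 h2 t₁ 0
    simpa only [Function.comp_apply, hk₁0, hk₁1, h_left, Real.toNNReal_zero, hγ.2.1] using h3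
  have hw : ‖J - w T‖ ≤ η / 2 := by
    rw [← dist_eq_norm, dist_comm]; exact hT2.le
  have e1 : J - (B (γ t₁.toNNReal) - B 0) =
      (J - w T) + (Φ (1, T) - Φ (0, T)) + (Φ (0, T) - Φ (0, t₁)) := by
    linear_combination -hrt - hbot + hstart
  rw [e1]
  have m1 := norm_add_le ((J - w T) + (Φ (1, T) - Φ (0, T))) (Φ (0, T) - Φ (0, t₁))
  have m2 := norm_add_le (J - w T) (Φ (1, T) - Φ (0, T))
  linarith

end homotopy

end Struve

end

noncomputable section

namespace Struve

open MeasureTheory Set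

/-! ### Paths to infinity -/

/-- The logarithm is bounded by its tangent at `k`, with `k` so large that `3A/k ≤ c/2`; half of the
decay survives. -/
theorem tendsto_mul_exp_neg_log {c : ℝ} (hc : 0 < c) {A : ℝ} (hA : 0 ≤ A) (B : ℝ) :
    Tendsto (fun T : ℝ => T * Real.exp (-(c * T) + A * Real.log (1 + 3 * T) + B)) atTop (𝓝 0) := by
  have h1 : Tendsto (fun T : ℝ => T * Real.exp (-T)) atTop (𝓝 0) := by
    simpa using Real.tendsto_pow_mul_exp_neg_atTop_nhds_zero 1
  have h2 : Tendsto (fun T : ℝ => c / 2 * T) atTop atTop :=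
    tendsto_id.const_mul_atTop (by positivity)
  have h3 := ((h1.comp h2).const_mul (2 / c)).mul_const
    (Real.exp (A * (Real.log (6 * A / c + 1) + 1 / (6 * A / c + 1)) + B))
  rw [mul_zero, zero_mul] at h3
  refine squeeze_zero' ?_ ?_ h3
  · filter_upwards [eventually_ge_atTop 0] with T hT
    positivity
  · filter_upwards [eventually_ge_atTop 0] with T hT
    set k := 6 * A / c + 1 with hk
    have hk0 : 0 < k := by positivity
    have e : 2 / c * ((fun T : ℝ => T * Real.exp (-T)) ∘ fun T => c / 2 * T) T *
        Real.exp (A * (Real.log k + 1 / k) + B) =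
        T * Real.exp (-(c / 2 * T) + (A * (Real.log k + 1 / k) + B)) := by
      simp only [Function.comp_apply]
      rw [Real.exp_add (-(c / 2 * T))]
      field_simp
    rw [e]
    refine mul_le_mul_of_nonneg_left (Real.exp_le_exp.mpr ?_) hT
    have h4 : Real.log (1 + 3 * T) ≤ (1 + 3 * T) / k + Real.log k := by
      have := Real.log_le_sub_one_of_pos (show 0 < (1 + 3 * T) / k by positivity)
      rw [Real.log_div (by positivity) hk0.ne'] at this
      linarith
    have h5 : A * (3 * T / k) ≤ c / 2 * T := by
      have : A * 3 / k ≤ c / 2 := by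
        rw [div_le_iff₀ hk0, hk]
        have : c / 2 * (6 * A / c + 1) = 3 * A + c / 2 := by field_simp; ring
        linarith
      calc A * (3 * T / k) = A * 3 / k * T := by ring
        _ ≤ _ := mul_le_mul_of_nonneg_right this hT
    have h6 := mul_le_mul_of_nonneg_left h4 hA
    have h7 : A * ((1 + 3 * T) / k + Real.log k) = A * (3 * T / k) +
      A * (Real.log k + 1 / k) := by ring
    linarith

/-- A branch of `log (1 + u²)` in the half-plane `Re (e^{iθ} u) > 1`. -/
theorem exists_log_halfPlane {θ : ℝ} (hθ : |θ| < Real.pi / 2) : ∃ ℓ : ℂ → ℂ,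
    ∀ u, 1 < (Complex.exp (θ * Complex.I) * u).re →
      DifferentiableAt ℂ ℓ u ∧ Complex.exp (ℓ u) = 1 + u ^ 2 ∧ |(ℓ u).im| ≤ 2 * Real.pi := by
  set a := Complex.exp (θ * Complex.I) with ha
  have hI : |(a * Complex.I).re| ≤ 1 := by
    refine (Complex.abs_re_le_norm _).trans ?_
    rw [norm_mul, Complex.norm_I, mul_one, ha, Complex.norm_exp_ofReal_mul_I]
  refine ⟨fun u => Complex.log (a * (u - Complex.I)) + Complex.log (a * (u + Complex.I)) -
    2 * (θ * Complex.I), fun u hu => ?_⟩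
  have h1 : 0 < (a * (u - Complex.I)).re := by
    rw [mul_sub, Complex.sub_re]; linarith [le_abs_self (a * Complex.I).re]
  have h2 : 0 < (a * (u + Complex.I)).re := by
    rw [mul_add, Complex.add_re]; linarith [neg_abs_le (a * Complex.I).re]
  refine ⟨?_, ?_, ?_⟩
  · have d1 : DifferentiableAt ℂ (fun u => a * (u - Complex.I)) u := by fun_prop
    have d2 : DifferentiableAt ℂ (fun u => a * (u + Complex.I)) u := by fun_prop
    exact ((d1.clog (Or.inl h1)).add (d2.clog (Or.inl h2))).sub_const _
  · rw [Complex.exp_sub, Complex.exp_add, Complex.exp_log (ne_zero_of_re_pos h1),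
      Complex.exp_log (ne_zero_of_re_pos h2), two_mul, Complex.exp_add, ← ha]
    have : a ≠ 0 := Complex.exp_ne_zero _
    field_simp
    linear_combination -Complex.I_sq
  · have e : (Complex.log (a * (u - Complex.I)) + Complex.log (a * (u + Complex.I)) -
        2 * (θ * Complex.I)).im = Complex.arg (a * (u - Complex.I)) +
        Complex.arg (a * (u + Complex.I)) - 2 * θ := by
      simp [Complex.log_im]
    change |(Complex.log (a * (u - Complex.I)) + Complex.log (a * (u + Complex.I)) -
        2 * (θ * Complex.I)).im| ≤ _
    rw [e]
    have a1 := abs_lt.mp (Complex.abs_arg_lt_pi_div_two_iff.mpr (Or.inl h1))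
    have a2 := abs_lt.mp (Complex.abs_arg_lt_pi_div_two_iff.mpr (Or.inl h2))
    have a3 := abs_lt.mp hθ
    rw [abs_le]
    constructor <;> linarith

theorem re_eq_log_norm_of_exp_eq {l w : ℂ} (h : Complex.exp l = w) : l.re = Real.log ‖w‖ := by
  rw [← h, Complex.norm_exp, Real.log_exp]

theorem one_le_norm_one_add_sq {u : ℂ} (hu : 2 ≤ ‖u‖) : 1 ≤ ‖1 + u ^ 2‖ := by
  have := norm_sub_norm_le (u ^ 2) (-1)
  rw [norm_pow, norm_neg, norm_one, sub_neg_eq_add, add_comm (u ^ 2)] at this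
  nlinarith

theorem norm_one_add_sq_le (u : ℂ) : ‖1 + u ^ 2‖ ≤ (1 + ‖u‖) ^ 2 := by
  have := norm_add_le 1 (u ^ 2)
  rw [norm_pow, norm_one] at this
  nlinarith [norm_nonneg u]

theorem mul_re_le_norm_mul {w l : ℂ} (hl : 0 ≤ l.re) : (w * l).re ≤ ‖w‖ * (l.re + |l.im|) := by
  rw [Complex.mul_re]
  have h1 := mul_le_mul_of_nonneg_right (Complex.re_le_norm w) hl
  have h2 : -(w.im * l.im) ≤ |w.im| * |l.im| := by
    rw [← abs_mul]; exact neg_le_abs _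
  have h3 := mul_le_mul_of_nonneg_right (Complex.abs_im_le_norm w) (abs_nonneg l.im)
  linarith

/-- The part of a deformation near infinity. -/
theorem norm_sub_le_of_halfPlane {θ r m R V : ℝ} {q : ℂ} (hθ : |θ| < Real.pi / 2) (hr : 0 ≤ r)
    (hm : 2 ≤ m) {h lam Φ : ℝ → ℂ} (hh : Continuous h)
    (hU : ∀ s, 1 < (Complex.exp (θ * Complex.I) * h s).re) (hlam : Continuous lam)
    (hexp : ∀ s, Complex.exp (lam s) = 1 + h s ^ 2) (hl1 : (lam 1).im = 0)
    (hV : ‖q * rayPoint θ r‖ ≤ V)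
    (hΦ : IsPrimAlong (rayPoint θ r) (q * rayPoint θ r) h lam Φ) :
    |(lam 0).im| ≤ 4 * Real.pi ∧ ((∀ s ∈ ({0, 1} : Set ℝ),
      m ≤ (Complex.exp (θ * Complex.I) * h s).re ∧ ‖h s‖ ≤ R) →
    ‖Φ 1 - Φ 0‖ ≤ Real.exp (-(r * m) + V * (2 * Real.log (1 + R) + 4 * Real.pi)) * (2 * R)) := by
  set a := Complex.exp (θ * Complex.I) with ha
  have hpi := Real.pi_pos
  obtain ⟨ℓ₀, hℓ₀⟩ := exists_log_halfPlane hθ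
  -- The branch reached by the deformation differs from the standard one by a period; it is bounded
  -- because the logarithm is real at the end on the axis.
  set κ := lam 1 - ℓ₀ (h 1) with hκ
  set U : Set ℂ := {u | 1 < (a * u).re} with hUdef
  have hUo : IsOpen U := isOpen_lt continuous_const (by fun_prop)
  have hlin : ∀ c : ℝ, Convex ℝ {u : ℂ | c ≤ (a * u).re} := fun c =>
    (convex_halfSpace_ge (f := fun u : ℂ => (a * u).re)
      ⟨fun x y => by rw [mul_add, Complex.add_re], fun k x => by
        rw [mul_smul_comm, Complex.smul_re]⟩ c)
  have hUc : Convex ℝ U := convex_halfSpace_gt (f := fun u : ℂ => (a * u).re)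
      ⟨fun x y => by rw [mul_add, Complex.add_re], fun k x => by
        rw [mul_smul_comm, Complex.smul_re]⟩ 1
  have hκe : Complex.exp κ = 1 := by
    rw [hκ, Complex.exp_sub, hexp, (hℓ₀ _ (hU 1)).2.1, div_self (hexp 1 ▸ Complex.exp_ne_zero _)]
  have hκre : κ.re = 0 := by
    rw [re_eq_log_norm_of_exp_eq hκe, norm_one, Real.log_one]
  set ℓ : ℂ → ℂ := fun u => ℓ₀ u + κ with hℓdef
  have hℓd : ∀ u ∈ U, DifferentiableAt ℂ ℓ u := fun u hu => (hℓ₀ u hu).1.add_const _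
  have hℓe : ∀ u ∈ U, Complex.exp (ℓ u) = 1 + u ^ 2 := fun u hu => by
    rw [hℓdef, Complex.exp_add, hκe, mul_one, (hℓ₀ u hu).2.1]
  have hκim : |κ.im| ≤ 2 * Real.pi := by
    rw [hκ, Complex.sub_im, hl1, zero_sub, abs_neg]; exact (hℓ₀ _ (hU 1)).2.2
  have hℓim : ∀ u ∈ U, |(ℓ u).im| ≤ 4 * Real.pi := fun u hu => by
    rw [hℓdef, Complex.add_im]
    have := abs_add_le (ℓ₀ u).im κ.im
    linarith [(hℓ₀ u hu).2.2]
  have hlaml : ∀ s, ℓ (h s) = lam s := by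
    have hc : Continuous fun s => ℓ (h s) := by
      rw [continuous_iff_continuousAt]
      exact fun s => (hℓd _ (hU s)).continuousAt.comp hh.continuousAt
    exact congrFun (eq_of_exp_eq hc hlam (fun s => by rw [hℓe _ (hU s), hexp]) (x₀ := 1)
      (by rw [hℓdef, hκ]; ring))
  refine ⟨hlaml 0 ▸ hℓim _ (hU 0), fun hends => ?_⟩
  set z := rayPoint θ r with hz
  have hg : DifferentiableOn ℂ (fun u => Complex.exp (-z * u + (q * z - 1 / 2) * ℓ u)) U :=
    fun u hu => (((differentiableAt_id.const_mul (-z)).add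
      ((hℓd u hu).const_mul (q * z - 1 / 2))).cexp).differentiableWithinAt
  obtain ⟨G, hG⟩ : ∃ G : ℂ → ℂ, ∀ u ∈ U,
      HasDerivAt G (Complex.exp (-z * u + (q * z - 1 / 2) * ℓ u)) u := by
    obtain ⟨G, hG⟩ := hUc.exists_forall_hasDerivWithinAt hg
    exact ⟨G, fun u hu => (hG u hu).hasDerivAt (hUo.mem_nhds hu)⟩
  have hP := isPrimAlong_of_isOpen hUo hU (fun u hu => (hℓd u hu).continuousAt.continuousWithinAt)
    hℓe hG hlaml
  rw [IsPrimAlong.sub_eq_sub hh hΦ hP 1 0]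
  have hmU : ∀ u, m ≤ (a * u).re → u ∈ U := fun u hu => by
    change 1 < (a * u).re; linarith
  -- The integral depends only on the two ends, since a primitive exists in the half-plane. It may
  -- be estimated along the chord, on which `Re(e^{iθ}u) ≥ m`, wherever the deformation itself runs.
  have hK : Convex ℝ ({u : ℂ | m ≤ (a * u).re} ∩ Metric.closedBall 0 R) :=
    (hlin m).inter (convex_closedBall _ _)
  have hmem : ∀ s ∈ ({0, 1} : Set ℝ), h s ∈ {u : ℂ | m ≤ (a * u).re} ∩ Metric.closedBall 0 R :=
    fun s hs => ⟨(hends s hs).1, mem_closedBall_zero_iff.mpr (hends s hs).2⟩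
  have hmv := hK.norm_image_sub_le_of_norm_hasDerivWithin_le
    (f := G) (f' := fun u => Complex.exp (-z * u + (q * z - 1 / 2) * ℓ u))
    (C := Real.exp (-(r * m) + V * (2 * Real.log (1 + R) + 4 * Real.pi)))
    (fun u hu => (hG u (hmU u hu.1)).hasDerivWithinAt) (fun u hu => by
      have huU := hmU u hu.1
      have hum : m ≤ (a * u).re := hu.1
      have huR : ‖u‖ ≤ R := mem_closedBall_zero_iff.mp hu.2
      have hu2 : 2 ≤ ‖u‖ := by
        have := Complex.re_le_norm (a * u)
        rw [norm_mul, ha, Complex.norm_exp_ofReal_mul_I, one_mul] at this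
        linarith
      have hre : (ℓ u).re = Real.log ‖1 + u ^ 2‖ := re_eq_log_norm_of_exp_eq (hℓe u huU)
      have hre0 : 0 ≤ (ℓ u).re := by
        rw [hre]; exact Real.log_nonneg (one_le_norm_one_add_sq hu2)
      have hre1 : (ℓ u).re ≤ 2 * Real.log (1 + R) := by
        rw [hre, ← Real.log_rpow (by linarith [norm_nonneg u])]
        refine Real.log_le_log (by linarith [one_le_norm_one_add_sq hu2]) ?_
        rw [Real.rpow_two]
        refine (norm_one_add_sq_le u).trans ?_
        gcongr
      rw [Complex.norm_exp]
      refine Real.exp_le_exp.mpr ?_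
      have e1 : (-z * u + (q * z - 1 / 2) * ℓ u).re =
          -(r * (a * u).re) + (q * z * ℓ u).re - (ℓ u).re / 2 := by
        have : -z * u + (q * z - 1 / 2) * ℓ u =
          -((r : ℂ) * (a * u)) + q * z * ℓ u - ((1 / 2 : ℝ) : ℂ) * ℓ u := by
          rw [hz, rayPoint]; push_cast; ring
        rw [this, Complex.sub_re, Complex.add_re, Complex.neg_re, Complex.re_ofReal_mul,
          Complex.re_ofReal_mul]
        ring
      rw [e1]
      have h1 := mul_re_le_norm_mul (w := q * z) hre0
      have h2 : ‖q * z‖ * ((ℓ u).re + |(ℓ u).im|) ≤ V * (2 * Real.log (1 + R) + 4 * Real.pi) :=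
        mul_le_mul hV (add_le_add hre1 (hℓim u huU)) (by positivity) ((norm_nonneg _).trans hV)
      have h3 := mul_le_mul_of_nonneg_left hum hr
      linarith) (hmem 0 (by simp)) (hmem 1 (by simp))
  refine hmv.trans (mul_le_mul_of_nonneg_left ?_ (Real.exp_pos _).le)
  have := norm_sub_le (h 1) (h 0)
  linarith [(hends 0 (by simp)).2, (hends 1 (by simp)).2]

theorem eventually_nonsaddle_of_tendsto_cobounded {θ : ℝ} {q : ℂ} {γ : ℝ≥0 → ℂ} (hq : q ≠ 0)
    (hγ : IsSteepestDescentPath θ q γ) (hlim : Tendsto γ atTop (Bornology.cobounded ℂ)) :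
    ∀ᶠ t : ℝ in atTop, 1 + γ t.toNNReal ^ 2 ≠ 2 * q * γ t.toNNReal ∧
      ‖Complex.exp (-(1 / 2) * pathLog θ q γ t) * pathVelocity θ q γ t‖ ≤ 2 := by
  have ha : Complex.exp (θ * Complex.I) ≠ 0 := Complex.exp_ne_zero _
  have hn := (tendsto_norm_cobounded_atTop.comp hlim).comp tendsto_real_toNNReal_atTop
  filter_upwards [hn.eventually_ge_atTop 2, hn.eventually_ge_atTop
    (1 + 4 * ‖q * Complex.exp (θ * Complex.I)‖ / ‖Complex.exp (θ * Complex.I)‖)] with t h1 h2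
  obtain ⟨h3, h4⟩ := velocity_bound ha h1 h2
  refine ⟨fun h => h3 ((meetsSaddle_iff ha).mpr h), ?_⟩
  rw [Complex.norm_exp_ofReal_mul_I, div_one] at h4
  have h5 := re_eq_log_norm_of_exp_eq (exp_pathLog hq hγ t)
  have h6 : ‖Complex.exp (-(1 / 2) * pathLog θ q γ t)‖ ≤ 1 := by
    rw [Complex.norm_exp, Real.exp_le_one_iff,
      show (-(1 / 2) : ℂ) = ((-(1 / 2) : ℝ) : ℂ) by push_cast; rfl, Complex.re_ofReal_mul, h5]
    linarith [Real.log_nonneg (one_le_norm_one_add_sq h1)]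
  rw [norm_mul]
  exact (mul_le_mul h6 h4 (norm_nonneg _) zero_le_one).trans (by norm_num)

/-- From `|u| ≤ t + |q||L|`, where `Re L` grows only like `2 log|u|`; the tangent of the logarithm
at `4|q|` costs half of `|u|`, which is absorbed on the left. -/
theorem norm_le_of_pathLog_bound {θ : ℝ} {q : ℂ} {γ : ℝ≥0 → ℂ} (hq : q ≠ 0)
    (hγ : IsSteepestDescentPath θ q γ) {T : ℝ} (hT : 0 ≤ T) (h2 : 2 ≤ ‖γ T.toNNReal‖)
    (hL : |(pathLog θ q γ T).im| ≤ 4 * Real.pi) :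
    ‖γ T.toNNReal‖ ≤ 2 * T + (1 + 2 * ‖q‖ * (4 * Real.pi + 2 * Real.log (4 * ‖q‖))) := by
  set L := pathLog θ q γ T
  set x := ‖γ T.toNNReal‖ with hx
  have hq0 : 0 < ‖q‖ := norm_pos_iff.mpr hq
  have h1 := mul_pathLog (θ := θ) (γ := γ) hq hT
  have h3 : x ≤ T + ‖q‖ * ‖L‖ := by
    have e : Complex.exp (θ * Complex.I) * γ T.toNNReal =
        T + q * Complex.exp (θ * Complex.I) * L := by rw [h1]; ring
    have e2 := congrArg norm e
    rw [norm_mul, Complex.norm_exp_ofReal_mul_I, one_mul] at e2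
    have e3 := norm_add_le (T : ℂ) (q * Complex.exp (θ * Complex.I) * L)
    rw [← e2, norm_mul, norm_mul, Complex.norm_exp_ofReal_mul_I, mul_one, Complex.norm_real,
      Real.norm_of_nonneg hT] at e3
    exact e3
  have h4 : L.re = Real.log ‖1 + γ T.toNNReal ^ 2‖ := re_eq_log_norm_of_exp_eq (exp_pathLog hq hγ T)
  have h5 : 0 ≤ L.re := h4 ▸ Real.log_nonneg (one_le_norm_one_add_sq h2)
  have h6 : L.re ≤ 2 * Real.log (1 + x) := by
    rw [h4, ← Real.log_rpow (by positivity), Real.rpow_two]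
    exact Real.log_le_log (by linarith [one_le_norm_one_add_sq h2]) (norm_one_add_sq_le _)
  have h7 : Real.log (1 + x) ≤ (1 + x) / (4 * ‖q‖) - 1 + Real.log (4 * ‖q‖) := by
    have := Real.log_le_sub_one_of_pos (show 0 < (1 + x) / (4 * ‖q‖) by positivity)
    rw [Real.log_div (by positivity) (by positivity)] at this
    linarith
  have h8 : ‖L‖ ≤ L.re + 4 * Real.pi := by
    have := Complex.norm_le_abs_re_add_abs_im L
    rw [abs_of_nonneg h5] at this
    linarith
  have h9 : ‖q‖ * ((1 + x) / (4 * ‖q‖)) = (1 + x) / 4 := by field_simp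
  have h10 := mul_le_mul_of_nonneg_left (show ‖L‖ ≤
    2 * ((1 + x) / (4 * ‖q‖) - 1 + Real.log (4 * ‖q‖)) + 4 * Real.pi by linarith) hq0.le
  have h11 : ‖q‖ * (2 * ((1 + x) / (4 * ‖q‖) - 1 + Real.log (4 * ‖q‖)) + 4 * Real.pi) =
      (1 + x) / 2 - 2 * ‖q‖ + ‖q‖ * (4 * Real.pi + 2 * Real.log (4 * ‖q‖)) := by
    linear_combination 2 * h9
  linarith

/-- The expansion of `𝐇_ν(z) - Y_ν(z)` from a path of steepest descent to infinity. -/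
theorem hyExpansion_of_deformable {θ : ℝ} {q : ℂ} {γ : ℝ≥0 → ℂ} (hθ : |θ| < Real.pi / 2)
    (hq : q ≠ 0) (hb : 0 ≤ (q * Complex.exp (θ * Complex.I)).re)
    (hγ : IsSteepestDescentPath θ q γ) (hlim : Tendsto γ atTop (Bornology.cobounded ℂ))
    (hdef : DeformableToRealAxis θ γ) : HYExpansion θ q := by
  have hcos : 0 < Real.cos θ := Real.cos_pos_of_mem_Ioo (abs_lt.mp hθ)
  have hpi := Real.pi_pos
  obtain ⟨H, hH, hH0, hHl, hHr, hH1, hHt⟩ := hdef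
  have hslit : ∀ t : ℝ, 1 + (t : ℂ) ^ 2 ∈ Complex.slitPlane := fun t => by
    rw [← Complex.ofReal_pow, ← Complex.ofReal_one, ← Complex.ofReal_add,
      Complex.ofReal_mem_slitPlane]
    positivity
  refine hasExpansion_of_homotopy (e := 1) (x := id) (x' := fun _ => 1) hq hγ hH hH0 hHl
    (fun t => by simp [hHr]) hH1 (fun t _ => hasDerivAt_id t)
    (fun t _ => by simpa using hslit t)
    (eventually_nonsaddle_of_tendsto_cobounded hq hγ hlim) (fun r hr η hη => ?_)
    (fun r hr => ?_)
  · have hr0 : 0 < r := by linarith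
    set b := q * Complex.exp (θ * Complex.I) with hbdef
    set V := ‖q‖ * r with hV
    set C := ‖b‖ * (4 * Real.pi) with hC
    have hC0 : 0 ≤ C := by positivity
    have hev : ∀ᶠ T : ℝ in atTop, ∀ s, 2 ≤ (Complex.exp (θ * Complex.I) * extendHomotopy H (s, T)).re := by
      have h1 := hHt.eventually_ge_atTop 2
      obtain ⟨pa, hpa, pb, hpb, hp⟩ := Filter.eventually_prod_iff.mp h1
      rw [Filter.eventually_top] at hpa
      filter_upwards [tendsto_real_toNNReal_atTop.eventually hpb] with T hT s
      exact hp (hpa _) hT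
    have hdecay := (tendsto_mul_exp_neg_log (mul_pos hr0 hcos) (A := 2 * V) (by positivity)
      (r * C + V * (4 * Real.pi))).const_mul 6
    rw [mul_zero] at hdecay
    filter_upwards [hev, hdecay.eventually_le_const hη, eventually_ge_atTop 0,
      eventually_ge_atTop ((2 + C) / Real.cos θ),
      eventually_ge_atTop (1 + 2 * ‖q‖ * (4 * Real.pi + 2 * Real.log (4 * ‖q‖)))] with
      T hT hd hT0 hTm hTR lam Φ hlam hexp hlam0 hlam1 hΦ
    have hm : 2 ≤ T * Real.cos θ - C := by
      have := (div_le_iff₀ hcos).mp hTm; linarith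
    have hh : Continuous fun s => extendHomotopy H (s, T) :=
      (continuous_extendHomotopy hH).comp (by fun_prop)
    have e0 : extendHomotopy H (0, T) = γ T.toNNReal := by rw [extendHomotopy_left, hHl]
    have e1 : extendHomotopy H (1, T) = T := by
      rw [extendHomotopy_right, hHr, Real.coe_toNNReal T hT0]
    have hl1 : (lam 1).im = 0 := by
      rw [hlam1, id, mul_one, ← Complex.ofReal_pow, ← Complex.ofReal_one, ← Complex.ofReal_add,
        ← Complex.ofReal_log (by positivity), Complex.ofReal_im]
    have hVn : ‖q * rayPoint θ r‖ ≤ V := by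
      rw [norm_mul, norm_rayPoint θ hr0.le]
    obtain ⟨him, hbound⟩ := norm_sub_le_of_halfPlane (R := 3 * T) hθ hr0.le hm hh
      (fun s => by linarith [hT s]) hlam hexp hl1 hVn hΦ
    rw [hlam0] at him
    have hg2 : 2 ≤ ‖γ T.toNNReal‖ := by
      have h1 := hT 0
      rw [e0] at h1
      have := Complex.re_le_norm (Complex.exp (θ * Complex.I) * γ T.toNNReal)
      rw [norm_mul, Complex.norm_exp_ofReal_mul_I, one_mul] at this
      linarith
    have hgR := norm_le_of_pathLog_bound hq hγ hT0 hg2 him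
    -- In `e^{iθ}γ = T + bL` both `Re b` and `Re L` are nonnegative and `|Im L| ≤ 4π`, so only `Im b
    -- · Im L` can reduce the real part.
    have hgm : T - C ≤ (Complex.exp (θ * Complex.I) * γ T.toNNReal).re := by
      have h1 := mul_pathLog (θ := θ) (γ := γ) hq hT0
      have h4 := re_eq_log_norm_of_exp_eq (exp_pathLog hq hγ T)
      have h5 : 0 ≤ (pathLog θ q γ T).re := h4 ▸ Real.log_nonneg (one_le_norm_one_add_sq hg2)
      have e : Complex.exp (θ * Complex.I) * γ T.toNNReal = T + b * pathLog θ q γ T := by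
        rw [hbdef, h1]; ring
      rw [e, Complex.add_re, Complex.ofReal_re, Complex.mul_re]
      have h6 := mul_nonneg hb h5
      have h7 : b.im * (pathLog θ q γ T).im ≤ C := by
        refine (le_abs_self _).trans ?_
        rw [abs_mul, hC]
        exact mul_le_mul (Complex.abs_im_le_norm b) him (abs_nonneg _) (norm_nonneg _)
      linarith
    refine (hbound ?_).trans (le_trans (le_of_eq ?_) hd)
    · intro s hs
      rcases hs with rfl | rfl
      · rw [e0]
        have := mul_le_of_le_one_right hT0 (Real.cos_le_one θ)
        exact ⟨by linarith, by linarith⟩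
      · rw [e1]
        refine ⟨?_, ?_⟩
        · rw [mul_comm (Complex.exp _), Complex.re_ofReal_mul, Complex.exp_ofReal_mul_I_re]
          linarith
        · rw [Complex.norm_real, Real.norm_of_nonneg hT0]; linarith
    · rw [show -(r * (T * Real.cos θ - C)) + V * (2 * Real.log (1 + 3 * T) + 4 * Real.pi) =
        -(r * Real.cos θ * T) + 2 * V * Real.log (1 + 3 * T) + (r * C + V * (4 * Real.pi)) by ring]
      ring
  · have hr0 : 0 < r := by linarith
    have hc : Continuous fun t : ℝ => phaseIntegrand q (rayPoint θ r) (t : ℂ) := by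
      rw [continuous_iff_continuousAt]
      exact fun t => (differentiableAt_phaseIntegrand (hslit t)).continuousAt.comp
        Complex.continuous_ofReal.continuousAt
    have hint : IntegrableOn (fun t : ℝ => phaseIntegrand q (rayPoint θ r) (t : ℂ)) (Ioi 0) := by
      refine (integrableOn_laplaceInt (q * rayPoint θ r) (rayPoint_re_pos hθ hr0)).congr_fun
        (fun t _ => ?_) measurableSet_Ioi
      simp only [← exp_mul_cpow_eq_phaseIntegrand (Complex.slitPlane_ne_zero (hslit t))]
      push_cast
      rfl
    have hd : ∀ t : ℝ, HasDerivAt (fun y => ∫ t in (0 : ℝ)..y, phaseIntegrand q (rayPoint θ r) t)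
        (phaseIntegrand q (rayPoint θ r) t) t := fun t => hc.integral_hasStrictDerivAt 0 t |>.hasDerivAt
    refine ⟨_, _, fun t _ => (hd t).continuousAt.continuousWithinAt, by simp, fun t _ => ?_,
      intervalIntegral_tendsto_integral_Ioi 0 hint tendsto_id, struveH_sub_besselY_eq q hθ hr0⟩
    simpa using hd t

end Struve

end

noncomputable section

namespace Struve

open MeasureTheory Set

/-! ### Paths to a branch point -/

theorem one_add_sq_eq_mul {c : ℂ} (hc : c ^ 2 = -1) (u : ℂ) : 1 + u ^ 2 = (u - c) * (u + c) := by
  linear_combination hc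

/-- A branch of `log (u + c)` near `c`, where `c = ±i`. -/
theorem exists_log_add {c : ℂ} (hc : ‖c‖ = 1) : ∃ (m : ℂ → ℂ) (K : ℝ), 0 ≤ K ∧
    ∀ u, ‖u - c‖ < 1 / 2 → DifferentiableAt ℂ m u ∧ Complex.exp (m u) = u + c ∧ ‖m u‖ ≤ K := by
  have hc1 : c ≠ 0 := norm_pos_iff.mp (by rw [hc]; exact one_pos)
  have hc0 : 2 * c ≠ 0 := mul_ne_zero two_ne_zero hc1
  refine ⟨fun u => Complex.log ((u + c) / (2 * c)) + Complex.log (2 * c),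
    3 / 4 + ‖Complex.log (2 * c)‖, by positivity, fun u hu => ?_⟩
  have h1 : ‖(u + c) / (2 * c) - 1‖ ≤ 1 / 2 := by
    rw [show (u + c) / (2 * c) - 1 = (u - c) / (2 * c) by field_simp; ring, norm_div, norm_mul, hc,
      Complex.norm_ofNat]
    linarith
  obtain ⟨h2, h3⟩ := mem_slitPlane_of_near h1
  refine ⟨?_, ?_, (norm_add_le _ _).trans (by linarith)⟩
  · have d : DifferentiableAt ℂ (fun u => (u + c) / (2 * c)) u := by fun_prop
    exact (d.clog h2).add_const _
  · rw [Complex.exp_add, Complex.exp_log (Complex.slitPlane_ne_zero h2), Complex.exp_log hc0,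
      div_mul_cancel₀ _ hc0]

/-- The part of a deformation near a branch point. -/
theorem exists_norm_sub_le_near_branchPoint {c : ℂ} (hc : c ^ 2 = -1) : ∃ K : ℝ, 0 ≤ K ∧
    ∀ (z ν : ℂ) (h lam Φ : ℝ → ℂ), Continuous h → (∀ s, ‖h s - c‖ < 1 / 2) → Continuous lam →
      (∀ s, Complex.exp (lam s) = 1 + h s ^ 2) → IsPrimAlong z ν h lam Φ → ∀ μ : ℝ,
      (ν * lam 0).re ≤ μ → (ν * lam 1).re ≤ μ →
      ‖Φ 1 - Φ 0‖ ≤ Real.exp (μ + 2 * ‖z‖ + K * (2 * ‖ν‖ + 1)) *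
        (‖lam 1‖ + ‖lam 0‖ + 2 * K) := by
  have hcn : ‖c‖ = 1 := by
    have := congrArg norm hc
    rw [norm_pow, norm_neg, norm_one] at this
    exact (pow_eq_one_iff_of_nonneg (norm_nonneg c) two_ne_zero).mp this
  obtain ⟨m, K, hK, hm⟩ := exists_log_add hcn
  refine ⟨K, hK, fun z ν h lam Φ hh hhc hlam hexp hΦ μ hμ0 hμ1 => ?_⟩
  -- The coordinate `log(u-c)`, continued along the deformation: it unwinds the punctured disc into
  -- a half-plane, so spirals do no harm.
  set ζ : ℝ → ℂ := fun s => lam s - m (h s) with hζ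
  have hmc : Continuous fun s => m (h s) := by
    rw [continuous_iff_continuousAt]
    exact fun s => (hm _ (hhc s)).1.continuousAt.comp hh.continuousAt
  have hζc : Continuous ζ := hlam.sub hmc
  have hu0 : ∀ u, ‖u - c‖ < 1 / 2 → u + c ≠ 0 := fun u hu => by
    rw [← (hm u hu).2.1]; exact Complex.exp_ne_zero _
  have hζe : ∀ s, Complex.exp (ζ s) = h s - c := fun s => by
    rw [hζ, Complex.exp_sub, hexp, (hm _ (hhc s)).2.1, one_add_sq_eq_mul hc,
      mul_div_cancel_right₀ _ (hu0 _ (hhc s))]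
  set V : Set ℂ := {w | w.re < Real.log (1 / 2)} with hV
  have hVo : IsOpen V := isOpen_lt Complex.continuous_re continuous_const
  have hVc : Convex ℝ V := convex_halfSpace_re_lt _
  have hVn : ∀ w, w ∈ V ↔ ‖Complex.exp w‖ < 1 / 2 := fun w => by
    rw [Complex.norm_exp, hV, mem_ofPred_eq, Real.lt_log_iff_exp_lt (by norm_num)]
  have hζV : ∀ s, ζ s ∈ V := fun s => by rw [hVn, hζe]; exact hhc s
  have hVu : ∀ w ∈ V, ‖c + Complex.exp w - c‖ < 1 / 2 := fun w hw => by
    rw [add_sub_cancel_left]; exact (hVn w).mp hw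
  -- The integrand in the variable `w = log(u-c)`; the last summand is the Jacobian `du = e^w dw`.
  set g : ℂ → ℂ := fun w => Complex.exp (-z * (c + Complex.exp w) +
    (ν - 1 / 2) * (w + m (c + Complex.exp w)) + w) with hg
  have hgd : DifferentiableOn ℂ g V := fun w hw => by
    have d1 : DifferentiableAt ℂ (fun w => c + Complex.exp w) w := by fun_prop
    have d2 : DifferentiableAt ℂ (fun w => m (c + Complex.exp w)) w :=
      (hm _ (hVu w hw)).1.comp w d1
    exact ((((d1.const_mul (-z)).add ((differentiableAt_id.add d2).const_mul (ν - 1 / 2))).add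
      differentiableAt_id).cexp).differentiableWithinAt
  obtain ⟨G, hG'⟩ := hVc.exists_forall_hasDerivWithinAt hgd
  have hG : ∀ w ∈ V, HasDerivAt G (g w) w := fun w hw => (hG' w hw).hasDerivAt (hVo.mem_nhds hw)
  have hP : IsPrimAlong z ν h lam (fun s => G (ζ s)) := by
    intro s
    set Z : ℂ → ℂ := fun u => ζ s + Complex.log ((u - c) / (h s - c)) with hZ
    have hs0 : h s - c ≠ 0 := hζe s ▸ Complex.exp_ne_zero _
    have hZs : Z (h s) = ζ s := by simp [hZ, div_self hs0]
    have hslit : ∀ᶠ u in 𝓝 (h s), (u - c) / (h s - c) ∈ Complex.slitPlane := by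
      have hcont : ContinuousAt (fun u => (u - c) / (h s - c)) (h s) := by fun_prop
      refine hcont.eventually_mem (Complex.isOpen_slitPlane.mem_nhds ?_)
      simp [div_self hs0]
    have hZd : ∀ u, (u - c) / (h s - c) ∈ Complex.slitPlane →
        Complex.exp (Z u) = u - c ∧ HasDerivAt Z (1 / (u - c)) u := by
      intro u hu
      have hu1 : u - c ≠ 0 := fun h0 => Complex.slitPlane_ne_zero hu (by rw [h0, zero_div])
      refine ⟨?_, ?_⟩
      · rw [hZ, Complex.exp_add, hζe, Complex.exp_log (Complex.slitPlane_ne_zero hu),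
          mul_div_cancel₀ _ hs0]
      · have d1 : HasDerivAt (fun u => (u - c) / (h s - c)) (1 / (h s - c)) u :=
          ((hasDerivAt_id u).sub_const c).div_const _
        refine ((d1.clog hu).const_add (ζ s)).congr_deriv ?_
        field_simp
    have hnear : ∀ᶠ u in 𝓝 (h s), ‖u - c‖ < 1 / 2 :=
      (isOpen_lt (by fun_prop) continuous_const).mem_nhds (hhc s)
    have hZc : ContinuousAt Z (h s) := (hZd _ hslit.self_of_nhds).2.continuousAt
    refine ⟨fun u => G (Z u), fun u => Z u + m u, ?_, hZc.add (hm _ (hhc s)).1.continuousAt, ?_, ?_⟩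
    · simp only [hZs, hζ]; ring
    · filter_upwards [hslit, hnear] with u hu hu'
      obtain ⟨e1, d1⟩ := hZd u hu
      have hu1 : u - c ≠ 0 := e1 ▸ Complex.exp_ne_zero _
      refine ⟨by rw [Complex.exp_add, e1, (hm u hu').2.1, one_add_sq_eq_mul hc], ?_⟩
      refine ((hG (Z u) ((hVn _).mpr (by rw [e1]; exact hu'))).comp u d1).congr_deriv ?_
      rw [hg]
      simp only [e1, add_sub_cancel]
      rw [Complex.exp_add _ (Z u), e1]
      field_simp
    · have h1 : ∀ᶠ y in 𝓝 s, Z (h y) = ζ y :=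
        eventually_eq_of_exp_eq (ContinuousAt.comp (g := Z) hZc hh.continuousAt) hζc.continuousAt hZs
          ((hh.continuousAt.eventually hslit).mono fun y hy => by rw [(hZd _ hy).1, hζe])
      filter_upwards [h1] with y hy
      rw [hy, hZs]
  rw [IsPrimAlong.sub_eq_sub hh hΦ hP 1 0]
  have hνm : ∀ (w : ℂ) u, ‖u - c‖ < 1 / 2 → |(w * m u).re| ≤ ‖w‖ * K := fun w u hu => by
    refine (Complex.abs_re_le_norm _).trans ?_
    rw [norm_mul]
    exact mul_le_mul_of_nonneg_left (hm u hu).2.2 (norm_nonneg _)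
  -- Both ends satisfy `Re(νw) ≤ μ + |ν|K`; by convexity so does the chord between them, and there
  -- the integrand is small.
  have hKc : Convex ℝ (V ∩ {w | (ν * w).re ≤ μ + ‖ν‖ * K}) :=
    hVc.inter (convex_halfSpace_le (f := fun u : ℂ => (ν * u).re)
      ⟨fun x y => by rw [mul_add, Complex.add_re], fun k x => by
        rw [mul_smul_comm, Complex.smul_re]⟩ _)
  have hmem : ∀ s, (ν * lam s).re ≤ μ → ζ s ∈ V ∩ {w | (ν * w).re ≤ μ + ‖ν‖ * K} := by
    intro s hs
    refine ⟨hζV s, ?_⟩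
    change (ν * (lam s - m (h s))).re ≤ _
    rw [mul_sub, Complex.sub_re]
    linarith [neg_abs_le (ν * m (h s)).re, hνm ν _ (hhc s)]
  have hmv := hKc.norm_image_sub_le_of_norm_hasDerivWithin_le (f := G) (f' := g)
    (C := Real.exp (μ + 2 * ‖z‖ + K * (2 * ‖ν‖ + 1)))
    (fun w hw => (hG w hw.1).hasDerivWithinAt) (fun w hw => by
      have hwV := hw.1
      have hwμ : (ν * w).re ≤ μ + ‖ν‖ * K := hw.2
      rw [hg, Complex.norm_exp]
      refine Real.exp_le_exp.mpr ?_
      have h1 : (-z * (c + Complex.exp w)).re ≤ 2 * ‖z‖ := by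
        refine (Complex.re_le_norm _).trans ?_
        rw [norm_mul, norm_neg, mul_comm]
        refine mul_le_mul_of_nonneg_right ?_ (norm_nonneg z)
        have := norm_add_le c (Complex.exp w)
        linarith [(hVn w).mp hwV]
      have h2 := hνm (ν - 1 / 2) _ (hVu w hwV)
      have h3 : ‖ν - 1 / 2‖ * K ≤ (‖ν‖ + 1) * K := by
        refine mul_le_mul_of_nonneg_right ?_ hK
        have := norm_sub_le ν (1 / 2)
        rw [norm_div, norm_one, Complex.norm_ofNat] at this
        linarith
      have h4 : w.re < 0 := lt_trans hwV (Real.log_neg (by norm_num) (by norm_num))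
      have e : -z * (c + Complex.exp w) + (ν - 1 / 2) * (w + m (c + Complex.exp w)) + w =
          -z * (c + Complex.exp w) + ν * w + (ν - 1 / 2) * m (c + Complex.exp w) +
          ((1 / 2 : ℝ) : ℂ) * w := by push_cast; ring
      rw [e, Complex.add_re, Complex.add_re, Complex.add_re, Complex.re_ofReal_mul]
      linarith [le_abs_self ((ν - 1 / 2) * m (c + Complex.exp w)).re])
    (hmem 0 hμ0) (hmem 1 hμ1)
  refine hmv.trans (mul_le_mul_of_nonneg_left ?_ (Real.exp_pos _).le)
  rw [show ζ 1 - ζ 0 = lam 1 - lam 0 - (m (h 1) - m (h 0)) by rw [hζ]; ring]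
  linarith [norm_sub_le (lam 1 - lam 0) (m (h 1) - m (h 0)), norm_sub_le (lam 1) (lam 0),
    norm_sub_le (m (h 1)) (m (h 0)), (hm _ (hhc 1)).2.2, (hm _ (hhc 0)).2.2]

/-- Near `c` the velocity vanishes like `1+u²` while `|e^{-L/2}| = |1+u²|^(-1/2)`, so the product
stays bounded. -/
theorem eventually_nonsaddle_of_tendsto {θ : ℝ} {q c : ℂ} {γ : ℝ≥0 → ℂ} (hq : q ≠ 0)
    (hc : c ^ 2 = -1) (hγ : IsSteepestDescentPath θ q γ) (hlim : Tendsto γ atTop (𝓝 c)) :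
    ∀ᶠ t : ℝ in atTop, 1 + γ t.toNNReal ^ 2 ≠ 2 * q * γ t.toNNReal ∧
      ‖Complex.exp (-(1 / 2) * pathLog θ q γ t) * pathVelocity θ q γ t‖ ≤ 1 / ‖q‖ := by
  have ha : Complex.exp (θ * Complex.I) ≠ 0 := Complex.exp_ne_zero _
  have hq0 : 0 < ‖q‖ := norm_pos_iff.mpr hq
  have hcn : ‖c‖ = 1 := by
    have := congrArg norm hc
    rw [norm_pow, norm_neg, norm_one] at this
    exact (pow_eq_one_iff_of_nonneg (norm_nonneg c) two_ne_zero).mp this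
  have hl : Tendsto (fun t : ℝ => γ t.toNNReal) atTop (𝓝 c) :=
    hlim.comp tendsto_real_toNNReal_atTop
  have h1 : Tendsto (fun t : ℝ => ‖1 + γ t.toNNReal ^ 2‖) atTop (𝓝 0) := by
    have := ((hl.pow 2).const_add 1).norm
    rwa [hc, add_neg_cancel, norm_zero] at this
  have h2 : Tendsto (fun t : ℝ => ‖Complex.exp (θ * Complex.I) * (1 + γ t.toNNReal ^ 2) -
      2 * (q * Complex.exp (θ * Complex.I)) * γ t.toNNReal‖) atTop (𝓝 (2 * ‖q‖)) := by
    have := ((((hl.pow 2).const_add 1).const_mul (Complex.exp (θ * Complex.I))).sub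
      (hl.const_mul (2 * (q * Complex.exp (θ * Complex.I))))).norm
    rw [hc, add_neg_cancel, mul_zero, zero_sub, norm_neg, norm_mul, norm_mul, norm_mul,
      Complex.norm_exp_ofReal_mul_I, hcn, Complex.norm_ofNat, mul_one, mul_one] at this
    exact this
  filter_upwards [h1.eventually_le_const one_pos,
    h2.eventually_const_le (show ‖q‖ < 2 * ‖q‖ by linarith)] with t h3 h4
  refine ⟨fun h => ?_, ?_⟩
  · rw [sub_eq_zero.mpr ((meetsSaddle_iff ha).mpr h), norm_zero] at h4
    linarith
  · have h5 := re_eq_log_norm_of_exp_eq (exp_pathLog hq hγ t)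
    set N := ‖1 + γ t.toNNReal ^ 2‖ with hN
    have hN0 : 0 < N := norm_pos_iff.mpr (exp_pathLog hq hγ t ▸ Complex.exp_ne_zero _)
    have h6 : ‖Complex.exp (-(1 / 2) * pathLog θ q γ t)‖ * N ≤ 1 := by
      rw [Complex.norm_exp, show (-(1 / 2) : ℂ) = ((-(1 / 2) : ℝ) : ℂ) by push_cast; rfl,
        Complex.re_ofReal_mul, h5]
      nth_rw 2 [← Real.exp_log hN0]
      rw [← Real.exp_add, Real.exp_le_one_iff]
      linarith [Real.log_nonpos hN0.le h3]
    rw [norm_mul, pathVelocity, norm_div, ← hN, ← mul_div_assoc]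
    exact div_le_div₀ zero_le_one h6 hq0 h4

/-- If `Re b = 0`, then `|(1+u²)e^{-au/b}|` is constantly `1` on the path, but it would have to tend
to `0` at `c`. -/
theorem re_pos_of_tendsto {θ : ℝ} {q c : ℂ} {γ : ℝ≥0 → ℂ} (hq : q ≠ 0)
    (hc : c ^ 2 = -1) (hb : 0 ≤ (q * Complex.exp (θ * Complex.I)).re)
    (hγ : IsSteepestDescentPath θ q γ) (hlim : Tendsto γ atTop (𝓝 c)) :
    0 < (q * Complex.exp (θ * Complex.I)).re := by
  refine hb.lt_of_ne fun h0 => ?_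
  have hl : Tendsto (fun t : ℝ => γ t.toNNReal) atTop (𝓝 c) :=
    hlim.comp tendsto_real_toNNReal_atTop
  have hcont : ContinuousAt (fun u : ℂ => ‖(1 + u ^ 2) * Complex.exp (-(Complex.exp (θ * Complex.I) *
      u / (q * Complex.exp (θ * Complex.I))))‖) c := by fun_prop
  have h1 := hcont.tendsto.comp hl
  rw [hc, add_neg_cancel, zero_mul, norm_zero] at h1
  refine zero_ne_one (tendsto_nhds_unique h1 (tendsto_const_nhds.congr' ?_))
  filter_upwards [eventually_ge_atTop 0] with t ht
  rw [Function.comp_apply, norm_one_add_sq_of_isLevel (hγ.isLevel hq ht), Complex.inv_re, ← h0]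
  simp

/-- With `p = e^{-T}` the argument is `p(2-p)`, which lies between `p` and `2p`. -/
theorem log_one_sub_sq_bounds {T : ℝ} (hT : 0 ≤ T) :
    0 < 1 - (1 - Real.exp (-T)) ^ 2 ∧ Real.log (1 - (1 - Real.exp (-T)) ^ 2) ≤ -T + Real.log 2 ∧
      |Real.log (1 - (1 - Real.exp (-T)) ^ 2)| ≤ T := by
  have h0 := Real.exp_pos (-T)
  have h1 : Real.exp (-T) ≤ 1 := Real.exp_le_one_iff.mpr (by linarith)
  have h2 : Real.exp (-T) ≤ 1 - (1 - Real.exp (-T)) ^ 2 := by nlinarith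
  have h3 : 0 < 1 - (1 - Real.exp (-T)) ^ 2 := h0.trans_le h2
  have h4 := Real.log_le_log h0 h2
  rw [Real.log_exp] at h4
  refine ⟨h3, ?_, abs_le.mpr ⟨h4, ?_⟩⟩
  · calc Real.log (1 - (1 - Real.exp (-T)) ^ 2) ≤ Real.log (Real.exp (-T) * 2) :=
        Real.log_le_log h3 (by nlinarith [sq_nonneg (Real.exp (-T))])
      _ = _ := by rw [Real.log_mul h0.ne' two_ne_zero, Real.log_exp]
  · exact (Real.log_nonpos h3.le (by nlinarith [sq_nonneg (1 - Real.exp (-T))])).trans hT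

/-- The expansion of `𝐇_ν(z) ± iJ_ν(z)` from a path of steepest descent to a branch point. -/
theorem hjExpansion_of_deformable {θ ε : ℝ} {q : ℂ} {γ : ℝ≥0 → ℂ} (hε : ε = 1 ∨ ε = -1)
    (hq : q ≠ 0) (hb : 0 < (q * Complex.exp (θ * Complex.I)).re)
    (hγ : IsSteepestDescentPath θ q γ) (hlim : Tendsto γ atTop (𝓝 (ε * Complex.I)))
    (hdef : DeformableToSegment (ε * Complex.I) γ) : HJExpansion ε θ q := by
  obtain ⟨H, hH, hH0, hHl, hHr, hH1, hHt⟩ := hdef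
  have hc : ((ε : ℂ) * Complex.I) ^ 2 = -1 := by rcases hε with rfl | rfl <;> norm_num
  have hcn : ‖(ε : ℂ) * Complex.I‖ = 1 := by rcases hε with rfl | rfl <;> simp
  have hsq : ∀ y : ℝ, 1 + ((y : ℂ) * (ε * Complex.I)) ^ 2 = ((1 - y ^ 2 : ℝ) : ℂ) := fun y => by
    rw [mul_comm, one_add_I_mul_sq hε]
  have hslit : ∀ y : ℝ, 0 < 1 - y ^ 2 → 1 + ((y : ℂ) * (ε * Complex.I)) ^ 2 ∈ Complex.slitPlane :=
    fun y hy => by rw [hsq, Complex.ofReal_mem_slitPlane]; exact hy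
  have hxd : ∀ t : ℝ, HasDerivAt (fun t : ℝ => 1 - Real.exp (-t)) (Real.exp (-t)) t := fun t => by
    have := (((hasDerivAt_id t).neg).exp).const_sub 1
    simpa using this
  refine hasExpansion_of_homotopy (e := ε * Complex.I) (x := fun t => 1 - Real.exp (-t))
    (x' := fun t => Real.exp (-t)) hq hγ hH hH0 hHl hHr hH1 (fun t _ => hxd t)
    (fun t ht => hslit _ (log_one_sub_sq_bounds ht).1)
    (eventually_nonsaddle_of_tendsto hq hc hγ hlim) (fun r hr η hη => ?_) (fun r hr => ?_)
  · have hr0 : 0 < r := by linarith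
    obtain ⟨K, hK, hKb⟩ := exists_norm_sub_le_near_branchPoint hc
    set b := q * Complex.exp (θ * Complex.I) with hbdef
    have hbn : 0 < ‖b‖ := norm_pos_iff.mpr (ne_zero_of_re_pos hb)
    -- The smaller of two rates of decay: on the path `Re(νL)` falls like `-rT`, on the segment like
    -- `-r Re(b) T`.
    set δ := min (r * b.re) r with hδ
    have hδ0 : 0 < δ := lt_min (by positivity) hr0
    set C := r * b.re * Real.log 2 + r * (3 / 2) with hC
    have hl2 : 0 ≤ Real.log 2 := Real.log_nonneg one_le_two
    set z := rayPoint θ r with hz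
    have hev : ∀ᶠ T : ℝ in atTop, ∀ s, ‖extendHomotopy H (s, T) - ε * Complex.I‖ < 1 / 2 := by
      have h1 := hHt.eventually (Metric.ball_mem_nhds _ (show (0 : ℝ) < 1 / 2 by norm_num))
      obtain ⟨pa, hpa, pb, hpb, hp⟩ := Filter.eventually_prod_iff.mp h1
      rw [Filter.eventually_top] at hpa
      filter_upwards [tendsto_real_toNNReal_atTop.eventually hpb] with T hT s
      exact mem_ball_iff_norm.mp (hp (hpa _) hT)
    set A := 1 + (3 / 2 + 1) / ‖b‖ + 2 * K with hA
    have hdecay := (tendsto_mul_exp_neg_log hδ0 le_rfl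
      (C + 2 * ‖z‖ + K * (2 * ‖q * z‖ + 1))).const_mul A
    rw [mul_zero] at hdecay
    filter_upwards [hev, hdecay.eventually_le_const hη, eventually_ge_atTop 1] with
      T hT hd hT1 lam Φ hlam hexp hlam0 hlam1 hΦ
    have hT0 : 0 ≤ T := by linarith
    have hh : Continuous fun s => extendHomotopy H (s, T) :=
      (continuous_extendHomotopy hH).comp (by fun_prop)
    have e0 : extendHomotopy H (0, T) = γ T.toNNReal := by rw [extendHomotopy_left, hHl]
    obtain ⟨hl0, hl1, hl3⟩ := log_one_sub_sq_bounds hT0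
    have hlam1' : lam 1 = (Real.log (1 - (1 - Real.exp (-T)) ^ 2) : ℝ) := by
      rw [hlam1, hsq, ← Complex.ofReal_log hl0.le]
    have hγn : ‖γ T.toNNReal‖ ≤ 3 / 2 := by
      have h1 := hT 0
      rw [e0] at h1
      have := norm_add_le (γ T.toNNReal - ε * Complex.I) (ε * Complex.I)
      rw [sub_add_cancel, hcn] at this
      linarith
    have hmul := mul_pathLog (θ := θ) (γ := γ) hq hT0
    have haγ : ‖Complex.exp (θ * Complex.I) * γ T.toNNReal‖ ≤ 3 / 2 := by
      rw [norm_mul, Complex.norm_exp_ofReal_mul_I, one_mul]; exact hγn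
    have hμ0 : (q * z * lam 0).re ≤ -(δ * T) + C := by
      have e : q * z * lam 0 = (r : ℂ) * (Complex.exp (θ * Complex.I) * γ T.toNNReal - T) := by
        rw [← hmul, hlam0, hz, rayPoint]; ring
      rw [e, Complex.re_ofReal_mul, Complex.sub_re, Complex.ofReal_re]
      have h1 := mul_le_mul_of_nonneg_left ((Complex.re_le_norm _).trans haγ) hr0.le
      have h2 := mul_le_mul_of_nonneg_right (min_le_right (r * b.re) r) hT0
      have h3 : 0 ≤ r * b.re * Real.log 2 := by positivity
      rw [hC]
      linarith
    have hμ1 : (q * z * lam 1).re ≤ -(δ * T) + C := by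
      rw [hlam1', mul_comm, Complex.re_ofReal_mul, hz, mul_rayPoint_re, ← hbdef]
      have h1 := mul_le_mul_of_nonneg_right hl1 (mul_nonneg hr0.le hb.le)
      have h2 := mul_le_mul_of_nonneg_right (min_le_left (r * b.re) r) hT0
      rw [hC]
      linarith
    have hn0 : ‖lam 0‖ ≤ (3 / 2 + T) / ‖b‖ := by
      rw [le_div_iff₀ hbn, hlam0, mul_comm, ← norm_mul, hbdef, hmul]
      refine (norm_sub_le _ _).trans ?_
      rw [Complex.norm_real, Real.norm_of_nonneg hT0]
      linarith
    have hn1 : ‖lam 1‖ ≤ T := by rw [hlam1', Complex.norm_real]; exact hl3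
    refine (hKb z (q * z) _ lam Φ hh hT hlam hexp hΦ _ hμ0 hμ1).trans (le_trans ?_ hd)
    have hlen : ‖lam 1‖ + ‖lam 0‖ + 2 * K ≤ A * T := by
      have h1 : (3 / 2 + T) / ‖b‖ ≤ (3 / 2 + 1) / ‖b‖ * T := by
        rw [div_mul_eq_mul_div]
        exact div_le_div_of_nonneg_right (by linarith) hbn.le
      have h2 : 2 * K ≤ 2 * K * T := le_mul_of_one_le_right (by positivity) hT1
      rw [hA]
      linarith
    refine (mul_le_mul_of_nonneg_left hlen (Real.exp_pos _).le).trans (le_of_eq ?_)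
    rw [zero_mul, add_zero, show -(δ * T) + C + 2 * ‖z‖ + K * (2 * ‖q * z‖ + 1) =
      -(δ * T) + (C + 2 * ‖z‖ + K * (2 * ‖q * z‖ + 1)) by ring]
    ring
  · have hr0 : 0 < r := by linarith
    set f : ℝ → ℂ := fun y => phaseIntegrand q (rayPoint θ r) (ε * Complex.I * y) *
      (ε * Complex.I) with hf
    have hfc : ContinuousOn f (Ioo (-1) 1) := by
      intro y hy
      have hs : 1 + ((ε : ℂ) * Complex.I * y) ^ 2 ∈ Complex.slitPlane := by
        rw [mul_comm]; exact hslit y (by nlinarith [hy.1, hy.2])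
      have hcy : ContinuousAt (fun y : ℝ => (ε : ℂ) * Complex.I * y) y := by fun_prop
      exact ((ContinuousAt.comp (f := fun y : ℝ => (ε : ℂ) * Complex.I * y)
        (differentiableAt_phaseIntegrand hs).continuousAt hcy).mul
        continuousAt_const).continuousWithinAt
    have hint : IntegrableOn f (Ioo 0 1) :=
      (integrableOn_phaseIntegrand_segment hr0 hb hε).mul_const _
    have hx1 : ∀ t : ℝ, 0 ≤ t → 1 - Real.exp (-t) ∈ Ico (0 : ℝ) 1 := fun t ht =>
      ⟨sub_nonneg.mpr (Real.exp_le_one_iff.mpr (by linarith)), by linarith [Real.exp_pos (-t)]⟩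
    have hd : ∀ t : ℝ, 0 ≤ t → HasDerivAt (fun t : ℝ => ∫ y in (0 : ℝ)..(1 - Real.exp (-t)), f y)
        (f (1 - Real.exp (-t)) * Real.exp (-t)) t := by
      intro t ht
      obtain ⟨h1, h2⟩ := hx1 t ht
      have hm : 1 - Real.exp (-t) ∈ Ioo (-1 : ℝ) 1 := ⟨by linarith, h2⟩
      have d := intervalIntegral.integral_hasDerivAt_right (a := (0 : ℝ)) (b := 1 - Real.exp (-t))
        ((hfc.mono (by
          rw [uIcc_of_le h1]
          exact fun y hy => ⟨by linarith [hy.1], by linarith [hy.2]⟩)).intervalIntegrable)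
        (hfc.stronglyMeasurableAtFilter isOpen_Ioo _ hm)
        (hfc.continuousAt (isOpen_Ioo.mem_nhds hm))
      have := HasDerivAt.scomp t d (hxd t)
      refine this.congr_deriv ?_
      rw [Complex.real_smul, mul_comm]
    refine ⟨_, _, fun t ht => (hd t ht).continuousAt.continuousWithinAt, by simp, fun t ht => ?_,
      ?_, struveH_add_besselJ_eq hr0 hb hε⟩
    · refine (hd t ht.le).congr_deriv ?_
      simp only [hf]
      rw [mul_comm ((ε : ℂ) * Complex.I) ((1 - Real.exp (-t) : ℝ) : ℂ)]
      ring
    · have hprim := intervalIntegral.continuousOn_primitive_interval (f := f) (a := (0 : ℝ)) (b := 1)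
        (μ := volume) (by
          rw [uIcc_of_le zero_le_one, integrableOn_Icc_iff_integrableOn_Ioo]; exact hint)
      have hlim1 : Tendsto (fun t : ℝ => 1 - Real.exp (-t)) atTop (𝓝[uIcc 0 1] 1) := by
        refine tendsto_nhdsWithin_iff.mpr ⟨?_, ?_⟩
        · simpa using (Real.tendsto_exp_neg_atTop_nhds_zero).const_sub 1
        · filter_upwards [eventually_ge_atTop 0] with t ht
          rw [uIcc_of_le zero_le_one]
          exact ⟨(hx1 t ht).1, (hx1 t ht).2.le⟩
      have := (hprim 1 (by simp)).tendsto.comp hlim1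
      rw [intervalIntegral.integral_of_le zero_le_one, integral_Ioc_eq_integral_Ioo] at this
      exact this

end Struve

end

/-! ### The expansion determined by the end of the path -/

namespace Struve

theorem re_nonneg_of_abs_arg_le {b : ℂ} (h : |Complex.arg b| ≤ Real.pi / 2) : 0 ≤ b.re :=
  Complex.abs_arg_le_pi_div_two_iff.mp h

/-- The endpoint of a path of steepest descent decides which expansion holds. -/
theorem expansions_of_isSteepestDescentPath {θ : ℝ} {q : ℂ} {γ : ℝ≥0 → ℂ}
    (hθ : |θ| < Real.pi / 2) (hq : q ≠ 0)
    (harg : |Complex.arg (q * Complex.exp (θ * Complex.I))| ≤ Real.pi / 2)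
    (hγ : IsSteepestDescentPath θ q γ) :
    (Tendsto γ atTop (Bornology.cobounded ℂ) → (θ = 0 ∨ DeformableToRealAxis θ γ) →
      HYExpansion θ q) ∧
    (∀ ε : ℝ, ε = 1 ∨ ε = -1 → Tendsto γ atTop (𝓝 (ε * Complex.I)) →
      (θ = 0 ∨ DeformableToSegment (ε * Complex.I) γ) → HJExpansion ε θ q) := by
  have hb := re_nonneg_of_abs_arg_le harg
  refine ⟨fun hlim h => ?_, fun ε hε hlim h => ?_⟩
  -- For `θ = 0` no deformation is required: a path to `∞` forces `Re q ≤ 1`, and then the real axis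
  -- itself is a good contour.
  · rcases h with rfl | h
    · refine hyExpansion_of_re_le hθ ?_
      rw [exp_zero_mul_I, mul_one, Real.cos_zero]
      exact hγ.re_le_one hq hlim
    · exact hyExpansion_of_deformable hθ hq hb hγ hlim h
  · have hc : ((ε : ℂ) * Complex.I) ^ 2 = -1 := by rcases hε with rfl | rfl <;> norm_num
    have hb' := re_pos_of_tendsto hq hc hb hγ hlim
    -- For `θ = 0` the sine vanishes, so the straight segment to `εi` always serves.
    rcases h with rfl | h
    · exact hjExpansion_of_sin_nonpos hε (by simp) hb'
    · exact hjExpansion_of_deformable hε hq hb' hγ hlim h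

end Struve

theorem mainTheorem1 :
    -- For `|arg ν| < π/2` there is a path of steepest descent from `0`; each one ends at `∞`,
    -- `i` or `-i`; and it is the only one if it meets no saddle point.
    (∀ (θ : ℝ) (q : ℂ), |θ| < Real.pi / 2 → q ≠ 0 →
      |Complex.arg (q * Complex.exp (θ * Complex.I))| < Real.pi / 2 →
        (∃ γ, Struve.IsSteepestDescentPath θ q γ) ∧
        (∀ γ, Struve.IsSteepestDescentPath θ q γ →
          Tendsto γ atTop (Bornology.cobounded ℂ) ∨
          Tendsto γ atTop (𝓝 Complex.I) ∨ Tendsto γ atTop (𝓝 (-Complex.I))) ∧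
        (∀ γ, Struve.IsSteepestDescentPath θ q γ → ¬ Struve.MeetsSaddle q γ →
          ∀ γ', Struve.IsSteepestDescentPath θ q γ' → γ' = γ)) ∧
    -- The endpoint of the path decides which expansion holds, when `|arg ν| ≤ π/2`.
    (∀ (θ : ℝ) (q : ℂ) (γ : ℝ≥0 → ℂ), |θ| < Real.pi / 2 → q ≠ 0 →
      |Complex.arg (q * Complex.exp (θ * Complex.I))| ≤ Real.pi / 2 →
      Struve.IsSteepestDescentPath θ q γ →
        (Tendsto γ atTop (Bornology.cobounded ℂ) → (θ = 0 ∨ Struve.DeformableToRealAxis θ γ) →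
          Struve.HYExpansion θ q) ∧
        (∀ ε : ℝ, ε = 1 ∨ ε = -1 → Tendsto γ atTop (𝓝 (ε * Complex.I)) →
          (θ = 0 ∨ Struve.DeformableToSegment (ε * Complex.I) γ) →
          Struve.HJExpansion ε θ q)) ∧
    -- `z > 0` and `0 < q < 1`: the path is the positive real axis.
    (∀ q : ℝ, 0 < q → q < 1 →
      (∃ γ, Struve.IsSteepestDescentPath 0 q γ ∧ ¬ Struve.MeetsSaddle q γ ∧
        (∀ t, (γ t).im = 0 ∧ 0 ≤ (γ t).re) ∧ Tendsto γ atTop (Bornology.cobounded ℂ)) ∧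
      Struve.HYExpansion 0 q) ∧
    -- `z > 0` and `q ≥ 1`: the real axis to the saddle point, then an arc to `i` or to `-i`.
    (∀ q : ℝ, 1 ≤ q → ∀ ε : ℝ, ε = 1 ∨ ε = -1 →
      (∃ γ, Struve.IsSteepestDescentPath 0 q γ ∧
        (∃ t₀, (∀ t ≤ t₀, (γ t).im = 0) ∧ γ t₀ = ((q - Real.sqrt (q ^ 2 - 1) : ℝ) : ℂ)) ∧
        Tendsto γ atTop (𝓝 (ε * Complex.I))) ∧
      Struve.HJExpansion ε 0 q) ∧
    -- `ν` and `z` of the same phase `ε θ ≠ 0`: the transition is at `q = Q θ`.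
    (∃ Q : ℝ → ℝ, ∀ θ : ℝ, 0 < θ → θ < Real.pi / 2 →
      0 < Q θ ∧ Q θ < 1 ∧
      ∀ ε : ℝ, ε = 1 ∨ ε = -1 →
        (∀ q : ℝ, 0 < q → q < Q θ →
          (∃ γ, Struve.IsSteepestDescentPath (ε * θ) q γ ∧ ¬ Struve.MeetsSaddle q γ ∧
            Tendsto γ atTop (Bornology.cobounded ℂ) ∧
            Struve.DeformableToRealAxis (ε * θ) γ) ∧
          Struve.HYExpansion (ε * θ) q) ∧
        (∃ γ₁ γ₂, Struve.IsSteepestDescentPath (ε * θ) (Q θ) γ₁ ∧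
          Struve.IsSteepestDescentPath (ε * θ) (Q θ) γ₂ ∧
          (∃ t₀, (∀ t ≤ t₀, γ₁ t = γ₂ t) ∧
            γ₁ t₀ = (Q θ : ℂ) - ε * Complex.I * (Real.sqrt (1 - Q θ ^ 2) : ℂ)) ∧
          Tendsto γ₁ atTop (Bornology.cobounded ℂ) ∧
          Tendsto γ₂ atTop (𝓝 (-ε * Complex.I))) ∧
        (∀ q : ℝ, Q θ ≤ q → Struve.HJExpansion (-ε) (ε * θ) q)) := by
  refine ⟨fun θ q hθ hq harg => ?_, fun θ q γ hθ hq harg hγ =>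
    Struve.expansions_of_isSteepestDescentPath hθ hq harg hγ, fun q h0 h1 => ?_,
    fun q hq ε hε => ?_, Struve.exists_transition⟩
  · have hb := Struve.re_pos_of_abs_arg_lt (mul_ne_zero hq (Complex.exp_ne_zero _)) harg
    exact ⟨Struve.exists_isSteepestDescentPath hq, fun γ hγ => hγ.ends hb,
      fun γ hγ hs γ' hγ' => hγ.eq_of_not_meetsSaddle hq hs hγ'⟩
  · refine ⟨Struve.exists_real_path h0 h1, Struve.hyExpansion_of_re_le ?_ ?_⟩
    · rw [abs_zero]
      positivity
    · rw [Struve.exp_zero_mul_I, mul_one, Real.cos_zero, Complex.ofReal_re]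
      exact h1.le
  · refine ⟨Struve.exists_path_to_I hq hε, Struve.hjExpansion_of_sin_nonpos hε (by simp) ?_⟩
    rw [Struve.exp_zero_mul_I, mul_one, Complex.ofReal_re]
    linarith
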